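/- Model of computation. Algorithms are deterministic programs for the real RAM: unit-cost exact arithmetic ($+,-,\times,/$) and comparisons on real numbers, no floor function, together with $w$-bit words with the usual unit-cost word operations. An algorithm has to be correct, within its time bound, for every word size $w\ge c\log_2(\text{input size}+2)$, where $c$ is a constant of the algorithm, and it may not assume anything about the contents of memory outside its input. "Finding a $k$-cycle" means reporting the $k$ distinct vertices of some $k$-cycle, or reporting that there is none. The intersection graph of $n$ line segments (given by the coordinates of their endpoints) has the segments as its vertices, two different ones being adjacent iff they have a common point. Theorem. (1) Let $k\ge 3$ be a constant, and let $T_k(m)\ge m$ be such that there is an algorithm that finds a $k$-cycle in every directed graph with $m$ edges (without loops or multiple edges, and with at most $2m$ vertices, given by its list of edges) in time $T_k(m)$. Then there is an algorithm that, given $n$ closed line segments in $\mathbb R^2$ (in arbitrary position), finds a $k$-cycle in their intersection graph in $\tilde O(T_k(n))$ time, that is, in time at most $C\cdot T_k(n)\cdot\log^{d}(n+2)$ for constants $C,d$ that do not depend on $n$. (2) Let $\omega$ be the exponent of matrix multiplication, i.e. the infimum of all $\tau\ge 2$ such that two real $n\times n$ matrices can be multiplied in $O(n^{\tau})$ time.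 For every $\varepsilon>0$, a $3$-cycle in the intersection graph of $n$ line segments in $\mathbb R^2$ can be found in $O(n^{2\omega/(\omega+1)+\varepsilon})$ time. In particular, if $\omega<2.373$, then it can be found in $O(n^{1.408})$ time. -/

import Mathlib

/-! ## The machine: a real RAM with `w`-bit words

The memory has word registers, word arrays, real registers and real arrays, each named by a
natural number.  Words are natural numbers below `2 ^ w`; word arithmetic is modulo `2 ^ w`
(subtraction is truncated at `0`).  Reals are exact and support `+, -, *, /` and comparison.
Words can be converted to reals, but not conversely (there is no floor function), and the only
constants in a program are natural numbers.  Every executed command or test costs one step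
(expressions have constant size, because the program is fixed). -/

namespace RealRAM

/-- Contents of the memory. -/
structure State where
  reg : ℕ → ℕ
  arr : ℕ → ℕ → ℕ
  rreg : ℕ → ℝ
  rarr : ℕ → ℕ → ℝ

/-- All words in memory are `w`-bit words.  Nothing else is assumed about uninitialised memory. -/
def State.Bounded (w : ℕ) (s : State) : Prop :=
  (∀ r, s.reg r < 2 ^ w) ∧ ∀ a i, s.arr a i < 2 ^ w

/-- Operations on words. -/
inductive WOp
  | add | sub | mul | div | mod | land | lor | xor | shl | shr

/-- The value of a word operation before reduction modulo `2 ^ w`. -/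
def WOp.eval : WOp → ℕ → ℕ → ℕ
  | .add, a, b => a + b
  | .sub, a, b => a - b
  | .mul, a, b => a * b
  | .div, a, b => a / b
  | .mod, a, b => a % b
  | .land, a, b => Nat.land a b
  | .lor, a, b => Nat.lor a b
  | .xor, a, b => Nat.xor a b
  | .shl, a, b => Nat.shiftLeft a b
  | .shr, a, b => Nat.shiftRight a b

/-- Word-valued expressions. -/
inductive WExpr
  | const (c : ℕ)
  | reg (r : ℕ)
  | arr (a : ℕ) (i : WExpr)
  | op (o : WOp) (e₁ e₂ : WExpr)

def WExpr.eval (w : ℕ) (s : State) : WExpr → ℕ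
  | .const c => c % 2 ^ w
  | .reg r => s.reg r
  | .arr a i => s.arr a (i.eval w s)
  | .op o e₁ e₂ => o.eval (e₁.eval w s) (e₂.eval w s) % 2 ^ w

/-- Operations on reals (division by zero returns zero). -/
inductive ROp
  | add | sub | mul | div

noncomputable def ROp.eval : ROp → ℝ → ℝ → ℝ
  | .add, x, y => x + y
  | .sub, x, y => x - y
  | .mul, x, y => x * y
  | .div, x, y => x / y

/-- Real-valued expressions. -/
inductive RExpr
  | reg (r : ℕ)
  | arr (a : ℕ) (i : WExpr)
  | ofWord (e : WExpr)
  | op (o : ROp) (e₁ e₂ : RExpr)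

noncomputable def RExpr.eval (w : ℕ) (s : State) : RExpr → ℝ
  | .reg r => s.rreg r
  | .arr a i => s.rarr a (i.eval w s)
  | .ofWord e => (e.eval w s : ℝ)
  | .op o e₁ e₂ => o.eval (e₁.eval w s) (e₂.eval w s)

/-- Tests. -/
inductive Test
  | wlt (e₁ e₂ : WExpr)
  | weq (e₁ e₂ : WExpr)
  | rlt (e₁ e₂ : RExpr)
  | req (e₁ e₂ : RExpr)
  | not (b : Test)
  | and (b₁ b₂ : Test)

def Test.eval (w : ℕ) (s : State) : Test → Prop
  | .wlt e₁ e₂ => e₁.eval w s < e₂.eval w s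
  | .weq e₁ e₂ => e₁.eval w s = e₂.eval w s
  | .rlt e₁ e₂ => e₁.eval w s < e₂.eval w s
  | .req e₁ e₂ => e₁.eval w s = e₂.eval w s
  | .not b => ¬ b.eval w s
  | .and b₁ b₂ => b₁.eval w s ∧ b₂.eval w s

/-- Programs. -/
inductive Prog
  | skip
  | setReg (r : ℕ) (e : WExpr)
  | setArr (a : ℕ) (i e : WExpr)
  | setRReg (r : ℕ) (e : RExpr)
  | setRArr (a : ℕ) (i : WExpr) (e : RExpr)
  | seq (p q : Prog)
  | ite (b : Test) (p q : Prog)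
  | while (b : Test) (p : Prog)

/-- `Exec w p s s' t`: with word size `w`, the program `p` started in memory `s` halts in memory
`s'` after exactly `t` steps. -/
inductive Exec (w : ℕ) : Prog → State → State → ℕ → Prop
  | skip (s : State) : Exec w .skip s s 1
  | setReg (s : State) (r : ℕ) (e : WExpr) :
      Exec w (.setReg r e) s { s with reg := Function.update s.reg r (e.eval w s) } 1
  | setArr (s : State) (a : ℕ) (i e : WExpr) :
      Exec w (.setArr a i e) s
        { s with arr := Function.update s.arr a
                          (Function.update (s.arr a) (i.eval w s) (e.eval w s)) } 1
  | setRReg (s : State) (r : ℕ) (e : RExpr) :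
      Exec w (.setRReg r e) s { s with rreg := Function.update s.rreg r (e.eval w s) } 1
  | setRArr (s : State) (a : ℕ) (i : WExpr) (e : RExpr) :
      Exec w (.setRArr a i e) s
        { s with rarr := Function.update s.rarr a
                          (Function.update (s.rarr a) (i.eval w s) (e.eval w s)) } 1
  | seq {p q : Prog} {s s' s'' : State} {t t' : ℕ} :
      Exec w p s s' t → Exec w q s' s'' t' → Exec w (.seq p q) s s'' (t + t')
  | iteTrue {b : Test} {p q : Prog} {s s' : State} {t : ℕ} :
      b.eval w s → Exec w p s s' t → Exec w (.ite b p q) s s' (t + 1)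
  | iteFalse {b : Test} {p q : Prog} {s s' : State} {t : ℕ} :
      ¬ b.eval w s → Exec w q s s' t → Exec w (.ite b p q) s s' (t + 1)
  | whileFalse {b : Test} {p : Prog} {s : State} :
      ¬ b.eval w s → Exec w (.while b p) s s 1
  | whileTrue {b : Test} {p : Prog} {s s' s'' : State} {t t' : ℕ} :
      b.eval w s → Exec w p s s' t → Exec w (.while b p) s' s'' t' →
      Exec w (.while b p) s s'' (t + t' + 1)

/-- `Solves Inst size Input Output T`: one program answers every instance in time `T (size x)` on
machines with word size `w ≥ c * ⌈log₂ (size x + 2)⌉`, for some constant `c`.  Here `Input x s` says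
that the memory `s` holds the input `x`, and `Output x s'` that `s'` holds a correct answer; memory
that is not part of the input has arbitrary initial contents. -/
def Solves (Inst : Type) (size : Inst → ℕ) (Input Output : Inst → State → Prop)
    (T : ℕ → ℝ) : Prop :=
  ∃ (p : Prog) (c : ℕ), ∀ (x : Inst) (w : ℕ), c * Nat.clog 2 (size x + 2) ≤ w →
    ∀ s : State, s.Bounded w → Input x s →
      ∃ (s' : State) (t : ℕ), Exec w p s s' t ∧ (t : ℝ) ≤ T (size x) ∧ Output x s'

end RealRAM

open RealRAM

/-! ## Cycles -/

/-- `v 0, …, v (k - 1)` are distinct vertices, each adjacent to the next one cyclically. -/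
def IsKCycle {V : Type} (adj : V → V → Prop) (k : ℕ) (v : Fin k → V) : Prop :=
  Function.Injective v ∧ ∀ i j : Fin k, (j : ℕ) = ((i : ℕ) + 1) % k → adj (v i) (v j)

/-- The memory holds a correct answer to the `k`-cycle problem: register `0` is `1` and array `0`
lists the vertices of a `k`-cycle, or register `0` is `0` and there is no `k`-cycle. -/
def CycleAnswer {n : ℕ} (adj : Fin n → Fin n → Prop) (k : ℕ) (s : State) : Prop :=
  (s.reg 0 = 1 ∧ ∃ v : Fin k → Fin n, IsKCycle adj k v ∧ ∀ i : Fin k, s.arr 0 i = (v i : ℕ)) ∨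
  (s.reg 0 = 0 ∧ ¬ ∃ v : Fin k → Fin n, IsKCycle adj k v)

/-! ## Sparse directed graphs -/

/-- A directed graph without loops and multiple edges, given by the list of its `m` edges.  The
vertices are `0, …, N - 1`, where `N ≤ 2 * m` (at most `2 * m` vertices are not isolated, and isolated
vertices do not matter for cycles). -/
structure SparseDigraph where
  N : ℕ
  m : ℕ
  edge : Fin m → Fin N × Fin N
  injective : Function.Injective edge
  loopless : ∀ i, (edge i).1 ≠ (edge i).2
  sparse : N ≤ 2 * m

def SparseDigraph.Adj (G : SparseDigraph) (u v : Fin G.N) : Prop := ∃ i, G.edge i = (u, v)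

/-- Register `0` holds `N`, register `1` holds `m`, and arrays `0` and `1` hold the tails and the
heads of the edges. -/
def SparseDigraph.Input (G : SparseDigraph) (s : State) : Prop :=
  s.reg 0 = G.N ∧ s.reg 1 = G.m ∧
    ∀ i : Fin G.m, s.arr 0 i = ((G.edge i).1 : ℕ) ∧ s.arr 1 i = ((G.edge i).2 : ℕ)

/-- A `k`-cycle in a directed graph with `m` edges can be found in time `T m`. -/
def DigraphCycleInTime (k : ℕ) (T : ℕ → ℝ) : Prop :=
  Solves SparseDigraph SparseDigraph.m SparseDigraph.Input
    (fun G s => CycleAnswer G.Adj k s) T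

/-! ## Line segments -/

/-- `n` closed line segments in the plane, the `i`-th one with endpoints `fst i` and `snd i`. -/
structure Segments where
  n : ℕ
  fst : Fin n → ℝ × ℝ
  snd : Fin n → ℝ × ℝ

/-- The intersection graph: distinct indices are adjacent if the segments have a common point. -/
def Segments.graph (S : Segments) : SimpleGraph (Fin S.n) where
  Adj i j := i ≠ j ∧ (segment ℝ (S.fst i) (S.snd i) ∩ segment ℝ (S.fst j) (S.snd j)).Nonempty
  symm := ⟨fun _ _ h => ⟨h.1.symm, by rw [Set.inter_comm]; exact h.2⟩⟩
  loopless := ⟨fun _ h => h.1 rfl⟩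

/-- Register `0` holds `n`, and real array `0` holds the four coordinates of each segment. -/
def Segments.Input (S : Segments) (s : State) : Prop :=
  s.reg 0 = S.n ∧ ∀ i : Fin S.n,
    s.rarr 0 (4 * i) = (S.fst i).1 ∧ s.rarr 0 (4 * i + 1) = (S.fst i).2 ∧
    s.rarr 0 (4 * i + 2) = (S.snd i).1 ∧ s.rarr 0 (4 * i + 3) = (S.snd i).2

/-- A `k`-cycle in the intersection graph of `n` line segments can be found in time `T n`. -/
def SegmentCycleInTime (k : ℕ) (T : ℕ → ℝ) : Prop :=
  Solves Segments Segments.n Segments.Input (fun S s => CycleAnswer S.graph.Adj k s) T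

/-! ## Matrix multiplication -/

/-- Two real `n × n` matrices. -/
structure MatrixPair where
  n : ℕ
  A : Matrix (Fin n) (Fin n) ℝ
  B : Matrix (Fin n) (Fin n) ℝ

/-- Register `0` holds `n`, and real arrays `0` and `1` hold the two matrices row by row. -/
def MatrixPair.Input (X : MatrixPair) (s : State) : Prop :=
  s.reg 0 = X.n ∧ ∀ i j : Fin X.n,
    s.rarr 0 (X.n * i + j) = X.A i j ∧ s.rarr 1 (X.n * i + j) = X.B i j

/-- Real array `2` holds the product. -/
def MatrixPair.Output (X : MatrixPair) (s : State) : Prop :=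
  ∀ i j : Fin X.n, s.rarr 2 (X.n * i + j) = (X.A * X.B) i j

/-- The exponent `ω` of matrix multiplication: the infimum of all `τ` such that real `n × n`
matrices can be multiplied in `O(n ^ τ)` time.  (Writing the `n ^ 2` entries of the product forces
`τ ≥ 2`.) -/
noncomputable def matMulExponent : ℝ :=
  sInf {τ : ℝ | 2 ≤ τ ∧ ∃ C : ℝ,
    Solves MatrixPair MatrixPair.n MatrixPair.Input MatrixPair.Output
      (fun n => C * ((n : ℝ) + 1) ^ τ)}

namespace RealRAM

/-! ## Frames and resource-bounded executions -/

/-! Part (1), geometry. After a shear no segment other than a point is vertical, so every segment is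
the graph of an affine function on a closed interval. Take a segment tree on the sorted endpoints.
If two segments meet, there is a node in which one of them is canonical (it spans the strip of the
node, but not that of the parent) and the other one passes through the strip; both have an item for
that node (`Sweep.Good.exists_items`). The canonical items of a node, ordered by left height, are
split greedily into `k` chains along which the right height increases, so that the members of a
chain do not cross. If an item is left over, it is the end of a sequence of pairwise crossing items,
one from each chain (`Sweep.exists_chain`), and these form a clique, which contains a `k`-cycle.
Otherwise, being below or above a given segment is monotone along each chain, so the members of a
chain that meet this segment form a range of positions. A range is covered by dyadic blocks, and
only the first and the last block of each length are needed (`exists_dyadic`). A block and the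
segments that select it are the two sides of a biclique. Hence every segment lies in
polylogarithmically many bicliques, segments on opposite sides of a biclique meet
(`Sweep.Good.link_meet`), and restricting adjacency to such links does not destroy the existence of
a `k`-cycle (`Sweep.Good.link_or`).

Part (1), digraphs. In a cycle of links exchange the roles of vertices and edges: the nodes of a
digraph are pairs of a biclique side and a layer modulo `k`, and a segment is an edge from the
biclique through which it is entered to the biclique through which it is left. Since `T` is an
arbitrary function, time `T n` is only available for digraphs with exactly `n` edges, so the digraph
with all choices of bicliques would be too large. Therefore all choices are fixed in advance by `3 *
k + k * k` digits below a polylogarithmic `P`: the incoming and the outgoing slot of each layer, the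
residue of the vertex modulo `2 * k`, and for every two layers a bit in which their vertices must
differ. The last digits are a deterministic colour coding, which makes the vertices of a cycle
distinct. All sequences of digits are tried; `IsLayered.sound` and `exists_digits` show that an
attempt succeeds iff there is a cycle of links.

Part (2). By (1) it remains to find triangles in digraphs with `m` edges, following Alon, Yuster and
Zwick. With a degree threshold `Δ`, try for each edge `(x, y)` the first `Δ` edges that leave `y`.
If this misses all triangles, every vertex of a triangle has more than `Δ` outgoing edges, hence is
the tail of some `Δ`-th edge of the sorted edge list (`TriContext.exists_sample`). There are about
`m / Δ` such samples, and the square of their adjacency matrix reveals a triangle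
(`TriContext.found`). For multiplication in time `n ^ τ`, the choice `Δ ≈ m ^ ((τ - 1) / (τ + 1))`
balances `m * Δ` with `(m / Δ) ^ τ`, and both are `m ^ (2 * τ / (τ + 1))`.

All programs are explicit. `Run` is a Hoare triple with a time bound; what a program leaves
untouched is read off from its text (`Exec.frame`); the assumed subroutines are moved to memory
names from `100` on (`Run.shift`). -/

instance (n : ℕ) : OfNat WExpr n := ⟨.const n⟩
instance : Add WExpr := ⟨.op .add⟩
instance : Sub WExpr := ⟨.op .sub⟩
instance : Mul WExpr := ⟨.op .mul⟩
instance : Div WExpr := ⟨.op .div⟩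
instance : Mod WExpr := ⟨.op .mod⟩
instance : Add RExpr := ⟨.op .add⟩
instance : Sub RExpr := ⟨.op .sub⟩
instance : Mul RExpr := ⟨.op .mul⟩
instance : Div RExpr := ⟨.op .div⟩

abbrev WExpr.shr (a b : WExpr) : WExpr := .op .shr a b
abbrev WExpr.shl (a b : WExpr) : WExpr := .op .shl a b

/-! ### Evaluation of expressions and tests. -/

section Eval
variable (w : ℕ) (s : State)

@[simp] theorem WExpr.eval_ofNat (n : ℕ) :
    WExpr.eval w s ofNat(n) = n % 2 ^ w := rfl
@[simp] theorem WExpr.eval_const (n : ℕ) : (WExpr.const n).eval w s = n % 2 ^ w := rfl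
@[simp] theorem WExpr.eval_reg (r : ℕ) : (WExpr.reg r).eval w s = s.reg r := rfl
@[simp] theorem WExpr.eval_arr (a : ℕ) (i : WExpr) :
    (WExpr.arr a i).eval w s = s.arr a (i.eval w s) := rfl
@[simp] theorem WExpr.eval_add (a b : WExpr) :
    (a + b).eval w s = (a.eval w s + b.eval w s) % 2 ^ w := rfl
@[simp] theorem WExpr.eval_sub (a b : WExpr) :
    (a - b).eval w s = (a.eval w s - b.eval w s) % 2 ^ w := rfl
@[simp] theorem WExpr.eval_mul (a b : WExpr) :
    (a * b).eval w s = (a.eval w s * b.eval w s) % 2 ^ w := rfl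
@[simp] theorem WExpr.eval_div (a b : WExpr) :
    (a / b).eval w s = (a.eval w s / b.eval w s) % 2 ^ w := rfl
@[simp] theorem WExpr.eval_mod (a b : WExpr) :
    (a % b).eval w s = (a.eval w s % b.eval w s) % 2 ^ w := rfl
@[simp] theorem WExpr.eval_shr (a b : WExpr) :
    (WExpr.op .shr a b).eval w s = (a.eval w s / 2 ^ b.eval w s) % 2 ^ w := by
  simp only [WExpr.eval, WOp.eval]; rw [← Nat.shiftRight_eq_div_pow]; rfl
@[simp] theorem WExpr.eval_shl (a b : WExpr) :
    (WExpr.op .shl a b).eval w s = (a.eval w s * 2 ^ b.eval w s) % 2 ^ w := by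
  simp only [WExpr.eval, WOp.eval]; rw [← Nat.shiftLeft_eq]; rfl

@[simp] theorem RExpr.eval_reg (r : ℕ) : (RExpr.reg r).eval w s = s.rreg r := rfl
@[simp] theorem RExpr.eval_arr (a : ℕ) (i : WExpr) :
    (RExpr.arr a i).eval w s = s.rarr a (i.eval w s) := rfl
@[simp] theorem RExpr.eval_ofWord (e : WExpr) :
    (RExpr.ofWord e).eval w s = (e.eval w s : ℝ) := rfl
@[simp] theorem RExpr.eval_add (a b : RExpr) :
    (a + b).eval w s = a.eval w s + b.eval w s := rfl
@[simp] theorem RExpr.eval_sub (a b : RExpr) :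
    (a - b).eval w s = a.eval w s - b.eval w s := rfl
@[simp] theorem RExpr.eval_mul (a b : RExpr) :
    (a * b).eval w s = a.eval w s * b.eval w s := rfl
@[simp] theorem RExpr.eval_div (a b : RExpr) :
    (a / b).eval w s = a.eval w s / b.eval w s := rfl

@[simp] theorem Test.eval_wlt (a b : WExpr) :
    (Test.wlt a b).eval w s ↔ a.eval w s < b.eval w s := Iff.rfl
@[simp] theorem Test.eval_weq (a b : WExpr) :
    (Test.weq a b).eval w s ↔ a.eval w s = b.eval w s := Iff.rfl
@[simp] theorem Test.eval_rlt (a b : RExpr) :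
    (Test.rlt a b).eval w s ↔ a.eval w s < b.eval w s := Iff.rfl
@[simp] theorem Test.eval_req (a b : RExpr) :
    (Test.req a b).eval w s ↔ a.eval w s = b.eval w s := Iff.rfl
@[simp] theorem Test.eval_not (b : Test) : (Test.not b).eval w s ↔ ¬ b.eval w s := Iff.rfl
@[simp] theorem Test.eval_and (a b : Test) :
    (Test.and a b).eval w s ↔ a.eval w s ∧ b.eval w s := Iff.rfl

/-- Disjunction of tests. -/
def Test.or (a b : Test) : Test := .not (.and (.not a) (.not b))

@[simp] theorem Test.eval_or (a b : Test) :
    (Test.or a b).eval w s ↔ a.eval w s ∨ b.eval w s := by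
  simp only [Test.or, Test.eval_not, Test.eval_and]; tauto

end Eval

theorem mod_pow_of_lt {a w : ℕ} (h : a < 2 ^ w) : a % 2 ^ w = a := Nat.mod_eq_of_lt h
theorem div_mod_pow {a b w : ℕ} (h : a < 2 ^ w) : a / b % 2 ^ w = a / b :=
  Nat.mod_eq_of_lt ((Nat.div_le_self _ _).trans_lt h)
theorem mod_mod_pow {a b w : ℕ} (h : a < 2 ^ w) : a % b % 2 ^ w = a % b :=
  Nat.mod_eq_of_lt ((Nat.mod_le _ _).trans_lt h)

theorem WExpr.eval_lt {w : ℕ} {s : State} (hs : s.Bounded w) (e : WExpr) :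
    e.eval w s < 2 ^ w := by
  cases e with
  | const c => exact Nat.mod_lt _ (by positivity)
  | reg r => exact hs.1 r
  | arr a i => exact hs.2 a _
  | op o a b => exact Nat.mod_lt _ (by positivity)

/-! ### Updates of the memory. -/

namespace State

def setReg (s : State) (r v : ℕ) : State := { s with reg := Function.update s.reg r v }
def setArr (s : State) (a i v : ℕ) : State :=
  { s with arr := Function.update s.arr a (Function.update (s.arr a) i v) }
def setRReg (s : State) (r : ℕ) (v : ℝ) : State :=
  { s with rreg := Function.update s.rreg r v }
def setRArr (s : State) (a i : ℕ) (v : ℝ) : State :=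
  { s with rarr := Function.update s.rarr a (Function.update (s.rarr a) i v) }

section
variable (s : State) (r r' a a' i i' v : ℕ) (x : ℝ)

@[simp] theorem setReg_reg : (s.setReg r v).reg r' = if r' = r then v else s.reg r' := by
  simp [setReg, Function.update_apply]
@[simp] theorem setReg_arr : (s.setReg r v).arr = s.arr := rfl
@[simp] theorem setReg_rreg : (s.setReg r v).rreg = s.rreg := rfl
@[simp] theorem setReg_rarr : (s.setReg r v).rarr = s.rarr := rfl
@[simp] theorem setArr_reg : (s.setArr a i v).reg = s.reg := rfl
@[simp] theorem setArr_arr : (s.setArr a i v).arr a' i' =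
    if a' = a then (if i' = i then v else s.arr a i') else s.arr a' i' := by
  simp only [setArr, Function.update_apply]; split_ifs <;> simp_all
@[simp] theorem setArr_rreg : (s.setArr a i v).rreg = s.rreg := rfl
@[simp] theorem setArr_rarr : (s.setArr a i v).rarr = s.rarr := rfl
@[simp] theorem setRReg_reg : (s.setRReg r x).reg = s.reg := rfl
@[simp] theorem setRReg_arr : (s.setRReg r x).arr = s.arr := rfl
@[simp] theorem setRReg_rreg :
    (s.setRReg r x).rreg r' = if r' = r then x else s.rreg r' := by
  simp [setRReg, Function.update_apply]
@[simp] theorem setRReg_rarr : (s.setRReg r x).rarr = s.rarr := rfl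
@[simp] theorem setRArr_reg : (s.setRArr a i x).reg = s.reg := rfl
@[simp] theorem setRArr_arr : (s.setRArr a i x).arr = s.arr := rfl
@[simp] theorem setRArr_rreg : (s.setRArr a i x).rreg = s.rreg := rfl
@[simp] theorem setRArr_rarr : (s.setRArr a i x).rarr a' i' =
    if a' = a then (if i' = i then x else s.rarr a i') else s.rarr a' i' := by
  simp only [setRArr, Function.update_apply]; split_ifs <;> simp_all
end

theorem Bounded.setReg {w : ℕ} {s : State} (hs : s.Bounded w) (r : ℕ) {v : ℕ} (hv : v < 2 ^ w) :
    (s.setReg r v).Bounded w :=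
  ⟨fun r' => by rw [setReg_reg]; split_ifs; exacts [hv, hs.1 r'], hs.2⟩

theorem Bounded.setArr {w : ℕ} {s : State} (hs : s.Bounded w) (a i : ℕ) {v : ℕ}
    (hv : v < 2 ^ w) : (s.setArr a i v).Bounded w :=
  ⟨hs.1, fun a' i' => by rw [setArr_arr]; split_ifs; exacts [hv, hs.2 a i', hs.2 a' i']⟩

end State

infixr:60 " ;; " => Prog.seq

/-! ### The memory that a program may write to, computed from its text. -/

namespace Prog

/-- The word registers, word arrays, real registers and real arrays a program may write to. -/
def modReg : Prog → ℕ → Bool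
  | skip, _ => false
  | setReg r _, x => r == x
  | setArr _ _ _, _ => false
  | setRReg _ _, _ => false
  | setRArr _ _ _, _ => false
  | seq p q, x => p.modReg x || q.modReg x
  | ite _ p q, x => p.modReg x || q.modReg x
  | .while _ p, x => p.modReg x

def modArr : Prog → ℕ → Bool
  | skip, _ => false
  | setReg _ _, _ => false
  | setArr a _ _, x => a == x
  | setRReg _ _, _ => false
  | setRArr _ _ _, _ => false
  | seq p q, x => p.modArr x || q.modArr x
  | ite _ p q, x => p.modArr x || q.modArr x
  | .while _ p, x => p.modArr x

def modRReg : Prog → ℕ → Bool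
  | skip, _ => false
  | setReg _ _, _ => false
  | setArr _ _ _, _ => false
  | setRReg r _, x => r == x
  | setRArr _ _ _, _ => false
  | seq p q, x => p.modRReg x || q.modRReg x
  | ite _ p q, x => p.modRReg x || q.modRReg x
  | .while _ p, x => p.modRReg x

def modRArr : Prog → ℕ → Bool
  | skip, _ => false
  | setReg _ _, _ => false
  | setArr _ _ _, _ => false
  | setRReg _ _, _ => false
  | setRArr a _ _, x => a == x
  | seq p q, x => p.modRArr x || q.modRArr x
  | ite _ p q, x => p.modRArr x || q.modRArr x
  | .while _ p, x => p.modRArr x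

end Prog

/-- `s'` differs from `s` only in memory that `p` may write to. -/
structure Frame (w : ℕ) (p : Prog) (s s' : State) : Prop where
  reg : ∀ r, p.modReg r = false → s'.reg r = s.reg r
  arr : ∀ a, p.modArr a = false → s'.arr a = s.arr a
  rreg : ∀ r, p.modRReg r = false → s'.rreg r = s.rreg r
  rarr : ∀ a, p.modRArr a = false → s'.rarr a = s.rarr a
  bdd : s.Bounded w → s'.Bounded w

theorem Frame.refl (w : ℕ) (p : Prog) (s : State) : Frame w p s s :=
  ⟨fun _ _ => rfl, fun _ _ => rfl, fun _ _ => rfl, fun _ _ => rfl, id⟩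

theorem Frame.trans {w : ℕ} {p : Prog} {s s' s'' : State} (h : Frame w p s s')
    (h' : Frame w p s' s'') : Frame w p s s'' :=
  ⟨fun r hr => (h'.reg r hr).trans (h.reg r hr), fun r hr => (h'.arr r hr).trans (h.arr r hr),
    fun r hr => (h'.rreg r hr).trans (h.rreg r hr), fun r hr => (h'.rarr r hr).trans (h.rarr r hr),
    fun hs => h'.bdd (h.bdd hs)⟩

/-- `q` may write to all the memory that `p` may write to. -/
structure Prog.Sub (p q : Prog) : Prop where
  reg : ∀ r, q.modReg r = false → p.modReg r = false
  arr : ∀ r, q.modArr r = false → p.modArr r = false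
  rreg : ∀ r, q.modRReg r = false → p.modRReg r = false
  rarr : ∀ r, q.modRArr r = false → p.modRArr r = false

theorem Frame.mono {w : ℕ} {p q : Prog} {s s' : State} (h : Frame w p s s') (hpq : p.Sub q) :
    Frame w q s s' :=
  ⟨fun r hr => h.reg r (hpq.reg r hr), fun r hr => h.arr r (hpq.arr r hr),
    fun r hr => h.rreg r (hpq.rreg r hr), fun r hr => h.rarr r (hpq.rarr r hr), h.bdd⟩

theorem Prog.Sub.refl (p : Prog) : p.Sub p := ⟨fun _ => id, fun _ => id, fun _ => id, fun _ => id⟩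
theorem Prog.Sub.trans {p q r : Prog} (h : p.Sub q) (h' : q.Sub r) : p.Sub r :=
  ⟨fun x hx => h.reg x (h'.reg x hx), fun x hx => h.arr x (h'.arr x hx),
    fun x hx => h.rreg x (h'.rreg x hx), fun x hx => h.rarr x (h'.rarr x hx)⟩
theorem Prog.sub_seq_left (p q : Prog) : p.Sub (p ;; q) := by
  constructor <;> intro r h <;> simp_all [Prog.modReg, Prog.modArr, Prog.modRReg, Prog.modRArr]
theorem Prog.sub_seq_right (p q : Prog) : q.Sub (p ;; q) := by
  constructor <;> intro r h <;> simp_all [Prog.modReg, Prog.modArr, Prog.modRReg, Prog.modRArr]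
theorem Prog.sub_ite_left (b : Test) (p q : Prog) : p.Sub (.ite b p q) := by
  constructor <;> intro r h <;> simp_all [Prog.modReg, Prog.modArr, Prog.modRReg, Prog.modRArr]
theorem Prog.sub_ite_right (b : Test) (p q : Prog) : q.Sub (.ite b p q) := by
  constructor <;> intro r h <;> simp_all [Prog.modReg, Prog.modArr, Prog.modRReg, Prog.modRArr]
theorem Prog.sub_while (b : Test) (p : Prog) : p.Sub (.while b p) := by
  constructor <;> intro r h <;> simp_all [Prog.modReg, Prog.modArr, Prog.modRReg, Prog.modRArr]

/-- The memory a program may write to, as a list of pairs of a kind and a name. -/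
def Prog.writes : Prog → List (ℕ × ℕ)
  | skip => []
  | setReg r _ => [(0, r)]
  | setArr a _ _ => [(1, a)]
  | setRReg r _ => [(2, r)]
  | setRArr a _ _ => [(3, a)]
  | seq p q => p.writes ++ q.writes
  | ite _ p q => p.writes ++ q.writes
  | .while _ p => p.writes

theorem Prog.modReg_iff (p : Prog) (r : ℕ) : p.modReg r = true ↔ (0, r) ∈ p.writes := by
  induction p <;> (simp_all [modReg, writes]; try exact eq_comm)
theorem Prog.modArr_iff (p : Prog) (r : ℕ) : p.modArr r = true ↔ (1, r) ∈ p.writes := by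
  induction p <;> (simp_all [modArr, writes]; try exact eq_comm)
theorem Prog.modRReg_iff (p : Prog) (r : ℕ) : p.modRReg r = true ↔ (2, r) ∈ p.writes := by
  induction p <;> (simp_all [modRReg, writes]; try exact eq_comm)
theorem Prog.modRArr_iff (p : Prog) (r : ℕ) : p.modRArr r = true ↔ (3, r) ∈ p.writes := by
  induction p <;> (simp_all [modRArr, writes]; try exact eq_comm)

/-- For explicit programs both lists consist of numerals, so evaluation settles the inclusion and
`rfl` proves the hypothesis. This carries a frame from a piece of a program to the whole program. -/
theorem Prog.sub_of_check {p q : Prog} (h : p.writes.all (q.writes.contains ·) = true) :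
    p.Sub q := by
  simp only [List.all_eq_true, List.contains_iff_mem] at h
  constructor <;> intro r <;> contrapose! <;> simp only [ne_eq, Bool.not_eq_false]
  · rw [modReg_iff, modReg_iff]; exact h _
  · rw [modArr_iff, modArr_iff]; exact h _
  · rw [modRReg_iff, modRReg_iff]; exact h _
  · rw [modRArr_iff, modRArr_iff]; exact h _

theorem frame_setReg (w : ℕ) (s : State) (r : ℕ) (e : WExpr) :
    Frame w (.setReg r e) s (s.setReg r (e.eval w s)) := by
  refine ⟨fun r' h => ?_, fun _ _ => rfl, fun _ _ => rfl, fun _ _ => rfl,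
    fun hs => hs.setReg r (e.eval_lt hs)⟩
  simp only [Prog.modReg, beq_eq_false_iff_ne] at h
  simp [h.symm]

theorem Frame.setReg {w r v : ℕ} {p : Prog} {s s' : State} (h : Frame w p s s')
    (hr : p.modReg r = true) (hv : v < 2 ^ w) : Frame w p s (s'.setReg r v) :=
  h.trans ⟨fun r' h' => by
    rw [State.setReg_reg, if_neg]; rintro rfl; simp [hr] at h',
    fun _ _ => rfl, fun _ _ => rfl, fun _ _ => rfl, fun hs => hs.setReg r hv⟩

/-- A single induction over executions makes it unnecessary to carry unchanged memory through loop
invariants: for an explicit program, `hf.reg r rfl` says that register `r` survives. -/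
theorem Exec.frame {w : ℕ} {p : Prog} {s s' : State} {t : ℕ} (h : Exec w p s s' t) :
    Frame w p s s' := by
  induction h with
  | skip s => exact Frame.refl _ _ _
  | setReg s r e => exact frame_setReg w s r e
  | setArr s a i e =>
    refine ⟨fun _ _ => rfl, fun a' h => ?_, fun _ _ => rfl, fun _ _ => rfl,
      fun hs => hs.setArr a _ (e.eval_lt hs)⟩
    simp only [Prog.modArr, beq_eq_false_iff_ne] at h
    simp [h.symm]
  | setRReg s r e =>
    refine ⟨fun _ _ => rfl, fun _ _ => rfl, fun a' h => ?_, fun _ _ => rfl, id⟩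
    simp only [Prog.modRReg, beq_eq_false_iff_ne] at h
    simp [h.symm]
  | setRArr s a i e =>
    refine ⟨fun _ _ => rfl, fun _ _ => rfl, fun _ _ => rfl, fun a' h => ?_, id⟩
    simp only [Prog.modRArr, beq_eq_false_iff_ne] at h
    simp [h.symm]
  | seq _ _ h₁ h₂ => exact (h₁.mono (Prog.sub_seq_left _ _)).trans (h₂.mono (Prog.sub_seq_right _ _))
  | iteTrue _ _ h => exact h.mono (Prog.sub_ite_left _ _ _)
  | iteFalse _ _ h => exact h.mono (Prog.sub_ite_right _ _ _)
  | whileFalse _ => exact Frame.refl _ _ _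
  | whileTrue _ _ _ h₁ h₂ => exact (h₁.mono (Prog.sub_while _ _)).trans h₂

/-- `p`, started in `s`, halts within `T` steps in a state satisfying `Q`. -/
def Run (w : ℕ) (p : Prog) (s : State) (T : ℕ) (Q : State → Prop) : Prop :=
  ∃ s' t, Exec w p s s' t ∧ t ≤ T ∧ Q s'

/-! ### Rules for time-bounded executions. -/

section Run
variable {w T T₁ T₂ : ℕ} {p q : Prog} {s : State} {P Q : State → Prop}

theorem Run.mono (h : Run w p s T₁ P) (hT : T₁ ≤ T) (hQ : ∀ s', Frame w p s s' → P s' → Q s') :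
    Run w p s T Q := by
  obtain ⟨s', t, he, ht, hp⟩ := h
  exact ⟨s', t, he, ht.trans hT, hQ s' he.frame hp⟩

theorem Run.time (h : Run w p s T₁ Q) (hT : T₁ ≤ T) : Run w p s T Q :=
  h.mono hT fun _ _ => id

theorem Run.post (h : Run w p s T P) (hQ : ∀ s', Frame w p s s' → P s' → Q s') : Run w p s T Q :=
  h.mono le_rfl hQ

theorem Run.bind (h : Run w p s T₁ P)
    (k : ∀ s', Frame w p s s' → P s' → Run w q s' T₂ Q) : Run w (p ;; q) s (T₁ + T₂) Q := by
  obtain ⟨s', t, he, ht, hp⟩ := h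
  obtain ⟨s'', t', he', ht', hq⟩ := k s' he.frame hp
  exact ⟨s'', t + t', .seq he he', by omega, hq⟩

theorem Run.skip (h : Q s) : Run w .skip s 1 Q := ⟨s, 1, .skip s, le_rfl, h⟩
theorem Run.setReg {r : ℕ} {e : WExpr} (h : Q (s.setReg r (e.eval w s))) :
    Run w (.setReg r e) s 1 Q := ⟨_, 1, .setReg s r e, le_rfl, h⟩
theorem Run.setArr {a : ℕ} {i e : WExpr} (h : Q (s.setArr a (i.eval w s) (e.eval w s))) :
    Run w (.setArr a i e) s 1 Q := ⟨_, 1, .setArr s a i e, le_rfl, h⟩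
theorem Run.setRReg {r : ℕ} {e : RExpr} (h : Q (s.setRReg r (e.eval w s))) :
    Run w (.setRReg r e) s 1 Q := ⟨_, 1, .setRReg s r e, le_rfl, h⟩
theorem Run.setRArr {a : ℕ} {i : WExpr} {e : RExpr}
    (h : Q (s.setRArr a (i.eval w s) (e.eval w s))) :
    Run w (.setRArr a i e) s 1 Q := ⟨_, 1, .setRArr s a i e, le_rfl, h⟩

theorem Run.setReg_seq {r : ℕ} {e : WExpr} (h : Run w q (s.setReg r (e.eval w s)) T Q) :
    Run w (.setReg r e ;; q) s (T + 1) Q := by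
  obtain ⟨s', t, he, ht, hq⟩ := h
  exact ⟨s', 1 + t, .seq (.setReg s r e) he, by omega, hq⟩
theorem Run.setArr_seq {a : ℕ} {i e : WExpr}
    (h : Run w q (s.setArr a (i.eval w s) (e.eval w s)) T Q) :
    Run w (.setArr a i e ;; q) s (T + 1) Q := by
  obtain ⟨s', t, he, ht, hq⟩ := h
  exact ⟨s', 1 + t, .seq (.setArr s a i e) he, by omega, hq⟩
theorem Run.setRReg_seq {r : ℕ} {e : RExpr} (h : Run w q (s.setRReg r (e.eval w s)) T Q) :
    Run w (.setRReg r e ;; q) s (T + 1) Q := by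
  obtain ⟨s', t, he, ht, hq⟩ := h
  exact ⟨s', 1 + t, .seq (.setRReg s r e) he, by omega, hq⟩
theorem Run.setRArr_seq {a : ℕ} {i : WExpr} {e : RExpr}
    (h : Run w q (s.setRArr a (i.eval w s) (e.eval w s)) T Q) :
    Run w (.setRArr a i e ;; q) s (T + 1) Q := by
  obtain ⟨s', t, he, ht, hq⟩ := h
  exact ⟨s', 1 + t, .seq (.setRArr s a i e) he, by omega, hq⟩

theorem Run.ite {b : Test} (h₁ : b.eval w s → Run w p s T Q) (h₂ : ¬ b.eval w s → Run w q s T Q) :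
    Run w (.ite b p q) s (T + 1) Q := by
  by_cases hb : b.eval w s
  · obtain ⟨s', t, he, ht, hq⟩ := h₁ hb
    exact ⟨s', t + 1, .iteTrue hb he, by omega, hq⟩
  · obtain ⟨s', t, he, ht, hq⟩ := h₂ hb
    exact ⟨s', t + 1, .iteFalse hb he, by omega, hq⟩

/-- A loop whose variant `V` decreases in every iteration. -/
theorem Run.while {b : Test} (I : State → Prop) (V : State → ℕ)
    (hI : I s) (step : ∀ s', Frame w (.while b p) s s' → I s' → b.eval w s' →
      Run w p s' T (fun s'' => I s'' ∧ V s'' < V s')) :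
    Run w (.while b p) s (V s * (T + 1) + 1) (fun s' => I s' ∧ ¬ b.eval w s') := by
  -- The induction is on a bound for the variant, because an iteration may lower it by more than
  -- one; the frame stays relative to the start of the loop.
  suffices H : ∀ m s', Frame w (.while b p) s s' → I s' → V s' ≤ m →
      Run w (.while b p) s' (V s' * (T + 1) + 1) (fun s' => I s' ∧ ¬ b.eval w s') from
    H _ s (Frame.refl _ _ _) hI le_rfl
  intro m
  induction m with
  | zero =>
    intro s' hf hi hv
    have hb : ¬ b.eval w s' := fun hb => by
      obtain ⟨_, _, _, _, _, h⟩ := step s' hf hi hb; omega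
    exact ⟨s', 1, .whileFalse hb, by omega, hi, hb⟩
  | succ m ih =>
    intro s' hf hi hv
    by_cases hb : b.eval w s'
    · obtain ⟨s₁, t₁, he, ht, hi₁, hv₁⟩ := step s' hf hi hb
      obtain ⟨s₂, t₂, he₂, ht₂, h₂⟩ :=
        ih s₁ (hf.trans (he.frame.mono (Prog.sub_while _ _))) hi₁ (by omega)
      refine ⟨s₂, t₁ + t₂ + 1, .whileTrue hb he he₂, ?_, h₂⟩
      have : (V s₁ + 1) * (T + 1) ≤ V s' * (T + 1) := Nat.mul_le_mul_right _ hv₁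
      rw [add_mul, one_mul] at this
      omega
    · exact ⟨s', 1, .whileFalse hb, by omega, hi, hb⟩

end Run

/-- `for r in 0, …, e - 1 do body`. -/
def Prog.for (r : ℕ) (e : WExpr) (body : Prog) : Prog :=
  .setReg r 0 ;; .while (.wlt (.reg r) e) (body ;; .setReg r (.reg r + 1))

/-- The bound `e` is evaluated anew before each iteration, so it has to keep its value in all states
that the frame allows; `n < 2 ^ w` keeps the counter from wrapping around. Each iteration pays for
one test and one increment besides the body. -/
theorem Run.for {w T n r : ℕ} {e : WExpr} {body : Prog} {s : State}
    (I : ℕ → State → Prop) (hn : n < 2 ^ w) (hr : body.modReg r = false)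
    (he : ∀ s', Frame w (.for r e body) s s' → e.eval w s' = n)
    (h0 : I 0 (s.setReg r 0))
    (step : ∀ i s', i < n → Frame w (.for r e body) s s' → s'.reg r = i → I i s' →
      Run w body s' T (fun s'' => I (i + 1) (s''.setReg r (i + 1)))) :
    Run w (.for r e body) s (n * (T + 2) + 2) (fun s' => I n s') := by
  have hz : WExpr.eval w s (0 : WExpr) = 0 := by simp
  have hsub : ∀ q : Prog, q.Sub (.while (.wlt (.reg r) e) (body ;; .setReg r (.reg r + 1))) →
      q.Sub (Prog.for r e body) := fun q h => h.trans (Prog.sub_seq_right _ _)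
  have hfr : Frame w (.for r e body) s (s.setReg r 0) := by
    have := (frame_setReg w s r 0).mono (Prog.sub_seq_left _
      (.while (.wlt (.reg r) e) (body ;; .setReg r (.reg r + 1))))
    rwa [hz] at this
  have key := Run.while (w := w) (T := T + 1) (p := body ;; .setReg r (.reg r + 1))
    (b := .wlt (.reg r) e) (s := s.setReg r 0)
    (fun s' => I (s'.reg r) s' ∧ s'.reg r ≤ n) (fun s' => n - s'.reg r)
    ⟨by simpa using h0, by simp⟩ ?_
  · refine Run.setReg_seq (T := n * (T + 1 + 1) + 1) ?_
    rw [hz]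
    refine key.mono (by simp) fun s' hf h => ?_
    have hb := h.2
    have := he s' (hfr.trans (hf.mono (hsub _ (Prog.Sub.refl _))))
    simp only [Test.eval_wlt, WExpr.eval_reg, this, not_lt] at hb
    obtain ⟨h1, h2⟩ := h.1
    rwa [le_antisymm h2 hb] at h1
  · rintro s' hf ⟨hI, hle⟩ hb
    have hf' := hfr.trans (hf.mono (hsub _ (Prog.Sub.refl _)))
    have hv := he s' hf'
    simp only [Test.eval_wlt, WExpr.eval_reg, hv] at hb
    refine (step _ s' hb hf' rfl hI).bind fun s'' hf'' hI' => ?_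
    refine Run.setReg ?_
    have hreg : s''.reg r = s'.reg r := hf''.reg r hr
    have : WExpr.eval w s'' (.reg r + 1) = s'.reg r + 1 := by
      have h1 : 1 < 2 ^ w := by omega
      simp only [WExpr.eval_add, WExpr.eval_reg, WExpr.eval_ofNat, hreg]
      rw [Nat.mod_eq_of_lt h1, Nat.mod_eq_of_lt (by omega)]
    rw [this]
    simp only [State.setReg_reg, if_true]
    exact ⟨⟨hI', by omega⟩, by omega⟩

/-! ## Binary search -/

/-- The least index in `[lo, hi]` at which the test on `mid` fails, where `lo`, `hi` and `mid` are
registers `35`, `36` and `37`. -/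
def bsearch (c : Test) : Prog :=
  .while (.wlt (.reg 35) (.reg 36))
    (.setReg 37 ((.reg 35 + .reg 36) / 2) ;;
     .ite c (.setReg 35 (.reg 37 + 1)) (.setReg 36 (.reg 37)))

/-- The variant is the binary length of the remaining interval. The first alternative of `hab`
admits an empty interval with `b ≤ a`, which occurs when the block to be searched starts beyond the
end of the sequence. -/
theorem run_bsearch {w D a b ans : ℕ} {c : Test} {s : State} (ha : s.reg 35 = a)
    (hb : s.reg 36 = b) (hab : ans = a ∧ b ≤ a ∨ a ≤ ans ∧ ans ≤ b) (hD : b < a + 2 ^ D)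
    (hw : 2 * b + 2 < 2 ^ w)
    (hc : ∀ s' m, Frame w (bsearch c) s s' → a ≤ m → m < b → s'.reg 37 = m →
      (c.eval w s' ↔ m < ans)) :
    Run w (bsearch c) s (4 * D + 1) (fun s' => s'.reg 35 = ans) := by
  have key := Run.while (w := w) (T := 3)
    (b := .wlt (.reg 35) (.reg 36)) (p := .setReg 37 ((.reg 35 + .reg 36) / 2) ;;
     .ite c (.setReg 35 (.reg 37 + 1)) (.setReg 36 (.reg 37))) (s := s)
    (fun s' => a ≤ s'.reg 35 ∧ s'.reg 36 ≤ b ∧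
      (ans = s'.reg 35 ∧ s'.reg 36 ≤ s'.reg 35 ∨ s'.reg 35 ≤ ans ∧ ans ≤ s'.reg 36))
    (fun s' => Nat.size (s'.reg 36 - s'.reg 35))
    ⟨by omega, by omega, by rw [ha, hb]; exact hab⟩ ?_
  · refine key.mono ?_ ?_
    · have : Nat.size (s.reg 36 - s.reg 35) ≤ D :=
        Nat.size_le.2 (by have := Nat.two_pow_pos D; omega)
      omega
    · rintro s' - ⟨⟨h1, h2, h3⟩, h4⟩
      simp only [Test.eval_wlt, WExpr.eval_reg, not_lt] at h4
      omega
  · rintro s' hf ⟨h1, h2, h3⟩ h4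
    simp only [Test.eval_wlt, WExpr.eval_reg] at h4
    set x := s'.reg 35 with hx
    set y := s'.reg 36 with hy
    -- Halving a positive length removes at least one binary digit.
    have hsz : ∀ d, d ≤ (y - x) / 2 → Nat.size d < Nat.size (y - x) := fun d hd => by
      have h5 : 0 < Nat.size (y - x) := Nat.size_pos.2 (by omega)
      have : Nat.size d ≤ Nat.size (y - x) - 1 := by
        rw [Nat.size_le]
        have := Nat.lt_size_self (y - x)
        have h6 : 2 ^ Nat.size (y - x) = 2 * 2 ^ (Nat.size (y - x) - 1) := by
          rw [← pow_succ']; congr 1; omega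
        omega
      omega
    have hm : WExpr.eval w s' ((.reg 35 + .reg 36) / 2) = (x + y) / 2 := by
      simp (disch := omega) only [WExpr.eval_div, WExpr.eval_add, WExpr.eval_reg,
        WExpr.eval_ofNat, Nat.mod_eq_of_lt, ← hx, ← hy]
    refine Run.setReg_seq ?_
    rw [hm]
    have hf' : Frame w (bsearch c) s (s'.setReg 37 ((x + y) / 2)) := by
      rw [← hm]
      exact hf.trans ((frame_setReg w s' 37 _).mono
        ((Prog.sub_seq_left _ _).trans (Prog.sub_while _ _)))
    have hcc := hc _ ((x + y) / 2) hf' (by omega) (by omega) (by simp)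
    refine Run.ite (fun ht => Run.setReg ?_) (fun ht => Run.setReg ?_)
    · have : WExpr.eval w (s'.setReg 37 ((x + y) / 2)) (.reg 37 + 1) = (x + y) / 2 + 1 := by
        simp (disch := omega) [Nat.mod_eq_of_lt]
      rw [this]
      have := hcc.1 ht
      simp only [State.setReg_reg, ← hy]
      simp only [reduceIte, Nat.reduceEqDiff]
      exact ⟨⟨by omega, by omega, by omega⟩, hsz _ (by omega)⟩
    · have := mt hcc.2 ht
      simp only [State.setReg_reg, WExpr.eval_reg, ← hx]
      simp only [reduceIte, Nat.reduceEqDiff]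
      exact ⟨⟨by omega, by omega, by omega⟩, hsz _ (by omega)⟩

/-! ## Relocation -/

def WExpr.shift (K : ℕ) : WExpr → WExpr
  | .const c => .const c
  | .reg r => .reg (K + r)
  | .arr a i => .arr (K + a) (i.shift K)
  | .op o a b => .op o (a.shift K) (b.shift K)

def RExpr.shift (K : ℕ) : RExpr → RExpr
  | .reg r => .reg (K + r)
  | .arr a i => .arr (K + a) (i.shift K)
  | .ofWord e => .ofWord (e.shift K)
  | .op o a b => .op o (a.shift K) (b.shift K)

def Test.shift (K : ℕ) : Test → Test
  | .wlt a b => .wlt (a.shift K) (b.shift K)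
  | .weq a b => .weq (a.shift K) (b.shift K)
  | .rlt a b => .rlt (a.shift K) (b.shift K)
  | .req a b => .req (a.shift K) (b.shift K)
  | .not b => .not (b.shift K)
  | .and a b => .and (a.shift K) (b.shift K)

/-- The program that works like `p` on the memory with names at least `K`. -/
def Prog.shift (K : ℕ) : Prog → Prog
  | skip => skip
  | setReg r e => setReg (K + r) (e.shift K)
  | setArr a i e => setArr (K + a) (i.shift K) (e.shift K)
  | setRReg r e => setRReg (K + r) (e.shift K)
  | setRArr a i e => setRArr (K + a) (i.shift K) (e.shift K)
  | seq p q => seq (p.shift K) (q.shift K)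
  | ite b p q => ite (b.shift K) (p.shift K) (q.shift K)
  | .while b p => .while (b.shift K) (p.shift K)

/-- The part of the memory with names at least `K`. -/
def State.view (K : ℕ) (s : State) : State where
  reg r := s.reg (K + r)
  arr a := s.arr (K + a)
  rreg r := s.rreg (K + r)
  rarr a := s.rarr (K + a)

theorem State.Bounded.view {w : ℕ} {s : State} (hs : s.Bounded w) (K : ℕ) :
    (s.view K).Bounded w := ⟨fun _ => hs.1 _, fun _ _ => hs.2 _ _⟩

theorem WExpr.eval_shift (K w : ℕ) (s : State) (e : WExpr) :
    (e.shift K).eval w s = e.eval w (s.view K) := by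
  induction e <;> simp_all [WExpr.shift, WExpr.eval, State.view]

theorem RExpr.eval_shift (K w : ℕ) (s : State) (e : RExpr) :
    (e.shift K).eval w s = e.eval w (s.view K) := by
  induction e <;> simp_all [RExpr.shift, RExpr.eval, State.view, WExpr.eval_shift]

theorem Test.eval_shift (K w : ℕ) (s : State) (b : Test) :
    (b.shift K).eval w s ↔ b.eval w (s.view K) := by
  induction b <;> simp_all [Test.shift, Test.eval, WExpr.eval_shift, RExpr.eval_shift]

theorem update_comp_add {α : Type} (f : ℕ → α) (K r : ℕ) (v : α) :
    (fun i => Function.update f (K + r) v (K + i)) = Function.update (fun i => f (K + i)) r v := by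
  funext i; simp [Function.update_apply]

/-- All names in the relocated program are translated by `K`, and `State.view` undoes the
translation, so the two executions agree step by step. The initial contents of the upper memory are
arbitrary, as the specification of a subroutine permits. -/
theorem Exec.shift {w K : ℕ} {p : Prog} {s₀ s₁ : State} {t : ℕ} (h : Exec w p s₀ s₁ t) :
    ∀ s : State, s.view K = s₀ → ∃ s', Exec w (p.shift K) s s' t ∧ s'.view K = s₁ := by
  induction h with
  | skip s₀ => exact fun s hs => ⟨s, .skip s, hs⟩
  | setReg s₀ r e =>
    rintro s rfl
    refine ⟨_, .setReg s _ _, ?_⟩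
    simp [State.view, WExpr.eval_shift, update_comp_add]
  | setArr s₀ a i e =>
    rintro s rfl
    refine ⟨_, .setArr s _ _ _, ?_⟩
    simp [State.view, WExpr.eval_shift, update_comp_add]
  | setRReg s₀ r e =>
    rintro s rfl
    refine ⟨_, .setRReg s _ _, ?_⟩
    simp [State.view, RExpr.eval_shift, update_comp_add]
  | setRArr s₀ a i e =>
    rintro s rfl
    refine ⟨_, .setRArr s _ _ _, ?_⟩
    simp [State.view, WExpr.eval_shift, RExpr.eval_shift, update_comp_add]
  | seq _ _ h₁ h₂ =>
    intro s hs
    obtain ⟨s', he, hs'⟩ := h₁ s hs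
    obtain ⟨s'', he', hs''⟩ := h₂ s' hs'
    exact ⟨s'', .seq he he', hs''⟩
  | iteTrue hb _ h =>
    intro s hs
    obtain ⟨s', he, hs'⟩ := h s hs
    exact ⟨s', .iteTrue ((Test.eval_shift ..).2 (hs ▸ hb)) he, hs'⟩
  | iteFalse hb _ h =>
    intro s hs
    obtain ⟨s', he, hs'⟩ := h s hs
    exact ⟨s', .iteFalse (mt (Test.eval_shift ..).1 (hs ▸ hb)) he, hs'⟩
  | whileFalse hb =>
    exact fun s hs => ⟨s, .whileFalse (mt (Test.eval_shift ..).1 (hs ▸ hb)), hs⟩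
  | whileTrue hb _ _ h₁ h₂ =>
    intro s hs
    obtain ⟨s', he, hs'⟩ := h₁ s hs
    obtain ⟨s'', he', hs''⟩ := h₂ s' hs'
    exact ⟨s'', .whileTrue ((Test.eval_shift ..).2 (hs ▸ hb)) he he', hs''⟩

theorem Run.shift {w K T : ℕ} {p : Prog} {s : State} {Q : State → Prop}
    (h : Run w p (s.view K) T Q) : Run w (p.shift K) s T (fun s' => Q (s'.view K)) := by
  obtain ⟨s', t, he, ht, hq⟩ := h
  obtain ⟨s'', he', rfl⟩ := he.shift s rfl
  exact ⟨s'', t, he', ht, hq⟩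

/-- The data of the caller survive a subroutine about which nothing is known except its
specification. -/
theorem Prog.shift_mod (p : Prog) {K r : ℕ} (hr : r < K) :
    (p.shift K).modReg r = false ∧ (p.shift K).modArr r = false ∧
      (p.shift K).modRReg r = false ∧ (p.shift K).modRArr r = false := by
  induction p <;>
    simp_all [Prog.shift, modReg, modArr, modRReg, modRArr, (show ∀ a, K + a ≠ r by omega)]

/-! ## Sorting -/

/-- `lt` is a strict total order on the numbers below `N`. -/
structure StrictOn (lt : ℕ → ℕ → Prop) (N : ℕ) : Prop where
  irrefl : ∀ x < N, ¬ lt x x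
  trans : ∀ x < N, ∀ y < N, ∀ z < N, lt x y → lt y z → lt x z
  total : ∀ x < N, ∀ y < N, x ≠ y → lt x y ∨ lt y x

open scoped Classical in
/-- The number of elements of `S` that precede `x`. -/
noncomputable def cnt (lt : ℕ → ℕ → Prop) (S : Finset ℕ) (x : ℕ) : ℕ :=
  (S.filter fun y => lt y x).card

/-- The position of `x` in the sorted sequence of the numbers below `N`. -/
noncomputable def rank (lt : ℕ → ℕ → Prop) (N x : ℕ) : ℕ := cnt lt (Finset.range N) x

section
variable {lt : ℕ → ℕ → Prop} {N : ℕ} (h : StrictOn lt N) {S : Finset ℕ}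
include h

/-- The sets of predecessors are nested by transitivity; if `y` precedes `x`, the inclusion is
strict because `y` is not its own predecessor. -/
theorem StrictOn.cnt_lt_iff (hS : ∀ y ∈ S, y < N) {x y : ℕ} (hx : x < N) (hy : y ∈ S) :
    cnt lt S y < cnt lt S x ↔ lt y x := by
  classical
  have hy' := hS y hy
  constructor
  · intro hlt
    by_contra hn
    refine absurd hlt (not_lt.2 (Finset.card_le_card fun z hz => ?_))
    simp only [Finset.mem_filter] at hz ⊢
    refine ⟨hz.1, ?_⟩
    rcases eq_or_ne x y with rfl | hne
    · exact hz.2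
    · exact h.trans z (hS z hz.1) x hx y hy' hz.2 ((h.total x hx y hy' hne).resolve_right hn)
  · intro hlt
    refine Finset.card_lt_card ?_
    rw [Finset.ssubset_iff_of_subset]
    · exact ⟨y, by simp [hy, hlt], by simp [h.irrefl y hy']⟩
    · intro z hz
      simp only [Finset.mem_filter] at hz ⊢
      exact ⟨hz.1, h.trans z (hS z hz.1) y hy' x hx hz.2 hlt⟩

theorem StrictOn.cnt_lt_card (hS : ∀ y ∈ S, y < N) {x : ℕ} (hx : x ∈ S) :
    cnt lt S x < S.card := by
  classical
  refine Finset.card_lt_card ?_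
  rw [Finset.ssubset_iff_of_subset (Finset.filter_subset _ _)]
  exact ⟨x, hx, by simp [h.irrefl x (hS x hx)]⟩

theorem StrictOn.cnt_inj (hS : ∀ y ∈ S, y < N) {x y : ℕ} (hx : x ∈ S) (hy : y ∈ S)
    (hxy : cnt lt S x = cnt lt S y) : x = y := by
  by_contra hne
  rcases h.total x (hS x hx) y (hS y hy) hne with h' | h'
  · exact hxy.not_lt ((h.cnt_lt_iff hS (hS y hy) hx).2 h')
  · exact hxy.not_gt ((h.cnt_lt_iff hS (hS x hx) hy).2 h')

theorem StrictOn.cnt_surj (hS : ∀ y ∈ S, y < N) {m : ℕ} (hm : m < S.card) :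
    ∃ x ∈ S, cnt lt S x = m := by
  have := Finset.surj_on_of_inj_on_of_card_le (s := S) (t := Finset.range S.card)
    (fun x _ => cnt lt S x) (fun x hx => Finset.mem_range.2 (h.cnt_lt_card hS hx))
    (fun x y hx hy => h.cnt_inj hS hx hy) (by simp) m (Finset.mem_range.2 hm)
  obtain ⟨x, hx, e⟩ := this
  exact ⟨x, hx, e.symm⟩

theorem StrictOn.rank_lt {x : ℕ} (hx : x < N) : rank lt N x < N := by
  have := h.cnt_lt_card (S := Finset.range N) (by simp) (Finset.mem_range.2 hx)
  rwa [Finset.card_range] at this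

theorem StrictOn.rank_lt_iff {x y : ℕ} (hx : x < N) (hy : y < N) :
    rank lt N x < rank lt N y ↔ lt x y :=
  h.cnt_lt_iff (S := Finset.range N) (by simp) hy (Finset.mem_range.2 hx)

theorem StrictOn.rank_inj {x y : ℕ} (hx : x < N) (hy : y < N) (e : rank lt N x = rank lt N y) :
    x = y :=
  h.cnt_inj (S := Finset.range N) (by simp) (Finset.mem_range.2 hx) (Finset.mem_range.2 hy) e

theorem StrictOn.rank_surj {m : ℕ} (hm : m < N) : ∃ x < N, rank lt N x = m := by
  obtain ⟨x, hx, e⟩ := h.cnt_surj (S := Finset.range N) (by simp) (m := m) (by simpa)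
  exact ⟨x, Finset.mem_range.1 hx, e⟩

end

/-- The `b`-th block of length `W` of the numbers below `N`. -/
def block (N W b : ℕ) : Finset ℕ := (Finset.range N).filter fun y => y / W = b

theorem mem_block {N W b y : ℕ} : y ∈ block N W b ↔ y < N ∧ y / W = b := by simp [block]

theorem card_block {N W : ℕ} (hW : 0 < W) (b : ℕ) :
    (block N W b).card = min N (b * W + W) - b * W := by
  have : block N W b = Finset.Ico (b * W) (min N (b * W + W)) := by
    ext y
    rw [mem_block, Nat.div_eq_iff hW, Finset.mem_Ico, lt_min_iff]
    omega
  rw [this, Nat.card_Ico]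

/-- The position of `x` after sorting all blocks of length `W`. -/
noncomputable def blockPos (lt : ℕ → ℕ → Prop) (N W x : ℕ) : ℕ :=
  x / W * W + cnt lt (block N W (x / W)) x

section
variable {lt : ℕ → ℕ → Prop} {N W : ℕ} (h : StrictOn lt N) (hW : 0 < W)
include h hW

theorem StrictOn.cnt_block_lt {x : ℕ} (hx : x < N) :
    cnt lt (block N W (x / W)) x < W ∧ x / W * W + cnt lt (block N W (x / W)) x < N := by
  have h1 := h.cnt_lt_card (S := block N W (x / W)) (fun y hy => (mem_block.1 hy).1)
    (mem_block.2 ⟨hx, rfl⟩)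
  rw [card_block hW] at h1
  omega

theorem StrictOn.blockPos_div {x : ℕ} (hx : x < N) : blockPos lt N W x / W = x / W := by
  have := (h.cnt_block_lt hW hx).1
  rw [blockPos, mul_comm, Nat.mul_add_div hW, Nat.div_eq_of_lt this, add_zero]

theorem StrictOn.blockPos_mod {x : ℕ} (hx : x < N) :
    blockPos lt N W x % W = cnt lt (block N W (x / W)) x := by
  have := (h.cnt_block_lt hW hx).1
  rw [blockPos, mul_comm, Nat.mul_add_mod, Nat.mod_eq_of_lt this]

theorem StrictOn.blockPos_inj {x y : ℕ} (hx : x < N) (hy : y < N)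
    (e : blockPos lt N W x = blockPos lt N W y) : x = y := by
  have h1 : x / W = y / W := by rw [← h.blockPos_div hW hx, e, h.blockPos_div hW hy]
  have h2 : cnt lt (block N W (x / W)) x = cnt lt (block N W (x / W)) y := by
    rw [← h.blockPos_mod hW hx, e, h.blockPos_mod hW hy, h1]
  exact h.cnt_inj (fun z hz => (mem_block.1 hz).1) (mem_block.2 ⟨hx, rfl⟩)
    (mem_block.2 ⟨hy, h1.symm⟩) h2

theorem StrictOn.blockPos_surj {i : ℕ} (hi : i < N) : ∃ x < N, blockPos lt N W x = i := by
  have hm := Nat.mod_lt i hW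
  have hd := Nat.div_add_mod' i W
  obtain ⟨x, hx, e⟩ := h.cnt_surj (S := block N W (i / W)) (fun y hy => (mem_block.1 hy).1)
    (m := i % W) (by rw [card_block hW]; omega)
  rw [mem_block] at hx
  exact ⟨x, hx.1, by rw [blockPos, hx.2, e, hd]⟩

omit h hW in
-- A block of length `2 * W` is the disjoint union of the siblings `b` and `sib`, so the counts add
-- up. The first count is known from the position of `x` in its own sorted block, and one binary
-- search in the sibling gives the second.
theorem blockPos_double {x b sib : ℕ} (hb : b = x / W) (hsib : sib = b + 1 - 2 * (b % 2)) :
    blockPos lt N (W * 2) x =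
      b / 2 * (W * 2) + cnt lt (block N W b) x + cnt lt (block N W sib) x := by
  classical
  rw [blockPos, ← Nat.div_div_eq_div_mul, ← hb, add_assoc]
  congr 1
  rw [cnt, cnt, cnt, ← Finset.card_union_of_disjoint]
  · congr 1
    ext y
    simp only [Finset.mem_union, Finset.mem_filter, mem_block, ← Nat.div_div_eq_div_mul]
    generalize y / W = z
    have : z / 2 = b / 2 ↔ z = b ∨ z = sib := by omega
    rw [this]; tauto
  · rw [Finset.disjoint_left]
    intro y hy hy'
    simp only [Finset.mem_filter, mem_block] at hy hy'
    omega

end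

theorem blockPos_one {lt : ℕ → ℕ → Prop} {N : ℕ} (h : StrictOn lt N) {x : ℕ} (hx : x < N) :
    blockPos lt N 1 x = x := by
  have := h.blockPos_div one_pos hx
  simpa using this

theorem blockPos_of_le {lt : ℕ → ℕ → Prop} {N W : ℕ} (hW : N ≤ W) {x : ℕ} (hx : x < N) :
    blockPos lt N W x = rank lt N x := by
  have h1 : ∀ y < N, y / W = 0 := fun y hy => Nat.div_eq_of_lt (hy.trans_le hW)
  have : block N W 0 = Finset.range N := by
    ext y; rw [mem_block, Finset.mem_range]; exact ⟨fun h => h.1, fun h => ⟨h, h1 y h⟩⟩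
  rw [blockPos, h1 x hx, this, rank]; simp

/-- One merging pass; `c` compares two elements. -/
def mergePass (c : WExpr → WExpr → Test) : Prog :=
  .for 32 (.reg 30) (
    .setReg 33 (.arr 10 (.reg 32)) ;;
    .setReg 34 (.reg 32 / .reg 31) ;;
    .setReg 39 ((.reg 34 + 1 - 2 * (.reg 34 % 2)) * .reg 31) ;;
    .setReg 35 (.reg 39) ;;
    .setReg 36 (.reg 39 + .reg 31) ;;
    .ite (.wlt (.reg 30) (.reg 36)) (.setReg 36 (.reg 30)) .skip ;;
    bsearch (c (.arr 10 (.reg 37)) (.reg 33)) ;;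
    .setArr 11 (.reg 34 / 2 * (.reg 31 * 2) + .reg 32 % .reg 31 + (.reg 35 - .reg 39)) (.reg 33)) ;;
  .for 32 (.reg 30) (.setArr 10 (.reg 32) (.arr 11 (.reg 32)))

/-- Sorts the numbers below register `30`, in `D` passes, where `D` is register `29`: array `10`
will hold the sorted sequence, and array `12` the positions. -/
def sortProg (c : WExpr → WExpr → Test) : Prog :=
  .for 32 (.reg 30) (.setArr 10 (.reg 32) (.reg 32)) ;;
  .setReg 31 1 ;;
  .for 38 (.reg 29) (mergePass c ;; .setReg 31 (.reg 31 * 2)) ;;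
  .for 32 (.reg 30) (.setArr 12 (.arr 10 (.reg 32)) (.reg 32))

theorem run_mergePass {lt : ℕ → ℕ → Prop} {w N D W : ℕ} (h : StrictOn lt N)
    {c : WExpr → WExpr → Test} {s : State} (hW : 0 < W) (hWD : W * 2 ≤ 2 ^ D)
    (hw : 2 * N + 6 * 2 ^ D + 4 < 2 ^ w) (h30 : s.reg 30 = N) (h31 : s.reg 31 = W)
    (hc : ∀ s', Frame w (mergePass c) s s' → ∀ e₁ e₂, e₁.eval w s' < N → e₂.eval w s' < N →
      ((c e₁ e₂).eval w s' ↔ lt (e₁.eval w s') (e₂.eval w s')))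
    (ha : ∀ x < N, s.arr 10 (blockPos lt N W x) = x) :
    Run w (mergePass c) s (N * (4 * D + 15) + N * 3 + 4)
      (fun s' => ∀ x < N, s'.arr 10 (blockPos lt N (W * 2) x) = x) := by
  classical
  have hN : N < 2 ^ w := by omega
  refine (Run.bind (T₁ := N * (4 * D + 15) + 2) (T₂ := N * 3 + 2)
    (Run.for (n := N) (T := 4 * D + 13)
    (fun i s' => ∀ x < N, blockPos lt N W x < i → s'.arr 11 (blockPos lt N (W * 2) x) = x)
    hN rfl (fun s' hf => by simpa [hf.reg 30 rfl] using h30) (by simp) ?_) ?_).time (by omega)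
  · intro i s' hi hf h32 hI
    obtain ⟨x, hx, hxi⟩ := h.blockPos_surj hW hi
    have h30' : s'.reg 30 = N := by rw [hf.reg 30 rfl, h30]
    have h31' : s'.reg 31 = W := by rw [hf.reg 31 rfl, h31]
    have h10' : s'.arr 10 = s.arr 10 := hf.arr 10 rfl
    have hxa : s'.arr 10 i = x := by rw [h10', ← hxi, ha x hx]
    obtain ⟨b, hb⟩ : ∃ b, b = i / W := ⟨_, rfl⟩
    have hbx : b = x / W := by rw [← h.blockPos_div hW hx, hxi, hb]
    have hbW : b * W ≤ i := hb ▸ Nat.div_mul_le_self i W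
    obtain ⟨sib, hsib⟩ : ∃ sib, sib = b + 1 - 2 * (b % 2) := ⟨_, rfl⟩
    have hsW : sib * W ≤ b * W + W := by
      rw [← Nat.succ_mul]; exact Nat.mul_le_mul_right _ (by omega)
    have hdi : b ≤ i := hb ▸ Nat.div_le_self i W
    have hc' : cnt lt (block N W sib) x ≤ (block N W sib).card := Finset.card_filter_le _ _
    have hcard := card_block (N := N) hW sib
    have hbb : b / 2 * (W * 2) ≤ b * W := by
      calc b / 2 * (W * 2) = (b / 2 * 2) * W := by ring
        _ ≤ b * W := Nat.mul_le_mul_right _ (Nat.div_mul_le_self _ _)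
    have hmod : i % W < W := Nat.mod_lt _ hW
    have hmod' : i % W = cnt lt (block N W b) x := by rw [← hxi, h.blockPos_mod hW hx, hbx]
    have hdbl := blockPos_double (lt := lt) (N := N) hbx hsib
    refine Run.time (T₁ := (((((((1 + 1) + ((4 * D + 1) + 1)) + 1) + 1) + 1) + 1) + 1)) ?_
      (by omega)
    refine Run.setReg_seq (Run.setReg_seq (Run.setReg_seq (Run.setReg_seq (Run.setReg_seq ?_))))
    simp (disch := omega) only [WExpr.eval_reg, WExpr.eval_arr, WExpr.eval_add, WExpr.eval_sub,
      WExpr.eval_mul, WExpr.eval_div, WExpr.eval_mod, WExpr.eval_ofNat, State.setReg_reg,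
      State.setReg_arr, mod_pow_of_lt, h32, hxa, h31', reduceIte,
      Nat.reduceEqDiff, ← hb, ← hsib]
    obtain ⟨s₁, hs₁⟩ : ∃ s₁, s₁ = State.setReg (State.setReg (State.setReg (State.setReg
      (State.setReg s' 33 x) 34 b) 39 (sib * W)) 35 (sib * W)) 36 (sib * W + W) := ⟨_, rfl⟩
    rw [← hs₁]
    have hf₁ : Frame w (mergePass c) s s₁ := by
      rw [hs₁]
      refine Frame.setReg (Frame.setReg (Frame.setReg (Frame.setReg (Frame.setReg
        (hf.mono (Prog.sub_of_check rfl)) rfl ?_) rfl ?_) rfl ?_) rfl ?_) rfl ?_ <;> omega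
    -- The end of the sibling block, cut off at `N`; if the sibling lies beyond `N`, this is at most
    -- its start and the search interval is empty.
    obtain ⟨e, he⟩ : ∃ e, e = min N (sib * W + W) := ⟨_, rfl⟩
    have he' : e ≤ N ∧ e ≤ sib * W + W ∧ (e = N ∨ e = sib * W + W) := by omega
    rw [← he] at hcard
    refine Run.bind (P := fun s₂ => s₂.reg 36 = e) ?_ ?_
    · refine Run.ite (fun hb => Run.setReg ?_) (fun hb => Run.skip ?_) <;>
      · simp [hs₁, h30'] at hb ⊢
        omega
    intro s₂ hf₂ h36
    have hc₂ : Frame w (mergePass c) s s₂ := hf₁.trans (hf₂.mono (Prog.sub_of_check rfl))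
    refine Run.bind (run_bsearch (D := D) (a := sib * W) (b := e)
      (ans := sib * W + cnt lt (block N W sib) x) ?_ h36 ?_ ?_ ?_ ?_) ?_
    · rw [hf₂.reg 35 rfl, hs₁]; simp
    · generalize sib * W = a at hcard ⊢; omega
    · have := Nat.two_pow_pos D; omega
    · omega
    · intro s₃ m hf₃ ham hmb h37
      have hf' : Frame w (mergePass c) s s₃ := hc₂.trans (hf₃.mono (Prog.sub_of_check rfl))
      have h33 : s₃.reg 33 = x := by rw [hf₃.reg 33 rfl, hf₂.reg 33 rfl, hs₁]; simp
      have h10 : s₃.arr 10 = s.arr 10 := by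
        rw [hf₃.arr 10 rfl, hf₂.arr 10 rfl, hs₁]; simp [h10']
      -- The entry at index `m` of the sorted sibling block has exactly `m - sib * W` predecessors
      -- in the block, so comparing it with `x` amounts to comparing counts.
      obtain ⟨y, hy, hym⟩ := h.cnt_surj (S := block N W sib) (fun y hy => (mem_block.1 hy).1)
        (m := m - sib * W) (by omega)
      have hy' := mem_block.1 hy
      have hya : s₃.arr 10 m = y := by
        rw [h10, show m = blockPos lt N W y by rw [blockPos, hy'.2, hym]; omega, ha y hy'.1]
      rw [hc s₃ hf' _ _ (by simp [h37, hya, hy'.1]) (by simp [h33, hx])]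
      simp only [WExpr.eval_arr, WExpr.eval_reg, h37, hya, h33]
      rw [← h.cnt_lt_iff (fun y hy => (mem_block.1 hy).1) hx hy, hym]
      omega
    · intro s₃ hf₃ h35
      have hr : ∀ r, r ≠ 35 → r ≠ 36 → r ≠ 37 → s₃.reg r = s₁.reg r := fun r h1 h2 h3 => by
        rw [hf₃.reg r, hf₂.reg r] <;> simp [Prog.modReg, bsearch] <;> omega
      have h11 : s₃.arr 11 = s'.arr 11 := by
        rw [hf₃.arr 11 rfl, hf₂.arr 11 rfl, hs₁]; simp
      refine Run.setArr ?_
      intro z hz hzi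
      simp (disch := omega) only [WExpr.eval_reg, WExpr.eval_add, WExpr.eval_sub, WExpr.eval_mul,
        WExpr.eval_div, WExpr.eval_mod, WExpr.eval_ofNat, h35, hr 34, hr 31, hr 32, hr 39, hr 33,
        hs₁, State.setReg_reg, h32, h31', Nat.reduceEqDiff, reduceIte, mod_pow_of_lt,
        State.setArr_arr, h11, Nat.add_sub_cancel_left, hmod', ← hdbl]
      split_ifs with hzx
      · exact (h.blockPos_inj (by omega) hz hx hzx).symm
      · refine hI z hz (lt_of_le_of_ne (by omega) fun hh => hzx ?_)
        rw [h.blockPos_inj hW hz hx (hh.trans hxi.symm)]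
  · intro s₁ hf hI
    have h30' : s₁.reg 30 = N := by rw [hf.reg 30 rfl, h30]
    refine (Run.for (n := N) (T := 1) (fun i s' => ∀ j < i, s'.arr 10 j = s₁.arr 11 j)
      hN rfl (fun s' hf' => by simpa [hf'.reg 30 rfl] using h30') (by simp) ?_).post ?_
    · intro i s' hi hf' h32 hI'
      refine Run.setArr fun j hj => ?_
      simp only [State.setReg_arr, State.setArr_arr, WExpr.eval_reg, WExpr.eval_arr, h32, if_true,
        hf'.arr 11 rfl]
      split_ifs with hji
      · rw [hji]
      · exact hI' j (by omega)
    · intro s' hf' hI' x hx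
      have hlt : blockPos lt N (W * 2) x < N := (h.cnt_block_lt (by omega) hx).2
      rw [hI' _ hlt, hI x hx ((h.cnt_block_lt hW hx).2)]

/-- The length of the sorted blocks doubles from `1` to `2 ^ D ≥ N`; then there is one block, and
positions in it are ranks. A pass costs one binary search per element, which accounts for the second
factor of order `D`. -/
theorem run_sortProg {lt : ℕ → ℕ → Prop} {w N D : ℕ} (h : StrictOn lt N)
    {c : WExpr → WExpr → Test} {s : State} (hs : s.Bounded w) (hND : N ≤ 2 ^ D)
    (hw : 8 * 2 ^ D + 4 < 2 ^ w) (h30 : s.reg 30 = N) (h29 : s.reg 29 = D)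
    (hc : ∀ s', Frame w (sortProg c) s s' → ∀ e₁ e₂, e₁.eval w s' < N → e₂.eval w s' < N →
      ((c e₁ e₂).eval w s' ↔ lt (e₁.eval w s') (e₂.eval w s'))) :
    Run w (sortProg c) s ((D + 1) * (N * (4 * D + 18) + 16))
      (fun s' => ∀ x < N, s'.arr 10 (rank lt N x) = x ∧ s'.arr 12 x = rank lt N x) := by
  have hD : D < 2 ^ D := Nat.lt_two_pow_self
  refine (Run.bind (T₁ := N * 3 + 2) (P := fun s' => ∀ j < N, s'.arr 10 j = j)
    (Run.for (n := N) (T := 1) (fun i s' => ∀ j < i, s'.arr 10 j = j) (by omega) rfl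
      (fun s' hf => by simpa [hf.reg 30 rfl] using h30) (by simp) ?_) fun s₁ hf₁ h₁ =>
    Run.setReg_seq (Run.bind
      (P := fun s' => ∀ x < N, s'.arr 10 (rank lt N x) = x)
      (T₁ := D * (N * (4 * D + 18) + 5 + 2) + 2) (T₂ := N * 3 + 2)
      (((Run.for (n := D) (T := N * (4 * D + 18) + 5)
        (fun i s' => s'.reg 31 = 2 ^ i ∧ ∀ x < N, s'.arr 10 (blockPos lt N (2 ^ i) x) = x)
        (by omega) rfl ?_ ?_ ?_)).post ?_) fun s₂ hf₂ h₂ => ?_)).time ?_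
  · intro i s' hi hf h32 hI
    refine Run.setArr fun j hj => ?_
    simp only [State.setReg_arr, State.setArr_arr, WExpr.eval_reg, h32, if_true]
    split_ifs with hji
    · exact hji.symm
    · exact hI j (by omega)
  · intro s' hf'
    rw [WExpr.eval_reg, hf'.reg 29 rfl]
    simpa [hf₁.reg 29 rfl] using h29
  · constructor
    · simp (disch := omega) [mod_pow_of_lt]
    · intro x hx
      simp only [pow_zero, State.setReg_arr, blockPos_one h hx]
      exact h₁ x hx
  · rintro i s' hi hf' h38 ⟨h31, hI⟩
    have hf : Frame w (sortProg c) s s' := by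
      refine (((hf₁.mono (Prog.sub_of_check rfl)).setReg ?_ ?_)).trans
        (hf'.mono (Prog.sub_of_check rfl))
      · rfl
      · exact WExpr.eval_lt (hf₁.bdd hs) 1
    have hle : 2 ^ i * 2 ≤ 2 ^ D := by
      rw [← pow_succ]; exact Nat.pow_le_pow_right (by omega) hi
    refine Run.time (T₁ := N * (4 * D + 15) + N * 3 + 4 + 1) (Run.bind (run_mergePass (D := D) h
      (Nat.two_pow_pos i) (by omega) (by omega) ?_ h31 ?_ hI)
      (fun s₂ hf₂ h₂ => Run.setReg ?_)) ?_
    · rw [hf.reg 30 rfl, h30]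
    · exact fun s₂ hf₂ => hc s₂ (hf.trans (hf₂.mono (Prog.sub_of_check rfl)))
    · have := hf₂.reg 31 rfl
      refine ⟨by simp (disch := omega) [mod_pow_of_lt, this, h31, pow_succ], ?_⟩
      simpa [pow_succ] using h₂
    · ring_nf; omega
  · rintro s' hf' ⟨-, hI⟩ x hx
    rw [← blockPos_of_le hND hx]
    exact hI x hx
  · have h30' : s₂.reg 30 = N := by rw [hf₂.reg 30 rfl]; simpa [hf₁.reg 30 rfl] using h30
    refine (Run.for (n := N) (T := 1) (fun i s' => ∀ x < N, rank lt N x < i →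
      s'.arr 12 x = rank lt N x) (by omega) rfl
      (fun s' hf => by simpa [hf.reg 30 rfl] using h30') (by simp) ?_).post ?_
    · intro i s' hi hf h32 hI
      refine Run.setArr fun x hx hxi => ?_
      simp only [State.setReg_arr, State.setArr_arr, WExpr.eval_reg, WExpr.eval_arr, h32, if_true,
        hf.arr 10 rfl]
      split_ifs with hji
      · obtain ⟨y, hy, rfl⟩ := h.rank_surj hi
        rw [h₂ y hy] at hji
        rw [hji]
      · refine hI x hx (lt_of_le_of_ne (by omega) fun hh => hji ?_)
        rw [← hh, h₂ x hx]
    · intro s' hf hI x hx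
      exact ⟨by rw [hf.arr 10 rfl, h₂ x hx], hI x hx (h.rank_lt hx)⟩
  · ring_nf; nlinarith [Nat.zero_le D, Nat.zero_le N]

/-! ## Cycles through a biclique cover -/

/-- Exchanges `2 * z` and `2 * z + 1`. -/
def flip2 (x : ℕ) : ℕ := x + 1 - 2 * (x % 2)

/-- `v` belongs to one side of a biclique, and `v'` to its other side: `mem v p` is `0` or
`2 * z + τ`, where `z` is a biclique and `τ` is the side. -/
def Link (mem : ℕ → ℕ → ℕ) (P v v' : ℕ) : Prop :=
  ∃ p < P, ∃ p' < P, mem v p ≠ 0 ∧ mem v' p' ≠ 0 ∧ mem v p = flip2 (mem v' p')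

section Layers
variable (k n : ℕ) (mem : ℕ → ℕ → ℕ) (dg : ℕ → ℕ)

/-- The edge number `e` belongs to layer `e % k` and to the block number `e / k` of `2 * k`
consecutive vertices, from which the first group of digits selects one per layer. The digits from
`k` on are the outgoing slots of the layers, those from `2 * k` on the incoming slots, and those
from `3 * k` on encode, for two layers, a bit position (the half) and a bit value (the parity). -/
def vert (e : ℕ) : ℕ := 2 * k * (e / k) + dg (e % k)

/-- The vertex `v` may be used in layer `i`. -/
def FitsLayer (i v : ℕ) : Prop :=
  ∀ j < k,
    (i < j → v / 2 ^ (dg (3 * k + (i * k + j)) / 2) % 2 = dg (3 * k + (i * k + j)) % 2) ∧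
    (j < i → v / 2 ^ (dg (3 * k + (j * k + i)) / 2) % 2 = (dg (3 * k + (j * k + i)) + 1) % 2)

def memIn (e : ℕ) : ℕ := mem (vert k dg e) (dg (2 * k + e % k))
def memOut (e : ℕ) : ℕ := mem (vert k dg e) (dg (k + e % k))

def ValidEdge (e : ℕ) : Prop :=
  (vert k dg e < n ∧ FitsLayer k dg (e % k) (vert k dg e)) ∧
    memIn k mem dg e ≠ 0 ∧ memOut k mem dg e ≠ 0

-- The tail is named by the side opposite to the one through which the vertex is entered. Thus the
-- head of one edge is the tail of another iff the layers are consecutive and the two vertices lie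
-- on opposite sides of one biclique. The key `0` is reserved for invalid edges.
open scoped Classical in
noncomputable def tailKey (e : ℕ) : ℕ :=
  if ValidEdge k n mem dg e then flip2 (memIn k mem dg e) * k + e % k + 1 else 0

open scoped Classical in
noncomputable def headKey (e : ℕ) : ℕ :=
  if ValidEdge k n mem dg e then memOut k mem dg e * k + (e % k + 1) % k + 1 else 0

/-- Valid, and not a copy of an earlier edge. -/
def OkEdge (e : ℕ) : Prop :=
  tailKey k n mem dg e ≠ 0 ∧ ¬ ∃ e' < e, tailKey k n mem dg e' = tailKey k n mem dg e ∧
    headKey k n mem dg e' = headKey k n mem dg e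

/-- The slot `s` represents the vertex with key `x`. -/
def Slot (s x : ℕ) : Prop :=
  s < 2 * n ∧ OkEdge k n mem dg (s / 2) ∧
    x = if s % 2 = 0 then tailKey k n mem dg (s / 2) else headKey k n mem dg (s / 2)

/-- The numbers `tl e`, `hd e` describe the layered digraph. -/
structure IsLayered (tl hd : ℕ → ℕ) : Prop where
  rep : ∃ rep : ℕ → ℕ, ∀ e < n, OkEdge k n mem dg e →
    tl e = rep (tailKey k n mem dg e) ∧ hd e = rep (headKey k n mem dg e) ∧
    Slot k n mem dg (tl e) (tailKey k n mem dg e) ∧ Slot k n mem dg (hd e) (headKey k n mem dg e)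
  dummy : ∀ e < n, ¬ OkEdge k n mem dg e → tl e = 2 * e ∧ hd e = 2 * e + 1

variable {k n mem dg}

theorem tailKey_ne_zero {e : ℕ} : tailKey k n mem dg e ≠ 0 ↔ ValidEdge k n mem dg e := by
  unfold tailKey; split_ifs <;> simp_all

theorem key_decode {a b c d k : ℕ} (hc : c < k) (hd : d < k) (h : a * k + c + 1 = b * k + d + 1) :
    a = b ∧ c = d := by
  have h' : c + k * a = d + k * b := by linarith
  have h1 : c = d := by
    have := congrArg (· % k) h'
    simpa [Nat.mod_eq_of_lt hc, Nat.mod_eq_of_lt hd] using this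
  subst h1
  have : k * a = k * b := by omega
  exact ⟨Nat.eq_of_mul_eq_mul_left (by omega) this, rfl⟩

theorem key_link {e e' : ℕ} (hk : 0 < k) (he : ValidEdge k n mem dg e)
    (he' : ValidEdge k n mem dg e')
    (h : headKey k n mem dg e = tailKey k n mem dg e') :
    memOut k mem dg e = flip2 (memIn k mem dg e') ∧ (e % k + 1) % k = e' % k := by
  rw [headKey, tailKey, if_pos he, if_pos he'] at h
  exact key_decode (Nat.mod_lt _ hk) (Nat.mod_lt _ hk) h

theorem tailKey_inj {e e' : ℕ} (hk : 0 < k) (he : ValidEdge k n mem dg e)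
    (he' : ValidEdge k n mem dg e') (h : tailKey k n mem dg e = tailKey k n mem dg e') :
    e % k = e' % k := by
  rw [tailKey, tailKey, if_pos he, if_pos he'] at h
  exact (key_decode (Nat.mod_lt _ hk) (Nat.mod_lt _ hk) h).2

theorem succ_mod_ne {k i : ℕ} (hk : 2 ≤ k) (hi : i < k) : (i + 1) % k ≠ i := by
  rcases Nat.lt_or_ge (i + 1) k with h | h
  · rw [Nat.mod_eq_of_lt h]; omega
  · rw [show i + 1 = k by omega, Nat.mod_self]; omega

theorem tailKey_ne_headKey {e : ℕ} (hk : 2 ≤ k) (he : ValidEdge k n mem dg e) :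
    tailKey k n mem dg e ≠ headKey k n mem dg e := by
  rw [headKey, tailKey, if_pos he, if_pos he]
  exact fun h => succ_mod_ne hk (Nat.mod_lt e (by omega))
    (key_decode (Nat.mod_lt _ (by omega)) (Nat.mod_lt _ (by omega)) h).2.symm

theorem OkEdge.valid {e : ℕ} (h : OkEdge k n mem dg e) : ValidEdge k n mem dg e :=
  tailKey_ne_zero.1 h.1

theorem Slot.inj {s x y : ℕ} (h : Slot k n mem dg s x) (h' : Slot k n mem dg s y) : x = y :=
  h.2.2.trans h'.2.2.symm

/-- The first of all edges with the same two keys is not a copy, so discarding copies loses no arc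
of the digraph. -/
theorem exists_ok {e : ℕ} (he : ValidEdge k n mem dg e) :
    ∃ e' ≤ e, OkEdge k n mem dg e' ∧ tailKey k n mem dg e' = tailKey k n mem dg e ∧
      headKey k n mem dg e' = headKey k n mem dg e := by
  induction e using Nat.strong_induction_on with
  | _ e ih =>
    by_cases h : ∃ e' < e, tailKey k n mem dg e' = tailKey k n mem dg e ∧
        headKey k n mem dg e' = headKey k n mem dg e
    · obtain ⟨e', hlt, h1, h2⟩ := h
      obtain ⟨e'', hle, ho, h3, h4⟩ := ih e' hlt
        (tailKey_ne_zero.1 (h1 ▸ tailKey_ne_zero.2 he))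
      exact ⟨e'', by omega, ho, h3.trans h1, h4.trans h2⟩
    · exact ⟨e, le_rfl, ⟨tailKey_ne_zero.2 he, h⟩, rfl, rfl⟩

section Graph
variable {tl hd : ℕ → ℕ} (hG : IsLayered k n mem dg tl hd)
include hG

theorem IsLayered.lt {e : ℕ} (he : e < n) : tl e < 2 * n ∧ hd e < 2 * n := by
  obtain ⟨rep, hrep⟩ := hG.rep
  by_cases ho : OkEdge k n mem dg e
  · obtain ⟨-, -, h1, h2⟩ := hrep e he ho
    exact ⟨h1.1, h2.1⟩
  · obtain ⟨h1, h2⟩ := hG.dummy e he ho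
    omega

theorem IsLayered.loopless (hk : 2 ≤ k) {e : ℕ} (he : e < n) : tl e ≠ hd e := by
  obtain ⟨rep, hrep⟩ := hG.rep
  by_cases ho : OkEdge k n mem dg e
  · obtain ⟨-, -, h1, h2⟩ := hrep e he ho
    intro h
    rw [h] at h1
    exact tailKey_ne_headKey hk ho.valid (h1.inj h2)
  · obtain ⟨h1, h2⟩ := hG.dummy e he ho
    omega

theorem IsLayered.injective {e e' : ℕ} (he : e < n) (he' : e' < n) (ht : tl e = tl e')
    (hh : hd e = hd e') : e = e' := by
  obtain ⟨rep, hrep⟩ := hG.rep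
  wlog hle : e ≤ e' generalizing e e'
  · exact (this he' he ht.symm hh.symm (by omega)).symm
  by_cases ho : OkEdge k n mem dg e <;> by_cases ho' : OkEdge k n mem dg e'
  · obtain ⟨-, -, h1, h2⟩ := hrep e he ho
    obtain ⟨-, -, h1', h2'⟩ := hrep e' he' ho'
    rw [ht] at h1
    rw [hh] at h2
    by_contra hne
    exact ho'.2 ⟨e, by omega, h1.inj h1', h2.inj h2'⟩
  · obtain ⟨-, -, h1, h2⟩ := hrep e he ho
    obtain ⟨h1', h2'⟩ := hG.dummy e' he' ho'
    have := h1.2.1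
    rw [ht, h1', Nat.mul_div_cancel_left _ two_pos] at this
    exact absurd this ho'
  · obtain ⟨-, -, h1', h2'⟩ := hrep e' he' ho'
    obtain ⟨h1, h2⟩ := hG.dummy e he ho
    have := h1'.2.1
    rw [← ht, h1, Nat.mul_div_cancel_left _ two_pos] at this
    exact absurd this ho
  · obtain ⟨h1, h2⟩ := hG.dummy e he ho
    obtain ⟨h1', h2'⟩ := hG.dummy e' he' ho'
    omega

/-- The layered digraph. -/
def IsLayered.graph (hk : 2 ≤ k) : SparseDigraph where
  N := 2 * n
  m := n
  edge e := (⟨tl e, (hG.lt e.2).1⟩, ⟨hd e, (hG.lt e.2).2⟩)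
  injective e e' h := by
    simp only [Prod.mk.injEq, Fin.mk.injEq] at h
    exact Fin.ext (hG.injective e.2 e'.2 h.1 h.2)
  loopless e h := hG.loopless hk e.2 (by simpa using h)
  sparse := le_rfl

/-- A dummy edge ends in `2 * e + 1`, which is the tail of nothing: tails of dummy edges are even,
and the tail of a genuine edge is a slot of a genuine edge. Hence no dummy edge lies on a cycle. -/
theorem IsLayered.next_ok {e e' : ℕ} (he : e < n) (he' : e' < n) (h : hd e = tl e') :
    OkEdge k n mem dg e := by
  by_contra ho
  obtain ⟨h1, h2⟩ := hG.dummy e he ho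
  obtain ⟨rep, hrep⟩ := hG.rep
  by_cases ho' : OkEdge k n mem dg e'
  · obtain ⟨-, -, h1', h2'⟩ := hrep e' he' ho'
    have := h1'.2.1
    rw [← h, h2, show (2 * e + 1) / 2 = e by omega] at this
    exact ho this
  · obtain ⟨h1', h2'⟩ := hG.dummy e' he' ho'
    omega

theorem IsLayered.next {e e' : ℕ} (hk : 0 < k) (he : e < n) (he' : e' < n) (h : hd e = tl e')
    (ho : OkEdge k n mem dg e) (ho' : OkEdge k n mem dg e') :
    memOut k mem dg e = flip2 (memIn k mem dg e') ∧ (e % k + 1) % k = e' % k := by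
  obtain ⟨rep, hrep⟩ := hG.rep
  obtain ⟨-, -, -, h2⟩ := hrep e he ho
  obtain ⟨-, -, h1', -⟩ := hrep e' he' ho'
  rw [h] at h2
  exact key_link hk ho.valid ho'.valid (h2.inj h1')

end Graph

/-- The digit of the pair of layers prescribes one value of a certain bit in the lower layer and the
opposite value in the higher one. -/
theorem FitsLayer.ne {i j v v' : ℕ} (hij : i ≠ j) (hi : i < k) (hj : j < k)
    (h : FitsLayer k dg i v) (h' : FitsLayer k dg j v') : v ≠ v' := by
  rintro rfl
  rcases lt_or_gt_of_ne hij with hlt | hlt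
  · have h1 := (h j hj).1 hlt
    have h2 := (h' i hi).2 hlt
    omega
  · have h1 := (h j hj).2 hlt
    have h2 := (h' i hi).1 hlt
    omega

/-- A cycle of the layered digraph yields a cycle of links. -/
theorem IsLayered.sound {tl hd : ℕ → ℕ} {P : ℕ} (hG : IsLayered k n mem dg tl hd) (hk : 2 ≤ k)
    (hdg : ∀ x < 3 * k, dg x < P) (x : Fin k → ℕ) (e : Fin k → ℕ) (he : ∀ i, e i < n)
    (htl : ∀ i, tl (e i) = x i)
    (hhd : ∀ i j : Fin k, (j : ℕ) = ((i : ℕ) + 1) % k → hd (e i) = x j) :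
    (∀ i, vert k dg (e i) < n) ∧ (∀ i j, i ≠ j → vert k dg (e i) ≠ vert k dg (e j)) ∧
      ∀ i j : Fin k, (j : ℕ) = ((i : ℕ) + 1) % k →
        Link mem P (vert k dg (e i)) (vert k dg (e j)) := by
  have hk0 : 0 < k := by omega
  have hsucc : ∀ i : Fin k, ∃ j : Fin k, (j : ℕ) = ((i : ℕ) + 1) % k :=
    fun i => ⟨⟨_, Nat.mod_lt _ hk0⟩, rfl⟩
  have hok : ∀ i, OkEdge k n mem dg (e i) := fun i => by
    obtain ⟨j, hj⟩ := hsucc i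
    exact hG.next_ok (he i) (he j) ((hhd i j hj).trans (htl j).symm)
  have hnext : ∀ i j : Fin k, (j : ℕ) = ((i : ℕ) + 1) % k → _ := fun i j hj =>
    hG.next hk0 (he i) (he j) ((hhd i j hj).trans (htl j).symm) (hok i) (hok j)
  -- The layer increases by one along the cycle, which may start in any layer, so the `k` edges lie
  -- in different layers.
  have hlayer : ∀ m, ∀ hm : m < k, e ⟨m, hm⟩ % k = (e ⟨0, hk0⟩ + m) % k := by
    intro m
    induction m with
    | zero => intro hm; rfl
    | succ m ih =>
      intro hm
      have := (hnext ⟨m, by omega⟩ ⟨m + 1, hm⟩ (Nat.mod_eq_of_lt hm).symm).2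
      rw [← this, ih (by omega), Nat.mod_add_mod, add_assoc]
  refine ⟨fun i => (hok i).valid.1.1, fun i j hij => ?_, fun i j hj => ?_⟩
  · refine FitsLayer.ne ?_ (Nat.mod_lt _ hk0) (Nat.mod_lt _ hk0) (hok i).valid.1.2
      (hok j).valid.1.2
    rw [hlayer i i.2, hlayer j j.2]
    intro h
    have := Nat.ModEq.add_left_cancel' _ h
    rw [Nat.ModEq, Nat.mod_eq_of_lt i.2, Nat.mod_eq_of_lt j.2] at this
    exact hij (Fin.ext this)
  · have hl : ∀ e, e % k < k := fun e => Nat.mod_lt e hk0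
    exact ⟨_, hdg (k + e i % k) (by have := hl (e i); omega), _,
      hdg (2 * k + e j % k) (by have := hl (e j); omega), (hok i).valid.2.2, (hok j).valid.2.1,
      (hnext i j hj).1⟩

/-- A cycle of links yields a cycle of the layered digraph, for suitable digits. -/
theorem exists_digits {P ℓ : ℕ} (hk : 2 ≤ k) (hkn : k ≤ n) (hP : 2 * k ≤ P) (hℓ : 2 * ℓ ≤ P)
    (hn : n ≤ 2 ^ ℓ) (v : Fin k → ℕ) (hv : ∀ i, v i < n) (hinj : Function.Injective v)
    (hlink : ∀ i j : Fin k, (j : ℕ) = ((i : ℕ) + 1) % k → Link mem P (v i) (v j)) :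
    ∃ dg₀ : ℕ → ℕ, (∀ x, dg₀ x < P) ∧ ∀ dg : ℕ → ℕ, (∀ x < 3 * k + k * k, dg x = dg₀ x) →
      ∀ tl hd, IsLayered k n mem dg tl hd →
      ∃ x e : Fin k → ℕ, (∀ i, e i < n ∧ tl (e i) = x i) ∧ Function.Injective x ∧
        ∀ i j : Fin k, (j : ℕ) = ((i : ℕ) + 1) % k → hd (e i) = x j := by
  classical
  have hk0 : 0 < k := by omega
  -- Different numbers up to `2 ^ ℓ`, excluding it, differ in one of the lowest `ℓ` bits; this is
  -- why digits below `2 * ℓ` suffice for separating layers.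
  have hbit : ∀ i j, v i ≠ v j → ∃ b < ℓ, v i / 2 ^ b % 2 ≠ v j / 2 ^ b % 2 := by
    intro i j hij
    by_contra! hall
    refine hij (Nat.eq_of_testBit_eq fun b => ?_)
    rw [Nat.testBit_eq_decide_div_mod_eq, Nat.testBit_eq_decide_div_mod_eq]
    rcases lt_or_ge b ℓ with hb | hb
    · rw [hall b hb]
    · have : 2 ^ ℓ ≤ 2 ^ b := Nat.pow_le_pow_right (by omega) hb
      rw [Nat.div_eq_of_lt ((hv i).trans_le (hn.trans this)),
        Nat.div_eq_of_lt ((hv j).trans_le (hn.trans this))]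
  choose B hB hB' using hbit
  have hnx : ∀ i : Fin k, ∃ q : ℕ × ℕ, q.1 < P ∧ q.2 < P ∧ mem (v i) q.1 ≠ 0 ∧
      mem (v ⟨_, Nat.mod_lt (i + 1) hk0⟩) q.2 ≠ 0 ∧
      mem (v i) q.1 = flip2 (mem (v ⟨_, Nat.mod_lt (i + 1) hk0⟩) q.2) := fun i => by
    obtain ⟨p, hp, p', hp', h⟩ := hlink i ⟨_, Nat.mod_lt (i + 1) hk0⟩ rfl
    exact ⟨(p, p'), hp, hp', h⟩
  choose q hq1 hq2 hq3 hq4 hq5 using hnx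
  -- The incoming slot of a layer is fixed by the link from the cyclic predecessor.
  have hprev : ∀ i : Fin k, ∃ j : Fin k, (⟨_, Nat.mod_lt (j + 1) hk0⟩ : Fin k) = i := fun i => by
    refine ⟨⟨(i + (k - 1)) % k, Nat.mod_lt _ hk0⟩, Fin.ext ?_⟩
    simp only [Nat.mod_add_mod]
    rw [show (i : ℕ) + (k - 1) + 1 = i + k by omega, Nat.add_mod_right, Nat.mod_eq_of_lt i.2]
  choose pr hpr using hprev
  obtain ⟨dg₀, hdg⟩ : ∃ dg₀ : ℕ → ℕ, dg₀ = fun x =>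
      if h : x < k then v ⟨x, h⟩ % (2 * k) else
      if h : x - k < k then (q ⟨x - k, h⟩).1 else
      if h : x - 2 * k < k then (q (pr ⟨x - 2 * k, h⟩)).2 else
      if h : v ⟨(x - 3 * k) / k % k, Nat.mod_lt _ hk0⟩ ≠ v ⟨(x - 3 * k) % k, Nat.mod_lt _ hk0⟩
      then 2 * B _ _ h + v ⟨(x - 3 * k) / k % k, Nat.mod_lt _ hk0⟩ / 2 ^ (B _ _ h) % 2 else 0 :=
    ⟨_, rfl⟩
  have d1 : ∀ i : Fin k, dg₀ i = v i % (2 * k) := fun i => by rw [hdg]; simp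
  have d2 : ∀ i : Fin k, dg₀ (k + i) = (q i).1 := fun i => by rw [hdg]; simp
  have d3 : ∀ i : Fin k, dg₀ (2 * k + i) = (q (pr i)).2 := fun i => by
    rw [hdg]
    simp only
    rw [dif_neg (by omega), dif_neg (by omega), dif_pos (by omega)]
    simp
  have d4 : ∀ i j : Fin k, ∀ h : v i ≠ v j, dg₀ (3 * k + (i * k + j)) =
      2 * B _ _ h + v i / 2 ^ (B _ _ h) % 2 := fun i j h => by
    rw [hdg]
    simp only
    have e1 : (i * k + j : ℕ) / k % k = i := by
      rw [mul_comm, Nat.mul_add_div hk0, Nat.div_eq_of_lt j.2, add_zero, Nat.mod_eq_of_lt i.2]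
    have e2 : (i * k + j : ℕ) % k = j := by
      rw [mul_comm, Nat.mul_add_mod, Nat.mod_eq_of_lt j.2]
    rw [dif_neg (by omega), dif_neg (by omega), dif_neg (by omega), dif_pos]
    · simp only [Nat.add_sub_cancel_left, e1, e2]
    · simp only [Nat.add_sub_cancel_left, e1, e2]
      exact h
  refine ⟨dg₀, fun x => ?_, fun dg hagree tl hd hG => ?_⟩
  · rw [hdg]
    simp only
    by_cases h1 : x < k
    · rw [dif_pos h1]; exact (Nat.mod_lt _ (by omega)).trans_le hP
    by_cases h2 : x - k < k
    · rw [dif_neg h1, dif_pos h2]; exact hq1 _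
    by_cases h3 : x - 2 * k < k
    · rw [dif_neg h1, dif_neg h2, dif_pos h3]; exact hq2 _
    rw [dif_neg h1, dif_neg h2, dif_neg h3]
    split_ifs with h4
    · have := hB _ _ h4; omega
    · omega
  · obtain ⟨rep, hrep⟩ := hG.rep
    have d1 : ∀ i : Fin k, dg i = v i % (2 * k) := fun i => by
      rw [hagree _ (by have := i.2; omega), d1]
    have d2 : ∀ i : Fin k, dg (k + i) = (q i).1 := fun i => by
      rw [hagree _ (by have := i.2; omega), d2]
    have d3 : ∀ i : Fin k, dg (2 * k + i) = (q (pr i)).2 := fun i => by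
      rw [hagree _ (by have := i.2; omega), d3]
    have d4 : ∀ i j : Fin k, ∀ h : v i ≠ v j, dg (3 * k + (i * k + j)) =
        2 * B _ _ h + v i / 2 ^ (B _ _ h) % 2 := fun i j h => by
      have : (i : ℕ) * k + j < k * k := by
        calc (i : ℕ) * k + j < i * k + k := by omega
          _ = (i + 1) * k := by ring
          _ ≤ k * k := Nat.mul_le_mul_right _ i.2
      rw [hagree _ (by omega), d4]
    set E : Fin k → ℕ := fun i => k * (v i / (2 * k)) + i with hE
    have hEm : ∀ i, E i % k = i := fun i => by
      rw [hE]; simp only; rw [Nat.mul_add_mod, Nat.mod_eq_of_lt i.2]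
    have hEd : ∀ i, E i / k = v i / (2 * k) := fun i => by
      rw [hE]; simp only; rw [Nat.mul_add_div hk0, Nat.div_eq_of_lt i.2, add_zero]
    have hEv : ∀ i, vert k dg (E i) = v i := fun i => by
      rw [vert, hEm, hEd, d1, Nat.div_add_mod]
    -- A block has `2 * k` vertices but uses up only `k` edge numbers. In the first block `k ≤ n` is
    -- enough, and later `k * (c + 1) ≤ 2 * k * c ≤ v i` for the block number `c`; with blocks of
    -- `k` vertices the last one could overshoot.
    have hEn : ∀ i, E i < n := fun i => by
      have h1 := Nat.div_mul_le_self (v i) (2 * k)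
      have h2 := hv i
      have h3 := i.2
      rw [hE]; simp only
      rcases Nat.eq_zero_or_pos (v i / (2 * k)) with h0 | h0
      · rw [h0]; omega
      · have : k * 1 ≤ k * (v i / (2 * k)) := Nat.mul_le_mul_left _ h0
        have h4 : v i / (2 * k) * (2 * k) = 2 * (k * (v i / (2 * k))) := by ring
        omega
    have hIn : ∀ i, memIn k mem dg (E i) = mem (v i) (q (pr i)).2 := fun i => by
      rw [memIn, hEv, hEm, d3]
    have hOut : ∀ i, memOut k mem dg (E i) = mem (v i) (q i).1 := fun i => by
      rw [memOut, hEv, hEm, d2]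
    have hval : ∀ i, ValidEdge k n mem dg (E i) := fun i => by
      refine ⟨⟨by rw [hEv]; exact hv i, ?_⟩, ?_, by rw [hOut]; exact hq3 i⟩
      · rw [hEv, hEm]
        refine fun j hj => ⟨fun hlt => ?_, fun hlt => ?_⟩
        · have hne : v i ≠ v ⟨j, hj⟩ := hinj.ne (by rw [ne_eq, Fin.ext_iff]; simp; omega)
          have := d4 i ⟨j, hj⟩ hne
          simp only at this
          rw [this]
          rw [show ∀ a b : ℕ, (2 * a + b % 2) / 2 = a by omega]
          omega
        · have hne : v ⟨j, hj⟩ ≠ v i := hinj.ne (by rw [ne_eq, Fin.ext_iff]; simp; omega)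
          have := d4 ⟨j, hj⟩ i hne
          simp only at this
          rw [this]
          rw [show ∀ a b : ℕ, (2 * a + b % 2) / 2 = a by omega]
          have := hB' _ _ hne
          omega
      · rw [hIn]
        have := hq4 (pr i)
        rwa [hpr] at this
    -- The cycle may run through copies that were discarded; the earliest edge with the same keys
    -- replaces each.
    choose e' hle hok ht hh using fun i => exists_ok (hval i)
    have hlt : ∀ i, e' i < n := fun i => (hle i).trans_lt (hEn i)
    refine ⟨fun i => tl (e' i), e', fun i => ⟨hlt i, rfl⟩, fun i j hij => ?_, fun i j hj => ?_⟩
    · have h1 := (hrep _ (hlt i) (hok i)).2.2.1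
      have h2 := (hrep _ (hlt j) (hok j)).2.2.1
      simp only at hij
      rw [hij] at h1
      have := tailKey_inj hk0 (hval i) (hval j) ((ht i).symm.trans ((h1.inj h2).trans (ht j)))
      rw [hEm, hEm] at this
      exact Fin.ext this
    · simp only
      rw [(hrep _ (hlt i) (hok i)).2.1, (hrep _ (hlt j) (hok j)).1, hh, ht]
      congr 1
      have hj' : (⟨_, Nat.mod_lt (i + 1) hk0⟩ : Fin k) = j := Fin.ext hj.symm
      have hpj : pr j = i := by
        have h1 := hpr j
        rw [← hj', Fin.ext_iff] at h1
        simp only at h1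
        have h2 : ((pr j : ℕ)) ≡ i [MOD k] := Nat.ModEq.add_right_cancel' 1 (by
          rw [hj'] at h1; rw [Nat.ModEq, h1])
        rw [Nat.ModEq, Nat.mod_eq_of_lt (pr j).2, Nat.mod_eq_of_lt i.2] at h2
        exact Fin.ext h2
      rw [headKey, tailKey, if_pos (hval i), if_pos (hval j), hIn, hOut, hEm, hEm, hpj, hq5 i, hj,
        hj']

end Layers

/-- Every sequence of digits belongs to a number. -/
theorem exists_number {P : ℕ} (dg : ℕ → ℕ) (hdg : ∀ x, dg x < P) (N : ℕ) :
    ∃ q < P ^ N, ∀ x < N, q / P ^ x % P = dg x := by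
  have hP : 0 < P := (hdg 0).pos
  induction N generalizing dg with
  | zero => exact ⟨0, by simp, by simp⟩
  | succ N ih =>
    obtain ⟨q, hq, h⟩ := ih (fun x => dg (x + 1)) fun x => hdg _
    refine ⟨P * q + dg 0, ?_, fun x hx => ?_⟩
    · have := hdg 0
      have h2 : P * (q + 1) ≤ P * P ^ N := Nat.mul_le_mul_left _ hq
      rw [pow_succ']; nlinarith
    · cases x with
      | zero => simp [Nat.mod_eq_of_lt (hdg 0)]
      | succ x =>
        rw [pow_succ', ← Nat.div_div_eq_div_mul, Nat.mul_add_div hP,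
          Nat.div_eq_of_lt (hdg 0), add_zero]
        exact h x (by omega)

theorem strictOn_lt (N : ℕ) : StrictOn (· < ·) N :=
  ⟨fun _ _ => lt_irrefl _, fun _ _ _ _ _ _ => lt_trans, fun _ _ _ _ => lt_or_gt_of_ne⟩

/-- All orders used for sorting arise by refining the order of the indices; the indices break the
remaining ties, so that ranks are injective. -/
theorem StrictOn.lex {α : Type} [LinearOrder α] {lt : ℕ → ℕ → Prop} {N : ℕ} (h : StrictOn lt N)
    (f : ℕ → α) : StrictOn (fun x y => f x < f y ∨ f x = f y ∧ lt x y) N := by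
  refine ⟨fun x hx => ?_, fun x hx y hy z hz => ?_, fun x hx y hy hne => ?_⟩
  · rintro (h' | h')
    exacts [lt_irrefl _ h', h.irrefl x hx h'.2]
  · rintro (h1 | ⟨h1, h1'⟩) (h2 | ⟨h2, h2'⟩)
    · exact .inl (h1.trans h2)
    · exact .inl (h2 ▸ h1)
    · exact .inl (h1 ▸ h2)
    · exact .inr ⟨h1.trans h2, h.trans x hx y hy z hz h1' h2'⟩
  · rcases lt_trichotomy (f x) (f y) with h1 | h1 | h1
    · exact .inl (.inl h1)
    · rcases h.total x hx y hy hne with h2 | h2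
      · exact .inl (.inr ⟨h1, h2⟩)
      · exact .inr (.inr ⟨h1.symm, h2⟩)
    · exact .inr (.inl h1)

/-! ## The cycle program -/

/-- Writes the digits of register `44` to array `20`. -/
def digitsProg (k : ℕ) : Prog :=
  .setReg 45 (.reg 44) ;;
  .for 46 (.const (3 * k + k * k))
    (.setArr 20 (.reg 46) (.reg 45 % .reg 1) ;; .setReg 45 (.reg 45 / .reg 1))

theorem run_digitsProg {w k q P : ℕ} {s : State} (hs : s.Bounded w)
    (hw : 3 * k + k * k < 2 ^ w) (h44 : s.reg 44 = q) (h1 : s.reg 1 = P) :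
    Run w (digitsProg k) s ((3 * k + k * k) * 4 + 3)
      (fun s' => ∀ x < 3 * k + k * k, s'.arr 20 x = q / P ^ x % P) := by
  have hq : q < 2 ^ w := h44 ▸ hs.1 44
  refine Run.setReg_seq ((Run.for (n := 3 * k + k * k) (T := 2)
    (fun i s' => s'.reg 45 = q / P ^ i ∧ ∀ x < i, s'.arr 20 x = q / P ^ x % P) hw rfl
    (fun s' _ => by simp [mod_pow_of_lt hw]) (by simp [h44]) ?_).post fun s' _ h => h.2)
  rintro i s' hi hf h46 ⟨h45, hI⟩
  have h1' : s'.reg 1 = P := by rw [hf.reg 1 rfl]; simpa using h1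
  have hq' : q / P ^ i < 2 ^ w := (Nat.div_le_self _ _).trans_lt hq
  refine Run.setArr_seq (Run.setReg ?_)
  simp (disch := assumption) [h46, h45, h1', mod_mod_pow, div_mod_pow,
    Nat.div_div_eq_div_mul, pow_succ]
  intro x hx
  split_ifs with hxi
  · rw [hxi]
  · exact hI x (by omega)

/-- Clears register `50` unless vertex register `49` fits in layer register `48`. -/
def fitsProg (k : ℕ) : Prog :=
  .for 51 (.const k)
    (.ite (.or
      (.and (.wlt (.reg 48) (.reg 51)) (.not (.weq
        (.shr (.reg 49) (.arr 20 (.const (3 * k) + (.reg 48 * .const k + .reg 51)) / 2) % 2)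
        (.arr 20 (.const (3 * k) + (.reg 48 * .const k + .reg 51)) % 2))))
      (.and (.wlt (.reg 51) (.reg 48)) (.not (.weq
        (.shr (.reg 49) (.arr 20 (.const (3 * k) + (.reg 51 * .const k + .reg 48)) / 2) % 2)
        ((.arr 20 (.const (3 * k) + (.reg 51 * .const k + .reg 48)) + 1) % 2)))))
      (.setReg 50 0) .skip)

theorem run_fitsProg {w k i v : ℕ} {dg : ℕ → ℕ} {s : State} (hs : s.Bounded w)
    (hw : 3 * k + k * k + 3 < 2 ^ w) (h48 : s.reg 48 = i) (hi : i < k) (h49 : s.reg 49 = v)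
    (h50 : s.reg 50 = 1) (h20 : ∀ x < 3 * k + k * k, s.arr 20 x = dg x ∧ dg x + 1 < 2 ^ w) :
    Run w (fitsProg k) s (k * 4 + 2) (fun s' => s'.reg 50 = 1 ↔ FitsLayer k dg i v) := by
  have hv : v < 2 ^ w := h49 ▸ hs.1 49
  refine (Run.for (n := k) (T := 2)
    (fun m s' => s'.reg 50 = 1 ↔ ∀ j < m,
    (i < j → v / 2 ^ (dg (3 * k + (i * k + j)) / 2) % 2 = dg (3 * k + (i * k + j)) % 2) ∧
    (j < i → v / 2 ^ (dg (3 * k + (j * k + i)) / 2) % 2 = (dg (3 * k + (j * k + i)) + 1) % 2))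
    (by omega) rfl
    (fun s' _ => by simp [mod_pow_of_lt (show k < 2 ^ w by omega)]) (by simp [h50]) ?_)
  intro j s' hj hf h51 hI
  have h48' : s'.reg 48 = i := by rw [hf.reg 48 rfl, h48]
  have h49' : s'.reg 49 = v := by rw [hf.reg 49 rfl, h49]
  have h20' : s'.arr 20 = s.arr 20 := hf.arr 20 rfl
  have hik : i * k + j < k * k := by
    calc i * k + j < i * k + k := by omega
      _ = (i + 1) * k := by ring
      _ ≤ k * k := Nat.mul_le_mul_right _ hi
  have hjk : j * k + i < k * k := by
    calc j * k + i < j * k + k := by omega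
      _ = (j + 1) * k := by ring
      _ ≤ k * k := Nat.mul_le_mul_right _ hj
  obtain ⟨a1, b1⟩ := h20 (3 * k + (i * k + j)) (by omega)
  obtain ⟨a2, b2⟩ := h20 (3 * k + (j * k + i)) (by omega)
  have b1' : dg (3 * k + (i * k + j)) < 2 ^ w := by omega
  have b2' : dg (3 * k + (j * k + i)) < 2 ^ w := by omega
  have hv1 : ∀ x, v / x < 2 ^ w := fun x => (Nat.div_le_self _ _).trans_lt hv
  have e2 : ∀ x, x % 2 < 2 ^ w := fun x => by omega
  have key : ∀ b : Prop, (∀ j' < j + 1,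
    (i < j' → v / 2 ^ (dg (3 * k + (i * k + j')) / 2) % 2 = dg (3 * k + (i * k + j')) % 2) ∧
    (j' < i → v / 2 ^ (dg (3 * k + (j' * k + i)) / 2) % 2 = (dg (3 * k + (j' * k + i)) + 1) % 2))
    ↔ (s'.reg 50 = 1 ∧ (
    (i < j → v / 2 ^ (dg (3 * k + (i * k + j)) / 2) % 2 = dg (3 * k + (i * k + j)) % 2) ∧
    (j < i → v / 2 ^ (dg (3 * k + (j * k + i)) / 2) % 2 = (dg (3 * k + (j * k + i)) + 1) % 2))) :=
    fun _ => by rw [hI, Nat.forall_lt_succ_right]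
  have t1 : i * k < 2 ^ w := by omega
  have t2 : j * k < 2 ^ w := by omega
  have t3 : k < 2 ^ w := by omega
  have t4 : 3 * k < 2 ^ w := by omega
  have t5 : 3 * k + (i * k + j) < 2 ^ w := by omega
  have t6 : 3 * k + (j * k + i) < 2 ^ w := by omega
  have t7 : i * k + j < 2 ^ w := by omega
  have t8 : j * k + i < 2 ^ w := by omega
  have t9 : 2 < 2 ^ w := by omega
  have t10 : 1 < 2 ^ w := by omega
  refine Run.ite (fun hb => Run.setReg ?_) (fun hb => Run.skip ?_) <;>
  · simp only [Test.eval_or, Test.eval_and, Test.eval_wlt, Test.eval_not, Test.eval_weq,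
      WExpr.eval_reg, WExpr.eval_add, WExpr.eval_mul, WExpr.eval_mod, WExpr.eval_div,
      WExpr.eval_ofNat, WExpr.eval_const, WExpr.eval_arr, WExpr.eval_shr, h48', h49', h51, h20',
      mod_pow_of_lt t1, mod_pow_of_lt t2, mod_pow_of_lt t3, mod_pow_of_lt t4, mod_pow_of_lt t5,
      mod_pow_of_lt t6, mod_pow_of_lt t7, mod_pow_of_lt t8, mod_pow_of_lt t9, mod_pow_of_lt t10,
      a1, a2, mod_pow_of_lt b2, div_mod_pow b1', div_mod_pow b2',
      div_mod_pow hv, mod_pow_of_lt (e2 _)] at hb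
    simp only [State.setReg_reg, WExpr.eval_ofNat, Nat.zero_mod, Nat.reduceEqDiff, reduceIte]
    rw [key True]
    tauto

/-- Computes the keys of the edges in arrays `21` and `22`, and their vertices in array `23`. -/
def keysProg (k : ℕ) : Prog :=
  .for 47 (.reg 0) (
    .setReg 48 (.reg 47 % .const k) ;;
    .setReg 49 (.const (2 * k) * (.reg 47 / .const k) + .arr 20 (.reg 48)) ;;
    .setReg 50 1 ;;
    fitsProg k ;;
    .setReg 53 (.arr 5 (.reg 49 * .reg 1 + .arr 20 (.const (2 * k) + .reg 48))) ;;
    .setReg 54 (.arr 5 (.reg 49 * .reg 1 + .arr 20 (.const k + .reg 48))) ;;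
    .setArr 23 (.reg 47) (.reg 49) ;;
    .ite (.and (.and (.wlt (.reg 49) (.reg 0)) (.weq (.reg 50) 1))
        (.and (.not (.weq (.reg 53) 0)) (.not (.weq (.reg 54) 0))))
      (.setArr 21 (.reg 47) ((.reg 53 + 1 - 2 * (.reg 53 % 2)) * .const k + .reg 48 + 1) ;;
       .setArr 22 (.reg 47) (.reg 54 * .const k + (.reg 48 + 1) % .const k + 1))
      (.setArr 21 (.reg 47) 0 ;; .setArr 22 (.reg 47) 0))

theorem run_keysProg {w k n P Z : ℕ} {mem : ℕ → ℕ → ℕ} {dg : ℕ → ℕ} {s : State}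
    (hs : s.Bounded w) (hk : 0 < k) (hkn : k ≤ n) (hw1 : 3 * k + k * k + 3 < 2 ^ w)
    (hw2 : (2 * n + P) * P + P < 2 ^ w) (hw3 : (Z + 1) * k + k + 1 < 2 ^ w) (hP : 0 < P)
    (hn : 2 * n + P + 1 < 2 ^ w)
    (h0 : s.reg 0 = n) (h1 : s.reg 1 = P) (hdg : ∀ x < 3 * k + k * k, dg x < P)
    (h20 : ∀ x < 3 * k + k * k, s.arr 20 x = dg x)
    (hmem : ∀ v < n, ∀ p < P, s.arr 5 (v * P + p) = mem v p ∧ mem v p < Z) :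
    Run w (keysProg k) s (n * (k * 4 + 14) + 2) (fun s' => ∀ e < n,
      s'.arr 21 e = tailKey k n mem dg e ∧ s'.arr 22 e = headKey k n mem dg e ∧
        s'.arr 23 e = vert k dg e) := by
  refine (Run.for (n := n) (T := k * 4 + 12) (fun i s' => ∀ e < i,
      s'.arr 21 e = tailKey k n mem dg e ∧ s'.arr 22 e = headKey k n mem dg e ∧
        s'.arr 23 e = vert k dg e) (by omega) rfl
    (fun s' hf => by simpa [hf.reg 0 rfl] using h0) (by simp) ?_)
  intro e s' he hf h47 hI
  have h0' : s'.reg 0 = n := by rw [hf.reg 0 rfl, h0]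
  have h1' : s'.reg 1 = P := by rw [hf.reg 1 rfl, h1]
  have h20' : s'.arr 20 = s.arr 20 := hf.arr 20 rfl
  have h5' : s'.arr 5 = s.arr 5 := hf.arr 5 rfl
  obtain ⟨i, hi⟩ : ∃ i, i = e % k := ⟨_, rfl⟩
  have hik : i < k := hi ▸ Nat.mod_lt _ hk
  have hek : k * (e / k) + i = e := hi ▸ Nat.div_add_mod e k
  have hek' : 2 * k * (e / k) = 2 * (k * (e / k)) := mul_assoc _ _ _
  have hdk : e / k < 2 ^ w := (Nat.div_le_self _ _).trans_lt (by omega)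
  obtain ⟨v, hv⟩ : ∃ v, v = vert k dg e := ⟨_, rfl⟩
  have hv' : 2 * k * (e / k) + dg i = v := by rw [hv, vert, hi]
  have hd := fun x (hx : x < 3 * k) => hdg x (by omega)
  have hv2 : v < 2 * n + P := by have := hd i (by omega); omega
  have hvP : v * P ≤ (2 * n + P) * P := Nat.mul_le_mul_right _ hv2.le
  have d1 := hd (2 * k + i) (by omega)
  have d2 := hd (k + i) (by omega)
  have d3 := hd i (by omega)
  have ek : e % k < 2 ^ w := by omega
  refine Run.time (T₁ := ((((k * 4 + 2) + ((((2 + 1) + 1) + 1) + 1)) + 1) + 1) + 1) ?_ (by omega)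
  refine Run.setReg_seq (Run.setReg_seq (Run.setReg_seq ?_))
  simp (disch := omega) only [WExpr.eval_reg, WExpr.eval_add, WExpr.eval_mul, WExpr.eval_mod,
    WExpr.eval_div, WExpr.eval_ofNat, WExpr.eval_const, WExpr.eval_arr, mod_pow_of_lt,
    State.setReg_reg, State.setReg_arr, h47, ← hi, reduceIte, Nat.reduceEqDiff, h20', h20, hv']
  obtain ⟨s₁, hs₁⟩ : ∃ s₁, s₁ = ((s'.setReg 48 i).setReg 49 v).setReg 50 1 := ⟨_, rfl⟩
  rw [← hs₁]
  have hb₁ : s₁.Bounded w := by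
    rw [hs₁]; exact (((hf.bdd hs).setReg 48 (by omega)).setReg 49 (by omega)).setReg 50 (by omega)
  refine Run.bind (T₁ := k * 4 + 2) (T₂ := 6) (run_fitsProg (i := i) (v := v) (dg := dg) hb₁ hw1 (by rw [hs₁]; simp) hik
    (by rw [hs₁]; simp) (by rw [hs₁]; simp)
    fun x hx => ⟨by rw [hs₁]; simp [h20', h20 x hx], by have := hdg x hx; omega⟩)
    fun s₂ hf₂ hfit => ?_
  have r : ∀ r, r ≠ 50 → r ≠ 51 → s₂.reg r = s₁.reg r := fun r h1 h2 =>
    hf₂.reg r (by simp [Prog.modReg, fitsProg, Prog.for]; omega)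
  have r48 : s₂.reg 48 = i := by rw [r 48 (by omega) (by omega), hs₁]; simp
  have r49 : s₂.reg 49 = v := by rw [r 49 (by omega) (by omega), hs₁]; simp
  have r47 : s₂.reg 47 = e := by rw [r 47 (by omega) (by omega), hs₁]; simp [h47]
  have r0 : s₂.reg 0 = n := by rw [r 0 (by omega) (by omega), hs₁]; simp [h0']
  have r1 : s₂.reg 1 = P := by rw [r 1 (by omega) (by omega), hs₁]; simp [h1']
  have ha : ∀ a, s₂.arr a = s'.arr a := fun a => by rw [hf₂.arr a rfl, hs₁]; rfl
  refine Run.setReg_seq (Run.setReg_seq (Run.setArr_seq ?_))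
  simp (disch := omega) only [WExpr.eval_reg, WExpr.eval_add, WExpr.eval_mul,
    WExpr.eval_const, WExpr.eval_arr, mod_pow_of_lt, State.setReg_reg, State.setReg_arr, r48, r49,
    r47, r1, ha, reduceIte, Nat.reduceEqDiff, h20', h20]
  -- The last blocks can contain numbers `v ≥ n`. For these the program reads unspecified cells, but
  -- then the test on `v` fails whatever was read.
  have hin : v < n → s'.arr 5 (v * P + dg (2 * k + i)) = memIn k mem dg e ∧
      memIn k mem dg e < Z := fun h => by
    rw [h5', memIn, ← hi, ← hv]; exact hmem v h _ d1
  have hout : v < n → s'.arr 5 (v * P + dg (k + i)) = memOut k mem dg e ∧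
      memOut k mem dg e < Z := fun h => by
    rw [h5', memOut, ← hi, ← hv]; exact hmem v h _ d2
  generalize s'.arr 5 (v * P + dg (2 * k + i)) = x at hin ⊢
  generalize s'.arr 5 (v * P + dg (k + i)) = y at hout ⊢
  have hval : (v < n ∧ s₂.reg 50 = 1) ∧ x ≠ 0 ∧ y ≠ 0 ↔ ValidEdge k n mem dg e := by
    rw [ValidEdge, hfit, ← hv, ← hi]
    constructor
    · rintro ⟨⟨h1, h2⟩, h3, h4⟩
      exact ⟨⟨h1, h2⟩, (hin h1).1 ▸ h3, (hout h1).1 ▸ h4⟩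
    · rintro ⟨⟨h1, h2⟩, h3, h4⟩
      exact ⟨⟨h1, h2⟩, (hin h1).1 ▸ h3, (hout h1).1 ▸ h4⟩
  have fin : ∀ (s₃ : State) (t h : ℕ), s₃.arr 21 = Function.update (s'.arr 21) e t →
      s₃.arr 22 = Function.update (s'.arr 22) e h →
      s₃.arr 23 = Function.update (s'.arr 23) e v → t = tailKey k n mem dg e →
      h = headKey k n mem dg e → ∀ e' < e + 1, s₃.arr 21 e' = tailKey k n mem dg e' ∧
      s₃.arr 22 e' = headKey k n mem dg e' ∧ s₃.arr 23 e' = vert k dg e' := by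
    intro s₃ t h a1 a2 a3 ht hh e' he'
    rw [a1, a2, a3]
    rcases eq_or_ne e' e with rfl | hne
    · simp [ht, hh, hv]
    · simp only [ne_eq, hne, not_false_eq_true, Function.update_of_ne]
      exact hI e' (by omega)
  refine Run.ite (fun hb => ?_) (fun hb => ?_)
  · simp (disch := omega) only [Test.eval_and, Test.eval_wlt, Test.eval_not, Test.eval_weq,
      WExpr.eval_reg, WExpr.eval_ofNat, State.setArr_reg, State.setReg_reg, reduceIte,
      Nat.reduceEqDiff, mod_pow_of_lt, r0, r49] at hb
    have hv3 := hval.1 hb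
    obtain ⟨⟨hvn, -⟩, -⟩ := hb
    obtain ⟨rfl, hxZ⟩ := hin hvn
    obtain ⟨rfl, hyZ⟩ := hout hvn
    have b1 : (memIn k mem dg e + 1 - 2 * (memIn k mem dg e % 2)) * k ≤ Z * k :=
      Nat.mul_le_mul_right _ (by omega)
    have b2 : memOut k mem dg e * k ≤ Z * k := Nat.mul_le_mul_right _ hyZ.le
    have b3 : (Z + 1) * k = Z * k + k := Nat.succ_mul _ _
    have b4 : (i + 1) % k < k := Nat.mod_lt _ hk
    have b5 : Z ≤ Z * k := Nat.le_mul_of_pos_right _ hk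
    refine Run.setArr_seq (Run.setArr ?_)
    simp (disch := omega) only [WExpr.eval_reg, WExpr.eval_add, WExpr.eval_sub, WExpr.eval_mul,
      WExpr.eval_mod, WExpr.eval_ofNat, WExpr.eval_const, mod_pow_of_lt, State.setReg_reg,
      State.setArr_reg, r47, r48, reduceIte, Nat.reduceEqDiff]
    refine fin _ _ _ ?_ ?_ ?_ rfl rfl
    · rw [← ha 21, tailKey, if_pos hv3, flip2, ← hi]; rfl
    · rw [← ha 22, headKey, if_pos hv3, ← hi]; rfl
    · rw [← ha 23]; rfl
  · simp (disch := omega) only [Test.eval_and, Test.eval_wlt, Test.eval_not, Test.eval_weq,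
      WExpr.eval_reg, WExpr.eval_ofNat, State.setArr_reg, State.setReg_reg, reduceIte,
      Nat.reduceEqDiff, mod_pow_of_lt, r0, r49] at hb
    have hv3 := mt hval.2 hb
    refine Run.setArr_seq (Run.setArr ?_)
    simp (disch := omega) only [WExpr.eval_reg, WExpr.eval_ofNat, mod_pow_of_lt, State.setReg_reg,
      State.setArr_reg, r47, reduceIte, Nat.reduceEqDiff]
    refine fin _ _ _ ?_ ?_ ?_ rfl rfl
    · rw [← ha 21, tailKey, if_neg hv3]; rfl
    · rw [← ha 22, headKey, if_neg hv3]; rfl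
    · rw [← ha 23]; rfl

section Layers
variable {k n : ℕ} {mem : ℕ → ℕ → ℕ} {dg : ℕ → ℕ}

/-- The lexicographic order on pairs of keys. -/
def keyLt (f g : ℕ → ℕ) (x y : ℕ) : Prop := f x < f y ∨ f x = f y ∧ (g x < g y ∨ g x = g y ∧ x < y)

theorem strictOn_keyLt (f g : ℕ → ℕ) (N : ℕ) : StrictOn (keyLt f g) N :=
  ((strictOn_lt N).lex g).lex f

/-- Edges with equal keys are consecutive in the sorted sequence and ordered by index there, so an
earlier copy exists iff the immediate predecessor is a copy. -/
theorem exists_copy_iff (f g : ℕ → ℕ) {e : ℕ} (he : e < n) :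
    (∃ e' < e, f e' = f e ∧ g e' = g e) ↔
      0 < rank (keyLt f g) n e ∧ ∀ y < n, rank (keyLt f g) n y = rank (keyLt f g) n e - 1 →
        f y = f e ∧ g y = g e := by
  have hst := strictOn_keyLt f g n
  constructor
  · rintro ⟨e', hlt, h1, h2⟩
    have he' : e' < n := by omega
    have hl := (hst.rank_lt_iff he' he).2 (.inr ⟨h1, .inr ⟨h2, hlt⟩⟩)
    refine ⟨by omega, fun y hy hye => ?_⟩
    have h3 : keyLt f g y e := (hst.rank_lt_iff hy he).1 (by omega)
    rcases eq_or_ne e' y with rfl | hne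
    · exact ⟨h1, h2⟩
    · have h4 : keyLt f g e' y := (hst.total e' he' y hy hne).resolve_right fun h => by
        have := (hst.rank_lt_iff hy he').2 h; omega
      unfold keyLt at h3 h4
      omega
  · rintro ⟨hpos, h⟩
    obtain ⟨y, hy, hye⟩ := hst.rank_surj (m := rank (keyLt f g) n e - 1)
      (by have := hst.rank_lt he; omega)
    obtain ⟨h1, h2⟩ := h y hy hye
    have h3 : keyLt f g y e := (hst.rank_lt_iff hy he).1 (by omega)
    unfold keyLt at h3
    exact ⟨y, by omega, h1, h2⟩

/-- The order of the edges by their keys. -/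
def edgeTest (e₁ e₂ : WExpr) : Test :=
  .or (.wlt (.arr 21 e₁) (.arr 21 e₂)) (.and (.weq (.arr 21 e₁) (.arr 21 e₂))
    (.or (.wlt (.arr 22 e₁) (.arr 22 e₂)) (.and (.weq (.arr 22 e₁) (.arr 22 e₂)) (.wlt e₁ e₂))))

/-- Marks in array `24` the edges that are valid and not copies of earlier ones. -/
def okProg : Prog :=
  .for 47 (.reg 0) (
    .setReg 48 (.arr 12 (.reg 47)) ;;
    .setReg 49 (.arr 10 (.reg 48 - 1)) ;;
    .ite (.and (.not (.weq (.arr 21 (.reg 47)) 0)) (.not (.and (.wlt 0 (.reg 48))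
        (.and (.weq (.arr 21 (.reg 49)) (.arr 21 (.reg 47)))
          (.weq (.arr 22 (.reg 49)) (.arr 22 (.reg 47)))))))
      (.setArr 24 (.reg 47) 1) (.setArr 24 (.reg 47) 0))

theorem run_okProg {w : ℕ} {s : State} (hw : n + 1 < 2 ^ w) (h0 : s.reg 0 = n)
    (hkey : ∀ e < n, s.arr 21 e = tailKey k n mem dg e ∧ s.arr 22 e = headKey k n mem dg e)
    (hsort : ∀ x < n, s.arr 10 (rank (keyLt (tailKey k n mem dg) (headKey k n mem dg)) n x) = x ∧
      s.arr 12 x = rank (keyLt (tailKey k n mem dg) (headKey k n mem dg)) n x) :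
    Run w okProg s (n * 6 + 2) (fun s' => ∀ e < n, s'.arr 24 e = 1 ↔ OkEdge k n mem dg e) := by
  refine Run.for (n := n) (T := 4) (fun i s' => ∀ e < i, s'.arr 24 e = 1 ↔ OkEdge k n mem dg e)
    (by omega) rfl (fun s' hf => by simpa [hf.reg 0 rfl] using h0) (by simp) ?_
  intro e s' he hf h47 hI
  have h21 : s'.arr 21 = s.arr 21 := hf.arr 21 rfl
  have h22 : s'.arr 22 = s.arr 22 := hf.arr 22 rfl
  have h10 : s'.arr 10 = s.arr 10 := hf.arr 10 rfl
  have h12 : s'.arr 12 = s.arr 12 := hf.arr 12 rfl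
  have hst := strictOn_keyLt (tailKey k n mem dg) (headKey k n mem dg) n
  obtain ⟨ρ, hρ⟩ : ∃ ρ, ρ = rank (keyLt (tailKey k n mem dg) (headKey k n mem dg)) n e :=
    ⟨_, rfl⟩
  have hρn : ρ < n := hρ ▸ hst.rank_lt he
  -- For `ρ = 0` the truncated subtraction makes `y` the edge itself; this is harmless because the
  -- program also tests `0 < ρ`.
  obtain ⟨y, hy, hye⟩ := hst.rank_surj (m := ρ - 1) (by omega)
  have hyu : ∀ z < n, rank (keyLt (tailKey k n mem dg) (headKey k n mem dg)) n z = ρ - 1 → z = y :=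
    fun z hz h => hst.rank_inj hz hy (h.trans hye.symm)
  have hok : OkEdge k n mem dg e ↔ tailKey k n mem dg e ≠ 0 ∧ ¬ (0 < ρ ∧
      tailKey k n mem dg y = tailKey k n mem dg e ∧
      headKey k n mem dg y = headKey k n mem dg e) := by
    rw [OkEdge, exists_copy_iff _ _ he, ← hρ]
    refine and_congr_right fun _ => not_congr (and_congr_right fun _ => ?_)
    constructor
    · exact fun h => h y hy hye
    · intro h z hz hze
      rw [hyu z hz hze]; exact h
  have hy10 : s.arr 10 (ρ - 1) = y := by rw [← hye, (hsort y hy).1]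
  refine Run.setReg_seq (Run.setReg_seq ?_)
  simp (disch := omega) only [WExpr.eval_reg, WExpr.eval_arr, WExpr.eval_sub, WExpr.eval_ofNat,
    mod_pow_of_lt, State.setReg_reg, State.setReg_arr, h47, h12, (hsort e he).2, ← hρ, reduceIte,
    h10, hy10]
  refine Run.ite (fun hb => Run.setArr ?_) (fun hb => Run.setArr ?_) <;>
  · simp (disch := omega) only [Test.eval_and, Test.eval_not, Test.eval_weq, Test.eval_wlt,
      WExpr.eval_arr, WExpr.eval_reg, WExpr.eval_ofNat, mod_pow_of_lt, State.setReg_reg,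
      State.setReg_arr, reduceIte, Nat.reduceEqDiff, h47, h21, h22, (hkey e he).1, (hkey e he).2,
      (hkey y hy).1, (hkey y hy).2] at hb
    rw [← hok] at hb
    intro e' he'
    simp (disch := omega) only [State.setReg_reg, State.setReg_arr, State.setArr_arr,
      WExpr.eval_reg, WExpr.eval_ofNat, mod_pow_of_lt, reduceIte, Nat.reduceEqDiff, h47]
    split_ifs with h
    · subst h; simp [hb]
    · exact hI e' (by omega)

/-- Chooses representatives of the vertices of the layered digraph in array `25`. -/
def repProg : Prog :=
  .for 47 (.reg 0) (.ite (.weq (.arr 24 (.reg 47)) 1)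
    (.setArr 25 (.arr 21 (.reg 47)) (2 * .reg 47) ;;
     .setArr 25 (.arr 22 (.reg 47)) (2 * .reg 47 + 1)) .skip)

/-- Later edges overwrite earlier ones, but any writer at a key is an end with that key and so
represents it. Only cells at keys of genuine edges matter, and these have been written, so the
initial contents of array `25` play no role. -/
theorem run_repProg {w : ℕ} {s : State} (hw : 2 * n + 2 < 2 ^ w) (h0 : s.reg 0 = n)
    (hkey : ∀ e < n, s.arr 21 e = tailKey k n mem dg e ∧ s.arr 22 e = headKey k n mem dg e)
    (hok : ∀ e < n, s.arr 24 e = 1 ↔ OkEdge k n mem dg e) :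
    Run w repProg s (n * 5 + 2) (fun s' => ∀ e < n, OkEdge k n mem dg e →
      Slot k n mem dg (s'.arr 25 (tailKey k n mem dg e)) (tailKey k n mem dg e) ∧
      Slot k n mem dg (s'.arr 25 (headKey k n mem dg e)) (headKey k n mem dg e)) := by
  refine (Run.for (n := n) (T := 3) (fun i s' => ∀ x, (∃ e < i, OkEdge k n mem dg e ∧
      (x = tailKey k n mem dg e ∨ x = headKey k n mem dg e)) → Slot k n mem dg (s'.arr 25 x) x)
    (by omega) rfl (fun s' hf => by simpa [hf.reg 0 rfl] using h0) (by simp) ?_).post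
    fun s' _ h e he ho => ⟨h _ ⟨e, he, ho, .inl rfl⟩, h _ ⟨e, he, ho, .inr rfl⟩⟩
  intro e s' he hf h47 hI
  have h21 : s'.arr 21 = s.arr 21 := hf.arr 21 rfl
  have h22 : s'.arr 22 = s.arr 22 := hf.arr 22 rfl
  have h24 : s'.arr 24 = s.arr 24 := hf.arr 24 rfl
  refine Run.ite (T := 2) (fun hb => Run.setArr_seq (Run.setArr ?_))
    (fun hb => (Run.skip ?_).time (by omega))
  · simp (disch := omega) only [Test.eval_weq, WExpr.eval_arr, WExpr.eval_reg, WExpr.eval_ofNat,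
      mod_pow_of_lt, h47, h24, hok e he] at hb
    rintro x ⟨e', he', ho', hx⟩
    simp (disch := omega) only [State.setReg_arr, State.setArr_arr, State.setArr_reg,
      WExpr.eval_reg, WExpr.eval_arr, WExpr.eval_ofNat, WExpr.eval_add, WExpr.eval_mul,
      mod_pow_of_lt, reduceIte, Nat.reduceEqDiff, h47, h21, h22, (hkey e he).1, (hkey e he).2]
    split_ifs with h1 h2
    · exact ⟨by omega, by rwa [show (2 * e + 1) / 2 = e by omega], by
        rw [show (2 * e + 1) / 2 = e by omega, if_neg (by omega), h1]⟩
    · exact ⟨by omega, by rwa [show (2 * e) / 2 = e by omega], by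
        rw [show (2 * e) / 2 = e by omega, if_pos (by omega), h2]⟩
    · refine hI x ⟨e', ?_, ho', hx⟩
      rcases Nat.lt_succ_iff_lt_or_eq.1 he' with h | rfl
      · exact h
      · tauto
  · simp (disch := omega) only [Test.eval_weq, WExpr.eval_arr, WExpr.eval_reg, WExpr.eval_ofNat,
      mod_pow_of_lt, h47, h24, hok e he] at hb
    rintro x ⟨e', he', ho', hx⟩
    refine hI x ⟨e', ?_, ho', hx⟩
    rcases Nat.lt_succ_iff_lt_or_eq.1 he' with h | rfl
    · exact h
    · exact absurd ho' hb

/-- Writes the layered digraph to arrays `26` and `27`, and to arrays `100` and `101`. -/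
def edgesProg : Prog :=
  .for 47 (.reg 0) (
    .ite (.weq (.arr 24 (.reg 47)) 1)
      (.setArr 26 (.reg 47) (.arr 25 (.arr 21 (.reg 47))) ;;
       .setArr 27 (.reg 47) (.arr 25 (.arr 22 (.reg 47))))
      (.setArr 26 (.reg 47) (2 * .reg 47) ;; .setArr 27 (.reg 47) (2 * .reg 47 + 1)) ;;
    .setArr 100 (.reg 47) (.arr 26 (.reg 47)) ;;
    .setArr 101 (.reg 47) (.arr 27 (.reg 47))) ;;
  .setReg 100 (2 * .reg 0) ;;
  .setReg 101 (.reg 0)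

theorem run_edgesProg {w : ℕ} {s : State} (hw : 2 * n + 2 < 2 ^ w) (h0 : s.reg 0 = n)
    (hkey : ∀ e < n, s.arr 21 e = tailKey k n mem dg e ∧ s.arr 22 e = headKey k n mem dg e)
    (hok : ∀ e < n, s.arr 24 e = 1 ↔ OkEdge k n mem dg e)
    (hrep : ∀ e < n, OkEdge k n mem dg e →
      Slot k n mem dg (s.arr 25 (tailKey k n mem dg e)) (tailKey k n mem dg e) ∧
      Slot k n mem dg (s.arr 25 (headKey k n mem dg e)) (headKey k n mem dg e)) :
    Run w edgesProg s (n * 7 + 4) (fun s' => IsLayered k n mem dg (s'.arr 26) (s'.arr 27) ∧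
      (∀ e < n, s'.arr 100 e = s'.arr 26 e ∧ s'.arr 101 e = s'.arr 27 e) ∧
      s'.reg 100 = 2 * n ∧ s'.reg 101 = n) := by
  refine Run.bind (T₁ := n * 7 + 2) (T₂ := 2) (P := fun s' =>
      IsLayered k n mem dg (s'.arr 26) (s'.arr 27) ∧
      (∀ e < n, s'.arr 100 e = s'.arr 26 e ∧ s'.arr 101 e = s'.arr 27 e)) ?_ ?_
  · refine (Run.for (n := n) (T := 5) (fun i s' => ∀ e < i,
      (OkEdge k n mem dg e → s'.arr 26 e = s.arr 25 (tailKey k n mem dg e) ∧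
        s'.arr 27 e = s.arr 25 (headKey k n mem dg e)) ∧
      (¬ OkEdge k n mem dg e → s'.arr 26 e = 2 * e ∧ s'.arr 27 e = 2 * e + 1) ∧
      s'.arr 100 e = s'.arr 26 e ∧ s'.arr 101 e = s'.arr 27 e)
      (by omega) rfl (fun s' hf => by simpa [hf.reg 0 rfl] using h0) (by simp) ?_).post ?_
    · intro e s' he hf h47 hI
      have h21 : s'.arr 21 = s.arr 21 := hf.arr 21 rfl
      have h22 : s'.arr 22 = s.arr 22 := hf.arr 22 rfl
      have h24 : s'.arr 24 = s.arr 24 := hf.arr 24 rfl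
      have h25 : s'.arr 25 = s.arr 25 := hf.arr 25 rfl
      refine Run.bind (T₁ := 3) (T₂ := 2) (P := fun s'' => ∃ x y,
        s''.arr 26 = Function.update (s'.arr 26) e x ∧
        s''.arr 27 = Function.update (s'.arr 27) e y ∧
        (OkEdge k n mem dg e → x = s.arr 25 (tailKey k n mem dg e) ∧
          y = s.arr 25 (headKey k n mem dg e)) ∧
        (¬ OkEdge k n mem dg e → x = 2 * e ∧ y = 2 * e + 1)) ?_ ?_
      · refine Run.ite (fun hb => Run.setArr_seq (Run.setArr ?_))
          (fun hb => Run.setArr_seq (Run.setArr ?_)) <;>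
        · simp (disch := omega) only [Test.eval_weq, WExpr.eval_arr, WExpr.eval_reg,
            WExpr.eval_ofNat, mod_pow_of_lt, h47, h24, hok e he] at hb
          simp (disch := omega) only [WExpr.eval_reg, WExpr.eval_arr, WExpr.eval_ofNat,
            WExpr.eval_add, WExpr.eval_mul, mod_pow_of_lt, h47, h21, h22, State.setArr_reg,
            State.setArr_arr, reduceIte, Nat.reduceEqDiff, (hkey e he).1, (hkey e he).2, h25]
          exact ⟨_, _, rfl, rfl, by simp [hb], by simp [hb]⟩
      · rintro s₂ hf₂ ⟨x, y, hx, hy, h1, h2⟩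
        refine Run.setArr_seq (Run.setArr ?_)
        have h47' : s₂.reg 47 = e := by rw [hf₂.reg 47 rfl, h47]
        have h100 : s₂.arr 100 = s'.arr 100 := hf₂.arr 100 rfl
        have h101 : s₂.arr 101 = s'.arr 101 := hf₂.arr 101 rfl
        intro e' he'
        simp only [WExpr.eval_reg, WExpr.eval_arr, State.setArr_reg, State.setReg_arr,
          State.setArr_arr, reduceIte, Nat.reduceEqDiff, h47', hx, hy, h100, h101]
        rcases eq_or_ne e' e with rfl | hne
        · simp only [Function.update_self, if_true]
          exact ⟨h1, h2, trivial, trivial⟩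
        · simp only [ne_eq, hne, not_false_eq_true, Function.update_of_ne, if_false]
          exact hI e' (by omega)
    · intro s' hf h
      refine ⟨⟨⟨s.arr 25, fun e he ho => ?_⟩, fun e he ho => ((h e he).2.1 ho)⟩,
        fun e he => (h e he).2.2⟩
      obtain ⟨h1, h2⟩ := (h e he).1 ho
      rw [h1, h2]
      exact ⟨rfl, rfl, hrep e he ho⟩
  · rintro s' hf ⟨hL, hE⟩
    refine Run.setReg_seq (Run.setReg ?_)
    have h0' : s'.reg 0 = n := by rw [hf.reg 0 rfl, h0]
    refine ⟨hL, hE, ?_, ?_⟩ <;>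
      simp (disch := omega) [h0', mod_pow_of_lt]

end Layers

/-- Turns an answer for the layered digraph into an answer for the original problem. -/
def extractProg (k : ℕ) : Prog :=
  .ite (.weq (.reg 100) 1)
    (.setReg 40 1 ;;
     .for 46 (.const k) (.for 47 (.reg 0)
      (.ite (.and (.weq (.arr 26 (.reg 47)) (.arr 100 (.reg 46)))
          (.weq (.arr 27 (.reg 47)) (.arr 100 ((.reg 46 + 1) % .const k))))
        (.setArr 0 (.reg 46) (.arr 23 (.reg 47))) .skip)))
    .skip

/-- The digraph program reports nodes, whereas the sought vertices are edges of the layered digraph.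
A scan of all edges for each pair of consecutive nodes recovers them. -/
theorem run_extractProg {w k n : ℕ} {x : ℕ → ℕ} {s : State} (hw : n + k + 2 < 2 ^ w) (hk : 0 < k)
    (h0 : s.reg 0 = n) (h100 : s.reg 100 = 1) (hx : ∀ i < k, s.arr 100 i = x i)
    (hex : ∀ i < k, ∃ e < n, s.arr 26 e = x i ∧ s.arr 27 e = x ((i + 1) % k)) :
    Run w (extractProg k) s (k * (n * 4 + 4) + 4) (fun s' => s'.reg 40 = 1 ∧
      ∃ E : ℕ → ℕ, ∀ i < k, E i < n ∧ s.arr 26 (E i) = x i ∧ s.arr 27 (E i) = x ((i + 1) % k) ∧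
        s'.arr 0 i = s.arr 23 (E i)) := by
  refine Run.ite (fun hb => Run.setReg_seq ?_) (fun hb => ?_)
  swap
  · simp (disch := omega) [h100, mod_pow_of_lt] at hb
  obtain ⟨s₁, hs₁⟩ : ∃ s₁, s₁ = s.setReg 40 (WExpr.eval w s 1) := ⟨_, rfl⟩
  have h40 : s₁.reg 40 = 1 := by rw [hs₁]; simp (disch := omega) [mod_pow_of_lt]
  have ha : s₁.arr = s.arr := by rw [hs₁]; rfl
  have h0' : s₁.reg 0 = n := by rw [hs₁]; simpa using h0
  rw [← hs₁]
  refine (Run.for (n := k) (T := n * 4 + 2) (fun m s' => ∀ i < m, ∃ e < n, s.arr 26 e = x i ∧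
    s.arr 27 e = x ((i + 1) % k) ∧ s'.arr 0 i = s.arr 23 e) (by omega) rfl
    (fun s' _ => by simp (disch := omega) [mod_pow_of_lt]) (by simp) ?_).post ?_
  · intro i s' hi hf h46 hI
    have h26 : s'.arr 26 = s.arr 26 := by rw [hf.arr 26 rfl, ha]
    have h27 : s'.arr 27 = s.arr 27 := by rw [hf.arr 27 rfl, ha]
    have h23 : s'.arr 23 = s.arr 23 := by rw [hf.arr 23 rfl, ha]
    have ha100 : s'.arr 100 = s.arr 100 := by rw [hf.arr 100 rfl, ha]
    have hr0 : s'.reg 0 = n := by rw [hf.reg 0 rfl, h0']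
    have him : (i + 1) % k < k := Nat.mod_lt _ hk
    refine (Run.for (n := n) (T := 2) (fun m s₂ => (∀ i' < i, s₂.arr 0 i' = s'.arr 0 i') ∧
      ((∃ e < m, s.arr 26 e = x i ∧ s.arr 27 e = x ((i + 1) % k)) →
      ∃ e < n, s.arr 26 e = x i ∧ s.arr 27 e = x ((i + 1) % k) ∧ s₂.arr 0 i = s.arr 23 e))
      (by omega) rfl (fun s' hf => by simpa [hf.reg 0 rfl] using hr0) (by simp) ?_).post ?_
    · rintro e s₂ he hf₂ h47 ⟨hJ1, hJ2⟩
      have h26' : s₂.arr 26 = s.arr 26 := by rw [hf₂.arr 26 rfl, h26]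
      have h27' : s₂.arr 27 = s.arr 27 := by rw [hf₂.arr 27 rfl, h27]
      have h23' : s₂.arr 23 = s.arr 23 := by rw [hf₂.arr 23 rfl, h23]
      have h100' : s₂.arr 100 = s.arr 100 := by rw [hf₂.arr 100 rfl, ha100]
      have h46' : s₂.reg 46 = i := by rw [hf₂.reg 46 rfl, h46]
      refine Run.ite (fun hb => Run.setArr ?_) (fun hb => Run.skip ?_) <;>
        simp (disch := omega) only [Test.eval_and, Test.eval_weq, WExpr.eval_arr, WExpr.eval_reg,
          WExpr.eval_add, WExpr.eval_mod, WExpr.eval_ofNat, WExpr.eval_const, mod_pow_of_lt, h47,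
          h26', h27', h100', h46', hx i hi, hx _ him] at hb
      · simp only [State.setReg_arr, State.setArr_arr, WExpr.eval_arr, WExpr.eval_reg, h47, h46',
          h23', if_true]
        refine ⟨fun i' hi' => ?_, fun _ => ⟨e, he, hb.1, hb.2, rfl⟩⟩
        rw [if_neg (by omega), hJ1 i' hi']
      · refine ⟨hJ1, ?_⟩
        rintro ⟨e', he', h1, h2⟩
        refine hJ2 ⟨e', ?_, h1, h2⟩
        rcases Nat.lt_succ_iff_lt_or_eq.1 he' with h | rfl
        · exact h
        · exact absurd ⟨h1, h2⟩ hb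
    · rintro s₂ hf₂ ⟨hJ1, hJ2⟩ i' hi'
      simp only [State.setReg_arr]
      rcases Nat.lt_succ_iff_lt_or_eq.1 hi' with h | rfl
      · rw [hJ1 i' h]; exact hI i' h
      · exact hJ2 (hex i' hi)
  · intro s' hf h
    refine ⟨by rw [hf.reg 40 rfl, h40], ?_⟩
    choose! E hE using h
    exact ⟨E, hE⟩

/-- Builds the layered digraph that belongs to the number in register `44`. -/
def prepProg (k : ℕ) : Prog :=
  digitsProg k ;; keysProg k ;; .setReg 30 (.reg 0) ;; .setReg 29 (.reg 2) ;;
  sortProg edgeTest ;; okProg ;; repProg ;; edgesProg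

def prepTime (k n ℓ : ℕ) : ℕ :=
  ((3 * k + k * k) * 4 + 3) + ((n * (k * 4 + 14) + 2) + (((((ℓ + 1) * (n * (4 * ℓ + 18) + 16)) +
    ((n * 6 + 2) + ((n * 5 + 2) + (n * 7 + 4))) + 1) + 1)))

/-- The word size suffices for the cycle program. -/
structure CycleWord (w k n P ℓ Z : ℕ) : Prop where
  h1 : 3 * k + k * k + 3 < 2 ^ w
  h2 : (2 * n + P) * P + P < 2 ^ w
  h3 : (Z + 1) * k + k + 1 < 2 ^ w
  h4 : 2 * n + P + 2 < 2 ^ w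
  h5 : 8 * 2 ^ ℓ + 4 < 2 ^ w
  h6 : P ^ (3 * k + k * k) < 2 ^ w

/-- The memory holds a biclique cover. -/
structure CoverInput (n P ℓ Z : ℕ) (mem : ℕ → ℕ → ℕ) (s : State) : Prop where
  h0 : s.reg 0 = n
  h1 : s.reg 1 = P
  h2 : s.reg 2 = ℓ
  mem : ∀ v < n, ∀ p < P, s.arr 5 (v * P + p) = mem v p ∧ mem v p < Z

theorem run_prepProg {w k n P ℓ Z q : ℕ} {mem : ℕ → ℕ → ℕ} {s : State} (hs : s.Bounded w)
    (hk : 0 < k) (hkn : k ≤ n) (hP : 0 < P) (hℓ : n ≤ 2 ^ ℓ) (hw : CycleWord w k n P ℓ Z)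
    (hin : CoverInput n P ℓ Z mem s) (h44 : s.reg 44 = q) :
    Run w (prepProg k) s (prepTime k n ℓ) (fun s' =>
      IsLayered k n mem (fun x => q / P ^ x % P) (s'.arr 26) (s'.arr 27) ∧
      (∀ e < n, s'.arr 100 e = s'.arr 26 e ∧ s'.arr 101 e = s'.arr 27 e) ∧
      s'.reg 100 = 2 * n ∧ s'.reg 101 = n ∧
      ∀ e < n, s'.arr 23 e = vert k (fun x => q / P ^ x % P) e) := by
  obtain ⟨dg, hdg⟩ : ∃ dg, dg = fun x => q / P ^ x % P := ⟨_, rfl⟩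
  rw [← hdg]
  have hn := hw.h4
  refine Run.bind (run_digitsProg hs (by have := hw.h1; omega) h44 hin.h1) fun s₁ f₁ h₁ => ?_
  refine Run.bind (run_keysProg (Z := Z) (mem := mem) (dg := dg) (f₁.bdd hs) hk hkn hw.h1 hw.h2
    hw.h3 hP (by omega) ((f₁.reg 0 rfl).trans hin.h0) ((f₁.reg 1 rfl).trans hin.h1)
    (fun x _ => by rw [hdg]; exact Nat.mod_lt _ hP) (fun x hx => by rw [h₁ x hx, hdg])
    (by rw [f₁.arr 5 rfl]; exact hin.mem)) fun s₂ f₂ h₂ => ?_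
  refine Run.setReg_seq (Run.setReg_seq ?_)
  obtain ⟨s₃, hs₃⟩ : ∃ s₃, s₃ = (s₂.setReg 30 (WExpr.eval w s₂ (.reg 0))).setReg 29
    (WExpr.eval w (s₂.setReg 30 (WExpr.eval w s₂ (.reg 0))) (.reg 2)) := ⟨_, rfl⟩
  rw [← hs₃]
  have hb₂ := f₂.bdd (f₁.bdd hs)
  have hb₃ : s₃.Bounded w := by
    rw [hs₃]
    exact (hb₂.setReg 30 (WExpr.eval_lt hb₂ _)).setReg 29
      (WExpr.eval_lt (hb₂.setReg 30 (WExpr.eval_lt hb₂ _)) _)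
  have r0 : s₂.reg 0 = n := by rw [f₂.reg 0 rfl, f₁.reg 0 rfl, hin.h0]
  have r2 : s₂.reg 2 = ℓ := by rw [f₂.reg 2 rfl, f₁.reg 2 rfl, hin.h2]
  have a₃ : s₃.arr = s₂.arr := by rw [hs₃]; rfl
  have r0' : s₃.reg 0 = n := by rw [hs₃]; simp [r0]
  refine Run.bind (run_sortProg (strictOn_keyLt (tailKey k n mem dg) (headKey k n mem dg) n)
    (D := ℓ) hb₃ hℓ hw.h5 (by rw [hs₃]; simp [r0]) (by rw [hs₃]; simp [r2]) ?_) fun s₄ f₄ h₄ => ?_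
  · intro s' hf e₁ e₂ h1 h2
    rw [edgeTest, keyLt]
    simp only [Test.eval_or, Test.eval_and, Test.eval_wlt, Test.eval_weq, WExpr.eval_arr,
      hf.arr 21 rfl, hf.arr 22 rfl, a₃, (h₂ _ h1).1, (h₂ _ h2).1, (h₂ _ h1).2.1, (h₂ _ h2).2.1]
  have key₄ : ∀ e < n, s₄.arr 21 e = tailKey k n mem dg e ∧ s₄.arr 22 e = headKey k n mem dg e :=
    fun e he => by
      rw [f₄.arr 21 rfl, f₄.arr 22 rfl, a₃]; exact ⟨(h₂ e he).1, (h₂ e he).2.1⟩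
  have r4 : s₄.reg 0 = n := by rw [f₄.reg 0 rfl, r0']
  refine Run.bind (run_okProg (by omega) r4 key₄ h₄) fun s₅ f₅ h₅ => ?_
  have key₅ : ∀ e < n, s₅.arr 21 e = tailKey k n mem dg e ∧ s₅.arr 22 e = headKey k n mem dg e :=
    fun e he => by rw [f₅.arr 21 rfl, f₅.arr 22 rfl]; exact key₄ e he
  have r5 : s₅.reg 0 = n := by rw [f₅.reg 0 rfl, r4]
  refine Run.bind (run_repProg (by omega) r5 key₅ h₅) fun s₆ f₆ h₆ => ?_
  have key₆ : ∀ e < n, s₆.arr 21 e = tailKey k n mem dg e ∧ s₆.arr 22 e = headKey k n mem dg e :=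
    fun e he => by rw [f₆.arr 21 rfl, f₆.arr 22 rfl]; exact key₅ e he
  have r6 : s₆.reg 0 = n := by rw [f₆.reg 0 rfl, r5]
  refine (run_edgesProg (by omega) r6 key₆ (by rw [f₆.arr 24 rfl]; exact h₅) h₆).post ?_
  rintro s₇ f₇ ⟨h7, h8, h9, h10⟩
  refine ⟨h7, h8, h9, h10, fun e he => ?_⟩
  rw [f₇.arr 23 rfl, f₆.arr 23 rfl, f₅.arr 23 rfl, f₄.arr 23 rfl, a₃]
  exact (h₂ e he).2.2

/-- Looks for a cycle in the layered digraph that belongs to the number in register `44`. -/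
def attemptProg (k : ℕ) (D : Prog) : Prog := prepProg k ;; D.shift 100 ;; extractProg k

/-- `D` finds `k`-cycles in digraphs with `n` edges. -/
def FindsCycles (w k n TD : ℕ) (D : Prog) : Prop :=
  ∀ G : SparseDigraph, G.m = n → ∀ s : State, s.Bounded w → G.Input s →
    Run w D s TD (CycleAnswer G.Adj k)

theorem attemptProg_mod (k : ℕ) (D : Prog) :
    (∀ r ∈ [0, 1, 2, 41, 44], (attemptProg k D).modReg r = false) ∧
      (attemptProg k D).modArr 5 = false := by
  have h : ∀ r < 100, (D.shift 100).modReg r = false := fun r hr => (D.shift_mod hr).1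
  have key : ∀ r < 100, (prepProg k).modReg r = false → (extractProg k).modReg r = false →
      (attemptProg k D).modReg r = false := fun r hr h1 h2 => by
    show ((prepProg k).modReg r || ((D.shift 100).modReg r || (extractProg k).modReg r)) = false
    rw [h1, h r hr, h2]; rfl
  constructor
  · simp only [List.mem_cons, List.not_mem_nil, or_false]
    rintro r (rfl | rfl | rfl | rfl | rfl) <;> exact key _ (by omega) rfl rfl
  · show ((prepProg k).modArr 5 || ((D.shift 100).modArr 5 || (extractProg k).modArr 5)) = false
    rw [(D.shift_mod (by omega : 5 < 100)).2.1]; rfl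

/-- Registers and arrays hold a cycle of links. -/
def LinkCycle (k n P : ℕ) (mem : ℕ → ℕ → ℕ) (s : State) : Prop :=
  ∃ v : Fin k → ℕ, (∀ i, v i < n) ∧ Function.Injective v ∧
    (∀ i j : Fin k, (j : ℕ) = ((i : ℕ) + 1) % k → Link mem P (v i) (v j)) ∧
    ∀ i : Fin k, s.arr 0 i = v i

/-- The layered digraph with these digits has no `k`-cycle. -/
def NoCycle (k n : ℕ) (mem : ℕ → ℕ → ℕ) (dg : ℕ → ℕ) : Prop :=
  ∃ tl hd, IsLayered k n mem dg tl hd ∧ ¬ ∃ x e : Fin k → ℕ, (∀ i, e i < n ∧ tl (e i) = x i) ∧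
    Function.Injective x ∧ ∀ i j : Fin k, (j : ℕ) = ((i : ℕ) + 1) % k → hd (e i) = x j

theorem run_attemptProg {w k n P ℓ Z q TD : ℕ} {mem : ℕ → ℕ → ℕ} {D : Prog} {s : State}
    (hs : s.Bounded w) (hk : 2 ≤ k) (hkn : k ≤ n) (hP : 0 < P) (hℓ : n ≤ 2 ^ ℓ)
    (hw : CycleWord w k n P ℓ Z) (hD : FindsCycles w k n TD D)
    (hin : CoverInput n P ℓ Z mem s) (h44 : s.reg 44 = q) (h40 : s.reg 40 = 0) :
    Run w (attemptProg k D) s (prepTime k n ℓ + (TD + (k * (n * 4 + 4) + 4))) (fun s' =>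
      s'.reg 40 = 1 ∧ LinkCycle k n P mem s' ∨
      s'.reg 40 = 0 ∧ NoCycle k n mem (fun x => q / P ^ x % P)) := by
  obtain ⟨dg, hdg⟩ : ∃ dg, dg = fun x => q / P ^ x % P := ⟨_, rfl⟩
  have hk0 : 0 < k := by omega
  have hwk := hw.h1
  have hwn := hw.h4
  refine Run.bind (run_prepProg hs hk0 hkn hP hℓ hw hin h44) ?_
  rw [← hdg]
  rintro s₁ f₁ ⟨hL, hE, h100, h101, h23⟩
  have hb₁ := f₁.bdd hs
  have hG := hL.graph hk
  refine Run.bind (Run.shift (hD (hL.graph hk) rfl (s₁.view 100) (hb₁.view 100) ?_)) ?_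
  · exact ⟨h100, h101, fun i => hE i i.2⟩
  intro s₂ f₂ h₂
  have m : ∀ r < 100, s₂.reg r = s₁.reg r ∧ s₂.arr r = s₁.arr r := fun r hr =>
    ⟨f₂.reg r (D.shift_mod hr).1, f₂.arr r (D.shift_mod hr).2.1⟩
  have h0 : s₂.reg 0 = n := by rw [(m 0 (by omega)).1, f₁.reg 0 rfl, hin.h0]
  rcases h₂ with ⟨h100', x, ⟨hinj, hcyc⟩, hx⟩ | ⟨h100', hno⟩
  · have hsucc : ∀ i : Fin k, (⟨_, Nat.mod_lt (i + 1) hk0⟩ : Fin k) = ⟨((i : ℕ) + 1) % k,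
      Nat.mod_lt _ hk0⟩ := fun _ => rfl
    have hx' : ∀ i (hi : i < k), s₂.arr 100 i = x ⟨i, hi⟩ := fun i hi => hx ⟨i, hi⟩
    have hex : ∀ i (hi : i < k), ∃ e < n, s₂.arr 26 e = x ⟨i, hi⟩ ∧
        s₂.arr 27 e = x ⟨(i + 1) % k, Nat.mod_lt _ hk0⟩ := fun i hi => by
      obtain ⟨e, he⟩ := hcyc ⟨i, hi⟩ ⟨(i + 1) % k, Nat.mod_lt _ hk0⟩ rfl
      rw [Prod.ext_iff, Fin.ext_iff, Fin.ext_iff] at he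
      rw [(m 26 (by omega)).2, (m 27 (by omega)).2]
      exact ⟨e, e.2, he.1, he.2⟩
    refine (run_extractProg (x := s₂.arr 100) (by nlinarith) hk0 h0 h100' (fun _ _ => rfl)
      fun i hi => ?_).post ?_
    · obtain ⟨e, he, h1, h2⟩ := hex i hi
      exact ⟨e, he, by rw [h1, hx'], by rw [h2, hx']⟩
    · rintro s₃ f₃ ⟨h40', E, hE'⟩
      left
      refine ⟨h40', ?_⟩
      -- The digits of a number in base `P` are below `P` automatically, so a reported cycle is
      -- genuine for every number.
      obtain ⟨h1, h2, h3⟩ := hL.sound (P := P) hk (fun x _ => by rw [hdg]; exact Nat.mod_lt _ hP)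
        (fun i => s₂.arr 100 i) (fun i => E i)
        (fun i => (hE' i i.2).1) (fun i => by rw [← (m 26 (by omega)).2]; exact (hE' i i.2).2.1)
        (fun i j hj => by rw [hj, ← (m 27 (by omega)).2]; exact (hE' i i.2).2.2.1)
      refine ⟨fun i => vert k dg (E i), h1, fun i j hij => ?_, h3, fun i => ?_⟩
      · by_contra hne
        exact h2 i j hne hij
      · rw [(hE' i i.2).2.2.2, (m 23 (by omega)).2, h23 _ (hE' i i.2).1]
  · refine Run.ite (T := k * (n * 4 + 4) + 3) (fun hb => ?_)
      (fun hb => (Run.skip ?_).time (by omega))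
    · have : s₂.reg 100 = 0 := h100'
      simp (disch := omega) [this, mod_pow_of_lt] at hb
    · right
      refine ⟨by rw [(m 40 (by omega)).1, f₁.reg 40 rfl, h40], _, _, hL, ?_⟩
      rintro ⟨x, e, he, hinj, hcyc⟩
      refine hno ⟨fun i => ⟨x i, ?_⟩, fun i j hij => hinj (by simpa using hij), fun i j hj => ?_⟩
      · rw [← (he i).2]; exact (hL.lt (he i).1).1
      · refine ⟨⟨e i, (he i).1⟩, ?_⟩
        rw [Prod.ext_iff, Fin.ext_iff, Fin.ext_iff]
        exact ⟨(he i).2, hcyc i j hj⟩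

/-- Finds a `k`-cycle in a graph given by a biclique cover. -/
def cycleProg (k : ℕ) (D : Prog) : Prog :=
  .setReg 40 0 ;; .setReg 41 1 ;;
  .for 42 (.const (3 * k + k * k)) (.setReg 41 (.reg 41 * .reg 1)) ;;
  .for 44 (.reg 41) (.ite (.weq (.reg 40) 0) (attemptProg k D) .skip) ;;
  .setReg 0 (.reg 40)

def cycleTime (k n P ℓ TD : ℕ) : ℕ :=
  ((3 * k + k * k) * 3 + 2) + (P ^ (3 * k + k * k) *
    ((prepTime k n ℓ + (TD + (k * (n * 4 + 4) + 4)) + 1) + 2) + 2 + 1) + 1 + 1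

/-- The hypothesis `complete` does not ask that adjacent vertices be linked, only that some cycle of
links exists if there is a cycle; the geometry provides no more. The loop runs through all sequences
of digits and stops calling the subroutine after a success. -/
theorem run_cycleProg {w k n P ℓ Z TD : ℕ} {mem : ℕ → ℕ → ℕ} {D : Prog} {s : State}
    {adj : Fin n → Fin n → Prop}
    (hs : s.Bounded w) (hk : 2 ≤ k) (hkn : k ≤ n) (hP : 2 * k ≤ P) (hℓP : 2 * ℓ ≤ P)
    (hℓ : n ≤ 2 ^ ℓ)
    (hw : CycleWord w k n P ℓ Z) (hD : FindsCycles w k n TD D)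
    (hin : CoverInput n P ℓ Z mem s)
    (sound : ∀ v v' : Fin n, v ≠ v' → Link mem P v v' → adj v v')
    (complete : (∃ v : Fin k → Fin n, IsKCycle adj k v) → ∃ v : Fin k → Fin n,
      IsKCycle (fun a b : Fin n => Link mem P a b) k v) :
    Run w (cycleProg k D) s (cycleTime k n P ℓ TD) (CycleAnswer adj k) := by
  have hw1 := hw.h1
  have hw6 := hw.h6
  have hP0 : 0 < P := by omega
  have hnd : 3 * k + k * k < 2 ^ w := by omega
  refine Run.setReg_seq (Run.setReg_seq ?_)
  obtain ⟨s₀, hs₀⟩ : ∃ s₀, s₀ = ((s.setReg 40 (WExpr.eval w s 0)).setReg 41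
    (WExpr.eval w (s.setReg 40 (WExpr.eval w s 0)) 1)) := ⟨_, rfl⟩
  rw [← hs₀]
  have hb₀ : s₀.Bounded w := by
    rw [hs₀]
    exact (hs.setReg 40 (WExpr.eval_lt hs _)).setReg 41
      (WExpr.eval_lt (hs.setReg 40 (WExpr.eval_lt hs _)) _)
  have r40 : s₀.reg 40 = 0 := by rw [hs₀]; simp
  have r41 : s₀.reg 41 = 1 := by rw [hs₀]; simp (disch := omega) [mod_pow_of_lt]
  have hin₀ : CoverInput n P ℓ Z mem s₀ := by
    rw [hs₀]
    exact ⟨by simp [hin.h0], by simp [hin.h1], by simp [hin.h2], hin.mem⟩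
  refine Run.bind (T₁ := (3 * k + k * k) * 3 + 2) (T₂ := _ + 1)
    (P := fun s' => s'.reg 41 = P ^ (3 * k + k * k))
    (Run.for (n := 3 * k + k * k) (T := 1) (fun i s' => s'.reg 41 = P ^ i) hnd rfl
      (fun s' _ => by simp [mod_pow_of_lt hnd]) (by simp [r41]) ?_) ?_
  · intro i s' hi hf h42 hI
    have h1 : s'.reg 1 = P := by rw [hf.reg 1 rfl, hin₀.h1]
    refine Run.setReg ?_
    have : P ^ i * P < 2 ^ w := by
      rw [← pow_succ]; exact (Nat.pow_le_pow_right hP0 hi).trans_lt hw6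
    simp [hI, h1, pow_succ, mod_pow_of_lt this]
  intro s₁ f₁ h₁
  have hin₁ : CoverInput n P ℓ Z mem s₁ :=
    ⟨(f₁.reg 0 rfl).trans hin₀.h0, (f₁.reg 1 rfl).trans hin₀.h1, (f₁.reg 2 rfl).trans hin₀.h2,
      by rw [f₁.arr 5 rfl]; exact hin₀.mem⟩
  have hmod : ∀ r ∈ [0, 1, 2, 41],
      (Prog.for 44 (.reg 41) (.ite (.weq (.reg 40) 0) (attemptProg k D) .skip)).modReg r
        = false := by
    intro r hr
    have h44 : r ≠ 44 := by rintro rfl; simp at hr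
    have := (attemptProg_mod k D).1 r (by simp at hr ⊢; tauto)
    simp [Prog.for, Prog.modReg, this, h44.symm]
  have hmodA :
      (Prog.for 44 (.reg 41) (.ite (.weq (.reg 40) 0) (attemptProg k D) .skip)).modArr 5
        = false := by
    simp [Prog.for, Prog.modArr, (attemptProg_mod k D).2]
  have h44 : (Prog.ite (.weq (.reg 40) 0) (attemptProg k D) .skip).modReg 44 = false := by
    simp [Prog.modReg, (attemptProg_mod k D).1 44 (by simp)]
  refine Run.bind (Run.for (n := P ^ (3 * k + k * k))
    (fun q s' => s'.reg 40 = 1 ∧ LinkCycle k n P mem s' ∨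
      s'.reg 40 = 0 ∧ ∀ q' < q, NoCycle k n mem (fun x => q' / P ^ x % P)) hw6 h44
    (fun s' hf => (hf.reg 41 (hmod 41 (by simp))).trans h₁)
    (.inr ⟨by simp [f₁.reg 40 rfl, r40], by simp⟩) ?_) ?_
  · intro q s' hq hf h44' hI
    refine Run.ite (fun hb => ?_) (fun hb => (Run.skip ?_).time (by omega))
    · have h40 : s'.reg 40 = 0 := by simpa using hb
      have hno := hI.resolve_left (by omega)
      have hin' : CoverInput n P ℓ Z mem s' :=
        ⟨(hf.reg 0 (hmod 0 (by simp))).trans hin₁.h0, (hf.reg 1 (hmod 1 (by simp))).trans hin₁.h1,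
          (hf.reg 2 (hmod 2 (by simp))).trans hin₁.h2, by rw [hf.arr 5 hmodA]; exact hin₁.mem⟩
      refine (run_attemptProg (hf.bdd (f₁.bdd hb₀)) hk hkn hP0 hℓ hw hD hin' h44' h40).post ?_
      rintro s'' - (⟨h1, h2⟩ | ⟨h1, h2⟩)
      · exact .inl ⟨by simpa using h1, h2⟩
      · refine .inr ⟨by simpa using h1, fun q' hq' => ?_⟩
        rcases Nat.lt_succ_iff_lt_or_eq.1 hq' with h | rfl
        · exact hno.2 q' h
        · exact h2
    · have h40 : s'.reg 40 ≠ 0 := by simpa using hb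
      rcases hI with ⟨h1, h2⟩ | h
      · exact .inl ⟨by simpa using h1, h2⟩
      · exact absurd h.1 h40
  · rintro s₂ f₂ h₂
    refine Run.setReg ?_
    rcases h₂ with ⟨h40, v, hv, hinj, hl, ha⟩ | ⟨h40, hno⟩
    · refine .inl ⟨by simp [h40], fun i => ⟨v i, hv i⟩,
        ⟨fun i j hij => hinj (by simpa using hij), fun i j hj => ?_⟩, fun i => ha i⟩
      refine sound _ _ (fun h => ?_) (hl i j hj)
      have hij : i = j := hinj (by simpa using h)
      rw [← hij] at hj
      exact succ_mod_ne hk i.2 hj.symm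
    · refine .inr ⟨by simp [h40], fun hc => ?_⟩
      obtain ⟨v, hinj, hl⟩ := complete hc
      obtain ⟨dg, hdg, hall⟩ := exists_digits (mem := mem) hk hkn hP hℓP hℓ (fun i => v i)
        (fun i => (v i).2) (fun i j hij => hinj (Fin.ext hij)) hl
      obtain ⟨q, hq, hqd⟩ := exists_number dg hdg (3 * k + k * k)
      obtain ⟨tl, hd, hL, hn⟩ := hno q hq
      obtain ⟨x, e, h⟩ := hall _ hqd tl hd hL
      exact hn ⟨x, e, h⟩

/-! ## Segments as affine functions on intervals, and a segment tree on the sorted endpoints -/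

/-- The `i`-th segment is the graph of `x ↦ y i + m i * (x - c i)` on `[a i, b i]`; `X` lists the
sorted endpoints of these intervals, and `l i`, `r i` are the positions of `a i`, `b i`. -/
structure Sweep where
  n : ℕ
  h : ℕ
  a : ℕ → ℝ
  b : ℕ → ℝ
  c : ℕ → ℝ
  y : ℕ → ℝ
  m : ℕ → ℝ
  l : ℕ → ℕ
  r : ℕ → ℕ
  X : ℕ → ℝ

namespace Sweep

/-- The field `l_lt_r` is where closedness of the segments enters: among equal coordinates, left
endpoints precede right endpoints, so that even intervals with a single common point share a gap
between consecutive positions. -/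
structure Good (S : Sweep) : Prop where
  h_pos : 0 < S.h
  n_le : 2 * S.n ≤ 2 ^ S.h
  mono : ∀ i j, i ≤ j → j < 2 * S.n → S.X i ≤ S.X j
  r_lt : ∀ i < S.n, S.r i < 2 * S.n
  X_l : ∀ i < S.n, S.X (S.l i) = S.a i
  X_r : ∀ i < S.n, S.X (S.r i) = S.b i
  l_lt_r : ∀ i < S.n, ∀ j < S.n, S.a i ≤ S.b j → S.l i < S.r j
  a_le_b : ∀ i < S.n, S.a i ≤ S.b i

variable (S : Sweep)

def f (i : ℕ) (x : ℝ) : ℝ := S.y i + S.m i * (x - S.c i)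

/-- Two of the segments meet. -/
def Meet (i j : ℕ) : Prop :=
  ∃ x, (S.a i ≤ x ∧ x ≤ S.b i) ∧ (S.a j ≤ x ∧ x ≤ S.b j) ∧ S.f i x = S.f j x

/-- An item is a segment with one of four nodes on some level of the segment tree. -/
def seg (u : ℕ) : ℕ := u / (4 * S.h)
def lev (u : ℕ) : ℕ := u % (4 * S.h) / 4
def side (u : ℕ) : ℕ := u % (4 * S.h) / 2 % 2
def bit (u : ℕ) : ℕ := u % (4 * S.h) % 2
def lpar (u : ℕ) : ℕ := S.l (S.seg u) / 2 ^ (S.lev u + 1)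
def rpar (u : ℕ) : ℕ := (S.r (S.seg u) - 1) / 2 ^ (S.lev u + 1)
def par (u : ℕ) : ℕ := if S.side u = 0 then S.lpar u else S.rpar u
def nd (u : ℕ) : ℕ := 2 * S.par u + S.bit u
def lo (u : ℕ) : ℕ := S.nd u * 2 ^ S.lev u
def hi (u : ℕ) : ℕ := (S.nd u + 1) * 2 ^ S.lev u
def key (u : ℕ) : ℕ := S.nd u * S.h + S.lev u + 1

/-- The canonical nodes of a segment tree: the node is inside the interval, the parent is not. On
each level only children of the parents above the two ends of the interval matter. The last clause
drops the second copy when these parents coincide. -/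
def IsC (u : ℕ) : Prop :=
  (S.l (S.seg u) ≤ S.lo u ∧ S.hi u ≤ S.r (S.seg u)) ∧
  ¬ (S.l (S.seg u) ≤ S.par u * 2 ^ (S.lev u + 1) ∧
    (S.par u + 1) * 2 ^ (S.lev u + 1) ≤ S.r (S.seg u)) ∧
  ¬ (S.side u = 1 ∧ S.lpar u = S.rpar u)

def IsD (u : ℕ) : Prop := S.l (S.seg u) < S.hi u ∧ S.lo u < S.r (S.seg u)

open scoped Classical in
noncomputable def ck (u : ℕ) : ℕ := if S.IsC u then S.key u else 0
open scoped Classical in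
noncomputable def dk (u : ℕ) : ℕ := if S.IsD u then S.key u else 0

def xl (u : ℕ) : ℝ := S.X (S.lo u)
def xr (u : ℕ) : ℝ := S.X (S.hi u)
def L (u : ℕ) : ℝ := S.f (S.seg u) (S.xl u)
def R (u : ℕ) : ℝ := S.f (S.seg u) (S.xr u)
-- The window of `u` is the part of its interval above the strip of the node. A canonical item of
-- the same node is defined on the whole window, so comparing the two at both ends of it decides
-- whether they meet there.
noncomputable def xs (u : ℕ) : ℝ := max (S.a (S.seg u)) (S.xl u)
noncomputable def xe (u : ℕ) : ℝ := min (S.b (S.seg u)) (S.xr u)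

/-- The item `x`, whose node is that of `u`, passes below `u`. -/
def Below (x u : ℕ) : Prop :=
  S.f (S.seg x) (S.xs u) < S.f (S.seg u) (S.xs u) ∧ S.f (S.seg x) (S.xe u) < S.f (S.seg u) (S.xe u)

def Above (x u : ℕ) : Prop :=
  S.f (S.seg u) (S.xs u) < S.f (S.seg x) (S.xs u) ∧ S.f (S.seg u) (S.xe u) < S.f (S.seg x) (S.xe u)

/-- The number of items. -/
def M : ℕ := 4 * S.h * S.n

variable {S}

/-- The difference of two affine functions at `x` is a convex combination of its values at `p` and
`q`; multiplied by `q - p`, this is a polynomial identity. -/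
theorem f_lt_of_ends {i j : ℕ} {p q x : ℝ} (hp : p ≤ x) (hq : x ≤ q) (h1 : S.f i p < S.f j p)
    (h2 : S.f i q < S.f j q) : S.f i x < S.f j x := by
  simp only [f] at *
  rcases hp.eq_or_lt with rfl | hp'
  · exact h1
  · have hqp : 0 < q - p := by linarith
    have e : (q - p) * (S.y j + S.m j * (x - S.c j) - (S.y i + S.m i * (x - S.c i))) =
        (q - x) * (S.y j + S.m j * (p - S.c j) - (S.y i + S.m i * (p - S.c i))) +
        (x - p) * (S.y j + S.m j * (q - S.c j) - (S.y i + S.m i * (q - S.c i))) := by ring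
    have h3 : 0 < (q - p) * (S.y j + S.m j * (x - S.c j) - (S.y i + S.m i * (x - S.c i))) := by
      rw [e]
      have := mul_pos (sub_pos.2 hp') (sub_pos.2 h2)
      have := mul_nonneg (sub_nonneg.2 hq) (sub_pos.2 h1).le
      linarith
    linarith [(mul_pos_iff_of_pos_left hqp).1 h3]

/-- Otherwise the difference would have the same strict sign at both ends; the intermediate value
theorem does the rest. -/
theorem exists_f_eq {i j : ℕ} {p q : ℝ} (hpq : p ≤ q) (h1 : ¬ (S.f i p < S.f j p ∧ S.f i q < S.f j q))
    (h2 : ¬ (S.f j p < S.f i p ∧ S.f j q < S.f i q)) : ∃ x, p ≤ x ∧ x ≤ q ∧ S.f i x = S.f j x := by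
  have hc : Continuous fun x => S.f i x - S.f j x := by unfold f; fun_prop
  have key : 0 ∈ (fun x => S.f i x - S.f j x) '' Set.Icc p q := by
    by_cases h3 : S.f i p - S.f j p ≤ 0
    · by_cases h4 : 0 ≤ S.f i q - S.f j q
      · exact intermediate_value_Icc hpq hc.continuousOn ⟨h3, h4⟩
      · rcases h3.eq_or_lt with h5 | h5
        · exact ⟨p, ⟨le_rfl, hpq⟩, h5⟩
        · exact absurd ⟨by linarith, by linarith⟩ h1
    · by_cases h4 : S.f i q - S.f j q ≤ 0
      · exact intermediate_value_Icc' hpq hc.continuousOn ⟨h4, by linarith⟩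
      · exact absurd ⟨by linarith, by linarith⟩ h2
  obtain ⟨x, hx, h⟩ := key
  exact ⟨x, hx.1, hx.2, by simpa [sub_eq_zero] using h⟩

theorem Meet.symm {i j : ℕ} (h : S.Meet i j) : S.Meet j i := by
  obtain ⟨x, h1, h2, h3⟩ := h
  exact ⟨x, h2, h1, h3.symm⟩

theorem lev_lt (hh : 0 < S.h) (u : ℕ) : S.lev u < S.h := by
  have : u % (4 * S.h) < 4 * S.h := Nat.mod_lt _ (by omega)
  unfold lev; omega

theorem ck_ne {u : ℕ} : S.ck u ≠ 0 ↔ S.IsC u := by unfold ck key; split_ifs <;> simp_all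
theorem dk_ne {u : ℕ} : S.dk u ≠ 0 ↔ S.IsD u := by unfold dk key; split_ifs <;> simp_all
theorem ck_eq {u : ℕ} (h : S.IsC u) : S.ck u = S.key u := if_pos h
theorem dk_eq {u : ℕ} (h : S.IsD u) : S.dk u = S.key u := if_pos h

theorem key_inj (hh : 0 < S.h) {x u : ℕ} (h : S.key x = S.key u) :
    S.nd x = S.nd u ∧ S.lev x = S.lev u :=
  key_decode (lev_lt hh x) (lev_lt hh u) h

theorem lo_lt_hi (u : ℕ) : S.lo u < S.hi u := by
  unfold lo hi; rw [Nat.succ_mul]; have := Nat.two_pow_pos (S.lev u); omega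

theorem IsC.isD {u : ℕ} (h : S.IsC u) : S.IsD u :=
  ⟨h.1.1.trans_lt (lo_lt_hi u), (lo_lt_hi u).trans_le h.1.2⟩

theorem same_node (hh : 0 < S.h) {x u : ℕ} (h : S.key x = S.key u) :
    S.lo x = S.lo u ∧ S.hi x = S.hi u := by
  obtain ⟨h1, h2⟩ := key_inj hh h
  simp only [lo, hi, h1, h2, and_self]

theorem seg_lt {u : ℕ} (hu : u < S.M) : S.seg u < S.n :=
  Nat.div_lt_of_lt_mul hu

variable (hS : S.Good)
include hS

/-- A canonical item and another item of the same node that pass neither below nor above each other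
belong to segments that meet. -/
theorem Good.meet {x u : ℕ} (hx : x < S.M) (hu : u < S.M) (hc : S.IsC x) (hd : S.IsD u)
    (hkey : S.key x = S.key u) (h1 : ¬ S.Below x u) (h2 : ¬ S.Above x u) :
    S.Meet (S.seg x) (S.seg u) := by
  obtain ⟨hlo, hhi⟩ := same_node hS.h_pos hkey
  have hsx := seg_lt hx
  have hsu := seg_lt hu
  have hr := hS.r_lt _ hsx
  have hhi' : S.hi u < 2 * S.n := by rw [← hhi]; exact hc.1.2.trans_lt hr
  have hlh := lo_lt_hi (S := S) u
  have e1 : S.a (S.seg u) ≤ S.xr u := by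
    rw [← hS.X_l _ hsu]; exact hS.mono _ _ hd.1.le hhi'
  have e2 : S.xl u ≤ S.b (S.seg u) := by
    rw [← hS.X_r _ hsu]; exact hS.mono _ _ hd.2.le (hS.r_lt _ hsu)
  have e3 : S.xl u ≤ S.xr u := hS.mono _ _ hlh.le hhi'
  have e4 : S.a (S.seg x) ≤ S.xl u := by
    rw [← hS.X_l _ hsx, xl, ← hlo]; exact hS.mono _ _ hc.1.1 (by omega)
  have e5 : S.xr u ≤ S.b (S.seg x) := by
    rw [← hS.X_r _ hsx, xr, ← hhi]; exact hS.mono _ _ hc.1.2 hr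
  have hle : S.xs u ≤ S.xe u := max_le (le_min (hS.a_le_b _ hsu) e1) (le_min e2 e3)
  obtain ⟨z, hz1, hz2, hz⟩ := exists_f_eq hle h1 h2
  exact ⟨z, ⟨e4.trans ((le_max_right _ _).trans hz1), (hz2.trans (min_le_right _ _)).trans e5⟩,
    ⟨(le_max_left _ _).trans hz1, hz2.trans (min_le_left _ _)⟩, hz⟩

omit hS in
/-- The item of segment `i` at the node on level `t` above the gap `g`. -/
theorem exists_item {i g t : ℕ} (hi : i < S.n) (hl : S.l i ≤ g) (hr : g < S.r i) (ht : t < S.h)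
    (hpar : ¬ (S.l i ≤ g / 2 ^ (t + 1) * 2 ^ (t + 1) ∧
      (g / 2 ^ (t + 1) + 1) * 2 ^ (t + 1) ≤ S.r i)) :
    ∃ u < S.M, S.seg u = i ∧ S.lev u = t ∧ S.nd u = g / 2 ^ t ∧ S.par u = g / 2 ^ (t + 1) ∧
      ¬ (S.side u = 1 ∧ S.lpar u = S.rpar u) := by
  have h2 : 0 < 2 ^ (t + 1) := Nat.two_pow_pos _
  have hg := Nat.div_mul_le_self g (2 ^ (t + 1))
  have hg' : g < (g / 2 ^ (t + 1) + 1) * 2 ^ (t + 1) := by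
    rw [Nat.succ_mul]; exact Nat.lt_div_mul_add h2
  have hbit : 2 * (g / 2 ^ (t + 1)) + g / 2 ^ t % 2 = g / 2 ^ t := by
    rw [pow_succ, ← Nat.div_div_eq_div_mul]; omega
  have mk : ∀ σ < 2, ∃ u < S.M, S.seg u = i ∧ S.lev u = t ∧ S.side u = σ ∧
      S.bit u = g / 2 ^ t % 2 := by
    intro σ hσ
    have hb : g / 2 ^ t % 2 < 2 := Nat.mod_lt _ two_pos
    generalize g / 2 ^ t % 2 = β at hb ⊢
    have hj : 4 * t + 2 * σ + β < 4 * S.h := by omega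
    have e1 : (4 * S.h * i + (4 * t + 2 * σ + β)) % (4 * S.h) = 4 * t + 2 * σ + β := by
      rw [Nat.mul_add_mod, Nat.mod_eq_of_lt hj]
    refine ⟨4 * S.h * i + (4 * t + 2 * σ + β), ?_, ?_, ?_, ?_, ?_⟩
    · have : 4 * S.h * (i + 1) ≤ 4 * S.h * S.n := Nat.mul_le_mul_left _ hi
      rw [mul_add, mul_one] at this
      unfold M; omega
    · rw [seg, Nat.mul_add_div (by omega), Nat.div_eq_of_lt hj, add_zero]
    · rw [lev, e1]; omega
    · rw [side, e1]; omega
    · rw [bit, e1]; omega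
  -- The parent above `g` is not contained in the interval of `i`, so it contains one of the two
  -- ends. Side `0` serves the left end, also when both ends are below this parent, in line with the
  -- last clause of `IsC`.
  by_cases hp : S.l i / 2 ^ (t + 1) = g / 2 ^ (t + 1)
  · obtain ⟨u, hu, h1, h3, h4, h5⟩ := mk 0 (by omega)
    have : S.par u = g / 2 ^ (t + 1) := by rw [par, if_pos h4, lpar, h1, h3, hp]
    exact ⟨u, hu, h1, h3, by rw [nd, this, h5, hbit], this, by omega⟩
  · have hp' : (S.r i - 1) / 2 ^ (t + 1) = g / 2 ^ (t + 1) := by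
      have h6 : S.l i / 2 ^ (t + 1) ≤ g / 2 ^ (t + 1) := Nat.div_le_div_right hl
      have h7 : S.l i < g / 2 ^ (t + 1) * 2 ^ (t + 1) := (Nat.div_lt_iff_lt_mul h2).1 (by omega)
      have h8 : S.r i < (g / 2 ^ (t + 1) + 1) * 2 ^ (t + 1) := by
        by_contra h; exact hpar ⟨h7.le, by omega⟩
      refine le_antisymm ?_ (Nat.div_le_div_right (by omega))
      exact Nat.lt_succ_iff.1 ((Nat.div_lt_iff_lt_mul h2).2 (by simp only [Nat.succ_eq_add_one]; omega))
    obtain ⟨u, hu, h1, h3, h4, h5⟩ := mk 1 (by omega)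
    have : S.par u = g / 2 ^ (t + 1) := by rw [par, if_neg (by omega), rpar, h1, h3, hp']
    refine ⟨u, hu, h1, h3, by rw [nd, this, h5, hbit], this, ?_⟩
    rw [lpar, rpar, h1, h3, hp']
    tauto

omit hS in
theorem exists_gap {ξ : ℝ} {p q : ℕ} (hpq : p < q) (hp : S.X p ≤ ξ) (hq : ξ ≤ S.X q) :
    ∃ g, p ≤ g ∧ g < q ∧ S.X g ≤ ξ ∧ ξ ≤ S.X (g + 1) := by
  induction q, hpq using Nat.le_induction with
  | base => exact ⟨p, le_rfl, Nat.lt_succ_self _, hp, hq⟩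
  | succ q hpq ih =>
    rcases le_total ξ (S.X q) with h | h
    · obtain ⟨g, h1, h2, h3⟩ := ih h
      exact ⟨g, h1, by omega, h3⟩
    · exact ⟨q, by omega, by omega, h, hq⟩

/-- Two segments that meet have items in a common node, one of them canonical, that pass neither
below nor above each other. -/
theorem Good.exists_items {i j : ℕ} (hi : i < S.n) (hj : j < S.n) (h : S.Meet i j) :
    ∃ x < S.M, ∃ u < S.M, (S.seg x = i ∧ S.seg u = j ∨ S.seg x = j ∧ S.seg u = i) ∧
      S.IsC x ∧ S.IsD u ∧ S.key x = S.key u ∧ ¬ S.Below x u ∧ ¬ S.Above x u := by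
  obtain ⟨ξ, ⟨ha, hb⟩, ⟨ha', hb'⟩, hξ⟩ := h
  have hgap : ∃ g, S.l i ≤ g ∧ g < S.r i ∧ S.l j ≤ g ∧ g < S.r j ∧ S.X g ≤ ξ ∧ ξ ≤ S.X (g + 1) := by
    have h1 : max (S.l i) (S.l j) < min (S.r i) (S.r j) :=
      max_lt (lt_min (hS.l_lt_r i hi i hi (ha.trans hb)) (hS.l_lt_r i hi j hj (ha.trans hb')))
        (lt_min (hS.l_lt_r j hj i hi (ha'.trans hb)) (hS.l_lt_r j hj j hj (ha'.trans hb')))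
    obtain ⟨g, h2, h3, h4⟩ := exists_gap (ξ := ξ) h1
      (by rcases max_choice (S.l i) (S.l j) with h | h <;> rw [h]
          · rwa [hS.X_l i hi]
          · rwa [hS.X_l j hj])
      (by rcases min_choice (S.r i) (S.r j) with h | h <;> rw [h]
          · rwa [hS.X_r i hi]
          · rwa [hS.X_r j hj])
    exact ⟨g, by omega, by omega, by omega, by omega, h4⟩
  obtain ⟨g, hl, hr, hl', hr', hg1, hg2⟩ := hgap
  let cov : ℕ → ℕ → Prop := fun i t => S.l i ≤ g / 2 ^ t * 2 ^ t ∧ (g / 2 ^ t + 1) * 2 ^ t ≤ S.r i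
  -- Climb from the gap to the root. On level `0` both intervals cover the node; the root ends at `2
  -- ^ h ≥ 2 * n`, beyond every right endpoint, so no interval covers it. Where covering stops,
  -- neither interval covers the parent, and hence both segments have items for this node.
  have hex : ∃ t < S.h, (cov i t ∨ cov j t) ∧ ¬ (cov i (t + 1) ∨ cov j (t + 1)) := by
    by_contra! hall
    have hind : ∀ t ≤ S.h, cov i t ∨ cov j t := by
      intro t
      induction t with
      | zero => intro _; left; simp only [cov, pow_zero, Nat.div_one, mul_one]; omega
      | succ t ih => intro ht; exact hall t (by omega) (ih (by omega))
    have hg : g / 2 ^ S.h = 0 :=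
      Nat.div_eq_of_lt (by have := hS.r_lt i hi; have := hS.n_le; omega)
    have := hS.r_lt i hi
    have := hS.r_lt j hj
    have := hS.n_le
    rcases hind S.h le_rfl with h | h <;> simp only [cov, hg] at h <;> omega
  obtain ⟨t, ht, hc, hnc⟩ := hex
  have main : ∀ i < S.n, ∀ j < S.n, S.l i ≤ g → g < S.r i → S.l j ≤ g → g < S.r j →
      S.a j ≤ ξ → ξ ≤ S.b j → S.f i ξ = S.f j ξ → cov i t → ¬ cov i (t + 1) → ¬ cov j (t + 1) →
      ∃ x < S.M, ∃ u < S.M, (S.seg x = i ∧ S.seg u = j) ∧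
      S.IsC x ∧ S.IsD u ∧ S.key x = S.key u ∧ ¬ S.Below x u ∧ ¬ S.Above x u := by
    intro i hi j hj hl hr hl' hr' ha' hb' hξ hc hnc hnc'
    obtain ⟨x, hx, x1, x2, x3, x4, x5⟩ := exists_item hi hl hr ht hnc
    obtain ⟨u, hu, u1, u2, u3, u4, u5⟩ := exists_item hj hl' hr' ht hnc'
    have hgl := Nat.div_mul_le_self g (2 ^ t)
    have hgr : g < (g / 2 ^ t + 1) * 2 ^ t := by
      rw [Nat.succ_mul]; exact Nat.lt_div_mul_add (Nat.two_pow_pos t)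
    have hrn := hS.r_lt i hi
    have c1 : S.xs u ≤ ξ := by
      rw [xs, u1, xl, lo, u2, u3]
      exact max_le ha' ((hS.mono _ _ hgl (by omega)).trans hg1)
    have c2 : ξ ≤ S.xe u := by
      rw [xe, u1, xr, Sweep.hi, u2, u3]
      exact le_min hb' (hg2.trans (hS.mono _ _ hgr (hc.2.trans_lt hrn)))
    refine ⟨x, hx, u, hu, ⟨x1, u1⟩, ⟨?_, ?_, x5⟩, ?_, ?_, ?_, ?_⟩
    · rw [x1, lo, Sweep.hi, x2, x3]; exact hc
    · rw [x1, x2, x4]; exact hnc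
    · rw [IsD, u1, lo, Sweep.hi, u2, u3]; omega
    · rw [key, key, x2, x3, u2, u3]
    · rintro ⟨h1, h2⟩
      have := f_lt_of_ends c1 c2 h1 h2
      rw [x1, u1] at this; linarith
    · rintro ⟨h1, h2⟩
      have := f_lt_of_ends c1 c2 h1 h2
      rw [x1, u1] at this; linarith
  have hnc' := not_or.1 hnc
  rcases hc with hc | hc
  · obtain ⟨x, hx, u, hu, hxu, h⟩ :=
      main i hi j hj hl hr hl' hr' ha' hb' hξ hc hnc'.1 hnc'.2
    exact ⟨x, hx, u, hu, .inl hxu, h⟩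
  · obtain ⟨x, hx, u, hu, hxu, h⟩ :=
      main j hj i hi hl' hr' hl hr ha hb hξ.symm hc hnc'.2 hnc'.1
    exact ⟨x, hx, u, hu, .inr hxu, h⟩

/-- A segment has at most one canonical item in a node. -/
theorem Good.item_unique {x x' : ℕ} (hc : S.IsC x) (hc' : S.IsC x') (hkey : S.key x = S.key x')
    (hseg : S.seg x = S.seg x') : x = x' := by
  obtain ⟨h1, h2⟩ := key_inj hS.h_pos hkey
  have hb : S.bit x < 2 ∧ S.bit x' < 2 := ⟨Nat.mod_lt _ two_pos, Nat.mod_lt _ two_pos⟩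
  have hs : S.side x < 2 ∧ S.side x' < 2 := ⟨Nat.mod_lt _ two_pos, Nat.mod_lt _ two_pos⟩
  have h3 : S.bit x = S.bit x' := by unfold nd at h1; omega
  have h4 : S.par x = S.par x' := by unfold nd at h1; omega
  have el : S.lpar x = S.lpar x' := by rw [lpar, lpar, hseg, h2]
  have er : S.rpar x = S.rpar x' := by rw [rpar, rpar, hseg, h2]
  have d1 := hc.2.2
  have d2 := hc'.2.2
  have h5 : S.side x = S.side x' := by
    unfold par at h4
    rw [el, er] at h4 d1
    by_contra hne
    split_ifs at h4 <;> omega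
  have e : x % (4 * S.h) = x' % (4 * S.h) := by
    unfold lev at h2; unfold side at h5; unfold bit at h3; omega
  have e' : x / (4 * S.h) = x' / (4 * S.h) := hseg
  rw [← Nat.div_add_mod x (4 * S.h), ← Nat.div_add_mod x' (4 * S.h), e, e']

end Sweep

/-! ### Initial segments, dyadic blocks and links. -/

/-- A downward closed set with `c` elements consists of the first `c` elements. This turns
conditions on items into bounds on positions, which binary search can find. -/
theorem StrictOn.rank_lt_card_iff {lt : ℕ → ℕ → Prop} {N : ℕ} (h : StrictOn lt N) {p : ℕ → Prop}
    [DecidablePred p] (hp : ∀ x < N, ∀ y < N, lt x y → p y → p x) {x : ℕ} (hx : x < N) :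
    rank lt N x < ((Finset.range N).filter p).card ↔ p x := by
  classical
  constructor
  · intro hlt
    by_contra hn
    unfold rank cnt at hlt
    refine absurd hlt (not_lt.2 (Finset.card_le_card fun y hy => ?_))
    simp only [Finset.mem_filter, Finset.mem_range] at hy ⊢
    refine ⟨hy.1, (h.total x hx y hy.1 ?_).resolve_left fun h' => hn (hp x hx y hy.1 h' hy.2)⟩
    rintro rfl
    exact hn hy.2
  · intro hpx
    unfold rank cnt
    refine Finset.card_lt_card ?_
    rw [Finset.ssubset_iff_of_subset]
    · exact ⟨x, by simp [hpx, hx], by simp [h.irrefl x hx]⟩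
    · intro z hz
      simp only [Finset.mem_filter, Finset.mem_range] at hz ⊢
      exact ⟨hz.1, hp z hz.1 x hx hz.2 hpx⟩

/-- Every position of an interval lies in a dyadic block of the interval that is the first or the
last one of its length. -/
theorem exists_dyadic {lo hi pos T : ℕ} (h1 : lo ≤ pos) (h2 : pos < hi) (h3 : hi < 2 ^ T) :
    ∃ t < T, lo ≤ pos / 2 ^ t * 2 ^ t ∧ (pos / 2 ^ t + 1) * 2 ^ t ≤ hi ∧
      (pos / 2 ^ t = (lo + 2 ^ t - 1) / 2 ^ t ∨ pos / 2 ^ t = hi / 2 ^ t - 1) := by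
  -- Take a block around `pos` that fits while the block of twice the length does not.
  have hex : ∃ t < T, (lo ≤ pos / 2 ^ t * 2 ^ t ∧ (pos / 2 ^ t + 1) * 2 ^ t ≤ hi) ∧
      ¬ (lo ≤ pos / 2 ^ (t + 1) * 2 ^ (t + 1) ∧
        (pos / 2 ^ (t + 1) + 1) * 2 ^ (t + 1) ≤ hi) := by
    by_contra! hall
    have hind : ∀ t ≤ T, lo ≤ pos / 2 ^ t * 2 ^ t ∧ (pos / 2 ^ t + 1) * 2 ^ t ≤ hi := by
      intro t
      induction t with
      | zero => intro _; simp only [pow_zero, Nat.div_one, mul_one]; omega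
      | succ t ih => intro ht; exact hall t (by omega) (ih (by omega))
    have := (hind T le_rfl).2
    rw [Nat.succ_mul] at this
    omega
  obtain ⟨t, ht, ⟨h4, h5⟩, h6⟩ := hex
  refine ⟨t, ht, h4, h5, ?_⟩
  have hW : 0 < 2 ^ t := Nat.two_pow_pos t
  rw [pow_succ, ← Nat.div_div_eq_div_mul] at h6
  generalize pos / 2 ^ t = b at *
  generalize 2 ^ t = W at *
  have e1 : b / 2 * (W * 2) = b / 2 * 2 * W := by ring
  have e2 : (b / 2 + 1) * (W * 2) = (b / 2 * 2 + 2) * W := by ring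
  rw [e1, e2] at h6
  -- An even block shares its left end with its parent, so the parent sticks out on the right and
  -- the block is the last one that fits; an odd block is the first one by symmetry.
  rcases Nat.even_or_odd' b with ⟨c, rfl | rfl⟩
  · right
    rw [show 2 * c / 2 * 2 = 2 * c by omega] at h6
    have : hi / W = 2 * c + 1 := by
      rw [Nat.div_eq_iff hW]
      have e3 : (2 * c + 1) * W = 2 * c * W + W := by ring
      have e4 : (2 * c + 2) * W = 2 * c * W + 2 * W := by ring
      omega
    omega
  · left
    rw [show (2 * c + 1) / 2 * 2 = 2 * c by omega] at h6
    symm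
    rw [Nat.div_eq_iff hW]
    have e3 : (2 * c + 1) * W = 2 * c * W + W := by ring
    have e4 : (2 * c + 2) * W = 2 * c * W + 2 * W := by ring
    have e5 : (2 * c + 1 + 1) * W = 2 * c * W + 2 * W := by ring
    omega

theorem flip2_flip2 {x : ℕ} : flip2 (flip2 x) = x := by unfold flip2; omega

theorem Link.symm {mem : ℕ → ℕ → ℕ} {P v v' : ℕ} (h : Link mem P v v') : Link mem P v' v := by
  obtain ⟨p, hp, p', hp', h1, h2, h3⟩ := h
  exact ⟨p', hp', p, hp, h2, h1, by rw [h3, flip2_flip2]⟩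

/-! ### Chains of canonical items and the bicliques that they give. -/

namespace Sweep

variable (S : Sweep)

/-- The order of the items by node, then by height on the left border of the node. -/
def lt1 (x y : ℕ) : Prop :=
  S.ck x < S.ck y ∨ S.ck x = S.ck y ∧ (S.L x < S.L y ∨ S.L x = S.L y ∧ x < y)

theorem strictOn_lt1 (N : ℕ) : StrictOn S.lt1 N := ((strictOn_lt N).lex S.L).lex S.ck

/-- `lam` decomposes the canonical items of each node into `k` increasing chains, as far as
possible. -/
structure Layers (k : ℕ) (lam : ℕ → ℕ) : Prop where
  inc : ∀ x < S.M, ∀ y < S.M, S.lt1 x y → S.ck x ≠ 0 → S.ck x = S.ck y → lam x = lam y →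
    lam x < k → S.R x < S.R y
  dom : ∀ y < S.M, ∀ q < k, S.ck y ≠ 0 → lam y = q + 1 →
    ∃ x < S.M, S.lt1 x y ∧ S.ck x = S.ck y ∧ lam x = q ∧ S.R y ≤ S.R x
  le : ∀ x < S.M, lam x ≤ k

variable (lam : ℕ → ℕ)

/-- In this order every chain of every node occupies consecutive positions, so a single numbering of
all items serves all chains, and dyadic blocks can be taken globally. -/
def lt2 (x y : ℕ) : Prop :=
  S.ck x < S.ck y ∨ S.ck x = S.ck y ∧ (lam x < lam y ∨ lam x = lam y ∧ S.lt1 x y)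

theorem strictOn_lt2 (N : ℕ) : StrictOn (S.lt2 lam) N := ((S.strictOn_lt1 N).lex lam).lex S.ck

noncomputable def pos2 (x : ℕ) : ℕ := rank (S.lt2 lam) S.M x

/-- Precedes the items of the chain `q` of the node of `u` that meet `u`. -/
def PLo (u q x : ℕ) : Prop :=
  S.ck x < S.dk u ∨ S.ck x = S.dk u ∧ (lam x < q ∨ lam x = q ∧ S.Below x u)

/-- Does not follow the items of the chain `q` of the node of `u` that meet `u`. -/
def PHi (u q x : ℕ) : Prop :=
  S.ck x < S.dk u ∨ S.ck x = S.dk u ∧ (lam x < q ∨ lam x = q ∧ ¬ S.Above x u)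

open scoped Classical in
noncomputable def cLo (u q : ℕ) : ℕ := ((Finset.range S.M).filter (S.PLo lam u q)).card
open scoped Classical in
noncomputable def cHi (u q : ℕ) : ℕ := ((Finset.range S.M).filter (S.PHi lam u q)).card

/-- The candidates for the first and the last block of length `2 ^ t` in the range. If the range
contains no such block, or the subtraction is truncated, the candidate may stick out, so `BlkOk` has
to be tested. -/
noncomputable def blk (u q t sd : ℕ) : ℕ :=
  if sd = 0 then (S.cLo lam u q + 2 ^ t - 1) / 2 ^ t else S.cHi lam u q / 2 ^ t - 1

def BlkOk (u q t sd : ℕ) : Prop :=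
  S.cLo lam u q ≤ S.blk lam u q t sd * 2 ^ t ∧ (S.blk lam u q t sd + 1) * 2 ^ t ≤ S.cHi lam u q

/-- A slot number is read in mixed radix: its parity is the side of the biclique, then come one bit
for first or last block, the chain below `k`, the level `t` below `tm`, and one of the `4 * h` items
of the segment. -/
def slotItem (k tm v p : ℕ) : ℕ := v * (4 * S.h) + p / (4 * k) / tm

open scoped Classical in
/-- The biclique of slot `p` of the segment `v`. -/
noncomputable def slot (k tm v p : ℕ) : ℕ :=
  if p % 2 = 0 then
    if S.ck (S.slotItem k tm v p) ≠ 0 then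
      2 * (S.pos2 lam (S.slotItem k tm v p) / 2 ^ (p / (4 * k) % tm) * tm + p / (4 * k) % tm + 1)
    else 0
  else
    if S.dk (S.slotItem k tm v p) ≠ 0 ∧
        S.BlkOk lam (S.slotItem k tm v p) (p / 4 % k) (p / (4 * k) % tm) (p / 2 % 2) then
      2 * (S.blk lam (S.slotItem k tm v p) (p / 4 % k) (p / (4 * k) % tm) (p / 2 % 2) * tm +
        p / (4 * k) % tm + 1) + 1
    else 0

variable {S lam}

theorem f_le_of_ends {i j : ℕ} {p q x : ℝ} (hp : p ≤ x) (hq : x ≤ q) (h1 : S.f i p ≤ S.f j p)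
    (h2 : S.f i q ≤ S.f j q) : S.f i x ≤ S.f j x := by
  by_contra! h
  simp only [f] at *
  rcases hp.eq_or_lt with rfl | hp'
  · linarith
  · have e : (q - p) * (S.y j + S.m j * (x - S.c j) - (S.y i + S.m i * (x - S.c i))) =
        (q - x) * (S.y j + S.m j * (p - S.c j) - (S.y i + S.m i * (p - S.c i))) +
        (x - p) * (S.y j + S.m j * (q - S.c j) - (S.y i + S.m i * (q - S.c i))) := by ring
    have h3 := mul_pos (show 0 < q - p by linarith) (sub_pos.2 h)
    have := mul_nonneg (sub_nonneg.2 hp'.le) (sub_nonneg.2 h2)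
    have := mul_nonneg (sub_nonneg.2 hq) (sub_nonneg.2 h1)
    linarith

variable (hS : S.Good)
include hS

theorem Good.ends {u : ℕ} (hu : u < S.M) (hd : S.IsD u) (hhi : S.hi u < 2 * S.n) :
    S.xl u ≤ S.xs u ∧ S.xs u ≤ S.xe u ∧ S.xe u ≤ S.xr u := by
  have hsu := seg_lt hu
  have e1 : S.a (S.seg u) ≤ S.xr u := by
    rw [← hS.X_l _ hsu]; exact hS.mono _ _ hd.1.le hhi
  have e2 : S.xl u ≤ S.b (S.seg u) := by
    rw [← hS.X_r _ hsu]; exact hS.mono _ _ hd.2.le (hS.r_lt _ hsu)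
  have e3 : S.xl u ≤ S.xr u := hS.mono _ _ (lo_lt_hi u).le hhi
  exact ⟨le_max_right _ _, max_le (le_min (hS.a_le_b _ hsu) e1) (le_min e2 e3), min_le_right _ _⟩

/-- An item in the same node as `u`. -/
theorem Good.mate {x u : ℕ} (hx : x < S.M) (h : S.ck x = S.dk u) (h0 : S.dk u ≠ 0) :
    S.IsC x ∧ S.IsD u ∧ S.key x = S.key u ∧ S.xl x = S.xl u ∧ S.xr x = S.xr u ∧
      S.hi u < 2 * S.n := by
  have hc := ck_ne.1 (h ▸ h0)
  have hd := dk_ne.1 h0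
  have hk : S.key x = S.key u := by rw [← ck_eq hc, ← dk_eq hd, h]
  obtain ⟨h1, h2⟩ := same_node hS.h_pos hk
  refine ⟨hc, hd, hk, by rw [xl, xl, h1], by rw [xr, xr, h2], ?_⟩
  rw [← h2]
  exact hc.1.2.trans_lt (hS.r_lt _ (seg_lt hx))

variable {k : ℕ} (hl : S.Layers k lam)
include hl

/-- Along a chain the heights on both borders of the strip do not decrease, hence by affinity the
heights at all points between the borders do not either. -/
theorem Good.le_of_lt2 {u q x y : ℕ} (hu : u < S.M) (hx : x < S.M) (hy : y < S.M) (h0 : S.dk u ≠ 0)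
    (hq : q < k)
    (hxy : S.lt2 lam x y) (h1 : S.ck x = S.dk u) (h2 : S.ck y = S.dk u) (h3 : lam x = q)
    (h4 : lam y = q) :
    S.f (S.seg x) (S.xs u) ≤ S.f (S.seg y) (S.xs u) ∧
      S.f (S.seg x) (S.xe u) ≤ S.f (S.seg y) (S.xe u) := by
  obtain ⟨-, hd, -, x1, x2, hhi⟩ := hS.mate hx h1 h0
  obtain ⟨-, -, -, y1, y2, -⟩ := hS.mate hy h2 h0
  obtain ⟨e1, e2, e3⟩ := hS.ends hu hd hhi
  have h12 : S.ck x = S.ck y := h1.trans h2.symm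
  have hlt : S.lt1 x y := by
    rcases hxy with h | ⟨-, h | h⟩
    · omega
    · omega
    · exact h.2
  have hR := hl.inc x hx y hy hlt (by omega) h12 (h3.trans h4.symm) (by omega)
  have hL : S.L x ≤ S.L y := by
    rcases hlt with h | ⟨-, h | h⟩
    · omega
    · exact h.le
    · exact h.1.le
  unfold L at hL
  unfold R at hR
  rw [x1, y1] at hL
  rw [x2, y2] at hR
  exact ⟨f_le_of_ends e1 (e2.trans e3) hL hR.le, f_le_of_ends (e1.trans e2) e3 hL hR.le⟩

/-- What lies lower in the chain than an item below `u` is itself below `u`; `pHi_mono` is the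
analogue for items not above `u`. -/
theorem Good.pLo_mono {u q : ℕ} (hu : u < S.M) (h0 : S.dk u ≠ 0) (hq : q < k) {x y : ℕ}
    (hx : x < S.M) (hy : y < S.M) (hxy : S.lt2 lam x y) (h : S.PLo lam u q y) :
    S.PLo lam u q x := by
  have key := hS.le_of_lt2 hl hu hx hy h0 hq hxy
  unfold PLo at *
  rcases hxy with h' | ⟨h', h''⟩
  · exact .inl (by omega)
  · rcases h with h | ⟨h, h3⟩
    · exact .inl (by omega)
    · refine .inr ⟨by omega, ?_⟩
      rcases h3 with h3 | ⟨h3, h4⟩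
      · exact .inl (by omega)
      · rcases Nat.lt_or_ge (lam x) q with h5 | h5
        · exact .inl h5
        · have h6 : lam x = q := by omega
          obtain ⟨k1, k2⟩ := key (by omega) h h6 h3
          exact .inr ⟨h6, k1.trans_lt h4.1, k2.trans_lt h4.2⟩

theorem Good.pHi_mono {u q : ℕ} (hu : u < S.M) (h0 : S.dk u ≠ 0) (hq : q < k) {x y : ℕ}
    (hx : x < S.M) (hy : y < S.M) (hxy : S.lt2 lam x y) (h : S.PHi lam u q y) :
    S.PHi lam u q x := by
  have key := hS.le_of_lt2 hl hu hx hy h0 hq hxy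
  unfold PHi at *
  rcases hxy with h' | ⟨h', h''⟩
  · exact .inl (by omega)
  · rcases h with h | ⟨h, h3⟩
    · exact .inl (by omega)
    · refine .inr ⟨by omega, ?_⟩
      rcases h3 with h3 | ⟨h3, h4⟩
      · exact .inl (by omega)
      · rcases Nat.lt_or_ge (lam x) q with h5 | h5
        · exact .inl h5
        · have h6 : lam x = q := by omega
          obtain ⟨k1, k2⟩ := key (by omega) h h6 h3
          exact .inr ⟨h6, fun h7 => h4 ⟨h7.1.trans_le k1, h7.2.trans_le k2⟩⟩

theorem Good.lt_cLo_iff {u q x : ℕ} (hu : u < S.M) (h0 : S.dk u ≠ 0) (hq : q < k) (hx : x < S.M) :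
    S.pos2 lam x < S.cLo lam u q ↔ S.PLo lam u q x := by
  classical
  exact (S.strictOn_lt2 lam S.M).rank_lt_card_iff
    (fun x hx y hy => hS.pLo_mono hl hu h0 hq hx hy) hx

theorem Good.lt_cHi_iff {u q x : ℕ} (hu : u < S.M) (h0 : S.dk u ≠ 0) (hq : q < k) (hx : x < S.M) :
    S.pos2 lam x < S.cHi lam u q ↔ S.PHi lam u q x := by
  classical
  exact (S.strictOn_lt2 lam S.M).rank_lt_card_iff
    (fun x hx y hy => hS.pHi_mono hl hu h0 hq hx hy) hx

/-- The two counts bound initial segments in the order `lt2`, and their difference is the part of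
one chain of the node of `u` whose members meet `u` in its window. -/
theorem Good.range_iff {u q x : ℕ} (hu : u < S.M) (h0 : S.dk u ≠ 0) (hq : q < k) (hx : x < S.M) :
    (S.cLo lam u q ≤ S.pos2 lam x ∧ S.pos2 lam x < S.cHi lam u q) ↔
      S.ck x = S.dk u ∧ lam x = q ∧ ¬ S.Below x u ∧ ¬ S.Above x u := by
  rw [← not_lt, hS.lt_cLo_iff hl hu h0 hq hx, hS.lt_cHi_iff hl hu h0 hq hx]
  unfold PLo PHi
  constructor
  · rintro ⟨h1, h2⟩
    rcases h2 with h2 | ⟨h2, h3 | h3⟩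
    · exact absurd (.inl h2) h1
    · exact absurd (.inr ⟨h2, .inl h3⟩) h1
    · exact ⟨h2, h3.1, fun h4 => h1 (.inr ⟨h2, .inr ⟨h3.1, h4⟩⟩), h3.2⟩
  · rintro ⟨h1, h2, h3, h4⟩
    refine ⟨?_, .inr ⟨h1, .inr ⟨h2, h4⟩⟩⟩
    rintro (h5 | ⟨-, h5 | h5⟩)
    · omega
    · omega
    · exact h3 h5.2

variable {tm : ℕ} (htm : S.M < 2 ^ tm)

omit hS hl in
theorem cHi_le (u q : ℕ) : S.cHi lam u q ≤ S.M := by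
  classical
  exact (Finset.card_filter_le _ _).trans (by simp)

omit hS hl in
theorem slotItem_seg {v p : ℕ} (hp : p < 16 * k * S.h * tm) (hv : v < S.n) :
    S.slotItem k tm v p < S.M ∧ S.seg (S.slotItem k tm v p) = v ∧ 0 < k ∧ 0 < tm := by
  have hk : 0 < k := by
    rcases Nat.eq_zero_or_pos k with rfl | h
    · simp at hp
    · exact h
  have htm : 0 < tm := by
    rcases Nat.eq_zero_or_pos tm with rfl | h
    · simp at hp
    · exact h
  have h1 : p / (4 * k) / tm < 4 * S.h := by
    rw [Nat.div_div_eq_div_mul]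
    refine Nat.div_lt_of_lt_mul ?_
    calc p < _ := hp
      _ = _ := by ring
  refine ⟨?_, ?_, hk, htm⟩
  · have : (v + 1) * (4 * S.h) ≤ S.n * (4 * S.h) := Nat.mul_le_mul_right _ hv
    have e : S.M = S.n * (4 * S.h) := by unfold M; ring
    unfold slotItem
    rw [Nat.succ_mul] at this
    omega
  · unfold seg slotItem
    rw [mul_comm v, Nat.mul_add_div ((Nat.zero_le _).trans_lt h1), Nat.div_eq_of_lt h1, add_zero]

omit hS hl in
theorem slot_lt {v p : ℕ} (hp : p < 16 * k * S.h * tm) (hv : v < S.n) :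
    S.slot lam k tm v p < 2 * ((S.M + 1) * tm) + 2 := by
  obtain ⟨h1, -, -, h4⟩ := slotItem_seg hp hv
  have ht : p / (4 * k) % tm < tm := Nat.mod_lt _ h4
  have aux : ∀ b < S.M, 2 * (b * tm + p / (4 * k) % tm + 1) + 1 < 2 * ((S.M + 1) * tm) + 2 := by
    intro b hb
    have h5 : (b + 1) * tm ≤ S.M * tm := Nat.mul_le_mul_right _ hb
    rw [add_mul, one_mul] at h5
    rw [add_mul S.M, one_mul]
    generalize p / (4 * k) % tm = o at ht ⊢
    omega
  unfold slot
  split_ifs with c1 c2 c3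
  · have := aux (S.pos2 lam (S.slotItem k tm v p) / 2 ^ (p / (4 * k) % tm))
      ((Nat.div_le_self _ _).trans_lt ((S.strictOn_lt2 lam S.M).rank_lt h1))
    omega
  · omega
  · refine aux _ ?_
    have h6 := c3.2.2.trans (cHi_le _ _)
    have h7 := Nat.le_mul_of_pos_right
      (S.blk lam (S.slotItem k tm v p) (p / 4 % k) (p / (4 * k) % tm) (p / 2 % 2) + 1)
      (Nat.two_pow_pos (p / (4 * k) % tm))
    omega
  · omega

omit hS hl in
theorem div_eq_mem {b t pos lo hi : ℕ} (e : b = pos / 2 ^ t) (h1 : lo ≤ b * 2 ^ t)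
    (h2 : (b + 1) * 2 ^ t ≤ hi) : lo ≤ pos ∧ pos < hi := by
  subst e
  have h3 := Nat.div_mul_le_self pos (2 ^ t)
  have h4 : pos < (pos / 2 ^ t + 1) * 2 ^ t := by
    rw [Nat.succ_mul]; exact Nat.lt_div_mul_add (Nat.two_pow_pos t)
  omega

/-- The parity of a nonzero slot value is the parity of the slot. So a link always joins an item in
a dyadic block to an item whose range contains the block, and membership in the range means meeting.
-/
theorem Good.link_meet {v v' : ℕ} (hv : v < S.n) (hv' : v' < S.n)
    (h : Link (S.slot lam k tm) (16 * k * S.h * tm) v v') : S.Meet v v' := by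
  have main : ∀ v < S.n, ∀ v' < S.n, ∀ p < 16 * k * S.h * tm, ∀ p' < 16 * k * S.h * tm,
      S.slot lam k tm v p ≠ 0 → S.slot lam k tm v' p' ≠ 0 →
      p % 2 = 0 → p' % 2 ≠ 0 → S.slot lam k tm v' p' = S.slot lam k tm v p + 1 → S.Meet v v' := by
    intro v hv v' hv' p hp p' hp' h1 h2 c c' h3
    obtain ⟨x1, x2, hk, htm⟩ := slotItem_seg hp hv
    obtain ⟨u1, u2, -, -⟩ := slotItem_seg hp' hv'
    unfold slot at h1 h2 h3
    rw [if_pos c] at h1 h3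
    rw [if_neg c'] at h2 h3
    split_ifs at h1 h2 h3 with hc hd
    · obtain ⟨e1, e2⟩ := key_decode (k := tm) (Nat.mod_lt _ htm) (Nat.mod_lt _ htm)
        (Nat.eq_of_mul_eq_mul_left two_pos (Nat.succ.inj h3))
      obtain ⟨hd1, hd2, hd3⟩ := hd
      have hr := div_eq_mem (by rw [e1, e2]) hd2 hd3
      obtain ⟨r1, r2, r3, r4⟩ := (hS.range_iff hl u1 hd1 (Nat.mod_lt _ hk) x1).1 hr
      obtain ⟨m1, m2, m3, -⟩ := hS.mate x1 r1 hd1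
      have := hS.meet x1 u1 m1 m2 m3 r3 r4
      rwa [x2, u2] at this
    all_goals exact absurd rfl h1
  have hpar : ∀ v p, S.slot lam k tm v p ≠ 0 → S.slot lam k tm v p % 2 = p % 2 := by
    intro v p h
    unfold slot at h ⊢
    split_ifs at h ⊢ <;> omega
  obtain ⟨p, hp, p', hp', h1, h2, h3⟩ := h
  have g1 := hpar v p h1
  have g2 := hpar v' p' h2
  unfold flip2 at h3
  rcases Nat.mod_two_eq_zero_or_one p with c | c
  · exact main v hv v' hv' p hp p' hp' h1 h2 c (by omega) (by omega)
  · exact (main v' hv' v hv p' hp' p hp h2 h1 (by omega) (by omega) (by omega)).symm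

-- The position of `x` is in the range of `u`, and `exists_dyadic` supplies a block around it that
-- is the first or the last of its length there. The two slots that record this block have the same
-- mixed-radix digits except for the parity and the item.
include htm in
theorem Good.link_items {x u : ℕ} (hx : x < S.M) (hu : u < S.M) (hc : S.IsC x) (hd : S.IsD u)
    (hkey : S.key x = S.key u) (hlam : lam x < k) (h1 : ¬ S.Below x u) (h2 : ¬ S.Above x u) :
    Link (S.slot lam k tm) (16 * k * S.h * tm) (S.seg x) (S.seg u) := by
  have hh := hS.h_pos
  have h0 : S.dk u ≠ 0 := dk_ne.2 hd
  have hck : S.ck x = S.dk u := by rw [ck_eq hc, dk_eq hd, hkey]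
  obtain ⟨r1, r2⟩ := (hS.range_iff hl hu h0 hlam hx).2 ⟨hck, rfl, h1, h2⟩
  obtain ⟨t, ht, t1, t2, t3⟩ := exists_dyadic r1 r2 ((cHi_le u (lam x)).trans_lt htm)
  obtain ⟨sd, hsd, hb⟩ : ∃ sd < 2, S.pos2 lam x / 2 ^ t = S.blk lam u (lam x) t sd := by
    rcases t3 with h | h
    · exact ⟨0, by omega, h⟩
    · exact ⟨1, by omega, h⟩
  have mk : ∀ τ < 2, ∀ sd < 2, ∀ q < k, ∀ y, ∃ p < 16 * k * S.h * tm,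
      p % 2 = τ ∧ p / 2 % 2 = sd ∧ p / 4 % k = q ∧ p / (4 * k) % tm = t ∧
      S.slotItem k tm (S.seg y) p = y := by
    intro τ hτ sd hsd q hq y
    have hj : y % (4 * S.h) < 4 * S.h := Nat.mod_lt _ (by omega)
    obtain ⟨j, hj'⟩ : ∃ j, j = y % (4 * S.h) := ⟨_, rfl⟩
    obtain ⟨p, hp⟩ : ∃ p, p = 4 * (k * (tm * j + t) + q) + (2 * sd + τ) := ⟨_, rfl⟩
    have e1 : p / 4 = k * (tm * j + t) + q := by omega
    have e2 : p / (4 * k) = tm * j + t := by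
      rw [← Nat.div_div_eq_div_mul, e1, Nat.mul_add_div (by omega), Nat.div_eq_of_lt hq, add_zero]
    refine ⟨p, ?_, by omega, by omega, ?_, ?_, ?_⟩
    · have a1 : tm * (j + 1) ≤ tm * (4 * S.h) := Nat.mul_le_mul_left _ (by omega)
      have a2 : k * (tm * j + t + 1) ≤ k * (tm * (4 * S.h)) := Nat.mul_le_mul_left _ (by
        rw [Nat.mul_succ] at a1; omega)
      rw [Nat.mul_succ] at a2
      have a3 : 4 * (k * (tm * (4 * S.h))) = 16 * k * S.h * tm := by ring
      omega
    · rw [e1, Nat.mul_add_mod, Nat.mod_eq_of_lt hq]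
    · rw [e2, Nat.mul_add_mod, Nat.mod_eq_of_lt ht]
    · rw [slotItem, e2, Nat.mul_add_div (by omega), Nat.div_eq_of_lt ht, add_zero, hj', mul_comm]
      exact Nat.div_add_mod y (4 * S.h)
  obtain ⟨p, hp, p1, p2, p3, p4, p5⟩ := mk 0 (by omega) sd hsd _ hlam x
  obtain ⟨p', hp', p1', p2', p3', p4', p5'⟩ := mk 1 (by omega) sd hsd _ hlam u
  have s1 : S.slot lam k tm (S.seg x) p = 2 * (S.pos2 lam x / 2 ^ t * tm + t + 1) := by
    rw [slot, if_pos p1, p5, if_pos (ck_ne.2 hc), p4]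
  have s2 : S.slot lam k tm (S.seg u) p' = 2 * (S.pos2 lam x / 2 ^ t * tm + t + 1) + 1 := by
    rw [slot, if_neg (by omega), p5', p2', p3', p4', if_pos, ← hb]
    exact ⟨h0, by rw [BlkOk, ← hb]; exact ⟨t1, t2⟩⟩
  refine ⟨p, hp, p', hp', by omega, by omega, ?_⟩
  rw [s1, s2, flip2]
  omega

-- Going down by `dom`, each chain contributes an earlier item of the node whose right height is at
-- least as large. So left heights rise while right heights fall, and all these items cross or touch
-- one another.
omit hS in
theorem exists_chain {y : ℕ} {q : ℕ} (hq : q ≤ k) (hy : y < S.M) (h0 : S.ck y ≠ 0)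
    (hlam : lam y = q) :
    ∃ z : ℕ → ℕ, z q = y ∧ (∀ a ≤ q, z a < S.M ∧ S.ck (z a) = S.ck y ∧ lam (z a) = a) ∧
      ∀ b ≤ q, ∀ a ≤ b, S.L (z a) ≤ S.L (z b) ∧ S.R (z b) ≤ S.R (z a) := by
  induction q generalizing y with
  | zero =>
    refine ⟨fun _ => y, rfl, fun a ha => ⟨hy, rfl, hlam.trans (by omega)⟩, fun b _ a _ => ⟨le_rfl, le_rfl⟩⟩
  | succ q ih =>
    obtain ⟨x, hx, h1, h2, h3, h4⟩ := hl.dom y hy q (by omega) h0 hlam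
    obtain ⟨z, hz, z1, z2⟩ := ih (by omega) hx (by omega) h3
    have hL : S.L x ≤ S.L y := by
      rcases h1 with h | ⟨-, h | h⟩
      · omega
      · exact h.le
      · exact h.1.le
    refine ⟨Function.update z (q + 1) y, by simp, fun a ha => ?_, fun b hb a ha => ?_⟩
    · rcases Nat.lt_or_ge a (q + 1) with h | h
      · rw [Function.update_of_ne (by omega), ← h2]
        exact z1 a (by omega)
      · obtain rfl : a = q + 1 := by omega
        rw [Function.update_self]
        exact ⟨hy, rfl, hlam⟩
    · rcases Nat.lt_or_ge b (q + 1) with h | h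
      · rw [Function.update_of_ne (by omega), Function.update_of_ne (by omega)]
        exact z2 b (by omega) a ha
      · obtain rfl : b = q + 1 := by omega
        rw [Function.update_self]
        rcases Nat.lt_or_ge a (q + 1) with h' | h'
        · rw [Function.update_of_ne (by omega)]
          obtain ⟨h5, h6⟩ := z2 q le_rfl a (by omega)
          rw [hz] at h5 h6
          exact ⟨h5.trans hL, h4.trans h6⟩
        · obtain rfl : a = q + 1 := by omega
          rw [Function.update_self]
          exact ⟨le_rfl, le_rfl⟩

include htm in
/-- Either all meeting pairs of segments are linked, or there is a linked clique. -/
theorem Good.link_or : (∀ i < S.n, ∀ j < S.n, S.Meet i j →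
      Link (S.slot lam k tm) (16 * k * S.h * tm) i j) ∨
    ∃ v : ℕ → ℕ, (∀ a < k, v a < S.n) ∧ (∀ a < k, ∀ b < k, v a = v b → a = b) ∧
      ∀ a < k, ∀ b < k, a ≠ b → Link (S.slot lam k tm) (16 * k * S.h * tm) (v a) (v b) := by
  -- An item marked `k` did not find a place in any chain. It is itself not in a linkable chain, so
  -- only its `k` predecessors with marks `0, …, k - 1` are used.
  by_cases hex : ∃ y < S.M, S.ck y ≠ 0 ∧ lam y = k
  · right
    obtain ⟨y, hy, h0, hlam⟩ := hex
    obtain ⟨z, -, z1, z2⟩ := exists_chain hl le_rfl hy h0 hlam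
    have hlt : ∀ b < k, ∀ a < b, Link (S.slot lam k tm) (16 * k * S.h * tm)
        (S.seg (z a)) (S.seg (z b)) := by
      intro b hb a ha
      obtain ⟨a1, a2, a3⟩ := z1 a (by omega)
      obtain ⟨b1, b2, b3⟩ := z1 b (by omega)
      obtain ⟨hL, hR⟩ := z2 b hb.le a ha.le
      have ca : S.IsC (z a) := ck_ne.1 (by omega)
      have cb : S.IsC (z b) := ck_ne.1 (by omega)
      have hd := cb.isD
      obtain ⟨-, -, m3, m4, m5, m6⟩ := hS.mate (u := z b) a1
        (by rw [a2, ← b2, ck_eq cb, dk_eq hd]) (dk_ne.2 hd)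
      have hsb := seg_lt b1
      -- A canonical item is defined on the whole strip, so its window is bounded by the borders of
      -- the strip.
      have e1 : S.xs (z b) = S.xl (z b) := max_eq_right (by
        rw [← hS.X_l _ hsb]
        exact hS.mono _ _ cb.1.1 ((lo_lt_hi _).trans m6))
      have e2 : S.xe (z b) = S.xr (z b) := min_eq_right (by
        rw [← hS.X_r _ hsb]
        exact hS.mono _ _ cb.1.2 (hS.r_lt _ hsb))
      refine hS.link_items hl htm a1 b1 ca hd m3 (by omega) (fun h => ?_) (fun h => ?_)
      · have := h.2
        rw [e2] at this
        unfold R at hR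
        rw [m5] at hR
        linarith
      · have := h.1
        rw [e1] at this
        unfold L at hL
        rw [m4] at hL
        linarith
    refine ⟨fun a => S.seg (z a), fun a ha => seg_lt (z1 a ha.le).1, fun a ha b hb hab => ?_,
      fun a ha b hb hab => ?_⟩
    · obtain ⟨-, a2, a3⟩ := z1 a ha.le
      obtain ⟨-, b2, b3⟩ := z1 b hb.le
      have ca : S.IsC (z a) := ck_ne.1 (by omega)
      have cb : S.IsC (z b) := ck_ne.1 (by omega)
      have := hS.item_unique ca cb (by rw [← ck_eq ca, ← ck_eq cb, a2, b2]) hab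
      rw [← a3, ← b3, this]
    · rcases lt_or_gt_of_ne hab with h | h
      · exact hlt b hb a h
      · exact (hlt a ha b h).symm
  · left
    intro i hi j hj h
    obtain ⟨x, hx, u, hu, h1, h2, h3, h4, h5, h6⟩ := hS.exists_items hi hj h
    have := hS.link_items hl htm hx hu h2 h3 h4
      (lt_of_le_of_ne (hl.le x hx) fun h => hex ⟨x, hx, ck_ne.2 h2, h⟩) h5 h6
    rcases h1 with ⟨rfl, rfl⟩ | ⟨rfl, rfl⟩
    · exact this
    · exact this.symm

end Sweep
/-! ## Reading the segments -/

/-- Register `2` becomes the binary logarithm of `n`; registers `4` to `7` and `1` are the height of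
the segment tree, the number of dyadic levels, the number of items of a segment, the number of items
and the number of slots of a segment. -/
def dimsProg (k : ℕ) : Prog :=
  .setReg 2 0 ;; .setReg 3 1 ;;
  .while (.wlt (.reg 3) (.reg 0)) (.setReg 3 (.reg 3 * 2) ;; .setReg 2 (.reg 2 + 1)) ;;
  .setReg 4 (.reg 2 + 1) ;;
  .setReg 5 (2 * .reg 2 + 3) ;;
  .setReg 6 (4 * .reg 4) ;;
  .setReg 7 (.reg 6 * .reg 0) ;;
  .setReg 1 (.const (16 * k) * .reg 4 * .reg 5)

structure Dims (k n ℓ : ℕ) (s : State) : Prop where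
  h0 : s.reg 0 = n
  h1 : s.reg 1 = 16 * k * (ℓ + 1) * (2 * ℓ + 3)
  h2 : s.reg 2 = ℓ
  h4 : s.reg 4 = ℓ + 1
  h5 : s.reg 5 = 2 * ℓ + 3
  h6 : s.reg 6 = 4 * (ℓ + 1)
  h7 : s.reg 7 = 4 * (ℓ + 1) * n

theorem Dims.of_frame {k n ℓ w : ℕ} {s s' : State} {p : Prog} (h : Dims k n ℓ s)
    (hf : Frame w p s s') (hp : p.modReg 0 = false ∧ p.modReg 1 = false ∧ p.modReg 2 = false ∧
      p.modReg 4 = false ∧ p.modReg 5 = false ∧ p.modReg 6 = false ∧ p.modReg 7 = false) :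
    Dims k n ℓ s' := by
  obtain ⟨a, b, c, d, e, f, g⟩ := hp
  exact ⟨(hf.reg 0 a).trans h.h0, (hf.reg 1 b).trans h.h1, (hf.reg 2 c).trans h.h2,
    (hf.reg 4 d).trans h.h4, (hf.reg 5 e).trans h.h5, (hf.reg 6 f).trans h.h6,
    (hf.reg 7 g).trans h.h7⟩

theorem run_dimsProg {k w n : ℕ} {s : State} (h0 : s.reg 0 = n)
    (hw1 : 16 * k * (Nat.clog 2 n + 1) * (2 * Nat.clog 2 n + 3) < 2 ^ w) (hk : 0 < k)
    (hw2 : 4 * (Nat.clog 2 n + 1) * n < 2 ^ w) (hw3 : 2 * 2 ^ Nat.clog 2 n < 2 ^ w) :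
    Run w (dimsProg k) s (Nat.clog 2 n * 3 + 8) (Dims k n (Nat.clog 2 n)) := by
  obtain ⟨ℓ, hℓ⟩ : ∃ ℓ, ℓ = Nat.clog 2 n := ⟨_, rfl⟩
  rw [← hℓ] at hw1 hw2 hw3 ⊢
  have hl : ℓ < 2 ^ ℓ := Nat.lt_two_pow_self
  have a1 : 16 * 1 ≤ 16 * k := Nat.mul_le_mul_left _ hk
  have a2 : 16 * k * 1 ≤ 16 * k * (ℓ + 1) := Nat.mul_le_mul_left _ (by omega)
  have a3 : 16 * k * (ℓ + 1) * 1 ≤ 16 * k * (ℓ + 1) * (2 * ℓ + 3) :=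
    Nat.mul_le_mul_left _ (by omega)
  have a4 : 16 * (ℓ + 1) ≤ 16 * k * (ℓ + 1) := Nat.mul_le_mul_right _ (by omega)
  refine Run.time (T₁ := ((ℓ - 0) * (2 + 1) + 1 + 5) + 1 + 1) ?_ (by omega)
  refine Run.setReg_seq (Run.setReg_seq ?_)
  obtain ⟨s₁, hs₁⟩ : ∃ s₁, s₁ = ((s.setReg 2 (WExpr.eval w s 0)).setReg 3
    (WExpr.eval w (s.setReg 2 (WExpr.eval w s 0)) 1)) := ⟨_, rfl⟩
  rw [← hs₁]
  have e0 : s₁.reg 0 = n := by rw [hs₁]; simpa using h0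
  have e2 : s₁.reg 2 = 0 := by rw [hs₁]; simp
  have e3 : s₁.reg 3 = 1 := by
    rw [hs₁]; simp (disch := omega) only [State.setReg_reg, WExpr.eval_ofNat, mod_pow_of_lt,
      reduceIte]
  have hloop := Run.while (w := w) (T := 2) (b := .wlt (.reg 3) (.reg 0))
    (p := .setReg 3 (.reg 3 * 2) ;; .setReg 2 (.reg 2 + 1)) (s := s₁)
    (fun s' => s'.reg 3 = 2 ^ s'.reg 2 ∧ s'.reg 2 ≤ ℓ) (fun s' => ℓ - s'.reg 2)
    ⟨by rw [e2, e3, pow_zero], by omega⟩ ?_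
  · rw [e2] at hloop
    refine Run.bind (T₂ := 5) hloop fun s₂ hf h => ?_
    have f0 : s₂.reg 0 = n := by rw [hf.reg 0 rfl, e0]
    have f2 : s₂.reg 2 = ℓ := by
      obtain ⟨⟨h1, h2⟩, h3⟩ := h
      simp only [Test.eval_wlt, WExpr.eval_reg, not_lt, f0, h1] at h3
      refine le_antisymm h2 ?_
      rw [hℓ]
      exact Nat.clog_le_of_le_pow h3
    refine Run.setReg_seq (T := 4) (Run.setReg_seq (Run.setReg_seq (Run.setReg_seq (Run.setReg ?_))))
    constructor <;>
      simp (disch := omega) only [State.setReg_reg, WExpr.eval_add, WExpr.eval_mul,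
        WExpr.eval_const, WExpr.eval_ofNat, WExpr.eval_reg, mod_pow_of_lt, reduceIte,
        Nat.reduceEqDiff, f0, f2]
  · rintro s' hf ⟨h1, h2⟩ h3
    have f0 : s'.reg 0 = n := by rw [hf.reg 0 rfl, e0]
    simp only [Test.eval_wlt, WExpr.eval_reg, f0, h1] at h3
    have h4 : s'.reg 2 < ℓ := by
      by_contra h5
      have := Nat.le_pow_clog (b := 2) (by omega) n
      rw [← hℓ] at this
      have := Nat.pow_le_pow_right (n := 2) (by omega) (not_lt.1 h5)
      omega
    have h5 : 2 ^ s'.reg 2 ≤ 2 ^ ℓ := Nat.pow_le_pow_right (by omega) h2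
    refine Run.setReg_seq (Run.setReg ?_)
    simp (disch := omega) only [State.setReg_reg, WExpr.eval_add, WExpr.eval_mul,
        WExpr.eval_ofNat, WExpr.eval_reg, mod_pow_of_lt, reduceIte, Nat.reduceEqDiff, h1, pow_succ,
        true_and]
    omega

/-- Real register `0` becomes the slope of a shear after which no segment is vertical. -/
def shearProg : Prog :=
  .setRReg 0 (.ofWord 1) ;;
  .for 50 (.reg 0) (
    .setRReg 1 ((.arr 0 (4 * .reg 50 + 2) - .arr 0 (4 * .reg 50)) /
      (.arr 0 (4 * .reg 50 + 3) - .arr 0 (4 * .reg 50 + 1))) ;;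
    .setRReg 0 (.reg 0 + .reg 1 * .reg 1))

/-- A sum of squares bounds all quotients at once without comparisons. For horizontal segments the
quotient is `0`, the value of a division by zero. -/
theorem run_shearProg {w n : ℕ} {s : State} (h0 : s.reg 0 = n) (hw : 4 * n + 4 < 2 ^ w) :
    Run w shearProg s (n * 4 + 3) (fun s' => 1 ≤ s'.rreg 0 ∧ ∀ i < n,
      ((s.rarr 0 (4 * i + 2) - s.rarr 0 (4 * i)) / (s.rarr 0 (4 * i + 3) - s.rarr 0 (4 * i + 1))) ^ 2
        ≤ s'.rreg 0 - 1) := by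
  refine Run.setRReg_seq ((Run.for (n := n) (T := 2) (fun j s' => 1 ≤ s'.rreg 0 ∧ ∀ i < j,
      ((s.rarr 0 (4 * i + 2) - s.rarr 0 (4 * i)) / (s.rarr 0 (4 * i + 3) - s.rarr 0 (4 * i + 1))) ^ 2
        ≤ s'.rreg 0 - 1) (by omega) rfl (fun s' hf => ?_) ⟨?_, by simp⟩ ?_))
  · simpa [hf.reg 0 rfl] using h0
  · simp (disch := omega) [mod_pow_of_lt]
  · rintro j s' hj hf h50 ⟨h1, h2⟩
    have hr : s'.rarr 0 = s.rarr 0 := by rw [hf.rarr 0 rfl]; rfl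
    refine Run.setRReg_seq (Run.setRReg ?_)
    simp (disch := omega) only [State.setReg_rreg, State.setRReg_rreg, RExpr.eval_add,
      RExpr.eval_mul, RExpr.eval_reg, RExpr.eval_div, RExpr.eval_sub, RExpr.eval_arr, WExpr.eval_add,
      WExpr.eval_mul, WExpr.eval_ofNat, WExpr.eval_reg, h50, mod_pow_of_lt, reduceIte,
      hr, zero_ne_one]
    rw [← pow_two]
    refine ⟨h1.trans (le_add_of_nonneg_right (sq_nonneg _)), fun i hi => ?_⟩
    rcases Nat.lt_succ_iff_lt_or_eq.1 hi with hi | rfl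
    · refine (h2 i hi).trans ?_
      have := sq_nonneg ((s.rarr 0 (4 * j + 2) - s.rarr 0 (4 * j)) /
        (s.rarr 0 (4 * j + 3) - s.rarr 0 (4 * j + 1)))
      linarith
    · linarith

/-- Writes the affine functions and their intervals to the real arrays `1` to `4`. -/
def affineProg : Prog :=
  .for 50 (.reg 0) (
    .setRReg 1 (.arr 0 (4 * .reg 50) + .reg 0 * .arr 0 (4 * .reg 50 + 1)) ;;
    .setRReg 2 (.arr 0 (4 * .reg 50 + 2) + .reg 0 * .arr 0 (4 * .reg 50 + 3)) ;;
    .setRArr 2 (.reg 50) (.reg 1) ;;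
    .setRArr 3 (.reg 50) (.arr 0 (4 * .reg 50 + 1)) ;;
    .setRArr 4 (.reg 50) ((.arr 0 (4 * .reg 50 + 3) - .arr 0 (4 * .reg 50 + 1)) / (.reg 2 - .reg 1)) ;;
    .ite (.rlt (.reg 2) (.reg 1))
      (.setRArr 1 (.reg 50) (.reg 2) ;; .setRArr 1 (.reg 0 + .reg 50) (.reg 1))
      (.setRArr 1 (.reg 50) (.reg 1) ;; .setRArr 1 (.reg 0 + .reg 50) (.reg 2)))

/-- The affine function of a segment with endpoints `(u₁, y₁)` and `(u₂, y₂)`. -/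
structure IsAffine (n i : ℕ) (u₁ y₁ u₂ y₂ : ℝ) (s : State) : Prop where
  a : s.rarr 1 i = min u₁ u₂
  b : s.rarr 1 (n + i) = max u₁ u₂
  c : s.rarr 2 i = u₁
  y : s.rarr 3 i = y₁
  m : s.rarr 4 i = (y₂ - y₁) / (u₂ - u₁)

theorem run_affineProg {w n : ℕ} {s : State} (h0 : s.reg 0 = n) (hw : 4 * n + 4 < 2 ^ w) :
    Run w affineProg s (n * 10 + 2) (fun s' => ∀ i < n,
      IsAffine n i (s.rarr 0 (4 * i) + s.rreg 0 * s.rarr 0 (4 * i + 1)) (s.rarr 0 (4 * i + 1))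
        (s.rarr 0 (4 * i + 2) + s.rreg 0 * s.rarr 0 (4 * i + 3)) (s.rarr 0 (4 * i + 3)) s') := by
  refine Run.for (n := n) (T := 8) (fun j s' => ∀ i < j,
      IsAffine n i (s.rarr 0 (4 * i) + s.rreg 0 * s.rarr 0 (4 * i + 1)) (s.rarr 0 (4 * i + 1))
        (s.rarr 0 (4 * i + 2) + s.rreg 0 * s.rarr 0 (4 * i + 3)) (s.rarr 0 (4 * i + 3)) s')
    (by omega) rfl (fun s' hf => by simpa [hf.reg 0 rfl] using h0) (by simp) ?_
  intro j s' hj hf h50 hI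
  have h0' : s'.reg 0 = n := (hf.reg 0 rfl).trans h0
  have hr : s'.rarr 0 = s.rarr 0 := hf.rarr 0 rfl
  have hr0 : s'.rreg 0 = s.rreg 0 := hf.rreg 0 rfl
  refine Run.setRReg_seq (T := 7) (Run.setRReg_seq (Run.setRArr_seq (Run.setRArr_seq (Run.setRArr_seq
    (Run.ite (T := 2) (fun h => Run.setRArr_seq (Run.setRArr ?_))
      (fun h => Run.setRArr_seq (Run.setRArr ?_)))))))
  all_goals
    simp (disch := omega) only [State.setRReg_rreg, State.setRReg_reg, State.setRReg_rarr,
      State.setRArr_rreg, Test.eval_rlt, RExpr.eval_add,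
      RExpr.eval_mul, RExpr.eval_reg, RExpr.eval_arr, WExpr.eval_add,
      WExpr.eval_mul, WExpr.eval_ofNat, WExpr.eval_reg, h50, mod_pow_of_lt, reduceIte,
      Nat.reduceEqDiff, hr, hr0, not_lt] at h
    intro i hi
    rcases Nat.lt_succ_iff_lt_or_eq.1 hi with hi | rfl
    · obtain ⟨h1, h2, h3, h4, h5⟩ := hI i hi
      constructor <;>
      simp (disch := omega) only [State.setRReg_rreg, State.setRReg_reg, State.setRReg_rarr,
        State.setReg_rarr, State.setRArr_rreg, State.setRArr_rarr, State.setRArr_reg, RExpr.eval_add,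
        RExpr.eval_mul, RExpr.eval_reg, RExpr.eval_sub, RExpr.eval_div, RExpr.eval_arr, WExpr.eval_add,
        WExpr.eval_mul, WExpr.eval_ofNat, WExpr.eval_reg, h50, mod_pow_of_lt, reduceIte,
        Nat.reduceEqDiff, hr, hr0, h0', h1, h2, h3, h4, h5, Nat.add_left_cancel_iff, hi.ne, if_neg,
        (show i ≠ n + j by omega), (show n + i ≠ j by omega)]
    · constructor <;>
      simp (disch := omega) only [State.setRReg_rreg, State.setRReg_reg, State.setRReg_rarr,
        State.setReg_rarr, State.setRArr_rreg, State.setRArr_rarr, State.setRArr_reg, RExpr.eval_add,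
        RExpr.eval_mul, RExpr.eval_reg, RExpr.eval_sub, RExpr.eval_div, RExpr.eval_arr, WExpr.eval_add,
        WExpr.eval_mul, WExpr.eval_ofNat, WExpr.eval_reg, h50, mod_pow_of_lt, reduceIte,
        Nat.reduceEqDiff, hr, hr0, h0', if_neg, (show i ≠ n + i by omega), (show n + i ≠ i by omega)]
      <;> first
        | exact (min_eq_right h.le).symm | exact (max_eq_left h.le).symm
        | exact (min_eq_left h).symm | exact (max_eq_right h).symm

/-- Sorts the endpoints. -/
def endsTest (e₁ e₂ : WExpr) : Test :=
  .or (.rlt (.arr 1 e₁) (.arr 1 e₂)) (.and (.req (.arr 1 e₁) (.arr 1 e₂)) (.wlt e₁ e₂))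

def endsProg : Prog :=
  .setReg 30 (2 * .reg 0) ;; .setReg 29 (.reg 4) ;;
  sortProg endsTest ;;
  .for 50 (.reg 30) (
    .setArr 3 (.reg 50) (.arr 12 (.reg 50)) ;;
    .setRArr 5 (.reg 50) (.arr 1 (.arr 10 (.reg 50))))

/-- The sweep in the memory. -/
def sweepOf (n h : ℕ) (s : State) : Sweep where
  n := n
  h := h
  a := s.rarr 1
  b i := s.rarr 1 (n + i)
  c := s.rarr 2
  y := s.rarr 3
  m := s.rarr 4
  l := s.arr 3
  r i := s.arr 3 (n + i)
  X := s.rarr 5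

theorem run_endsProg {w n h : ℕ} {s : State} (hs : s.Bounded w) (h0 : s.reg 0 = n) (h4 : s.reg 4 = h)
    (hh : 0 < h) (hn : 2 * n ≤ 2 ^ h) (hab : ∀ i < n, s.rarr 1 i ≤ s.rarr 1 (n + i))
    (hw : 8 * 2 ^ h + 4 < 2 ^ w) :
    Run w endsProg s ((h + 1) * (2 * n * (4 * h + 18) + 16) + (2 * n * 4 + 4))
      (fun s' => (sweepOf n h s').Good) := by
  have st : StrictOn (fun x y => s.rarr 1 x < s.rarr 1 y ∨ s.rarr 1 x = s.rarr 1 y ∧ x < y) (2 * n) :=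
    (strictOn_lt _).lex (s.rarr 1)
  refine Run.time (T₁ := ((h + 1) * (2 * n * (4 * h + 18) + 16) + (2 * n * 4 + 2)) + 1 + 1) ?_
    (by omega)
  refine Run.setReg_seq (Run.setReg_seq ?_)
  obtain ⟨s₁, hs₁⟩ : ∃ s₁, s₁ = ((s.setReg 30 (WExpr.eval w s (2 * .reg 0))).setReg 29
    (WExpr.eval w (s.setReg 30 (WExpr.eval w s (2 * .reg 0))) (.reg 4))) := ⟨_, rfl⟩
  rw [← hs₁]
  have hb : s₁.Bounded w := by
    rw [hs₁]
    exact (hs.setReg _ (WExpr.eval_lt hs _)).setReg _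
      (WExpr.eval_lt (hs.setReg _ (WExpr.eval_lt hs _)) _)
  have e30 : s₁.reg 30 = 2 * n := by
    rw [hs₁]
    simp (disch := omega) only [State.setReg_reg, WExpr.eval_mul, WExpr.eval_ofNat, WExpr.eval_reg,
      mod_pow_of_lt, reduceIte, Nat.reduceEqDiff, h0]
  have e29 : s₁.reg 29 = h := by rw [hs₁]; simpa using h4
  have e1 : s₁.rarr 1 = s.rarr 1 := by rw [hs₁]; rfl
  refine Run.bind (run_sortProg st (s := s₁) hb hn hw e30 e29 ?_) fun s₂ hf₂ h2 => ?_
  · intro s' hf e₁ e₂ _ _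
    have : s'.rarr 1 = s.rarr 1 := by rw [hf.rarr 1 rfl, e1]
    simp only [endsTest, Test.eval_or, Test.eval_rlt, Test.eval_and, Test.eval_req, Test.eval_wlt,
      RExpr.eval_arr, this]
  · have f30 : s₂.reg 30 = 2 * n := by rw [hf₂.reg 30 rfl, e30]
    have f1 : s₂.rarr 1 = s.rarr 1 := by rw [hf₂.rarr 1 rfl, e1]
    refine (Run.for (n := 2 * n) (T := 2) (fun j s' => ∀ x < j, s'.arr 3 x = s₂.arr 12 x ∧
      s'.rarr 5 x = s.rarr 1 (s₂.arr 10 x)) (by omega) rfl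
      (fun s' hf => by rw [WExpr.eval_reg, hf.reg 30 rfl, f30]) (by simp) ?_).post ?_
    · intro j s' hj hf h50 hI
      have g12 : s'.arr 12 = s₂.arr 12 := hf.arr 12 rfl
      have g10 : s'.arr 10 = s₂.arr 10 := hf.arr 10 rfl
      have g1 : s'.rarr 1 = s.rarr 1 := by rw [hf.rarr 1 rfl, f1]
      refine Run.setArr_seq (Run.setRArr ?_)
      intro x hx
      simp only [State.setReg_arr, State.setReg_rarr, State.setRArr_arr, State.setRArr_rarr,
        State.setArr_arr, State.setArr_rarr, State.setArr_reg, WExpr.eval_reg, WExpr.eval_arr,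
        RExpr.eval_arr, h50, g12, g10, g1, Nat.reduceEqDiff, reduceIte]
      rcases Nat.lt_succ_iff_lt_or_eq.1 hx with hx | rfl
      · rw [if_neg (by omega), if_neg (by omega)]; exact hI x hx
      · simp
    · intro s' hf h3
      have g1 : s'.rarr 1 = s.rarr 1 := by rw [hf.rarr 1 rfl, f1]
      have hpos : ∀ x < 2 * n, s'.arr 3 x = rank (fun x y => s.rarr 1 x < s.rarr 1 y ∨
          s.rarr 1 x = s.rarr 1 y ∧ x < y) (2 * n) x := fun x hx => by
        rw [(h3 x hx).1, (h2 x hx).2]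
      have hX : ∀ x < 2 * n, s'.rarr 5 (s'.arr 3 x) = s.rarr 1 x := fun x hx => by
        rw [hpos x hx, (h3 _ (st.rank_lt hx)).2, (h2 x hx).1]
      refine ⟨hh, hn, ?_, ?_, ?_, ?_, ?_, ?_⟩
      · intro i j hij hj
        simp only [sweepOf] at *
        obtain ⟨x, hx, rfl⟩ := st.rank_surj (show i < 2 * n by omega)
        obtain ⟨y, hy, rfl⟩ := st.rank_surj hj
        rw [← hpos x hx, ← hpos y hy, hX x hx, hX y hy]
        rcases hij.eq_or_lt with e | hlt
        · rw [st.rank_inj hx hy e]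
        · rcases (st.rank_lt_iff hx hy).1 hlt with h | h
          · exact h.le
          · exact h.1.le
      · intro i hi
        simp only [sweepOf] at *
        rw [hpos _ (by omega)]
        exact st.rank_lt (by omega)
      · intro i hi
        simp only [sweepOf] at *
        rw [hX _ (by omega), g1]
      · intro i hi
        simp only [sweepOf] at *
        rw [hX _ (by omega), g1]
      · intro i hi j hj hle
        simp only [sweepOf] at *
        rw [hpos _ (by omega), hpos _ (by omega), st.rank_lt_iff (by omega) (by omega)]
        rw [g1] at hle
        rcases hle.lt_or_eq with h | h
        · exact .inl h
        -- For equal coordinates the index decides, and left endpoints are stored at `i < n`, right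
        -- endpoints at `n + j`.
        · exact .inr ⟨h, by omega⟩
      · intro i hi
        simp only [sweepOf] at *
        rw [g1]
        exact hab i hi

/-! ### The geometry of the shear. -/

/-- Two different points with the same sheared abscissa would have quotient `-t`, so that `t ^ 2 ≤ t
- 1`, which no real number satisfies. -/
theorem eq_of_shear_eq {p q : ℝ × ℝ} {t : ℝ} (h1 : 1 ≤ t)
    (h2 : ((q.1 - p.1) / (q.2 - p.2)) ^ 2 ≤ t - 1) (h : p.1 + t * p.2 = q.1 + t * q.2) : p = q := by
  by_cases hy : q.2 - p.2 = 0
  · have h3 : p.2 = q.2 := by linarith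
    rw [h3] at h
    exact Prod.ext (by linarith) h3
  · have h3 : (q.1 - p.1) / (q.2 - p.2) = -t := by
      rw [div_eq_iff hy]; linarith
    rw [h3] at h2
    nlinarith

/-- In the coordinates `x + t * y` and `y` the segment is a graph over the interval between the
sheared abscissas of its ends. If these agree, the segment is a point, and the slope is `0` by
division by zero, which is still correct. -/
theorem mem_segment_iff {p q z : ℝ × ℝ} {t : ℝ}
    (h : p.1 + t * p.2 = q.1 + t * q.2 → p = q) :
    z ∈ segment ℝ p q ↔
      (min (p.1 + t * p.2) (q.1 + t * q.2) ≤ z.1 + t * z.2 ∧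
        z.1 + t * z.2 ≤ max (p.1 + t * p.2) (q.1 + t * q.2)) ∧
      z.2 = p.2 + (q.2 - p.2) / (q.1 + t * q.2 - (p.1 + t * p.2)) *
        (z.1 + t * z.2 - (p.1 + t * p.2)) := by
  obtain ⟨u, hu⟩ : ∃ u, u = p.1 + t * p.2 := ⟨_, rfl⟩
  obtain ⟨v, hv⟩ : ∃ v, v = q.1 + t * q.2 := ⟨_, rfl⟩
  rw [← hu, ← hv] at h ⊢
  rw [segment_eq_image']
  constructor
  · rintro ⟨θ, ⟨h0, h1⟩, rfl⟩
    have e : (p + θ • (q - p)).1 + t * (p + θ • (q - p)).2 = u + θ * (v - u) := by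
      simp only [Prod.fst_add, Prod.snd_add, Prod.smul_fst, Prod.smul_snd, Prod.fst_sub,
        Prod.snd_sub, smul_eq_mul, hu, hv]
      ring
    rw [e]
    refine ⟨⟨?_, ?_⟩, ?_⟩
    · rcases le_total u v with huv | huv
      · rw [min_eq_left huv]; nlinarith
      · rw [min_eq_right huv]; nlinarith
    · rcases le_total u v with huv | huv
      · rw [max_eq_right huv]; nlinarith
      · rw [max_eq_left huv]; nlinarith
    · simp only [Prod.snd_add, Prod.smul_snd, Prod.snd_sub, smul_eq_mul]
      by_cases huv : u = v
      · rw [h huv]; simp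
      · have : v - u ≠ 0 := fun h' => huv (by linarith)
        field_simp
        ring
  · rintro ⟨⟨h1, h2⟩, h3⟩
    by_cases huv : u = v
    · have hpq := h huv
      subst hpq
      rw [huv, min_self] at h1
      rw [huv, max_self] at h2
      refine ⟨0, by simp, ?_⟩
      have e : z.2 = p.2 := by rw [h3]; simp
      rw [e] at h1 h2
      refine Prod.ext ?_ ?_
      · simp only [zero_smul, add_zero]; linarith
      · simp [e]
    · have hd : v - u ≠ 0 := fun h' => huv (by linarith)
      refine ⟨(z.1 + t * z.2 - u) / (v - u), ?_, ?_⟩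
      · rcases lt_or_gt_of_ne huv with h' | h'
        · rw [min_eq_left h'.le] at h1
          rw [max_eq_right h'.le] at h2
          exact ⟨div_nonneg (by linarith) (by linarith), (div_le_one (by linarith)).2 (by linarith)⟩
        · rw [min_eq_right h'.le] at h1
          rw [max_eq_left h'.le] at h2
          exact ⟨div_nonneg_of_nonpos (by linarith) (by linarith),
            (div_le_one_of_neg (by linarith)).2 (by linarith)⟩
      · have e2 : z.2 - p.2 = (z.1 + t * z.2 - u) / (v - u) * (q.2 - p.2) := by
          have : (q.2 - p.2) / (v - u) * (z.1 + t * z.2 - u) =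
            (z.1 + t * z.2 - u) / (v - u) * (q.2 - p.2) := by ring
          linarith
        have e3 : (z.1 + t * z.2 - u) / (v - u) * (v - u) = z.1 + t * z.2 - u :=
          div_mul_cancel₀ _ hd
        generalize (z.1 + t * z.2 - u) / (v - u) = θ at e2 e3 ⊢
        have e4 : v - u = (q.1 - p.1) + t * (q.2 - p.2) := by rw [hu, hv]; ring
        rw [e4, mul_add] at e3
        refine Prod.ext ?_ ?_
        · simp only [Prod.fst_add, Prod.smul_fst, Prod.fst_sub, smul_eq_mul]
          have : θ * (t * (q.2 - p.2)) = t * (z.2 - p.2) := by rw [e2]; ring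
          rw [this, hu] at e3
          linarith
        · simp only [Prod.snd_add, Prod.smul_snd, Prod.snd_sub, smul_eq_mul]
          linarith

/-- In the sweep of the sheared segments, two segments meet if they have a common point. -/
theorem inter_nonempty_iff {S : Sweep} {i j : ℕ} {t : ℝ} {p q p' q' : ℝ × ℝ}
    (h : p.1 + t * p.2 = q.1 + t * q.2 → p = q)
    (h' : p'.1 + t * p'.2 = q'.1 + t * q'.2 → p' = q')
    (hi : S.a i = min (p.1 + t * p.2) (q.1 + t * q.2) ∧
      S.b i = max (p.1 + t * p.2) (q.1 + t * q.2) ∧ S.c i = p.1 + t * p.2 ∧ S.y i = p.2 ∧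
      S.m i = (q.2 - p.2) / (q.1 + t * q.2 - (p.1 + t * p.2)))
    (hj : S.a j = min (p'.1 + t * p'.2) (q'.1 + t * q'.2) ∧
      S.b j = max (p'.1 + t * p'.2) (q'.1 + t * q'.2) ∧ S.c j = p'.1 + t * p'.2 ∧ S.y j = p'.2 ∧
      S.m j = (q'.2 - p'.2) / (q'.1 + t * q'.2 - (p'.1 + t * p'.2))) :
    (segment ℝ p q ∩ segment ℝ p' q').Nonempty ↔ S.Meet i j := by
  obtain ⟨i1, i2, i3, i4, i5⟩ := hi
  obtain ⟨j1, j2, j3, j4, j5⟩ := hj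
  unfold Sweep.Meet Sweep.f
  rw [i1, i2, i3, i4, i5, j1, j2, j3, j4, j5]
  constructor
  · rintro ⟨z, hz, hz'⟩
    rw [mem_segment_iff h] at hz
    rw [mem_segment_iff h'] at hz'
    exact ⟨z.1 + t * z.2, hz.1, hz'.1, hz.2.symm.trans hz'.2⟩
  · rintro ⟨x, h1, h2, h3⟩
    obtain ⟨y, hy⟩ : ∃ y, y = p.2 + (q.2 - p.2) / (q.1 + t * q.2 - (p.1 + t * p.2)) *
      (x - (p.1 + t * p.2)) := ⟨_, rfl⟩
    rw [← hy] at h3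
    have e : (x - t * y) + t * y = x := by ring
    refine ⟨(x - t * y, y), ?_, ?_⟩
    · rw [mem_segment_iff h]
      simp only [e]
      exact ⟨h1, hy⟩
    · rw [mem_segment_iff h']
      simp only [e]
      exact ⟨h2, h3⟩

/-! ## The items -/

namespace Sweep
variable {S : Sweep} (hS : S.Good)
include hS

/-- These bounds show that the word arithmetic on nodes does not overflow, for items outside the
interval of the segment as well. -/
theorem Good.item_bounds {u : ℕ} (hu : u < S.M) :
    S.l (S.seg u) < 2 ^ S.h ∧ S.r (S.seg u) < 2 ^ S.h ∧ S.lev u < S.h ∧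
      2 ^ S.lev u * 2 ≤ 2 ^ S.h ∧
      S.par u * (2 ^ S.lev u * 2) < 2 ^ S.h ∧ S.par u < 2 ^ S.h ∧ S.bit u < 2 ∧ S.nd u < 2 * 2 ^ S.h ∧
      S.nd u * S.h ≤ 2 * 2 ^ S.h * S.h ∧ S.lo u = S.par u * (2 ^ S.lev u * 2) + S.bit u * 2 ^ S.lev u ∧
      S.hi u = S.lo u + 2 ^ S.lev u ∧ S.bit u * 2 ^ S.lev u ≤ 2 ^ S.lev u := by
  have hsu := seg_lt hu
  have hlt := hS.l_lt_r _ hsu _ hsu (hS.a_le_b _ hsu)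
  have hr := (hS.r_lt _ hsu).trans_le hS.n_le
  have hl : S.l (S.seg u) < 2 ^ S.h := hlt.trans hr
  have hlev := lev_lt hS.h_pos u
  have h2 : 2 ^ S.lev u * 2 ≤ 2 ^ S.h := by
    rw [← pow_succ]; exact Nat.pow_le_pow_right (by omega) hlev
  have hbit : S.bit u < 2 := Nat.mod_lt _ two_pos
  have hpar : S.par u * (2 ^ S.lev u * 2) < 2 ^ S.h := by
    unfold par
    rw [← pow_succ]
    split_ifs
    · exact (Nat.div_mul_le_self _ _).trans_lt hl
    · exact (Nat.div_mul_le_self _ _).trans_lt (by omega)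
  have hpar' : S.par u < 2 ^ S.h :=
    (Nat.le_mul_of_pos_right _ (by have := Nat.two_pow_pos (S.lev u); omega)).trans_lt hpar
  have hnd : S.nd u < 2 * 2 ^ S.h := by unfold nd; omega
  refine ⟨hl, hr, hlev, h2, hpar, hpar', hbit, hnd, Nat.mul_le_mul_right _ hnd.le, ?_, ?_, ?_⟩
  · unfold lo nd; ring
  · unfold hi lo; ring
  · calc _ ≤ 1 * 2 ^ S.lev u := Nat.mul_le_mul_right _ (by omega)
      _ = _ := one_mul _

end Sweep

/-- The sweep `S` is stored in the memory. -/
structure Stored (S : Sweep) (s : State) : Prop where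
  a : ∀ i, s.rarr 1 i = S.a i
  b : ∀ i, s.rarr 1 (S.n + i) = S.b i
  c : ∀ i, s.rarr 2 i = S.c i
  y : ∀ i, s.rarr 3 i = S.y i
  m : ∀ i, s.rarr 4 i = S.m i
  l : ∀ i, s.arr 3 i = S.l i
  r : ∀ i, s.arr 3 (S.n + i) = S.r i
  X : ∀ i, s.rarr 5 i = S.X i

/-- The sweep is read off from the memory including cells beyond the input. So when an item refers
to a position that is out of range, the program still computes the values that the sweep has there.
-/
theorem stored_sweepOf (n h : ℕ) (s : State) : Stored (sweepOf n h s) s := by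
  constructor <;> intro i <;> rfl

theorem Stored.l_add {S : Sweep} {s : State} (h : Stored S s) (i : ℕ) : S.l (S.n + i) = S.r i :=
  (h.l _).symm.trans (h.r i)

theorem Stored.a_add {S : Sweep} {s : State} (h : Stored S s) (i : ℕ) : S.a (S.n + i) = S.b i :=
  (h.a _).symm.trans (h.b i)

theorem Stored.of_frame {w : ℕ} {S : Sweep} {s s' : State} {p : Prog} (h : Stored S s)
    (hf : Frame w p s s') (hp : p.modRArr 1 = false ∧ p.modRArr 2 = false ∧ p.modRArr 3 = false ∧
      p.modRArr 4 = false ∧ p.modRArr 5 = false ∧ p.modArr 3 = false) : Stored S s' := by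
  obtain ⟨p1, p2, p3, p4, p5, p6⟩ := hp
  constructor <;> intro i <;>
    simp only [hf.rarr 1 p1, hf.rarr 2 p2, hf.rarr 3 p3, hf.rarr 4 p4, hf.rarr 5 p5, hf.arr 3 p6,
      h.a, h.c, h.y, h.m, h.l, h.X, h.l_add, h.a_add]

/-- The node of the item in register `50`. -/
def nodeProg : Prog :=
  .setReg 51 (.reg 50 / .reg 6) ;;
  .setReg 52 (.reg 50 % .reg 6) ;;
  .setReg 53 (.reg 52 / 4) ;;
  .setReg 54 (.reg 52 / 2 % 2) ;;
  .setReg 55 (.shr (.arr 3 (.reg 51)) (.reg 53 + 1)) ;;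
  .setReg 56 (.shr (.arr 3 (.reg 0 + .reg 51) - 1) (.reg 53 + 1)) ;;
  .setReg 59 (.shl 1 (.reg 53)) ;;
  .ite (.weq (.reg 54) 0) (.setReg 57 (.reg 55)) (.setReg 57 (.reg 56))

structure NodeRegs (S : Sweep) (u : ℕ) (s : State) : Prop where
  h51 : s.reg 51 = S.seg u
  h52 : s.reg 52 = u % (4 * S.h)
  h53 : s.reg 53 = S.lev u
  h54 : s.reg 54 = S.side u
  h55 : s.reg 55 = S.lpar u
  h56 : s.reg 56 = S.rpar u
  h57 : s.reg 57 = S.par u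
  h59 : s.reg 59 = 2 ^ S.lev u

theorem run_nodeProg {w u : ℕ} {S : Sweep} (hS : S.Good) {s : State} (hst : Stored S s)
    (h0 : s.reg 0 = S.n) (h6 : s.reg 6 = 4 * S.h) (h50 : s.reg 50 = u) (hu : u < S.M)
    (hw : 8 * (2 ^ S.h * (S.h + 1)) < 2 ^ w) (hM : S.M < 2 ^ w) :
    Run w nodeProg s 9 (NodeRegs S u) := by
  obtain ⟨b1, b2, b3, b4, -, -⟩ := hS.item_bounds hu
  have hsu := Sweep.seg_lt hu
  have hn := hS.n_le
  have a1 : 2 ^ S.h * 1 ≤ 2 ^ S.h * (S.h + 1) := Nat.mul_le_mul_left _ (by omega)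
  have a2 : S.h < 2 ^ S.h := Nat.lt_two_pow_self
  have hh := hS.h_pos
  have hbig : 4 ≤ S.M := by
    have : 4 * S.h * 1 ≤ 4 * S.h * S.n := Nat.mul_le_mul_left _ (by omega)
    unfold Sweep.M; omega
  have v1 : u / (4 * S.h) = S.seg u := rfl
  have v2 : u % (4 * S.h) / 4 = S.lev u := rfl
  have v3 : u % (4 * S.h) / 2 % 2 = S.side u := rfl
  have v4 : S.l (S.seg u) / 2 ^ (S.lev u + 1) = S.lpar u := rfl
  have v5 : (S.r (S.seg u) - 1) / 2 ^ (S.lev u + 1) = S.rpar u := rfl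
  have c1 : S.seg u < 2 ^ w := by omega
  have c2 : u % (4 * S.h) < 2 ^ w := (Nat.mod_le _ _).trans_lt (by omega)
  have c3 : S.lpar u < 2 ^ w := (Nat.div_le_self _ _).trans_lt (by omega)
  have c4 : S.rpar u < 2 ^ w := (Nat.div_le_self _ _).trans_lt (by omega)
  have c5 : S.side u < 2 := Nat.mod_lt _ two_pos
  have c6 : u % (4 * S.h) / 2 < 2 ^ w := (Nat.div_le_self _ _).trans_lt (by omega)
  refine Run.setReg_seq (T := 8) ?_
  simp (disch := omega) only [WExpr.eval_div, WExpr.eval_reg, mod_pow_of_lt, h6, h50, v1]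
  refine Run.setReg_seq (T := 7) ?_
  simp (disch := omega) only [WExpr.eval_mod, WExpr.eval_reg, mod_pow_of_lt, State.setReg_reg, reduceIte,
      Nat.reduceEqDiff, h6, h50]
  refine Run.setReg_seq (T := 6) ?_
  simp (disch := omega) only [WExpr.eval_div, WExpr.eval_ofNat, WExpr.eval_reg, mod_pow_of_lt, State.setReg_reg, reduceIte,
      Nat.reduceEqDiff, v2]
  refine Run.setReg_seq (T := 5) ?_
  simp (disch := omega) only [WExpr.eval_div, WExpr.eval_mod, WExpr.eval_ofNat, WExpr.eval_reg, mod_pow_of_lt, State.setReg_reg, reduceIte,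
      Nat.reduceEqDiff, v3]
  refine Run.setReg_seq (T := 4) ?_
  simp (disch := omega) only [WExpr.eval_add, WExpr.eval_shr, WExpr.eval_arr,
      WExpr.eval_ofNat, WExpr.eval_reg, mod_pow_of_lt, State.setReg_reg, State.setReg_arr, reduceIte,
      Nat.reduceEqDiff, v4, hst.l]
  refine Run.setReg_seq (T := 3) ?_
  simp (disch := omega) only [WExpr.eval_add, WExpr.eval_sub,
      WExpr.eval_shr, WExpr.eval_arr,
      WExpr.eval_ofNat, WExpr.eval_reg, mod_pow_of_lt, State.setReg_reg, State.setReg_arr, reduceIte,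
      Nat.reduceEqDiff, h0, v5, hst.l, hst.l_add]
  refine Run.setReg_seq (T := 2) ?_
  simp (disch := omega) only [WExpr.eval_shl, WExpr.eval_ofNat, WExpr.eval_reg, mod_pow_of_lt, State.setReg_reg, reduceIte,
      Nat.reduceEqDiff, one_mul]
  refine Run.ite (T := 1) (fun h => Run.setReg ?_) (fun h => Run.setReg ?_)
  all_goals
    simp only [Test.eval_weq, WExpr.eval_ofNat, WExpr.eval_reg, State.setReg_reg, reduceIte,
      Nat.reduceEqDiff, Nat.zero_mod] at h
    constructor <;>
    simp (disch := omega) only [WExpr.eval_reg, State.setReg_reg, reduceIte, Nat.reduceEqDiff,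
      Sweep.par, h]

def isCTest : Test :=
  .and (.and (.not (.wlt (.reg 60) (.reg 63))) (.not (.wlt (.reg 64) (.reg 61))))
    (.and (.not (.and (.not (.wlt (.reg 57 * (.reg 59 * 2)) (.reg 63)))
        (.not (.wlt (.reg 64) ((.reg 57 + 1) * (.reg 59 * 2))))))
      (.not (.and (.weq (.reg 54) 1) (.weq (.reg 55) (.reg 56)))))

def isDTest : Test := .and (.wlt (.reg 63) (.reg 61)) (.wlt (.reg 60) (.reg 64))

/-- Writes the keys of the item in register `50`. -/
def keyProg : Prog :=
  .setReg 58 (2 * .reg 57 + .reg 52 % 2) ;;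
  .setReg 60 (.reg 58 * .reg 59) ;;
  .setReg 61 (.reg 60 + .reg 59) ;;
  .setReg 62 (.reg 58 * .reg 4 + .reg 53 + 1) ;;
  .setReg 63 (.arr 3 (.reg 51)) ;;
  .setReg 64 (.arr 3 (.reg 0 + .reg 51)) ;;
  .setArr 6 (.reg 50) (.reg 51) ;;
  .setArr 13 (.reg 50) (.reg 60) ;;
  .setArr 14 (.reg 50) (.reg 61) ;;
  .ite isCTest (.setArr 7 (.reg 50) (.reg 62)) (.setArr 7 (.reg 50) 0) ;;
  .ite isDTest (.setArr 8 (.reg 50) (.reg 62)) (.setArr 8 (.reg 50) 0)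

theorem run_keyProg {w u : ℕ} {S : Sweep} (hS : S.Good) {s : State} (hst : Stored S s)
    (h0 : s.reg 0 = S.n) (h4 : s.reg 4 = S.h) (h50 : s.reg 50 = u) (hu : u < S.M)
    (hr : NodeRegs S u s) (hw : 8 * (2 ^ S.h * (S.h + 1)) < 2 ^ w) :
    Run w keyProg s 13 (fun s' =>
      (s'.arr 6 = Function.update (s.arr 6) u (S.seg u) ∧
      s'.arr 13 = Function.update (s.arr 13) u (S.lo u) ∧
      s'.arr 14 = Function.update (s.arr 14) u (S.hi u)) ∧
      s'.arr 7 = Function.update (s.arr 7) u (S.ck u) ∧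
      s'.arr 8 = Function.update (s.arr 8) u (S.dk u)) := by
  obtain ⟨b1, b2, b3, b4, b5, b6, b7, b8, b9, b10, b11, b12⟩ := hS.item_bounds hu
  obtain ⟨r51, r52, r53, r54, r55, r56, r57, r59⟩ := hr
  have a1 : 2 ^ S.h * (S.h + 1) = 2 ^ S.h * S.h + 2 ^ S.h := by ring
  have a2 : 2 * 2 ^ S.h * S.h = 2 * (2 ^ S.h * S.h) := by ring
  have a3 : S.h < 2 ^ S.h := Nat.lt_two_pow_self
  have hsu := Sweep.seg_lt hu
  have hn := hS.n_le
  have v1 : u % (4 * S.h) % 2 = S.bit u := rfl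
  have v2 : 2 * S.par u + S.bit u = S.nd u := rfl
  have v3 : S.nd u * 2 ^ S.lev u = S.lo u := rfl
  have v4 : S.lo u + 2 ^ S.lev u = S.hi u := b11.symm
  have v5 : S.nd u * S.h + S.lev u + 1 = S.key u := rfl
  have e1 : (S.par u + 1) * (2 ^ S.lev u * 2) = S.par u * (2 ^ S.lev u * 2) + 2 ^ S.lev u * 2 := by
    ring
  iterate 9 (
    first | refine Run.setReg_seq ?_ | refine Run.setArr_seq ?_
    simp (disch := omega) only [WExpr.eval_mod, WExpr.eval_add, WExpr.eval_mul, WExpr.eval_arr,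
      WExpr.eval_ofNat, WExpr.eval_reg, mod_pow_of_lt, State.setReg_reg, State.setReg_arr,
      State.setArr_reg, reduceIte, Nat.reduceEqDiff, h0, h4, h50, r51, r52, r53,
      r57, r59, v1, v2, v3, v4, v5, hst.l, hst.l_add])
  obtain ⟨s₁, hs₁⟩ : ∃ s₁, s₁ = (((((((((s.setReg 58 (S.nd u)).setReg 60 (S.lo u)).setReg 61
    (S.hi u)).setReg 62 (S.key u)).setReg 63 (S.l (S.seg u))).setReg 64 (S.r (S.seg u))).setArr 6 u
    (S.seg u)).setArr 13 u (S.lo u)).setArr 14 u (S.hi u)) := ⟨_, rfl⟩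
  rw [← hs₁]
  have f50 : s₁.reg 50 = u := by rw [hs₁]; simpa using h50
  have f54 : s₁.reg 54 = S.side u := by rw [hs₁]; simpa using r54
  have f55 : s₁.reg 55 = S.lpar u := by rw [hs₁]; simpa using r55
  have f56 : s₁.reg 56 = S.rpar u := by rw [hs₁]; simpa using r56
  have f57 : s₁.reg 57 = S.par u := by rw [hs₁]; simpa using r57
  have f59 : s₁.reg 59 = 2 ^ S.lev u := by rw [hs₁]; simpa using r59
  have f60 : s₁.reg 60 = S.lo u := by rw [hs₁]; simp
  have f61 : s₁.reg 61 = S.hi u := by rw [hs₁]; simp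
  have f62 : s₁.reg 62 = S.key u := by rw [hs₁]; simp
  have f63 : s₁.reg 63 = S.l (S.seg u) := by rw [hs₁]; simp
  have f64 : s₁.reg 64 = S.r (S.seg u) := by rw [hs₁]; simp
  have tC : isCTest.eval w s₁ ↔ S.IsC u := by
    simp (disch := omega) only [isCTest, Test.eval_and, Test.eval_not, Test.eval_wlt, Test.eval_weq,
      WExpr.eval_reg, WExpr.eval_mul, WExpr.eval_add, WExpr.eval_ofNat, mod_pow_of_lt, f54, f55,
      f56, f57, f59, f60, f61, f63, f64, Sweep.IsC, not_lt, pow_succ]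
  have tD : isDTest.eval w s₁ ↔ S.IsD u := by
    simp only [isDTest, Test.eval_and, Test.eval_wlt, WExpr.eval_reg, f60, f61, f63, f64, Sweep.IsD]
  refine Run.bind (T₁ := 2) (T₂ := 2) (P := fun s' => s' = s₁.setArr 7 u (S.ck u))
    (Run.ite (T := 1) (fun h => Run.setArr ?_) (fun h => Run.setArr ?_)) ?_
  · rw [WExpr.eval_reg, WExpr.eval_reg, f50, f62, Sweep.ck_eq (tC.1 h)]
  · rw [WExpr.eval_reg, WExpr.eval_ofNat, f50, Nat.zero_mod, Sweep.ck, if_neg (mt tC.2 h)]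
  · rintro s₂ - rfl
    have tD' : isDTest.eval w (s₁.setArr 7 u (S.ck u)) ↔ S.IsD u := tD
    refine Run.post (P := fun s' => s' = (s₁.setArr 7 u (S.ck u)).setArr 8 u (S.dk u))
      (Run.ite (T := 1) (fun h => Run.setArr ?_) (fun h => Run.setArr ?_)) ?_
    · simp only [WExpr.eval_reg, State.setArr_reg, f50, f62, Sweep.dk_eq (tD'.1 h)]
    · simp only [WExpr.eval_reg, WExpr.eval_ofNat, State.setArr_reg, f50, Nat.zero_mod, Sweep.dk,
        if_neg (mt tD'.2 h)]
    · rintro s₂ - rfl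
      rw [hs₁]
      simp [State.setArr, State.setReg]

/-- The combinatorial data of the items. -/
structure ItemArrays (S : Sweep) (j : ℕ) (s : State) : Prop where
  h6 : ∀ u < j, s.arr 6 u = S.seg u
  h13 : ∀ u < j, s.arr 13 u = S.lo u
  h14 : ∀ u < j, s.arr 14 u = S.hi u
  h7 : ∀ u < j, s.arr 7 u = S.ck u
  h8 : ∀ u < j, s.arr 8 u = S.dk u

def itemsProg : Prog := .for 50 (.reg 7) (nodeProg ;; keyProg)

theorem run_itemsProg {w : ℕ} {S : Sweep} (hS : S.Good) {s : State} (hst : Stored S s)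
    (h0 : s.reg 0 = S.n) (h4 : s.reg 4 = S.h) (h6 : s.reg 6 = 4 * S.h) (h7 : s.reg 7 = S.M)
    (hw : 8 * (2 ^ S.h * (S.h + 1)) < 2 ^ w) (hM : S.M < 2 ^ w) :
    Run w itemsProg s (S.M * 24 + 2) (ItemArrays S S.M) := by
  refine Run.for (n := S.M) (T := 9 + 13) (ItemArrays S) hM rfl
    (fun s' hf => by simpa [hf.reg 7 rfl] using h7) (by constructor <;> simp) ?_
  intro u s' hu hf h50 hI
  have g0 : s'.reg 0 = S.n := (hf.reg 0 rfl).trans h0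
  have g4 : s'.reg 4 = S.h := (hf.reg 4 rfl).trans h4
  have g6 : s'.reg 6 = 4 * S.h := (hf.reg 6 rfl).trans h6
  have hst' : Stored S s' := hst.of_frame hf ⟨rfl, rfl, rfl, rfl, rfl, rfl⟩
  refine Run.bind (run_nodeProg hS hst' g0 g6 h50 hu hw hM) fun s₁ hf₁ h₁ => ?_
  refine (run_keyProg hS (hst'.of_frame hf₁ ⟨rfl, rfl, rfl, rfl, rfl, rfl⟩)
    ((hf₁.reg 0 rfl).trans g0) ((hf₁.reg 4 rfl).trans g4) ((hf₁.reg 50 rfl).trans h50) hu h₁ hw).post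
    fun s₂ hf₂ h₂ => ?_
  obtain ⟨⟨k1, k2, k3⟩, k4, k5⟩ := h₂
  rw [hf₁.arr 6 rfl] at k1
  rw [hf₁.arr 13 rfl] at k2
  rw [hf₁.arr 14 rfl] at k3
  rw [hf₁.arr 7 rfl] at k4
  rw [hf₁.arr 8 rfl] at k5
  constructor <;> intro x hx <;> simp only [State.setReg_arr, k1, k2, k3, k4, k5] <;>
    rcases Nat.lt_succ_iff_lt_or_eq.1 hx with hx | rfl <;>
    first
    | simp only [Function.update_of_ne hx.ne, hI.h6 x hx, hI.h13 x hx, hI.h14 x hx, hI.h7 x hx,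
        hI.h8 x hx]
    | simp only [Function.update_self]

/-- The value of the affine function in `i` at `x`. -/
def affineExpr (i : WExpr) (x : RExpr) : RExpr := .arr 3 i + .arr 4 i * (x - .arr 2 i)

def valuesProg : Prog :=
  .for 50 (.reg 7) (
    .setReg 51 (.arr 6 (.reg 50)) ;;
    .setRReg 1 (.arr 5 (.arr 13 (.reg 50))) ;;
    .setRReg 2 (.arr 5 (.arr 14 (.reg 50))) ;;
    .setRArr 6 (.reg 50) (affineExpr (.reg 51) (.reg 1)) ;;
    .setRArr 7 (.reg 50) (affineExpr (.reg 51) (.reg 2)) ;;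
    .ite (.rlt (.reg 1) (.arr 1 (.reg 51))) (.setRReg 1 (.arr 1 (.reg 51))) .skip ;;
    .ite (.rlt (.arr 1 (.reg 0 + .reg 51)) (.reg 2)) (.setRReg 2 (.arr 1 (.reg 0 + .reg 51))) .skip ;;
    .setRArr 8 (.reg 50) (.reg 1) ;;
    .setRArr 9 (.reg 50) (.reg 2))

/-- The geometric data of the items. -/
structure ItemValues (S : Sweep) (j : ℕ) (s : State) : Prop where
  h6 : ∀ u < j, s.rarr 6 u = S.L u
  h7 : ∀ u < j, s.rarr 7 u = S.R u
  h8 : ∀ u < j, s.rarr 8 u = S.xs u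
  h9 : ∀ u < j, s.rarr 9 u = S.xe u

theorem run_valuesProg {w : ℕ} {S : Sweep} {s : State} (hst : Stored S s)
    (h0 : s.reg 0 = S.n) (h7 : s.reg 7 = S.M) (hI : ItemArrays S S.M s) (hM : S.M < 2 ^ w)
    (hn : 2 * S.n < 2 ^ w) :
    Run w valuesProg s (S.M * 13 + 2) (ItemValues S S.M) := by
  refine Run.for (n := S.M) (T := 11) (ItemValues S) hM rfl
    (fun s' hf => by simpa [hf.reg 7 rfl] using h7) (by constructor <;> simp) ?_
  intro u s' hu hf h50 hV
  have g0 : s'.reg 0 = S.n := (hf.reg 0 rfl).trans h0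
  have hst' : Stored S s' := hst.of_frame hf ⟨rfl, rfl, rfl, rfl, rfl, rfl⟩
  have i6 : s'.arr 6 u = S.seg u := by rw [hf.arr 6 rfl]; exact hI.h6 u hu
  have i13 : s'.arr 13 u = S.lo u := by rw [hf.arr 13 rfl]; exact hI.h13 u hu
  have i14 : s'.arr 14 u = S.hi u := by rw [hf.arr 14 rfl]; exact hI.h14 u hu
  have hsu := Sweep.seg_lt hu
  have v1 : S.X (S.lo u) = S.xl u := rfl
  have v2 : S.X (S.hi u) = S.xr u := rfl
  have v3 : S.y (S.seg u) + S.m (S.seg u) * (S.xl u - S.c (S.seg u)) = S.L u := rfl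
  have v4 : S.y (S.seg u) + S.m (S.seg u) * (S.xr u - S.c (S.seg u)) = S.R u := rfl
  iterate 5 (
    first | refine Run.setReg_seq ?_ | refine Run.setRReg_seq ?_ | refine Run.setRArr_seq ?_
    simp (disch := omega) only [affineExpr, WExpr.eval_arr, WExpr.eval_reg, RExpr.eval_arr,
      RExpr.eval_add, RExpr.eval_sub, RExpr.eval_mul, RExpr.eval_reg, State.setReg_reg,
      State.setReg_arr, State.setReg_rarr, State.setRReg_reg, State.setRReg_arr, State.setRReg_rreg,
      State.setRReg_rarr, State.setRArr_reg, State.setRArr_rreg, State.setRArr_rarr, reduceIte, Nat.reduceEqDiff, h50, i6, i13, i14, hst'.c, hst'.y, hst'.m, hst'.X, v1, v2, v3,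
      v4])
  obtain ⟨s₁, hs₁⟩ : ∃ s₁, s₁ = (((((s'.setReg 51 (S.seg u)).setRReg 1 (S.xl u)).setRReg 2
    (S.xr u)).setRArr 6 u (S.L u)).setRArr 7 u (S.R u)) := ⟨_, rfl⟩
  rw [← hs₁]
  have f0 : s₁.reg 0 = S.n := by rw [hs₁]; simpa using g0
  have f50 : s₁.reg 50 = u := by rw [hs₁]; simpa using h50
  have f51 : s₁.reg 51 = S.seg u := by rw [hs₁]; simp
  have f1 : s₁.rreg 1 = S.xl u := by rw [hs₁]; simp
  have f2 : s₁.rreg 2 = S.xr u := by rw [hs₁]; simp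
  have fr : ∀ i, s₁.rarr 1 i = S.a i := by rw [hs₁]; simpa using hst'.a
  have m1 : max (S.a (S.seg u)) (S.xl u) = S.xs u := rfl
  have m2 : min (S.b (S.seg u)) (S.xr u) = S.xe u := rfl
  refine Run.bind (T₁ := 2) (T₂ := 4) (P := fun s' => s'.rreg 1 = S.xs u ∧ s'.rreg 2 = S.xr u ∧
      s'.rarr = s₁.rarr)
    (Run.ite (T := 1) (fun h => Run.setRReg ?_) (fun h => Run.skip ?_)) ?_
  · simp only [Test.eval_rlt, RExpr.eval_reg, RExpr.eval_arr, WExpr.eval_reg, f1, f51, fr] at h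
    rw [max_eq_left h.le] at m1
    simp only [RExpr.eval_arr, WExpr.eval_reg, f51, fr, State.setRReg_rreg, State.setRReg_rarr,
      reduceIte, Nat.reduceEqDiff, m1, f2, and_self]
  · simp only [Test.eval_rlt, RExpr.eval_reg, RExpr.eval_arr, WExpr.eval_reg, f1, f51, fr,
      not_lt] at h
    rw [max_eq_right h] at m1
    exact ⟨f1.trans m1, f2, rfl⟩
  · rintro s₂ hf₂ ⟨k1, k2, k3⟩
    have k0 : s₂.reg 0 = S.n := (hf₂.reg 0 rfl).trans f0
    have k51 : s₂.reg 51 = S.seg u := (hf₂.reg 51 rfl).trans f51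
    have k50 : s₂.reg 50 = u := (hf₂.reg 50 rfl).trans f50
    refine Run.bind (T₁ := 2) (T₂ := 2) (P := fun s' => s'.rreg 1 = S.xs u ∧ s'.rreg 2 = S.xe u ∧
        s'.rarr = s₁.rarr)
      (Run.ite (T := 1) (fun h => Run.setRReg ?_) (fun h => Run.skip ?_)) ?_
    · simp (disch := omega) only [Test.eval_rlt, RExpr.eval_reg, RExpr.eval_arr, WExpr.eval_reg,
        WExpr.eval_add, k2, k51, k0, k3, fr, mod_pow_of_lt, hst'.a_add] at h
      rw [min_eq_left h.le] at m2
      simp (disch := omega) only [RExpr.eval_arr, WExpr.eval_reg, WExpr.eval_add, k51, k0, k3, fr,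
        State.setRReg_rreg, State.setRReg_rarr, mod_pow_of_lt, hst'.a_add,
        reduceIte, Nat.reduceEqDiff, m2, k1, and_self]
    · simp (disch := omega) only [Test.eval_rlt, RExpr.eval_reg, RExpr.eval_arr, WExpr.eval_reg,
        WExpr.eval_add, k2, k51, k0, k3, fr, mod_pow_of_lt, hst'.a_add, not_lt] at h
      rw [min_eq_right h] at m2
      exact ⟨k1, k2.trans m2, k3⟩
    · rintro s₃ hf₃ ⟨l1, l2, l3⟩
      have l50 : s₃.reg 50 = u := (hf₃.reg 50 rfl).trans k50
      refine Run.setRArr_seq (Run.setRArr ?_)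
      constructor <;> intro x hx <;>
        simp only [RExpr.eval_reg, WExpr.eval_reg, State.setRArr_reg, State.setRArr_rreg,
          State.setReg_rarr, State.setRArr_rarr, l1, l2, l3, l50, hs₁, State.setRReg_rarr,
          Nat.reduceEqDiff, reduceIte] <;>
        rcases Nat.lt_succ_iff_lt_or_eq.1 hx with hx | rfl <;>
        first
        | simp only [hx.ne, reduceIte, hV.h6 x hx, hV.h7 x hx, hV.h8 x hx, hV.h9 x hx]
        | simp only [reduceIte]

/-! ### Greedy assignment of items to chains. -/

namespace Sweep
variable (S : Sweep)

noncomputable def pos1 (x : ℕ) : ℕ := rank S.lt1 S.M x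

/-- The first `q` chains have been assigned, and the remaining items are marked with `k`. -/
structure LayInv (k q : ℕ) (lam : ℕ → ℕ) : Prop where
  rng : ∀ x < S.M, lam x < q ∨ lam x = k
  inc : ∀ x < S.M, ∀ y < S.M, S.lt1 x y → S.ck x ≠ 0 → S.ck x = S.ck y → lam x = lam y →
    lam x < q → S.R x < S.R y
  dom : ∀ q' < q, ∀ y < S.M, S.ck y ≠ 0 → q' < lam y →
    ∃ x < S.M, S.lt1 x y ∧ S.ck x = S.ck y ∧ lam x = q' ∧ S.R y ≤ S.R x

/-- The first `j` items have been considered for the chain `q`; the last item on the chain is in the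
node `κ` and has the right height `cur`. -/
structure RoundInv (k q j : ℕ) (lam : ℕ → ℕ) (κ : ℕ) (cur : ℝ) : Prop where
  rng : ∀ x < S.M, lam x < q ∨ lam x = q ∧ S.pos1 x < j ∨ lam x = k
  inc : ∀ x < S.M, ∀ y < S.M, S.lt1 x y → S.ck x ≠ 0 → S.ck x = S.ck y → lam x = lam y →
    lam x < q + 1 → S.R x < S.R y
  dom : ∀ q' < q, ∀ y < S.M, S.ck y ≠ 0 → q' < lam y →
    ∃ x < S.M, S.lt1 x y ∧ S.ck x = S.ck y ∧ lam x = q' ∧ S.R y ≤ S.R x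
  dom' : ∀ y < S.M, S.pos1 y < j → S.ck y ≠ 0 → q < lam y →
    ∃ x < S.M, S.lt1 x y ∧ S.ck x = S.ck y ∧ lam x = q ∧ S.R y ≤ S.R x
  c1 : ∀ x < S.M, lam x = q → S.ck x ≤ κ ∧ (S.ck x = κ → S.R x ≤ cur)
  c2 : κ ≠ 0 → ∃ x < S.M, S.pos1 x < j ∧ lam x = q ∧ S.ck x = κ ∧ S.R x = cur

variable {S} {k q j : ℕ} {lam : ℕ → ℕ} {κ : ℕ} {cur : ℝ}

theorem pos1_lt_iff {x y : ℕ} (hx : x < S.M) (hy : y < S.M) : S.pos1 x < S.pos1 y ↔ S.lt1 x y :=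
  (S.strictOn_lt1 S.M).rank_lt_iff hx hy

theorem LayInv.start (h : S.LayInv k q lam) (hq : q < k) : S.RoundInv k q 0 lam 0 cur where
  rng x hx := by have := h.rng x hx; omega
  inc x hx y hy h1 h2 h3 h4 h5 := by
    have := h.rng x hx
    exact h.inc x hx y hy h1 h2 h3 h4 (by omega)
  dom := h.dom
  dom' y _ h1 := absurd h1 (by omega)
  c1 x hx h1 := by have := h.rng x hx; omega
  c2 h1 := absurd rfl h1

theorem RoundInv.finish (h : S.RoundInv k q S.M lam κ cur) : S.LayInv k (q + 1) lam where
  rng x hx := by have := h.rng x hx; omega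
  inc := h.inc
  dom q' hq' y hy h1 h2 := by
    rcases Nat.lt_succ_iff_lt_or_eq.1 hq' with h3 | rfl
    · exact h.dom q' h3 y hy h1 h2
    · exact h.dom' y hy ((S.strictOn_lt1 S.M).rank_lt hy) h1 h2

/-- An item that is passed over already has a chain, or is not canonical, or is dominated by the
last item of the current chain in its node; the latter is the witness for `dom'`. -/
theorem RoundInv.skip (h : S.RoundInv k q j lam κ cur) {y : ℕ} (hy : y < S.M) (hj : S.pos1 y = j)
    (hskip : lam y ≠ k ∨ S.ck y = 0 ∨ S.ck y = κ ∧ S.R y ≤ cur) :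
    S.RoundInv k q (j + 1) lam κ cur where
  rng x hx := by have := h.rng x hx; omega
  inc := h.inc
  dom := h.dom
  dom' z hz h1 h2 h3 := by
    rcases Nat.lt_succ_iff_lt_or_eq.1 h1 with h4 | h4
    · exact h.dom' z hz h4 h2 h3
    · obtain rfl := (S.strictOn_lt1 S.M).rank_inj hz hy (h4.trans hj.symm)
      have := h.rng z hz
      rcases hskip with h5 | h5 | ⟨h5, h6⟩
      · omega
      · exact absurd h5 h2
      · obtain ⟨x, hx, x1, x2, x3, x4⟩ := h.c2 (h5 ▸ h2)
        exact ⟨x, hx, (pos1_lt_iff hx hz).1 (by omega), x3.trans h5.symm, x2, x4 ▸ h6⟩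
  c1 := h.c1
  c2 h1 := by
    obtain ⟨x, hx, x1, x2⟩ := h.c2 h1
    exact ⟨x, hx, by omega, x2⟩

/-- Items come sorted by node, so either `y` opens a new node or its right height exceeds `cur`, the
largest right height of the chain in this node. In both cases the chain stays increasing. -/
theorem RoundInv.assign (h : S.RoundInv k q j lam κ cur) (hq : q < k) {y : ℕ} (hy : y < S.M)
    (hj : S.pos1 y = j) (h1 : lam y = k) (h2 : S.ck y ≠ 0) (h3 : ¬ (S.ck y = κ ∧ S.R y ≤ cur)) :
    S.RoundInv k q (j + 1) (Function.update lam y q) (S.ck y) (S.R y) := by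
  have hup : ∀ x, x ≠ y → Function.update lam y q x = lam x := fun x hx => Function.update_of_ne hx _ _
  have hself : Function.update lam y q y = q := Function.update_self _ _ _
  have hpre : ∀ x < S.M, lam x = q → S.lt1 x y := fun x hx hxq => by
    have := h.rng x hx
    exact (pos1_lt_iff hx hy).1 (by omega)
  have hκ : κ ≤ S.ck y := by
    rcases Nat.eq_zero_or_pos κ with h0 | h0
    · omega
    · obtain ⟨x, hx, x1, x2, x3, -⟩ := h.c2 h0.ne'
      rcases hpre x hx x2 with h4 | h4
      · omega
      · omega
  have key : ∀ x < S.M, lam x = q → S.ck x = S.ck y → S.R x < S.R y := fun x hx hxq hc => by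
    obtain ⟨c1, c1'⟩ := h.c1 x hx hxq
    have hk : S.ck y = κ := by omega
    have := c1' (hc.trans hk)
    by_contra h4
    exact h3 ⟨hk, (not_lt.1 h4).trans this⟩
  refine ⟨fun x hx => ?_, fun x hx z hz a1 a2 a3 a4 a5 => ?_, fun q' hq' z hz a1 a2 => ?_,
    fun z hz a1 a2 a3 => ?_, fun x hx a1 => ?_, fun _ => ⟨y, hy, by omega, hself, rfl, rfl⟩⟩
  · rcases eq_or_ne x y with rfl | hne
    · right; left; exact ⟨hself, by omega⟩
    · rw [hup x hne]; have := h.rng x hx; omega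
  · rcases eq_or_ne x y with rfl | hxy
    · rcases eq_or_ne z x with rfl | hzx
      · exact absurd a1 ((S.strictOn_lt1 S.M).irrefl z hz)
      · rw [hself, hup z hzx] at a4
        exact absurd ((S.strictOn_lt1 S.M).trans _ hx _ hz _ hx a1 (hpre z hz a4.symm))
          ((S.strictOn_lt1 S.M).irrefl x hx)
    · rw [hup x hxy] at a4 a5
      rcases eq_or_ne z y with rfl | hzy
      · rw [hself] at a4
        exact key x hx a4 a3
      · rw [hup z hzy] at a4
        exact h.inc x hx z hz a1 a2 a3 a4 a5
  · have a3 : q' < lam z := by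
      rcases eq_or_ne z y with rfl | hzy
      · omega
      · rwa [hup z hzy] at a2
    obtain ⟨x, hx, x1, x2, x3, x4⟩ := h.dom q' hq' z hz a1 a3
    refine ⟨x, hx, x1, x2, ?_, x4⟩
    rwa [hup x]
    rintro rfl
    omega
  · have hzy : z ≠ y := by
      rintro rfl
      rw [hself] at a3
      omega
    rw [hup z hzy] at a3
    have : S.pos1 z < j := by
      refine lt_of_le_of_ne (by omega) fun e => hzy ?_
      exact (S.strictOn_lt1 S.M).rank_inj hz hy (e.trans hj.symm)
    obtain ⟨x, hx, x1, x2, x3, x4⟩ := h.dom' z hz this a2 a3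
    refine ⟨x, hx, x1, x2, ?_, x4⟩
    rwa [hup x]
    rintro rfl
    omega
  · rcases eq_or_ne x y with rfl | hxy
    · exact ⟨le_rfl, fun _ => le_rfl⟩
    · rw [hup x hxy] at a1
      exact ⟨((h.c1 x hx a1).1).trans hκ, fun e => (key x hx a1 e).le⟩

theorem LayInv.layers (h : S.LayInv k k lam) : S.Layers k lam where
  inc := h.inc
  dom y hy q hq h1 h2 := h.dom q hq y hy h1 (by omega)
  le x hx := by have := h.rng x hx; omega

end Sweep

/-! ## Sorting the items and assigning the chains -/

def lt1Test (e₁ e₂ : WExpr) : Test :=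
  .or (.wlt (.arr 7 e₁) (.arr 7 e₂)) (.and (.weq (.arr 7 e₁) (.arr 7 e₂))
    (.or (.rlt (.arr 6 e₁) (.arr 6 e₂)) (.and (.req (.arr 6 e₁) (.arr 6 e₂)) (.wlt e₁ e₂))))

def sort1Prog : Prog :=
  .setReg 30 (.reg 7) ;; .setReg 29 (.reg 5) ;;
  sortProg lt1Test ;;
  .for 50 (.reg 7) (
    .setArr 15 (.reg 50) (.arr 12 (.reg 50)) ;;
    .setArr 16 (.reg 50) (.arr 10 (.reg 50)))

/-- Arrays `15` and `16` hold the positions of the items, and the sorted sequence. -/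
def Sorted1 (S : Sweep) (s : State) : Prop :=
  ∀ x < S.M, s.arr 15 x = S.pos1 x ∧ s.arr 16 (S.pos1 x) = x

theorem run_sort1Prog {w tm : ℕ} {S : Sweep} {s : State} (hs : s.Bounded w)
    (h5 : s.reg 5 = tm) (h7 : s.reg 7 = S.M) (hI : ItemArrays S S.M s) (hV : ItemValues S S.M s)
    (hM : S.M < 2 ^ tm) (hw : 8 * 2 ^ tm + 4 < 2 ^ w) :
    Run w sort1Prog s ((tm + 1) * (S.M * (4 * tm + 18) + 16) + (S.M * 4 + 4)) (Sorted1 S) := by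
  have st := S.strictOn_lt1 S.M
  refine Run.time (T₁ := ((tm + 1) * (S.M * (4 * tm + 18) + 16) + (S.M * 4 + 2)) + 1 + 1) ?_
    (by omega)
  refine Run.setReg_seq (Run.setReg_seq ?_)
  obtain ⟨s₁, hs₁⟩ : ∃ s₁, s₁ = ((s.setReg 30 (WExpr.eval w s (.reg 7))).setReg 29
    (WExpr.eval w (s.setReg 30 (WExpr.eval w s (.reg 7))) (.reg 5))) := ⟨_, rfl⟩
  rw [← hs₁]
  have hb : s₁.Bounded w := by
    rw [hs₁]
    exact (hs.setReg _ (WExpr.eval_lt hs _)).setReg _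
      (WExpr.eval_lt (hs.setReg _ (WExpr.eval_lt hs _)) _)
  have e30 : s₁.reg 30 = S.M := by rw [hs₁]; simpa using h7
  have e29 : s₁.reg 29 = tm := by rw [hs₁]; simpa using h5
  have e7 : s₁.reg 7 = S.M := by rw [hs₁]; simpa using h7
  have a7 : s₁.arr 7 = s.arr 7 := by rw [hs₁]; rfl
  have a6 : s₁.rarr 6 = s.rarr 6 := by rw [hs₁]; rfl
  refine Run.bind (run_sortProg st (s := s₁) hb hM.le hw e30 e29 ?_) fun s₂ hf₂ h2 => ?_
  · intro s' hf e₁ e₂ h1 h2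
    have k7 : s'.arr 7 = s.arr 7 := by rw [hf.arr 7 rfl, a7]
    have k6 : s'.rarr 6 = s.rarr 6 := by rw [hf.rarr 6 rfl, a6]
    simp only [lt1Test, Test.eval_or, Test.eval_rlt, Test.eval_and, Test.eval_req, Test.eval_wlt,
      Test.eval_weq, WExpr.eval_arr, RExpr.eval_arr, k7, k6, hI.h7 _ h1, hI.h7 _ h2, hV.h6 _ h1,
      hV.h6 _ h2, Sweep.lt1]
  · have f7 : s₂.reg 7 = S.M := by rw [hf₂.reg 7 rfl, e7]
    refine (Run.for (n := S.M) (T := 2) (fun j s' => ∀ x < j, s'.arr 15 x = s₂.arr 12 x ∧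
      s'.arr 16 x = s₂.arr 10 x) (by omega) rfl
      (fun s' hf => by rw [WExpr.eval_reg, hf.reg 7 rfl, f7]) (by simp) ?_).post ?_
    · intro j s' hj hf h50 hI
      have g12 : s'.arr 12 = s₂.arr 12 := hf.arr 12 rfl
      have g10 : s'.arr 10 = s₂.arr 10 := hf.arr 10 rfl
      refine Run.setArr_seq (Run.setArr ?_)
      intro x hx
      simp only [State.setReg_arr, State.setArr_arr, State.setArr_reg, WExpr.eval_reg,
        WExpr.eval_arr, h50, g12, g10, Nat.reduceEqDiff, reduceIte]
      rcases Nat.lt_succ_iff_lt_or_eq.1 hx with hx | rfl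
      · rw [if_neg (by omega), if_neg (by omega)]; exact hI x hx
      · simp
    · intro s' hf h3 x hx
      have hp : S.pos1 x < S.M := st.rank_lt hx
      refine ⟨by rw [(h3 x hx).1, (h2 x hx).2]; rfl, ?_⟩
      rw [(h3 _ hp).2]
      exact (h2 x hx).1

def layerTest (k : ℕ) : Test :=
  .and (.weq (.arr 17 (.reg 54)) (.const k)) (.and (.not (.weq (.arr 7 (.reg 54)) 0))
    (.not (.and (.weq (.arr 7 (.reg 54)) (.reg 52)) (.not (.rlt (.reg 1) (.arr 7 (.reg 54)))))))

def roundProg (k : ℕ) : Prog :=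
  .setReg 52 0 ;;
  .for 53 (.reg 7) (
    .setReg 54 (.arr 16 (.reg 53)) ;;
    .ite (layerTest k)
      (.setArr 17 (.reg 54) (.reg 51) ;; .setReg 52 (.arr 7 (.reg 54)) ;;
        .setRReg 1 (.arr 7 (.reg 54)))
      .skip)

def layersProg (k : ℕ) : Prog :=
  .for 50 (.reg 7) (.setArr 17 (.reg 50) (.const k)) ;;
  .for 51 (.const k) (roundProg k)

theorem run_roundProg {w k q : ℕ} {S : Sweep} {s : State} (hq : q < k) (hk : k < 2 ^ w)
    (h7 : s.reg 7 = S.M) (hM : S.M < 2 ^ w) (h51 : s.reg 51 = q) (hI : ItemArrays S S.M s)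
    (hV : ItemValues S S.M s) (hs1 : Sorted1 S s) (hlam : S.LayInv k q (s.arr 17)) :
    Run w (roundProg k) s (S.M * 7 + 3) (fun s' => S.LayInv k (q + 1) (s'.arr 17)) := by
  refine Run.setReg_seq ?_
  obtain ⟨s₁, hs₁⟩ : ∃ s₁, s₁ = s.setReg 52 (WExpr.eval w s 0) := ⟨_, rfl⟩
  rw [← hs₁]
  have e52 : s₁.reg 52 = 0 := by rw [hs₁]; simp
  have e7 : s₁.reg 7 = S.M := by rw [hs₁]; simpa using h7
  have e51 : s₁.reg 51 = q := by rw [hs₁]; simpa using h51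
  have ea : s₁.arr = s.arr := by rw [hs₁]; rfl
  have er : s₁.rarr = s.rarr := by rw [hs₁]; rfl
  refine (Run.for (n := S.M) (T := 5)
    (fun j s' => S.RoundInv k q j (s'.arr 17) (s'.reg 52) (s'.rreg 1)) hM rfl
    (fun s' hf => by rw [WExpr.eval_reg, hf.reg 7 rfl, e7]) ?_ ?_).post fun s' _ h => h.finish
  · simp only [State.setReg_arr, State.setReg_reg, State.setReg_rreg, Nat.reduceEqDiff, reduceIte,
      ea, e52]
    exact hlam.start hq
  · intro j s' hj hf h53 hR
    obtain ⟨y, hy, hyj⟩ := (S.strictOn_lt1 S.M).rank_surj hj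
    have hyj' : S.pos1 y = j := hyj
    have g16 : s'.arr 16 j = y := by rw [hf.arr 16 rfl, ea, ← hyj']; exact (hs1 y hy).2
    have g7 : s'.arr 7 y = S.ck y := by rw [hf.arr 7 rfl, ea]; exact hI.h7 y hy
    have gr7 : s'.rarr 7 y = S.R y := by rw [hf.rarr 7 rfl, er]; exact hV.h7 y hy
    have g51 : s'.reg 51 = q := by rw [hf.reg 51 rfl, e51]
    refine Run.setReg_seq (Run.ite (T := 3) (fun h => ?_) (fun h => ?_))
    · simp (disch := omega) only [layerTest, Test.eval_and, Test.eval_not, Test.eval_weq,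
        Test.eval_rlt, WExpr.eval_arr, WExpr.eval_reg, WExpr.eval_const, WExpr.eval_ofNat,
        RExpr.eval_reg, RExpr.eval_arr, State.setReg_reg, State.setReg_arr, State.setReg_rreg,
        State.setReg_rarr, reduceIte, Nat.reduceEqDiff, mod_pow_of_lt, h53, g16, g7,
        gr7, not_lt] at h
      obtain ⟨h1, h2, h3⟩ := h
      refine Run.setArr_seq (Run.setReg_seq (Run.setRReg ?_))
      simp only [WExpr.eval_arr, WExpr.eval_reg, RExpr.eval_arr, State.setReg_reg, State.setReg_arr,
        State.setReg_rreg, State.setReg_rarr, State.setArr_reg, State.setArr_rarr,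
        State.setRReg_rreg, State.setRReg_arr, State.setRReg_reg, reduceIte, Nat.reduceEqDiff, h53,
        g16, gr7, g51, State.setArr_arr, g7]
      have := hR.assign hq hy hyj' h1 h2 h3
      convert this using 1
      simp [State.setArr]
    · simp (disch := omega) only [layerTest, Test.eval_and, Test.eval_not, Test.eval_weq,
        Test.eval_rlt, WExpr.eval_arr, WExpr.eval_reg, WExpr.eval_const, WExpr.eval_ofNat,
        RExpr.eval_reg, RExpr.eval_arr, State.setReg_reg, State.setReg_arr, State.setReg_rreg,
        State.setReg_rarr, reduceIte, Nat.reduceEqDiff, mod_pow_of_lt, h53, g16, g7,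
        gr7, not_lt] at h
      refine (Run.skip ?_).time (by omega)
      simp only [State.setReg_arr, State.setReg_reg, State.setReg_rreg, Nat.reduceEqDiff, reduceIte]
      refine hR.skip hy hyj' ?_
      tauto

theorem ItemArrays.of_frame {w : ℕ} {S : Sweep} {j : ℕ} {s s' : State} {p : Prog}
    (h : ItemArrays S j s) (hf : Frame w p s s') (hp : p.modArr 6 = false ∧ p.modArr 13 = false ∧
      p.modArr 14 = false ∧ p.modArr 7 = false ∧ p.modArr 8 = false) : ItemArrays S j s' := by
  obtain ⟨p1, p2, p3, p4, p5⟩ := hp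
  exact ⟨by rw [hf.arr 6 p1]; exact h.h6, by rw [hf.arr 13 p2]; exact h.h13,
    by rw [hf.arr 14 p3]; exact h.h14, by rw [hf.arr 7 p4]; exact h.h7,
    by rw [hf.arr 8 p5]; exact h.h8⟩

theorem ItemValues.of_frame {w : ℕ} {S : Sweep} {j : ℕ} {s s' : State} {p : Prog}
    (h : ItemValues S j s) (hf : Frame w p s s') (hp : p.modRArr 6 = false ∧ p.modRArr 7 = false ∧
      p.modRArr 8 = false ∧ p.modRArr 9 = false) : ItemValues S j s' := by
  obtain ⟨p1, p2, p3, p4⟩ := hp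
  exact ⟨by rw [hf.rarr 6 p1]; exact h.h6, by rw [hf.rarr 7 p2]; exact h.h7,
    by rw [hf.rarr 8 p3]; exact h.h8, by rw [hf.rarr 9 p4]; exact h.h9⟩

theorem Sorted1.of_frame {w : ℕ} {S : Sweep} {s s' : State} {p : Prog}
    (h : Sorted1 S s) (hf : Frame w p s s') (hp : p.modArr 15 = false ∧ p.modArr 16 = false) :
    Sorted1 S s' := by
  unfold Sorted1
  rw [hf.arr 15 hp.1, hf.arr 16 hp.2]
  exact h

/-- The mark `k` serves for items not yet assigned, so after `k` rounds it remains exactly on the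
left-over items and on those that are not canonical. -/
theorem run_layersProg {w k : ℕ} {S : Sweep} {s : State} (hk : k < 2 ^ w)
    (h7 : s.reg 7 = S.M) (hM : S.M < 2 ^ w) (hI : ItemArrays S S.M s)
    (hV : ItemValues S S.M s) (hs1 : Sorted1 S s) :
    Run w (layersProg k) s (S.M * 3 + 2 + (k * (S.M * 7 + 3 + 2) + 2))
      (fun s' => S.Layers k (s'.arr 17)) := by
  refine Run.bind (P := fun s' => S.LayInv k 0 (s'.arr 17))
    ((Run.for (n := S.M) (T := 1) (fun j s' => ∀ x < j, s'.arr 17 x = k) hM rfl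
      (fun s' hf => by rw [WExpr.eval_reg, hf.reg 7 rfl, h7]) (by simp) ?_).post ?_) ?_
  · intro j s' hj hf h50 hA
    refine Run.setArr fun x hx => ?_
    simp only [State.setReg_arr, State.setArr_arr, WExpr.eval_reg, WExpr.eval_const,
      mod_pow_of_lt hk, h50, reduceIte]
    split_ifs with h
    · rfl
    · exact hA x (by omega)
  · intro s' hf h
    exact ⟨fun x hx => .inr (h x hx), fun x _ y _ _ _ _ _ h => absurd h (by omega),
      fun q hq => absurd hq (by omega)⟩
  · intro s₁ hf₁ h₁
    refine (Run.for (n := k) (T := S.M * 7 + 3) (fun q s' => S.LayInv k q (s'.arr 17)) hk rfl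
      (fun s' hf => by rw [WExpr.eval_const, mod_pow_of_lt hk]) h₁ ?_).post fun s' _ h => h.layers
    intro q s' hq hf h51 hL
    have := hf₁.reg 7 rfl
    exact (run_roundProg hq hk (by rw [hf.reg 7 rfl, hf₁.reg 7 rfl, h7]) hM h51
      ((hI.of_frame hf₁ ⟨rfl, rfl, rfl, rfl, rfl⟩).of_frame hf ⟨rfl, rfl, rfl, rfl, rfl⟩)
      ((hV.of_frame hf₁ ⟨rfl, rfl, rfl, rfl⟩).of_frame hf ⟨rfl, rfl, rfl, rfl⟩)
      ((hs1.of_frame hf₁ ⟨rfl, rfl⟩).of_frame hf ⟨rfl, rfl⟩) hL).post fun s₂ _ h => h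

def lt2Test (e₁ e₂ : WExpr) : Test :=
  .or (.wlt (.arr 7 e₁) (.arr 7 e₂)) (.and (.weq (.arr 7 e₁) (.arr 7 e₂))
    (.or (.wlt (.arr 17 e₁) (.arr 17 e₂)) (.and (.weq (.arr 17 e₁) (.arr 17 e₂))
      (.wlt (.arr 15 e₁) (.arr 15 e₂)))))

def sort2Prog : Prog :=
  .setReg 30 (.reg 7) ;; .setReg 29 (.reg 5) ;; sortProg lt2Test

theorem run_sort2Prog {w tm : ℕ} {S : Sweep} {s : State} (hs : s.Bounded w)
    (h5 : s.reg 5 = tm) (h7 : s.reg 7 = S.M) (hI : ItemArrays S S.M s) (hs1 : Sorted1 S s)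
    (hM : S.M < 2 ^ tm) (hw : 8 * 2 ^ tm + 4 < 2 ^ w) :
    Run w sort2Prog s ((tm + 1) * (S.M * (4 * tm + 18) + 16) + 2)
      (fun s' => ∀ x < S.M, s'.arr 10 (S.pos2 (s.arr 17) x) = x ∧
        s'.arr 12 x = S.pos2 (s.arr 17) x) := by
  refine Run.setReg_seq (T := (tm + 1) * (S.M * (4 * tm + 18) + 16) + 1) (Run.setReg_seq ?_)
  obtain ⟨s₁, hs₁⟩ : ∃ s₁, s₁ = ((s.setReg 30 (WExpr.eval w s (.reg 7))).setReg 29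
    (WExpr.eval w (s.setReg 30 (WExpr.eval w s (.reg 7))) (.reg 5))) := ⟨_, rfl⟩
  rw [← hs₁]
  have hb : s₁.Bounded w := by
    rw [hs₁]
    exact (hs.setReg _ (WExpr.eval_lt hs _)).setReg _
      (WExpr.eval_lt (hs.setReg _ (WExpr.eval_lt hs _)) _)
  have e30 : s₁.reg 30 = S.M := by rw [hs₁]; simpa using h7
  have e29 : s₁.reg 29 = tm := by rw [hs₁]; simpa using h5
  have ea : s₁.arr = s.arr := by rw [hs₁]; rfl
  refine run_sortProg (S.strictOn_lt2 (s.arr 17) S.M) hb hM.le hw e30 e29 ?_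
  intro s' hf e₁ e₂ h1 h2
  have k7 : s'.arr 7 = s.arr 7 := by rw [hf.arr 7 rfl, ea]
  have k15 : s'.arr 15 = s.arr 15 := by rw [hf.arr 15 rfl, ea]
  have k17 : s'.arr 17 = s.arr 17 := by rw [hf.arr 17 rfl, ea]
  simp only [lt2Test, Test.eval_or, Test.eval_and, Test.eval_wlt, Test.eval_weq, WExpr.eval_arr, k7,
    k15, k17, hI.h7 _ h1, hI.h7 _ h2, (hs1 _ h1).1, (hs1 _ h2).1, Sweep.pos1_lt_iff h1 h2, Sweep.lt2]

/-! ## The table of bicliques -/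

/-- The item `x` passes below the item `u` at the point in real array `a`. -/
def passTest (a : ℕ) (x u : WExpr) : Test :=
  .rlt (affineExpr (.arr 6 x) (.arr a u)) (affineExpr (.arr 6 u) (.arr a u))

/-- As `passTest`, with the roles exchanged. -/
def passTest' (a : ℕ) (x u : WExpr) : Test :=
  .rlt (affineExpr (.arr 6 u) (.arr a u)) (affineExpr (.arr 6 x) (.arr a u))

/-- Compares the item at the probed position with the chain `56` of the node of item `53`, first by
node and then by chain; `t` decides within the chain. -/
def posTest (t : Test) : Test :=
  .or (.wlt (.arr 7 (.arr 10 (.reg 37))) (.arr 8 (.reg 53)))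
    (.and (.weq (.arr 7 (.arr 10 (.reg 37))) (.arr 8 (.reg 53)))
      (.or (.wlt (.arr 17 (.arr 10 (.reg 37))) (.reg 56))
        (.and (.weq (.arr 17 (.arr 10 (.reg 37))) (.reg 56)) t)))

def loTest : Test :=
  posTest (.and (passTest 8 (.arr 10 (.reg 37)) (.reg 53)) (passTest 9 (.arr 10 (.reg 37)) (.reg 53)))

def hiTest : Test :=
  posTest (.not (.and (passTest' 8 (.arr 10 (.reg 37)) (.reg 53))
    (passTest' 9 (.arr 10 (.reg 37)) (.reg 53))))

/-- Register `59` becomes the biclique that contains a block of the chain `56` next to the item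
`53`, where `54` is the level and `55` the length of the block. -/
def blockProg : Prog :=
  .setReg 35 0 ;; .setReg 36 (.reg 7) ;; bsearch loTest ;; .setReg 57 (.reg 35) ;;
  .setReg 35 0 ;; .setReg 36 (.reg 7) ;; bsearch hiTest ;; .setReg 58 (.reg 35) ;;
  .ite (.weq (.reg 51 / 2 % 2) 0) (.setReg 60 ((.reg 57 + .reg 55 - 1) / .reg 55))
    (.setReg 60 (.reg 58 / .reg 55 - 1)) ;;
  .ite (.and (.not (.wlt (.reg 60 * .reg 55) (.reg 57)))
      (.not (.wlt (.reg 58) ((.reg 60 + 1) * .reg 55))))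
    (.setReg 59 (2 * (.reg 60 * .reg 5 + .reg 54 + 1) + 1)) .skip

/-- The state in which the bicliques are computed. -/
structure Table (S : Sweep) (k tm : ℕ) (lam : ℕ → ℕ) (s : State) : Prop where
  h5 : s.reg 5 = tm
  h7 : s.reg 7 = S.M
  st : Stored S s
  hI : ItemArrays S S.M s
  hV : ItemValues S S.M s
  h17 : s.arr 17 = lam
  h10 : ∀ x < S.M, s.arr 10 (S.pos2 lam x) = x ∧ s.arr 12 x = S.pos2 lam x

theorem Table.of_frame {w k tm : ℕ} {S : Sweep} {lam : ℕ → ℕ} {s s' : State} {p : Prog}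
    (h : Table S k tm lam s) (hf : Frame w p s s')
    (hp : (p.modReg 5 = false ∧ p.modReg 7 = false ∧ p.modArr 17 = false ∧ p.modArr 10 = false ∧
      p.modArr 12 = false) ∧ (p.modRArr 1 = false ∧ p.modRArr 2 = false ∧ p.modRArr 3 = false ∧
      p.modRArr 4 = false ∧ p.modRArr 5 = false ∧ p.modArr 3 = false) ∧
      (p.modArr 6 = false ∧ p.modArr 13 = false ∧ p.modArr 14 = false ∧ p.modArr 7 = false ∧
        p.modArr 8 = false) ∧
      (p.modRArr 6 = false ∧ p.modRArr 7 = false ∧ p.modRArr 8 = false ∧ p.modRArr 9 = false)) :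
    Table S k tm lam s' := by
  obtain ⟨⟨a, b, c, d, e⟩, h2, h3, h4⟩ := hp
  exact ⟨(hf.reg 5 a).trans h.h5, (hf.reg 7 b).trans h.h7, h.st.of_frame hf h2, h.hI.of_frame hf h3,
    h.hV.of_frame hf h4, (hf.arr 17 c).trans h.h17, by
      rw [hf.arr 10 d, hf.arr 12 e]; exact h.h10⟩

theorem eval_passTest {w u x : ℕ} {S : Sweep} {k tm : ℕ} {lam : ℕ → ℕ} {s : State}
    (h : Table S k tm lam s) (hu : u < S.M) (hx : x < S.M) {ex eu : WExpr} (h1 : ex.eval w s = x)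
    (h2 : eu.eval w s = u) :
    ((passTest 8 ex eu).eval w s ∧ (passTest 9 ex eu).eval w s ↔ S.Below x u) ∧
      ((passTest' 8 ex eu).eval w s ∧ (passTest' 9 ex eu).eval w s ↔ S.Above x u) := by
  simp only [passTest, passTest', affineExpr, Test.eval_rlt, RExpr.eval_arr, RExpr.eval_add,
    RExpr.eval_mul, RExpr.eval_sub, WExpr.eval_arr, h1, h2, h.hI.h6 _ hu, h.hI.h6 _ hx, h.st.c,
    h.st.y, h.st.m, h.hV.h8 _ hu, h.hV.h9 _ hu, Sweep.Below, Sweep.Above, Sweep.f, and_self]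

/-- Both ends of the range are found by binary search, since `PLo` and `PHi` hold on initial
segments of the sorted items. -/
theorem run_blockProg {w k tm u q t sd : ℕ} {S : Sweep} (hS : S.Good) {lam : ℕ → ℕ}
    (hl : S.Layers k lam) {s : State}
    (h : Table S k tm lam s) (hu : u < S.M) (hd : S.dk u ≠ 0) (hq : q < k) (ht : t < tm)
    (h53 : s.reg 53 = u) (h54 : s.reg 54 = t) (h55 : s.reg 55 = 2 ^ t) (h56 : s.reg 56 = q)
    (hsd : s.reg 51 / 2 % 2 = sd) (hb51 : s.reg 51 < 2 ^ w)
    (h59 : s.reg 59 = 0) (hM : S.M < 2 ^ tm) (hw : 8 * 2 ^ tm + 4 < 2 ^ w)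
    (hw2 : 2 * ((S.M + 1) * tm) + 2 < 2 ^ w) :
    Run w blockProg s (8 * tm + 14) (fun s' => s'.reg 59 =
      open scoped Classical in if S.BlkOk lam u q t sd then
        2 * (S.blk lam u q t sd * tm + t + 1) + 1 else 0) := by
  classical
  have hcL : S.cLo lam u q ≤ S.M := (Finset.card_filter_le _ _).trans (by simp)
  have hcH := Sweep.cHi_le (S := S) (lam := lam) u q
  have h2t : 2 ^ t ≤ 2 ^ tm := Nat.pow_le_pow_right (by omega) ht.le
  have h2t0 : 0 < 2 ^ t := Nat.two_pow_pos t
  have cmp : ∀ (c : Test) (P : ℕ → Prop) (ans : ℕ),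
      (∀ s', Table S k tm lam s' → s'.reg 53 = u → s'.reg 56 = q → ∀ x < S.M,
        s'.arr 10 (s'.reg 37) = x → (c.eval w s' ↔ P x)) →
      (∀ x < S.M, S.pos2 lam x < ans ↔ P x) → ∀ s' m, Table S k tm lam s' → s'.reg 53 = u →
      s'.reg 56 = q → m < S.M → s'.reg 37 = m → (c.eval w s' ↔ m < ans) := by
    intro c P ans hc hans s' m hT g53 g56 hm g37
    obtain ⟨x, hx, hxm⟩ := (S.strictOn_lt2 lam S.M).rank_surj hm
    have hxm' : S.pos2 lam x = m := hxm
    rw [hc s' hT g53 g56 x hx (by rw [g37, ← hxm']; exact (hT.h10 x hx).1), ← hans x hx, hxm']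
  have cmpLo := cmp loTest (S.PLo lam u q) (S.cLo lam u q) (fun s' hT g53 g56 x hx g => by
    have e := (eval_passTest (w := w) hT hu hx (ex := .arr 10 (.reg 37)) (eu := .reg 53) g g53).1
    simp only [loTest, posTest, Test.eval_or, Test.eval_and, Test.eval_wlt, Test.eval_weq,
      WExpr.eval_arr, WExpr.eval_reg, g, g53, g56, hT.hI.h7 _ hx, hT.hI.h8 _ hu, hT.h17, e,
      Sweep.PLo]) (fun x hx => hS.lt_cLo_iff hl hu hd hq hx)
  have cmpHi := cmp hiTest (S.PHi lam u q) (S.cHi lam u q) (fun s' hT g53 g56 x hx g => by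
    have e := (eval_passTest (w := w) hT hu hx (ex := .arr 10 (.reg 37)) (eu := .reg 53) g g53).2
    simp only [hiTest, posTest, Test.eval_or, Test.eval_and, Test.eval_not, Test.eval_wlt,
      Test.eval_weq, WExpr.eval_arr, WExpr.eval_reg, g, g53, g56, hT.hI.h7 _ hx, hT.hI.h8 _ hu,
      hT.h17, e, Sweep.PHi]) (fun x hx => hS.lt_cHi_iff hl hu hd hq hx)
  refine Run.time (T₁ := (4 * tm + 1 + ((4 * tm + 1 + (2 + 2 + 1)) + 1 + 1 + 1)) + 1 + 1) ?_
    (by omega)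
  refine Run.setReg_seq (Run.setReg_seq ?_)
  obtain ⟨s₁, hs₁⟩ : ∃ s₁, s₁ = ((s.setReg 35 0).setReg 36 S.M) := ⟨_, rfl⟩
  simp only [WExpr.eval_ofNat, Nat.zero_mod, WExpr.eval_reg, State.setReg_reg, Nat.reduceEqDiff,
    reduceIte, h.h7]
  rw [← hs₁]
  have T₁ : Table S k tm lam s₁ := by
    rw [hs₁]
    exact ⟨by simpa using h.h5, by simpa using h.h7, by
      constructor <;> [exact h.st.a; exact h.st.b; exact h.st.c; exact h.st.y; exact h.st.m;
        exact h.st.l; exact h.st.r; exact h.st.X], by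
      constructor <;> [exact h.hI.h6; exact h.hI.h13; exact h.hI.h14; exact h.hI.h7;
        exact h.hI.h8], by
      constructor <;> [exact h.hV.h6; exact h.hV.h7; exact h.hV.h8; exact h.hV.h9], h.h17, h.h10⟩
  have hr : ∀ r, r ≠ 35 → r ≠ 36 → s₁.reg r = s.reg r := fun r h1 h2 => by
    rw [hs₁]; simp only [State.setReg_reg, if_neg h1, if_neg h2]
  refine Run.bind (run_bsearch (w := w) (s := s₁) (D := tm) (a := 0) (b := S.M) (ans := S.cLo lam u q)
    (by rw [hs₁]; simp) (by rw [hs₁]; simp) (.inr ⟨by omega, hcL⟩) (by omega) (by omega)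
    fun s' m hf _ hm g37 => ?_) fun s₂ hf₂ h₂ => ?_
  · exact cmpLo s' m (T₁.of_frame hf (by decide)) (by rw [hf.reg 53 rfl, hr _ (by omega) (by omega),
      h53]) (by rw [hf.reg 56 rfl, hr _ (by omega) (by omega), h56]) hm g37
  refine Run.setReg_seq (Run.setReg_seq (Run.setReg_seq ?_))
  have T₂ := T₁.of_frame hf₂ (by decide)
  obtain ⟨s₃, hs₃⟩ : ∃ s₃, s₃ = (((s₂.setReg 57 (S.cLo lam u q)).setReg 35 0).setReg 36 S.M) :=
    ⟨_, rfl⟩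
  simp only [WExpr.eval_ofNat, Nat.zero_mod, WExpr.eval_reg, State.setReg_reg, Nat.reduceEqDiff,
    reduceIte, T₂.h7, h₂]
  rw [← hs₃]
  have T₃ : Table S k tm lam s₃ := by
    rw [hs₃]
    exact ⟨by simpa using T₂.h5, by simpa using T₂.h7, by
      constructor <;> [exact T₂.st.a; exact T₂.st.b; exact T₂.st.c; exact T₂.st.y; exact T₂.st.m;
        exact T₂.st.l; exact T₂.st.r; exact T₂.st.X], by
      constructor <;> [exact T₂.hI.h6; exact T₂.hI.h13; exact T₂.hI.h14; exact T₂.hI.h7;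
        exact T₂.hI.h8], by
      constructor <;> [exact T₂.hV.h6; exact T₂.hV.h7; exact T₂.hV.h8; exact T₂.hV.h9],
      T₂.h17, T₂.h10⟩
  have hr₃ : ∀ r, r ≠ 35 → r ≠ 36 → r ≠ 57 → s₃.reg r = s₂.reg r := fun r h1 h2 h3 => by
    rw [hs₃]; simp only [State.setReg_reg, if_neg h1, if_neg h2, if_neg h3]
  refine Run.bind (T₁ := 4 * tm + 1) (T₂ := 5) (run_bsearch (w := w) (s := s₃) (D := tm) (a := 0) (b := S.M) (ans := S.cHi lam u q)
    (by rw [hs₃]; simp) (by rw [hs₃]; simp) (.inr ⟨by omega, hcH⟩) (by omega) (by omega)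
    fun s' m hf _ hm g37 => ?_) fun s₄ hf₄ h₄ => ?_
  · exact cmpHi s' m (T₃.of_frame hf (by decide))
      (by rw [hf.reg 53 rfl, hr₃ _ (by omega) (by omega) (by omega), hf₂.reg 53 rfl,
        hr _ (by omega) (by omega), h53])
      (by rw [hf.reg 56 rfl, hr₃ _ (by omega) (by omega) (by omega), hf₂.reg 56 rfl,
        hr _ (by omega) (by omega), h56]) hm g37
  have g : ∀ r, r ≠ 35 → r ≠ 36 → r ≠ 57 → (bsearch loTest).modReg r = false →
      (bsearch hiTest).modReg r = false → s₄.reg r = s.reg r := fun r h1 h2 h3 h4 h5 => by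
    rw [hf₄.reg r h5, hr₃ r h1 h2 h3, hf₂.reg r h4, hr r h1 h2]
  have g57 : s₄.reg 57 = S.cLo lam u q := by rw [hf₄.reg 57 rfl, hs₃]; simp
  have g51 := g 51 (by omega) (by omega) (by omega) rfl rfl
  have g54 := (g 54 (by omega) (by omega) (by omega) rfl rfl).trans h54
  have g55 := (g 55 (by omega) (by omega) (by omega) rfl rfl).trans h55
  have g59 := (g 59 (by omega) (by omega) (by omega) rfl rfl).trans h59
  have g5 := (g 5 (by omega) (by omega) (by omega) rfl rfl).trans h.h5
  have hb51' : s.reg 51 / 2 < 2 ^ w := (Nat.div_le_self _ _).trans_lt hb51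
  obtain ⟨b, hb⟩ : ∃ b, b = S.blk lam u q t sd := ⟨_, rfl⟩
  have hdiv : S.cHi lam u q / 2 ^ t < 2 ^ w := (Nat.div_le_self _ _).trans_lt (by omega)
  have hdiv' : (S.cLo lam u q + 2 ^ t - 1) / 2 ^ t < 2 ^ w :=
    (Nat.div_le_self _ _).trans_lt (by omega)
  have hsd2 : s.reg 51 / 2 % 2 < 2 := Nat.mod_lt _ two_pos
  refine Run.setReg_seq ?_
  rw [WExpr.eval_reg, h₄]
  refine Run.bind (T₁ := 2) (T₂ := 2) (P := fun s' => s'.reg 60 = b)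
    (Run.ite (T := 1) (fun hc => Run.setReg ?_) (fun hc => Run.setReg ?_)) fun s₅ hf₅ h₅ => ?_
  · simp (disch := omega) only [Test.eval_weq, WExpr.eval_mod, WExpr.eval_div, WExpr.eval_reg,
      WExpr.eval_ofNat, mod_pow_of_lt, State.setReg_reg, Nat.reduceEqDiff, reduceIte, g51, hsd] at hc
    simp (disch := omega) only [WExpr.eval_div, WExpr.eval_add, WExpr.eval_sub, WExpr.eval_reg,
      WExpr.eval_ofNat, mod_pow_of_lt, State.setReg_reg, Nat.reduceEqDiff, reduceIte, g57, g55,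
      hb, Sweep.blk, hc]
  · simp (disch := omega) only [Test.eval_weq, WExpr.eval_mod, WExpr.eval_div, WExpr.eval_reg,
      WExpr.eval_ofNat, mod_pow_of_lt, State.setReg_reg, Nat.reduceEqDiff, reduceIte, g51, hsd] at hc
    simp (disch := omega) only [WExpr.eval_div, WExpr.eval_sub, WExpr.eval_reg,
      WExpr.eval_ofNat, mod_pow_of_lt, State.setReg_reg, Nat.reduceEqDiff, reduceIte, g55,
      hb, Sweep.blk, hc]
  have k57 : s₅.reg 57 = S.cLo lam u q := by rw [hf₅.reg 57 rfl]; simpa using g57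
  have k58 : s₅.reg 58 = S.cHi lam u q := by rw [hf₅.reg 58 rfl]; simp
  have k55 : s₅.reg 55 = 2 ^ t := by rw [hf₅.reg 55 rfl]; simpa using g55
  have k54 : s₅.reg 54 = t := by rw [hf₅.reg 54 rfl]; simpa using g54
  have k59 : s₅.reg 59 = 0 := by rw [hf₅.reg 59 rfl]; simpa using g59
  have k5 : s₅.reg 5 = tm := by rw [hf₅.reg 5 rfl]; simpa using g5
  -- This is needed before the test on the block: it keeps the products in the test from overflowing
  -- also when the candidate sticks out of the range.
  have hbt : b * 2 ^ t < S.M + 2 ^ t + 1 := by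
    rw [hb, Sweep.blk]
    split_ifs
    · have := Nat.div_mul_le_self (S.cLo lam u q + 2 ^ t - 1) (2 ^ t)
      omega
    · have := Nat.div_mul_le_self (S.cHi lam u q) (2 ^ t)
      have := Nat.mul_le_mul_right (2 ^ t) (Nat.sub_le (S.cHi lam u q / 2 ^ t) 1)
      omega
  have hb' : b ≤ b * 2 ^ t := Nat.le_mul_of_pos_right _ h2t0
  have hbs : (b + 1) * 2 ^ t = b * 2 ^ t + 2 ^ t := by ring
  have hok : S.BlkOk lam u q t sd ↔ S.cLo lam u q ≤ b * 2 ^ t ∧ (b + 1) * 2 ^ t ≤ S.cHi lam u q := by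
    rw [hb]; rfl
  rw [hok, ← hb]
  have htest : Test.eval w s₅ (.and (.not (.wlt (.reg 60 * .reg 55) (.reg 57)))
      (.not (.wlt (.reg 58) ((.reg 60 + 1) * .reg 55)))) ↔
      S.cLo lam u q ≤ b * 2 ^ t ∧ (b + 1) * 2 ^ t ≤ S.cHi lam u q := by
    simp (disch := omega) only [Test.eval_and, Test.eval_not, Test.eval_wlt, WExpr.eval_mul,
      WExpr.eval_add, WExpr.eval_reg, WExpr.eval_ofNat, mod_pow_of_lt, k57, k58, k55, h₅, not_lt]
  refine Run.ite (T := 1) (fun hc => Run.setReg ?_) (fun hc => Run.skip ?_)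
  · have hc' := htest.1 hc
    rw [if_pos hc']
    have hbM : b < S.M := by
      have : (b + 1) * 1 ≤ (b + 1) * 2 ^ t := Nat.mul_le_mul_left _ h2t0
      omega
    have : (b + 1) * tm ≤ S.M * tm := Nat.mul_le_mul_right _ hbM
    have e1 : (b + 1) * tm = b * tm + tm := by ring
    have e2 : (S.M + 1) * tm = S.M * tm + tm := by ring
    simp (disch := omega) only [WExpr.eval_mul,
      WExpr.eval_add, WExpr.eval_reg, WExpr.eval_ofNat, mod_pow_of_lt, k54, k5, h₅,
      State.setReg_reg, reduceIte]
  · rw [if_neg (mt htest.2 hc), k59]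

/-- Writes the bicliques to array `5`. -/
def tableProg (k : ℕ) : Prog :=
  .for 50 (.reg 0) (.for 51 (.reg 1) (
    .setReg 52 (.reg 51 / .const (4 * k)) ;;
    .setReg 53 (.reg 50 * .reg 6 + .reg 52 / .reg 5) ;;
    .setReg 54 (.reg 52 % .reg 5) ;;
    .setReg 55 (.shl 1 (.reg 54)) ;;
    .setReg 56 (.reg 51 / 4 % .const k) ;;
    .setReg 59 0 ;;
    .ite (.weq (.reg 51 % 2) 0)
      (.ite (.not (.weq (.arr 7 (.reg 53)) 0))
        (.setReg 59 (2 * (.arr 12 (.reg 53) / .reg 55 * .reg 5 + .reg 54 + 1))) .skip)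
      (.ite (.not (.weq (.arr 8 (.reg 53)) 0)) blockProg .skip) ;;
    .setArr 5 (.reg 50 * .reg 1 + .reg 51) (.reg 59)))

theorem run_tableProg {w k tm : ℕ} {S : Sweep} (hS : S.Good) {lam : ℕ → ℕ}
    (hl : S.Layers k lam) {s : State} (hs : s.Bounded w)
    (h : Table S k tm lam s) (h0 : s.reg 0 = S.n) (h1 : s.reg 1 = 16 * k * S.h * tm)
    (h6 : s.reg 6 = 4 * S.h) (hM : S.M < 2 ^ tm) (hw : 8 * 2 ^ tm + 4 < 2 ^ w)
    (hw2 : 2 * ((S.M + 1) * tm) + 2 < 2 ^ w) (hw3 : 4 * k < 2 ^ w)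
    (hw4 : (S.n + 1) * (16 * k * S.h * tm) < 2 ^ w) (hn : S.n < 2 ^ w) :
    Run w (tableProg k) s (S.n * ((16 * k * S.h * tm) * (8 * tm + 27) + 4) + 2)
      (fun s' => ∀ v < S.n, ∀ p < 16 * k * S.h * tm,
        s'.arr 5 (v * (16 * k * S.h * tm) + p) = S.slot lam k tm v p) := by
  obtain ⟨P, hP⟩ : ∃ P, P = 16 * k * S.h * tm := ⟨_, rfl⟩
  rw [← hP] at h1 hw4 ⊢
  have hPw : P < 2 ^ w := by
    have : 1 * P ≤ (S.n + 1) * P := Nat.mul_le_mul_right _ (by omega)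
    omega
  have hvP : ∀ v < S.n, v * P + P < 2 ^ w := fun v hv => by
    have : (v + 1) * P ≤ (S.n + 1) * P := Nat.mul_le_mul_right _ (by omega)
    have e : (v + 1) * P = v * P + P := by ring
    omega
  refine Run.for (n := S.n) (T := P * (8 * tm + 27) + 2) (fun j s' => ∀ v < j, ∀ p < P,
    s'.arr 5 (v * P + p) = S.slot lam k tm v p) hn rfl
    (fun s' hf => by rw [WExpr.eval_reg, hf.reg 0 rfl, h0]) (by simp) ?_
  intro v s' hv hf h50 hA
  refine (Run.for (n := P) (T := 8 * tm + 25) (fun j s'' => (∀ v' < v, ∀ p < P,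
    s''.arr 5 (v' * P + p) = S.slot lam k tm v' p) ∧ ∀ p < j,
    s''.arr 5 (v * P + p) = S.slot lam k tm v p) hPw rfl
    (fun s'' hf' => by rw [WExpr.eval_reg, hf'.reg 1 rfl, hf.reg 1 rfl, h1])
    ⟨hA, by simp⟩ ?_).post ?_
  swap
  · rintro s'' - ⟨h2, h3⟩ v' hv' p hp
    rcases Nat.lt_succ_iff_lt_or_eq.1 hv' with hv' | rfl
    · exact h2 v' hv' p hp
    · exact h3 p hp
  rintro p s₁ hp hf₁ h51 ⟨hA₁, hB₁⟩
  have T₁ : Table S k tm lam s₁ := (h.of_frame hf ⟨⟨rfl, rfl, rfl, rfl, rfl⟩, ⟨rfl, rfl, rfl, rfl, rfl, rfl⟩,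
    ⟨rfl, rfl, rfl, rfl, rfl⟩, rfl, rfl, rfl, rfl⟩).of_frame
    hf₁ ⟨⟨rfl, rfl, rfl, rfl, rfl⟩, ⟨rfl, rfl, rfl, rfl, rfl, rfl⟩,
    ⟨rfl, rfl, rfl, rfl, rfl⟩, rfl, rfl, rfl, rfl⟩
  have g0 : s₁.reg 0 = S.n := by rw [hf₁.reg 0 rfl, hf.reg 0 rfl, h0]
  have g1 : s₁.reg 1 = P := by rw [hf₁.reg 1 rfl, hf.reg 1 rfl, h1]
  have g6 : s₁.reg 6 = 4 * S.h := by rw [hf₁.reg 6 rfl, hf.reg 6 rfl, h6]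
  have g50 : s₁.reg 50 = v := by rw [hf₁.reg 50 rfl, h50]
  have hb₁ : s₁.Bounded w := hf₁.bdd (hf.bdd hs)
  obtain ⟨u1, u2, hk, htm⟩ := Sweep.slotItem_seg (S := S) (k := k) (tm := tm) (hP ▸ hp) hv
  obtain ⟨u, hu⟩ : ∃ u, u = S.slotItem k tm v p := ⟨_, rfl⟩
  rw [← hu] at u1
  obtain ⟨d, hd⟩ : ∃ d, d = p / (4 * k) := ⟨_, rfl⟩
  obtain ⟨t, ht⟩ : ∃ t, t = d % tm := ⟨_, rfl⟩
  obtain ⟨js, hjs⟩ : ∃ js, js = d / tm := ⟨_, rfl⟩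
  obtain ⟨q, hq⟩ : ∃ q, q = p / 4 % k := ⟨_, rfl⟩
  have hdP : d ≤ p := hd ▸ Nat.div_le_self _ _
  have hjd : js ≤ d := hjs ▸ Nat.div_le_self _ _
  have htt : t < tm := ht ▸ Nat.mod_lt _ htm
  have hqk : q < k := hq ▸ Nat.mod_lt _ hk
  have hue : v * (4 * S.h) + js = u := by rw [hu, hjs, hd]; rfl
  have h2t : 2 ^ t ≤ 2 ^ tm := Nat.pow_le_pow_right (by omega) htt.le
  have hlt : tm < 2 ^ tm := Nat.lt_two_pow_self
  have hp4 : p / 4 < 2 ^ w := (Nat.div_le_self _ _).trans_lt (by omega)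
  have hMw : S.M < 2 ^ w := by omega
  -- The conjunction in `slot` is split into nested cases, as in the program, because the block is
  -- only computed for items that have a node.
  have hslot : S.slot lam k tm v p = if p % 2 = 0 then if S.ck u ≠ 0 then
      2 * (S.pos2 lam u / 2 ^ t * tm + t + 1) else 0 else if S.dk u ≠ 0 then
      (open scoped Classical in if S.BlkOk lam u q t (p / 2 % 2) then
        2 * (S.blk lam u q t (p / 2 % 2) * tm + t + 1) + 1 else 0) else 0 := by
    rw [Sweep.slot, ← hd, ← ht, ← hu, ← hq]
    split_ifs <;> simp_all
  refine Run.time (T₁ := ((8 * tm + 14 + 1 + 1 + 1) + 1 + 1 + 1 + 1 + 1 + 1)) ?_ (by omega)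
  iterate 6 (
    refine Run.setReg_seq ?_
    simp (disch := omega) only [WExpr.eval_div, WExpr.eval_mod, WExpr.eval_add, WExpr.eval_mul,
      WExpr.eval_shl, WExpr.eval_ofNat, WExpr.eval_const, WExpr.eval_reg, mod_pow_of_lt,
      State.setReg_reg, reduceIte, Nat.reduceEqDiff, g6, g50, h51, T₁.h5, ← hd, ← hjs, ← ht, ← hq,
      hue, one_mul])
  obtain ⟨s₂, hs₂⟩ : ∃ s₂, s₂ = ((((((s₁.setReg 52 d).setReg 53 u).setReg 54 t).setReg 55
    (2 ^ t)).setReg 56 q).setReg 59 0) := ⟨_, rfl⟩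
  rw [← hs₂]
  have hr : ∀ r < 52, s₂.reg r = s₁.reg r := fun r h1 => by
    rw [hs₂]
    simp (disch := omega) only [State.setReg_reg, if_neg]
  have k53 : s₂.reg 53 = u := by rw [hs₂]; simp
  have k54 : s₂.reg 54 = t := by rw [hs₂]; simp
  have k55 : s₂.reg 55 = 2 ^ t := by rw [hs₂]; simp
  have k56 : s₂.reg 56 = q := by rw [hs₂]; simp
  have k59 : s₂.reg 59 = 0 := by rw [hs₂]; simp
  have T₂ : Table S k tm lam s₂ := by
    refine ⟨(hr 5 (by omega)).trans T₁.h5, (hr 7 (by omega)).trans T₁.h7, ?_, ?_, ?_, ?_, ?_⟩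
    all_goals rw [hs₂]
    · constructor <;> [exact T₁.st.a; exact T₁.st.b; exact T₁.st.c; exact T₁.st.y; exact T₁.st.m;
        exact T₁.st.l; exact T₁.st.r; exact T₁.st.X]
    · constructor <;> [exact T₁.hI.h6; exact T₁.hI.h13; exact T₁.hI.h14; exact T₁.hI.h7;
        exact T₁.hI.h8]
    · constructor <;> [exact T₁.hV.h6; exact T₁.hV.h7; exact T₁.hV.h8; exact T₁.hV.h9]
    · exact T₁.h17
    · exact T₁.h10
  have k5 : s₂.arr 5 = s₁.arr 5 := by rw [hs₂]; rfl
  have hpos : S.pos2 lam u < S.M := (S.strictOn_lt2 lam S.M).rank_lt u1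
  have hpt : S.pos2 lam u / 2 ^ t ≤ S.pos2 lam u := Nat.div_le_self _ _
  refine Run.bind (T₁ := 8 * tm + 14 + 1 + 1) (T₂ := 1)
    (P := fun s' => s'.reg 59 = S.slot lam k tm v p)
    (Run.ite (fun hc => Run.ite (fun hc' => (Run.setReg ?_).time (by omega))
      (fun hc' => (Run.skip ?_).time (by omega))) (fun hc => Run.ite (fun hc' => ?_)
      (fun hc' => (Run.skip ?_).time (by omega)))) fun s₃ hf₃ h₃ => ?_
  · simp (disch := omega) only [Test.eval_weq, Test.eval_not, WExpr.eval_mod, WExpr.eval_arr,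
      WExpr.eval_reg, WExpr.eval_ofNat, mod_pow_of_lt, hr, h51, k53, T₂.hI.h7 u u1]
      at hc hc'
    rw [hslot, if_pos hc, if_pos hc']
    obtain ⟨b, hb⟩ : ∃ b, b = S.pos2 lam u / 2 ^ t := ⟨_, rfl⟩
    have : (b + 1) * tm ≤ S.M * tm := Nat.mul_le_mul_right _ (by omega)
    have e1 : (b + 1) * tm = b * tm + tm := by ring
    have e2 : (S.M + 1) * tm = S.M * tm + tm := by ring
    simp (disch := omega) only [WExpr.eval_mul, WExpr.eval_add, WExpr.eval_div, WExpr.eval_arr,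
      WExpr.eval_reg, WExpr.eval_ofNat, mod_pow_of_lt, State.setReg_reg, reduceIte, k53, k54, k55,
      T₂.h5, (T₂.h10 u u1).2, ← hb]
  · simp (disch := omega) only [Test.eval_weq, Test.eval_not, WExpr.eval_mod, WExpr.eval_arr,
      WExpr.eval_reg, WExpr.eval_ofNat, mod_pow_of_lt, hr, h51, k53, T₂.hI.h7 u u1]
      at hc hc'
    rw [hslot, if_pos hc, if_neg hc', k59]
  · simp (disch := omega) only [Test.eval_weq, Test.eval_not, WExpr.eval_mod, WExpr.eval_arr,
      WExpr.eval_reg, WExpr.eval_ofNat, mod_pow_of_lt, hr, h51, k53, T₂.hI.h8 u u1]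
      at hc hc'
    rw [hslot, if_neg hc, if_pos hc']
    exact run_blockProg hS hl T₂ u1 hc' hqk htt k53 k54 k55 k56
      (by rw [hr _ (by omega), h51]) (by rw [hr _ (by omega), h51]; omega) k59 hM hw hw2
  · simp (disch := omega) only [Test.eval_weq, Test.eval_not, WExpr.eval_mod, WExpr.eval_arr,
      WExpr.eval_reg, WExpr.eval_ofNat, mod_pow_of_lt, hr, h51, k53, T₂.hI.h8 u u1]
      at hc hc'
    rw [hslot, if_neg hc, if_neg hc', k59]
  · have l5 : s₃.arr 5 = s₁.arr 5 := by rw [hf₃.arr 5 rfl, k5]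
    have l50 : s₃.reg 50 = v := by rw [hf₃.reg 50 rfl, hr _ (by omega), g50]
    have l51 : s₃.reg 51 = p := by rw [hf₃.reg 51 rfl, hr _ (by omega), h51]
    have l1 : s₃.reg 1 = P := by rw [hf₃.reg 1 rfl, hr _ (by omega), g1]
    have hvp := hvP v hv
    refine Run.setArr ?_
    simp (disch := omega) only [WExpr.eval_mul, WExpr.eval_add, WExpr.eval_reg, mod_pow_of_lt,
      State.setReg_arr, State.setArr_arr, l50, l51, l1, h₃, l5, reduceIte]
    constructor
    · intro v' hv' p' hp'
      have : (v' + 1) * P ≤ v * P := Nat.mul_le_mul_right _ hv'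
      have e : (v' + 1) * P = v' * P + P := by ring
      rw [if_neg (by omega)]
      exact hA₁ v' hv' p' hp'
    · intro p' hp'
      rcases Nat.lt_succ_iff_lt_or_eq.1 hp' with hp' | rfl
      · rw [if_neg (by omega)]
        exact hB₁ p' hp'
      · rw [if_pos rfl]

/-! ## The bicliques of the intersection graph -/

def sweepProg (k : ℕ) : Prog := dimsProg k ;; shearProg ;; affineProg ;; endsProg

/-- The word size suffices for the bicliques. -/
structure GeoWord (w k n ℓ : ℕ) : Prop where
  h1 : (n + 1) * (16 * k * (ℓ + 1) * (2 * ℓ + 3)) < 2 ^ w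
  h2 : 8 * 2 ^ (2 * ℓ + 3) + 4 < 2 ^ w
  h3 : 8 * (2 ^ (ℓ + 1) * (ℓ + 1 + 1)) < 2 ^ w
  h4 : 2 * ((4 * (ℓ + 1) * n + 1) * (2 * ℓ + 3)) + 2 < 2 ^ w
  h5 : 4 * n + 4 < 2 ^ w

theorem GeoWord.slots_lt {w k n ℓ : ℕ} (h : GeoWord w k n ℓ) :
    16 * k * (ℓ + 1) * (2 * ℓ + 3) < 2 ^ w := by
  have : 1 * (16 * k * (ℓ + 1) * (2 * ℓ + 3)) ≤ (n + 1) * (16 * k * (ℓ + 1) * (2 * ℓ + 3)) :=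
    Nat.mul_le_mul_right _ (by omega)
  have := h.h1
  omega

theorem le_slots (k ℓ : ℕ) : 16 * k ≤ 16 * k * (ℓ + 1) * (2 * ℓ + 3) := by
  have a2 : 16 * k * 1 ≤ 16 * k * (ℓ + 1) := Nat.mul_le_mul_left _ (by omega)
  have a3 : 16 * k * (ℓ + 1) * 1 ≤ 16 * k * (ℓ + 1) * (2 * ℓ + 3) :=
    Nat.mul_le_mul_left _ (by omega)
  omega

theorem GeoWord.items_lt {w k n ℓ : ℕ} (h : GeoWord w k n ℓ) : 4 * (ℓ + 1) * n < 2 ^ w := by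
  have : (4 * (ℓ + 1) * n + 1) * 1 ≤ (4 * (ℓ + 1) * n + 1) * (2 * ℓ + 3) :=
    Nat.mul_le_mul_left _ (by omega)
  have := h.h4
  omega

/-- From `ℓ + 1 ≤ 2 ^ ℓ`; so `2 * ℓ + 3` dyadic levels are enough for all positions of items. -/
theorem items_lt_two_pow {n ℓ : ℕ} (h : n ≤ 2 ^ ℓ) : 4 * (ℓ + 1) * n < 2 ^ (2 * ℓ + 3) := by
  have hlt : ℓ + 1 ≤ 2 ^ ℓ := Nat.lt_two_pow_self
  have hpow' : 2 ^ (2 * ℓ + 3) = 8 * (2 ^ ℓ * 2 ^ ℓ) := by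
    rw [pow_add, two_mul, pow_add]; ring
  rw [hpow']
  have := Nat.mul_le_mul hlt h
  have h1 : 0 < 2 ^ ℓ * 2 ^ ℓ := by positivity
  calc 4 * (ℓ + 1) * n = 4 * ((ℓ + 1) * n) := by ring
    _ < _ := by omega

def sweepTime (n ℓ : ℕ) : ℕ :=
  (ℓ * 3 + 8) + ((n * 4 + 3) + ((n * 10 + 2) +
    ((ℓ + 1 + 1) * (2 * n * (4 * (ℓ + 1) + 18) + 16) + (2 * n * 4 + 4))))

theorem run_sweepProg {w k : ℕ} (S : Segments) {s : State} (hs : s.Bounded w) (hk : 0 < k)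
    (hin : S.Input s) {ℓ : ℕ} (hℓ : ℓ = Nat.clog 2 S.n) (hw : GeoWord w k S.n ℓ) :
    Run w (sweepProg k) s (sweepTime S.n ℓ) (fun s' => Dims k S.n ℓ s' ∧ ∃ W : Sweep,
      W.Good ∧ Stored W s' ∧ W.n = S.n ∧ W.h = ℓ + 1 ∧ ∀ i j : Fin S.n, W.Meet i j ↔
        (segment ℝ (S.fst i) (S.snd i) ∩ segment ℝ (S.fst j) (S.snd j)).Nonempty) := by
  have hP := hw.slots_lt
  have hM := hw.items_lt
  obtain ⟨w1, w2, w3, w4, w5⟩ := hw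
  obtain ⟨n, fst, snd⟩ := S
  obtain ⟨hin0, hin1⟩ := hin
  simp only at hin0 hin1 hℓ w1 w4 w5 hM ⊢
  have hnℓ : n ≤ 2 ^ ℓ := hℓ ▸ Nat.le_pow_clog (by omega) n
  have hpow : 2 ^ (ℓ + 1) = 2 * 2 ^ ℓ := pow_succ' _ _
  have hpow' : 2 ^ (2 * ℓ + 3) = 8 * (2 ^ ℓ * 2 ^ ℓ) := by
    rw [pow_add, two_mul, pow_add]; ring
  have hqq : 2 ^ ℓ * 1 ≤ 2 ^ ℓ * 2 ^ ℓ := Nat.mul_le_mul_left _ Nat.one_le_two_pow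
  have hdims := run_dimsProg (k := k) (w := w) hin0 (by rw [← hℓ]; exact hP) hk
    (by rw [← hℓ]; exact hM) (by rw [← hℓ]; omega)
  rw [← hℓ] at hdims
  refine Run.bind hdims fun s₁ f₁ D₁ => ?_
  refine Run.bind (run_shearProg D₁.h0 w5) fun s₂ f₂ h₂ => ?_
  have D₂ := D₁.of_frame f₂ ⟨rfl, rfl, rfl, rfl, rfl, rfl, rfl⟩
  refine Run.bind (run_affineProg D₂.h0 w5) fun s₃ f₃ h₃ => ?_
  have D₃ := D₂.of_frame f₃ ⟨rfl, rfl, rfl, rfl, rfl, rfl, rfl⟩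
  have b₃ : s₃.Bounded w := f₃.bdd (f₂.bdd (f₁.bdd hs))
  have r₂ : s₂.rarr 0 = s.rarr 0 := by rw [f₂.rarr 0 rfl, f₁.rarr 0 rfl]
  have r₁ : s₁.rarr 0 = s.rarr 0 := f₁.rarr 0 rfl
  rw [r₁] at h₂
  rw [r₂] at h₃
  refine (run_endsProg b₃ D₃.h0 D₃.h4 (by omega) (by omega) (fun i hi => ?_) (by omega)).post
    fun s₄ f₄ hS => ?_
  · rw [(h₃ i hi).a, (h₃ i hi).b]; exact min_le_max
  have key : ∀ i : Fin n, ((fst i).1 + s₂.rreg 0 * (fst i).2 = (snd i).1 + s₂.rreg 0 * (snd i).2 →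
      fst i = snd i) := fun i => by
    obtain ⟨i1, i2, i3, i4⟩ := hin1 i
    have := h₂.2 i i.2
    rw [i1, i2, i3, i4] at this
    exact eq_of_shear_eq h₂.1 this
  have key' : ∀ i : Fin n, IsAffine n i ((fst i).1 + s₂.rreg 0 * (fst i).2) (fst i).2
      ((snd i).1 + s₂.rreg 0 * (snd i).2) (snd i).2 s₄ := fun i => by
    obtain ⟨i1, i2, i3, i4⟩ := hin1 i
    have := h₃ i i.2
    rw [i1, i2, i3, i4] at this
    exact ⟨by rw [f₄.rarr 1 rfl]; exact this.a, by rw [f₄.rarr 1 rfl]; exact this.b,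
      by rw [f₄.rarr 2 rfl]; exact this.c, by rw [f₄.rarr 3 rfl]; exact this.y,
      by rw [f₄.rarr 4 rfl]; exact this.m⟩
  refine ⟨D₃.of_frame f₄ ⟨rfl, rfl, rfl, rfl, rfl, rfl, rfl⟩, sweepOf n (ℓ + 1) s₄, hS,
    stored_sweepOf _ _ _, rfl, rfl, fun i j => ?_⟩
  obtain ⟨i1, i2, i3, i4, i5⟩ := key' i
  obtain ⟨j1, j2, j3, j4, j5⟩ := key' j
  exact (inter_nonempty_iff (key i) (key j) ⟨i1, i2, i3, i4, i5⟩ ⟨j1, j2, j3, j4, j5⟩).symm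

def coverProg (k : ℕ) : Prog :=
  itemsProg ;; valuesProg ;; sort1Prog ;; layersProg k ;; sort2Prog ;; tableProg k

def coverTime (k n ℓ : ℕ) : ℕ :=
  (4 * (ℓ + 1) * n * 24 + 2) + ((4 * (ℓ + 1) * n * 13 + 2) +
    (((2 * ℓ + 3 + 1) * (4 * (ℓ + 1) * n * (4 * (2 * ℓ + 3) + 18) + 16) + (4 * (ℓ + 1) * n * 4 + 4)) +
    ((4 * (ℓ + 1) * n * 3 + 2 + (k * (4 * (ℓ + 1) * n * 7 + 3 + 2) + 2)) +
    (((2 * ℓ + 3 + 1) * (4 * (ℓ + 1) * n * (4 * (2 * ℓ + 3) + 18) + 16) + 2) +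
    (n * ((16 * k * (ℓ + 1) * (2 * ℓ + 3)) * (8 * (2 * ℓ + 3) + 27) + 4) + 2)))))

theorem run_coverProg {w k n ℓ : ℕ} {W : Sweep} (hW : W.Good) {s : State} (hs : s.Bounded w)
    (D : Dims k n ℓ s) (st : Stored W s) (hWn : W.n = n) (hWh : W.h = ℓ + 1) (hnℓ : n ≤ 2 ^ ℓ)
    (hw : GeoWord w k n ℓ) :
    Run w (coverProg k) s (coverTime k n ℓ) (fun s' => ∃ lam, W.Layers k lam ∧
      CoverInput n (16 * k * (ℓ + 1) * (2 * ℓ + 3)) ℓ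
        (2 * ((4 * (ℓ + 1) * n + 1) * (2 * ℓ + 3)) + 2) (W.slot lam k (2 * ℓ + 3)) s') := by
  have hP := hw.slots_lt
  have hkP := le_slots k ℓ
  have hM := hw.items_lt
  have hMtm := items_lt_two_pow hnℓ
  obtain ⟨w1, w2, w3, w4, w5⟩ := hw
  have WM : W.M = 4 * (ℓ + 1) * n := by rw [Sweep.M, hWn, hWh]
  obtain ⟨D0, D1, D2, D4, D5, D6, D7⟩ := id D
  rw [← hWn] at D0
  rw [← hWh] at D4 D6
  rw [← WM] at D7 hM hMtm
  unfold coverTime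
  rw [← WM]
  refine Run.bind (run_itemsProg hW st D0 D4 D6 D7 (by rw [hWh]; exact w3) hM) fun s₁ f₁ I₁ => ?_
  have st₁ := st.of_frame f₁ ⟨rfl, rfl, rfl, rfl, rfl, rfl⟩
  have D₁ := D.of_frame f₁ ⟨rfl, rfl, rfl, rfl, rfl, rfl, rfl⟩
  refine Run.bind (run_valuesProg st₁ (D₁.h0.trans hWn.symm) (D₁.h7.trans WM.symm) I₁ hM
    (by omega)) fun s₂ f₂ V₂ => ?_
  have st₂ := st₁.of_frame f₂ ⟨rfl, rfl, rfl, rfl, rfl, rfl⟩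
  have D₂ := D₁.of_frame f₂ ⟨rfl, rfl, rfl, rfl, rfl, rfl, rfl⟩
  have I₂ := I₁.of_frame f₂ ⟨rfl, rfl, rfl, rfl, rfl⟩
  have b₂ := f₂.bdd (f₁.bdd hs)
  refine Run.bind (run_sort1Prog b₂ D₂.h5 (D₂.h7.trans WM.symm) I₂ V₂ hMtm w2) fun s₃ f₃ S₃ => ?_
  have st₃ := st₂.of_frame f₃ ⟨rfl, rfl, rfl, rfl, rfl, rfl⟩
  have D₃ := D₂.of_frame f₃ ⟨rfl, rfl, rfl, rfl, rfl, rfl, rfl⟩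
  have I₃ := I₂.of_frame f₃ ⟨rfl, rfl, rfl, rfl, rfl⟩
  have V₃ := V₂.of_frame f₃ ⟨rfl, rfl, rfl, rfl⟩
  refine Run.bind (run_layersProg (by omega) (D₃.h7.trans WM.symm) hM I₃ V₃ S₃) fun s₄ f₄ L₄ => ?_
  have st₄ := st₃.of_frame f₄ ⟨rfl, rfl, rfl, rfl, rfl, rfl⟩
  have D₄ := D₃.of_frame f₄ ⟨rfl, rfl, rfl, rfl, rfl, rfl, rfl⟩
  have I₄ := I₃.of_frame f₄ ⟨rfl, rfl, rfl, rfl, rfl⟩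
  have V₄ := V₃.of_frame f₄ ⟨rfl, rfl, rfl, rfl⟩
  have S₄ := S₃.of_frame f₄ ⟨rfl, rfl⟩
  have b₄ := f₄.bdd (f₃.bdd b₂)
  refine Run.bind (run_sort2Prog b₄ D₄.h5 (D₄.h7.trans WM.symm) I₄ S₄ hMtm w2) fun s₅ f₅ h₅ => ?_
  have D₅ := D₄.of_frame f₅ ⟨rfl, rfl, rfl, rfl, rfl, rfl, rfl⟩
  have T₅ : Table W k (2 * ℓ + 3) (s₄.arr 17) s₅ :=
    ⟨D₅.h5, D₅.h7.trans WM.symm, st₄.of_frame f₅ ⟨rfl, rfl, rfl, rfl, rfl, rfl⟩,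
      I₄.of_frame f₅ ⟨rfl, rfl, rfl, rfl, rfl⟩, V₄.of_frame f₅ ⟨rfl, rfl, rfl, rfl⟩,
      f₅.arr 17 rfl, h₅⟩
  have htab := run_tableProg hW L₄ (f₅.bdd b₄) T₅ (D₅.h0.trans hWn.symm)
    (by rw [hWh]; exact D₅.h1) (by rw [hWh]; exact D₅.h6) hMtm w2 (by rw [WM]; exact w4)
    (by omega) (by rw [hWh, hWn]; exact w1) (by omega)
  rw [hWh, hWn] at htab
  refine htab.post fun s₆ f₆ h₆ => ⟨s₄.arr 17, L₄, ?_⟩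
  have D₆ := D₅.of_frame f₆ ⟨rfl, rfl, rfl, rfl, rfl, rfl, rfl⟩
  refine ⟨D₆.h0, D₆.h1, D₆.h2, fun v hv p hp => ⟨h₆ v hv p hp, ?_⟩⟩
  exact Sweep.slot_lt (by rw [hWh]; exact hp) (by rw [hWn]; exact hv)

theorem Sweep.Good.cover_sound {W : Sweep} (hW : W.Good) {k tm : ℕ} {lam : ℕ → ℕ}
    (hl : W.Layers k lam) (S : Segments) (hn : W.n = S.n)
    (hmeet : ∀ i j : Fin S.n, W.Meet i j ↔
        (segment ℝ (S.fst i) (S.snd i) ∩ segment ℝ (S.fst j) (S.snd j)).Nonempty)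
    {v v' : Fin S.n} (hne : v ≠ v') (h : Link (W.slot lam k tm) (16 * k * W.h * tm) v v') :
    S.graph.Adj v v' :=
  ⟨hne, (hmeet v v').1 (hW.link_meet hl (by rw [hn]; exact v.2) (by rw [hn]; exact v'.2) h)⟩

/-- If all meetings are links, the given cycle is a cycle of links. Otherwise there is a linked
clique on `k` vertices, whose members in any order form a cycle, unrelated to the given one. -/
theorem Sweep.Good.cover_complete {W : Sweep} (hW : W.Good) {k tm : ℕ} {lam : ℕ → ℕ} (hk : 2 ≤ k)
    (hl : W.Layers k lam) (htm : W.M < 2 ^ tm) (S : Segments) (hn : W.n = S.n)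
    (hmeet : ∀ i j : Fin S.n, W.Meet i j ↔
        (segment ℝ (S.fst i) (S.snd i) ∩ segment ℝ (S.fst j) (S.snd j)).Nonempty)
    (h : ∃ v : Fin k → Fin S.n, IsKCycle S.graph.Adj k v) :
    ∃ v : Fin k → Fin S.n,
      IsKCycle (fun a b : Fin S.n => Link (W.slot lam k tm) (16 * k * W.h * tm) a b) k v := by
  rcases hW.link_or hl htm with hall | ⟨v, h1, h2, h3⟩
  · obtain ⟨v, hv, hadj⟩ := h
    exact ⟨v, hv, fun i j hij => hall _ (by rw [hn]; exact (v i).2) _ (by rw [hn]; exact (v j).2)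
      ((hmeet _ _).2 (hadj i j hij).2)⟩
  · refine ⟨fun i => ⟨v i, by rw [← hn]; exact h1 i i.2⟩, fun i j hij => Fin.ext (h2 i i.2 j j.2 ?_),
      fun i j hij => h3 i i.2 j j.2 ?_⟩
    · simpa using hij
    · rw [hij]
      exact (succ_mod_ne hk i.2).symm

/-! ## Finding cycles of segments -/

/-- Finds a `k`-cycle of segments, where `D` finds a `k`-cycle of a sparse digraph. -/
def segmentProg (k : ℕ) (D : Prog) : Prog :=
  .ite (.wlt (.reg 0) (.const k)) (.setReg 0 0) ((sweepProg k ;; coverProg k) ;; cycleProg k D)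

theorem run_segmentProg {w k TD : ℕ} {D : Prog} (S : Segments) {s : State} (hs : s.Bounded w)
    (hk : 2 ≤ k) (hin : S.Input s) (hkw : k < 2 ^ w) (hD : k ≤ S.n → FindsCycles w k S.n TD D)
    (hw : GeoWord w k S.n (Nat.clog 2 S.n))
    (hw' : CycleWord w k S.n (16 * k * (Nat.clog 2 S.n + 1) * (2 * Nat.clog 2 S.n + 3))
      (Nat.clog 2 S.n) (2 * ((4 * (Nat.clog 2 S.n + 1) * S.n + 1) * (2 * Nat.clog 2 S.n + 3)) + 2)) :
    Run w (segmentProg k D) s (sweepTime S.n (Nat.clog 2 S.n) + coverTime k S.n (Nat.clog 2 S.n) +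
      cycleTime k S.n (16 * k * (Nat.clog 2 S.n + 1) * (2 * Nat.clog 2 S.n + 3))
        (Nat.clog 2 S.n) TD + 1) (CycleAnswer S.graph.Adj k) := by
  obtain ⟨ℓ, hℓ⟩ : ∃ ℓ, ℓ = Nat.clog 2 S.n := ⟨_, rfl⟩
  rw [← hℓ] at hw hw' ⊢
  have hnℓ : S.n ≤ 2 ^ ℓ := hℓ ▸ Nat.le_pow_clog (by omega) S.n
  refine Run.ite (fun h => (Run.setReg (.inr ⟨by simp, ?_⟩)).time ?_) (fun h => ?_)
  · unfold sweepTime; omega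
  · simp only [Test.eval_wlt, WExpr.eval_reg, WExpr.eval_const, mod_pow_of_lt hkw, hin.1,
      not_lt] at h
    refine Run.bind (P := fun s' => ∃ (W : Sweep) (lam : ℕ → ℕ), W.Good ∧ W.Layers k lam ∧
      W.n = S.n ∧ W.h = ℓ + 1 ∧ (∀ i j : Fin S.n, W.Meet i j ↔
        (segment ℝ (S.fst i) (S.snd i) ∩ segment ℝ (S.fst j) (S.snd j)).Nonempty) ∧
      CoverInput S.n (16 * k * (ℓ + 1) * (2 * ℓ + 3)) ℓ
        (2 * ((4 * (ℓ + 1) * S.n + 1) * (2 * ℓ + 3)) + 2) (W.slot lam k (2 * ℓ + 3)) s')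
      (Run.bind (run_sweepProg S hs (by omega) hin hℓ hw) ?_) ?_
    · rintro s₁ f₁ ⟨D₁, W, hW, st, hWn, hWh, hmeet⟩
      refine (run_coverProg hW (f₁.bdd hs) D₁ st hWn hWh hnℓ hw).post ?_
      rintro s₂ - ⟨lam, hl, hc⟩
      exact ⟨W, lam, hW, hl, hWn, hWh, hmeet, hc⟩
    · rintro s₂ f₂ ⟨W, lam, hW, hl, hWn, hWh, hmeet, hc⟩
      have hkP := le_slots k ℓ
      refine run_cycleProg (f₂.bdd hs) hk h (by omega) ?_ hnℓ hw' (hD h) hc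
        (fun v v' hne hlk => hW.cover_sound hl S hWn hmeet hne (tm := 2 * ℓ + 3) ?_)
        (fun hex => ?_)
      · have a1 : 16 * 1 ≤ 16 * k := by omega
        calc 2 * ℓ ≤ 1 * (2 * ℓ + 3) := by omega
          _ ≤ 16 * k * (ℓ + 1) * (2 * ℓ + 3) := Nat.mul_le_mul_right _ (by
              have := Nat.mul_le_mul a1 (show 1 ≤ ℓ + 1 by omega)
              omega)
      · rw [hWh]; exact hlk
      · have := hW.cover_complete hk hl (tm := 2 * ℓ + 3)
          (by rw [Sweep.M, hWn, hWh]; exact items_lt_two_pow hnℓ) S hWn hmeet hex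
        rwa [hWh] at this
  -- With fewer than `k` segments there are not enough vertices; the cycle program relies on `k ≤
  -- n`.
  · rintro ⟨v, hv, -⟩
    simp only [Test.eval_wlt, WExpr.eval_reg, WExpr.eval_const, mod_pow_of_lt hkw, hin.1] at h
    have := Fintype.card_le_of_injective v hv
    simp only [Fintype.card_fin] at this
    omega

/-! ## Polynomial bounds -/

/-- `f` is bounded by a power of `B`. -/
def PolyIn (B f : ℕ → ℕ) : Prop := ∃ c, ∀ n, f n ≤ B n ^ c

section PolyIn
variable {B f g : ℕ → ℕ}

theorem PolyIn.mono (h : PolyIn B g) (hf : ∀ n, f n ≤ g n) : PolyIn B f :=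
  h.imp fun _ hc n => (hf n).trans (hc n)

theorem PolyIn.self : PolyIn B B := ⟨1, fun n => by simp⟩

theorem PolyIn.const (hB : ∀ n, 2 ≤ B n) (a : ℕ) : PolyIn B (fun _ => a) :=
  ⟨a, fun n => Nat.lt_two_pow_self.le.trans (Nat.pow_le_pow_left (hB n) a)⟩

theorem PolyIn.add (hB : ∀ n, 2 ≤ B n) (hf : PolyIn B f) (hg : PolyIn B g) :
    PolyIn B (fun n => f n + g n) := by
  obtain ⟨c, hc⟩ := hf
  obtain ⟨d, hd⟩ := hg
  refine ⟨c + d + 1, fun n => ?_⟩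
  have h1 : B n ^ c ≤ B n ^ (c + d) := Nat.pow_le_pow_right (by have := hB n; omega) (by omega)
  have h2 : B n ^ d ≤ B n ^ (c + d) := Nat.pow_le_pow_right (by have := hB n; omega) (by omega)
  have h3 : B n ^ (c + d) * 2 ≤ B n ^ (c + d) * B n := Nat.mul_le_mul_left _ (hB n)
  have := hc n
  have := hd n
  show f n + g n ≤ B n ^ (c + d + 1)
  rw [pow_succ]
  omega

theorem PolyIn.mul (hf : PolyIn B f) (hg : PolyIn B g) : PolyIn B (fun n => f n * g n) := by
  obtain ⟨c, hc⟩ := hf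
  obtain ⟨d, hd⟩ := hg
  exact ⟨c + d, fun n => (Nat.mul_le_mul (hc n) (hd n)).trans (pow_add _ _ _).ge⟩

theorem PolyIn.pow (hf : PolyIn B f) (e : ℕ) : PolyIn B (fun n => f n ^ e) := by
  obtain ⟨c, hc⟩ := hf
  exact ⟨c * e, fun n => (Nat.pow_le_pow_left (hc n) e).trans (pow_mul _ _ _).ge⟩

/-- `f` is at most `g` times a power of `B`. -/
def QuasiIn (B g f : ℕ → ℕ) : Prop := ∃ c, ∀ n, f n ≤ B n ^ c * g n

variable {f₁ f₂ : ℕ → ℕ}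

theorem QuasiIn.mul (h₁ : PolyIn B f₁) (h₂ : QuasiIn B g f₂) :
    QuasiIn B g (fun n => f₁ n * f₂ n) := by
  obtain ⟨c, hc⟩ := h₁
  obtain ⟨d, hd⟩ := h₂
  exact ⟨c + d, fun n => (Nat.mul_le_mul (hc n) (hd n)).trans (by rw [pow_add, mul_assoc])⟩

theorem QuasiIn.mul' (h₁ : QuasiIn B g f₁) (h₂ : PolyIn B f₂) :
    QuasiIn B g (fun n => f₁ n * f₂ n) := by
  simpa only [mul_comm] using QuasiIn.mul h₂ h₁

theorem QuasiIn.add (hB : ∀ n, 2 ≤ B n) (h₁ : QuasiIn B g f₁) (h₂ : QuasiIn B g f₂) :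
    QuasiIn B g (fun n => f₁ n + f₂ n) := by
  obtain ⟨c, hc⟩ := h₁
  obtain ⟨d, hd⟩ := h₂
  obtain ⟨e, he⟩ := PolyIn.add (B := B) (f := fun n => B n ^ c) (g := fun n => B n ^ d) hB
    ⟨c, fun _ => le_rfl⟩ ⟨d, fun _ => le_rfl⟩
  refine ⟨e, fun n => (Nat.add_le_add (hc n) (hd n)).trans ?_⟩
  rw [← add_mul]
  exact Nat.mul_le_mul_right _ (he n)

theorem QuasiIn.of_le (h : ∀ n, f n ≤ g n) : QuasiIn B g f := ⟨0, fun n => by simpa using h n⟩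

theorem QuasiIn.of_poly (hg : ∀ n, 1 ≤ g n) (h : PolyIn B f) : QuasiIn B g f := by
  simpa using QuasiIn.mul h (QuasiIn.of_le (f := fun _ => 1) hg)
end PolyIn

theorem two_pow_clog_le (n : ℕ) : 2 ^ Nat.clog 2 n ≤ 2 * n + 1 := by
  rcases Nat.lt_or_ge 1 n with h | h
  · have h1 := Nat.pow_pred_clog_lt_self (b := 2) (by omega) h
    have h2 : 0 < Nat.clog 2 n := Nat.clog_pos (by omega) h
    have h3 : 2 ^ Nat.clog 2 n = 2 ^ (Nat.clog 2 n).pred * 2 := by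
      rw [← pow_succ, ← Nat.succ_eq_add_one, Nat.succ_pred (by omega)]
    omega
  · rw [Nat.clog_of_right_le_one h]; simp

/-- Words of `c * log₂ (n + 2)` bits hold all numbers below `(n + 2) ^ c`, so any polynomial bound
becomes a condition on the constant of the algorithm. -/
theorem PolyIn.exists_word {f : ℕ → ℕ} (h : PolyIn (fun n => n + 2) f) :
    ∃ c, ∀ n w, c * Nat.clog 2 (n + 2) ≤ w → f n < 2 ^ w := by
  obtain ⟨c, hc⟩ := PolyIn.add (fun n => by omega) h (PolyIn.const (fun n => by omega) 1)
  refine ⟨c, fun n w hw => ?_⟩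
  have h1 : (n + 2) ^ c ≤ (2 ^ Nat.clog 2 (n + 2)) ^ c :=
    Nat.pow_le_pow_left (Nat.le_pow_clog (by omega) _) c
  rw [← pow_mul, mul_comm] at h1
  have h2 : 2 ^ (c * Nat.clog 2 (n + 2)) ≤ 2 ^ w := Nat.pow_le_pow_right (by omega) hw
  have : f n + 1 ≤ (n + 2) ^ c := hc n
  omega

/-- All quantities are added up to a single polynomial, which dominates each of them. -/
theorem exists_segment_word (k : ℕ) : ∃ c, ∀ n w, c * Nat.clog 2 (n + 2) ≤ w →
    k < 2 ^ w ∧ GeoWord w k n (Nat.clog 2 n) ∧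
    CycleWord w k n (16 * k * (Nat.clog 2 n + 1) * (2 * Nat.clog 2 n + 3))
      (Nat.clog 2 n) (2 * ((4 * (Nat.clog 2 n + 1) * n + 1) * (2 * Nat.clog 2 n + 3)) + 2) := by
  have hB : ∀ n : ℕ, 2 ≤ n + 2 := fun n => by omega
  have hc : ∀ a, PolyIn (fun n => n + 2) (fun _ => a) := PolyIn.const hB
  have hn : PolyIn (fun n => n + 2) (fun n => n) := PolyIn.self.mono fun n => by omega
  have h2 : PolyIn (fun n => n + 2) (fun n => 2 ^ Nat.clog 2 n) :=
    ((hc 2).mul hn |>.add hB (hc 1)).mono two_pow_clog_le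
  have hl : PolyIn (fun n => n + 2) (fun n => Nat.clog 2 n) :=
    h2.mono fun n => Nat.lt_two_pow_self.le
  have hl1 := hl.add hB (hc 1)
  have hl3 := ((hc 2).mul hl).add hB (hc 3)
  have hP := ((hc (16 * k)).mul hl1).mul hl3
  have hZ := ((((hc 4).mul hl1).mul hn).add hB (hc 1)).mul hl3
  have hZ2 := ((hc 2).mul hZ).add hB (hc 2)
  have g1 := (hn.add hB (hc 1)).mul hP
  have g2 := ((hc 64).mul (h2.mul h2)).add hB (hc 4)
  have g3 := (hc 16).mul (h2.mul (hl1.add hB (hc 1)))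
  have c1 := ((((hc 2).mul hn).add hB hP).mul hP).add hB hP
  have c2 := (((hZ2.add hB (hc 1)).mul (hc k)).add hB (hc k)).add hB (hc 1)
  have c3 := (((hc 4).mul hn).add hB hP).add hB (hc 4)
  have c4 := ((hc 8).mul h2).add hB (hc 4)
  obtain ⟨c, key⟩ := ((((((((g1.add hB g2).add hB g3).add hB hZ2).add hB c1).add hB c2).add hB
    c3).add hB c4).add hB ((hP.pow (3 * k + k * k)).add hB (hc (3 * k + k * k + 3)))).exists_word
  refine ⟨c, fun n w hw => ?_⟩
  have := key n w hw
  have e1 : 2 ^ (2 * Nat.clog 2 n + 3) = 8 * (2 ^ Nat.clog 2 n * 2 ^ Nat.clog 2 n) := by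
    rw [pow_add, two_mul, pow_add]; ring
  have e2 : 2 ^ (Nat.clog 2 n + 1) * (Nat.clog 2 n + 1 + 1) =
      2 * (2 ^ Nat.clog 2 n * (Nat.clog 2 n + 1 + 1)) := by rw [pow_succ]; ring
  refine ⟨by omega, ⟨by omega, by omega, by omega, by omega, by omega⟩,
    ⟨by omega, by omega, by omega, by omega, by omega, by omega⟩⟩

/-- The time is built from polylogarithmic factors and from terms linear in `n` and in `TD n`. Only
the value of `TD` at the same `n` occurs, so no growth condition on it is needed. -/
theorem exists_segment_time (k : ℕ) (TD : ℕ → ℕ) :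
    QuasiIn (fun n => Nat.clog 2 n + 2) (fun n => n + TD n + 1)
      (fun n => sweepTime n (Nat.clog 2 n) + coverTime k n (Nat.clog 2 n) +
        cycleTime k n (16 * k * (Nat.clog 2 n + 1) * (2 * Nat.clog 2 n + 3))
        (Nat.clog 2 n) (TD n) + 1) := by
  have hB : ∀ n : ℕ, 2 ≤ Nat.clog 2 n + 2 := fun n => by omega
  obtain ⟨B, hBdef⟩ : ∃ B, B = fun n => Nat.clog 2 n + 2 := ⟨_, rfl⟩
  obtain ⟨g, hg⟩ : ∃ g, g = fun n => n + TD n + 1 := ⟨_, rfl⟩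
  have hc : ∀ a, PolyIn B (fun _ => a) := by rw [hBdef]; exact PolyIn.const hB
  have hl : PolyIn B (fun n => Nat.clog 2 n) := by
    rw [hBdef]; exact PolyIn.self.mono fun n => by omega
  rw [← hBdef, ← hg]
  replace hB : ∀ n, 2 ≤ B n := by rw [hBdef]; exact hB
  have g1 : ∀ n, 1 ≤ g n := fun n => by rw [hg]; exact Nat.le_add_left _ _
  have qn : QuasiIn B g (fun n => n) := .of_le fun n => by rw [hg]; show n ≤ n + TD n + 1; omega
  have qT : QuasiIn B g (fun n => TD n) := .of_le fun n => by
    rw [hg]; show TD n ≤ n + TD n + 1; omega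
  have qc : ∀ a, QuasiIn B g (fun _ => a) := fun a => .of_poly g1 (hc a)
  have ql : QuasiIn B g (fun n => Nat.clog 2 n) := .of_poly g1 hl
  have hl1 := hl.add hB (hc 1)
  have hl3 := ((hc 2).mul hl).add hB (hc 3)
  have hP := ((hc (16 * k)).mul hl1).mul hl3
  have qM := QuasiIn.mul ((hc 4).mul hl1) qn
  have pb : ∀ {e : ℕ → ℕ}, PolyIn B e → PolyIn B (fun n => 4 * e n + 18) := fun he =>
    ((hc 4).mul he).add hB (hc 18)
  have qs : ∀ {e m : ℕ → ℕ}, PolyIn B e → QuasiIn B g m →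
      QuasiIn B g (fun n => (e n + 1) * (m n * (4 * e n + 18) + 16)) := fun he hm =>
    .mul (he.add hB (hc 1)) (.add hB (.mul' hm (pb he)) (qc 16))
  have q2n := QuasiIn.mul (hc 2) qn
  refine .add hB (.add hB (.add hB ?_ ?_) ?_) (qc 1)
  · exact .add hB (.add hB (ql.mul' (hc 3)) (qc 8)) (.add hB (.add hB (qn.mul' (hc 4)) (qc 3))
      (.add hB (.add hB (qn.mul' (hc 10)) (qc 2)) (.add hB (qs hl1 q2n)
        (.add hB (q2n.mul' (hc 4)) (qc 4)))))
  · refine .add hB (.add hB (qM.mul' (hc 24)) (qc 2)) (.add hB (.add hB (qM.mul' (hc 13)) (qc 2))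
      (.add hB (.add hB (qs hl3 qM) (.add hB (qM.mul' (hc 4)) (qc 4))) (.add hB
        (.add hB (.add hB (qM.mul' (hc 3)) (qc 2)) (.add hB (.mul (hc k)
          (.add hB (.add hB (qM.mul' (hc 7)) (qc 3)) (qc 2))) (qc 2))) (.add hB
          (.add hB (qs hl3 qM) (qc 2)) (.add hB (.mul' qn (.add hB (.mul hP
            (.add hB (.mul (hc 8) hl3) (hc 27))) (hc 4))) (qc 2))))))
  · have prep : QuasiIn B g (fun n => prepTime k n (Nat.clog 2 n)) :=
      .add hB (qc _) (.add hB (.add hB (qn.mul' (hc _)) (qc 2)) (.add hB (.add hB (.add hB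
        (.mul hl1 (.add hB (qn.mul' (pb hl)) (qc 16))) (.add hB (.add hB (qn.mul' (hc 6)) (qc 2))
          (.add hB (.add hB (qn.mul' (hc 5)) (qc 2)) (.add hB (qn.mul' (hc 7)) (qc 4))))) (qc 1))
            (qc 1)))
    exact .add hB (.add hB (.add hB (qc _) (.add hB (.add hB (.mul (hP.pow _) (.add hB (.add hB
      (.add hB prep (.add hB qT (.add hB (.mul (hc k) (.add hB (qn.mul' (hc 4)) (qc 4))) (qc 4))))
        (qc 1)) (qc 2))) (qc 2)) (qc 1))) (qc 1)) (qc 1)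

/-! ## From sparse digraphs to segments -/

theorem Exec.pos {w : ℕ} {p : Prog} {s s' : State} {t : ℕ} (h : Exec w p s s' t) : 1 ≤ t := by
  induction h <;> omega

/-- As `log 2 ≥ 1 / 2`, the binary logarithm is at most `2 * log ((n + 2) ^ 2)`, which gives one
half of the factor `8`; the summand `2` is at most `4 * log 2` and gives the other half. -/
theorem clog_le_log (n : ℕ) : ((Nat.clog 2 n + 2 : ℕ) : ℝ) ≤ 8 * Real.log ((n : ℝ) + 2) := by
  have h2 : (1 / 2 : ℝ) ≤ Real.log 2 := by linarith [Real.log_two_gt_d9]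
  have hlog : Real.log 2 ≤ Real.log ((n : ℝ) + 2) :=
    Real.log_le_log (by norm_num) (by linarith [n.cast_nonneg (α := ℝ)])
  have h3 : ((2 : ℝ) ^ Nat.clog 2 n) ≤ ((n : ℝ) + 2) ^ 2 := by
    have : ((2 ^ Nat.clog 2 n : ℕ) : ℝ) ≤ ((2 * n + 1 : ℕ) : ℝ) := by
      exact_mod_cast two_pow_clog_le n
    push_cast at this
    nlinarith [n.cast_nonneg (α := ℝ)]
  have h4 := Real.log_le_log (by positivity) h3
  rw [Real.log_pow, Real.log_pow] at h4
  have h5 : (Nat.clog 2 n : ℝ) * (1 / 2) ≤ Nat.clog 2 n * Real.log 2 :=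
    mul_le_mul_of_nonneg_left h2 (Nat.cast_nonneg _)
  push_cast at h4 ⊢
  linarith

/-- For `n = 0` the bound `n ≤ T n` says too little; there the algorithm is applied to the empty
digraph, and every execution takes at least one step. -/
theorem one_le_of_digraphCycleInTime {k : ℕ} {T : ℕ → ℝ} (hm : ∀ m : ℕ, (m : ℝ) ≤ T m)
    (h : DigraphCycleInTime k T) (n : ℕ) : 1 ≤ T n := by
  rcases Nat.eq_zero_or_pos n with rfl | hn
  · obtain ⟨p, c, h⟩ := h
    obtain ⟨s', t, he, ht, -⟩ := h ⟨0, 0, Fin.elim0, fun i => i.elim0, fun i => i.elim0, le_rfl⟩ _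
      le_rfl ⟨fun _ => 0, fun _ _ => 0, fun _ => 0, fun _ _ => 0⟩
      ⟨fun _ => by simp, fun _ _ => by simp⟩ ⟨rfl, rfl, fun i => i.elim0⟩
    exact le_trans (by exact_mod_cast he.pos) ht
  · exact le_trans (by exact_mod_cast hn) (hm n)

theorem segmentCycleInTime_of_digraph {k : ℕ} (hk : 3 ≤ k) {T : ℕ → ℝ}
    (hm : ∀ m : ℕ, (m : ℝ) ≤ T m) (h : DigraphCycleInTime k T) :
    ∃ (C : ℝ) (d : ℕ), SegmentCycleInTime k
      (fun n => C * T n * Real.log ((n : ℝ) + 2) ^ d) := by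
  have h1 := one_le_of_digraphCycleInTime hm h
  obtain ⟨D, c₁, hD⟩ := h
  obtain ⟨c₂, hw⟩ := exists_segment_word k
  obtain ⟨e, he⟩ := exists_segment_time k fun n => ⌊T n⌋₊
  refine ⟨3 * 8 ^ e, e, segmentProg k D, c₁ + c₂, fun S w hcw s hs hin => ?_⟩
  rw [add_mul] at hcw
  obtain ⟨hkw, hg, hc⟩ := hw S.n w (by omega)
  have hfind : FindsCycles w k S.n ⌊T S.n⌋₊ D := fun G hG s hs hin => by
    obtain ⟨s', t, hE, ht, hQ⟩ := hD G w (by rw [hG]; omega) s hs hin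
    exact ⟨s', t, hE, Nat.le_floor (by rw [← hG]; exact ht), hQ⟩
  obtain ⟨s', t, hE, ht, hQ⟩ := run_segmentProg S hs (by omega) hin hkw (fun _ => hfind) hg hc
  refine ⟨s', t, hE, ?_, hQ⟩
  have a1 : (t : ℝ) ≤ (((Nat.clog 2 S.n + 2) ^ e * (S.n + ⌊T S.n⌋₊ + 1) : ℕ) : ℝ) := by
    exact_mod_cast ht.trans (he S.n)
  rw [Nat.cast_mul, Nat.cast_pow] at a1
  -- Each of the three summands is at most `T n`.
  have a2 : ((S.n + ⌊T S.n⌋₊ + 1 : ℕ) : ℝ) ≤ 3 * T S.n := by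
    have := Nat.floor_le (show 0 ≤ T S.n by linarith [h1 S.n])
    have := hm S.n
    have := h1 S.n
    push_cast
    linarith
  have a3 := pow_le_pow_left₀ (Nat.cast_nonneg _) (clog_le_log S.n) e
  refine a1.trans ((mul_le_mul a3 a2 (Nat.cast_nonneg _) (le_trans (by positivity) a3)).trans ?_)
  rw [mul_pow]
  apply le_of_eq
  ring

/-! ## Looking up edges -/

theorem Run.assign {w T r v : ℕ} {e : WExpr} {q : Prog} {s : State} {Q : State → Prop}
    (hv : e.eval w s = v) (h : Run w q (s.setReg r v) T Q) : Run w (.setReg r e ;; q) s (T + 1) Q :=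
  Run.setReg_seq (by rw [hv]; exact h)

/-- `S 0 < S 1 < ⋯ < S (m - 1)` encode the edges `(x, y)` of a digraph as numbers `x * N + y`. -/
structure EdgeList (N m : ℕ) (S : ℕ → ℕ) : Prop where
  mono : ∀ p q, p < q → q < m → S p < S q
  lt : ∀ p < m, S p < N * N

def HasEdge (N m : ℕ) (S : ℕ → ℕ) (x y : ℕ) : Prop := ∃ p < m, S p = x * N + y

/-- The codes below `K` form an initial segment of the increasing list. For `K = y * N` its end is
the place where the edges that leave `y` begin. -/
theorem EdgeList.exists_pos {N m : ℕ} {S : ℕ → ℕ} (h : EdgeList N m S) (K : ℕ) :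
    ∃ a ≤ m, ∀ p < m, S p < K ↔ p < a := by
  classical
  have hex : ∃ a, a = m ∨ K ≤ S a := ⟨m, .inl rfl⟩
  refine ⟨Nat.find hex, Nat.find_min' hex (.inl rfl), fun p hp => ⟨fun hS => ?_, fun hpa => ?_⟩⟩
  · by_contra hle
    have := Nat.find_spec hex
    rcases Nat.lt_or_ge (Nat.find hex) p with h1 | h1
    · have := h.mono _ _ h1 hp
      omega
    · have e : Nat.find hex = p := by omega
      rw [e] at this
      omega
  · have := Nat.find_min hex hpa
    omega

/-- The memory holds the edge list. -/
structure Ready (N m : ℕ) (S : ℕ → ℕ) (s : State) : Prop where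
  h10 : s.reg 10 = N
  h11 : s.reg 11 = m
  h3 : ∀ p < m, s.arr 3 p = S p

theorem Ready.of_frame {N m w : ℕ} {S : ℕ → ℕ} {s s' : State} {p : Prog} (h : Ready N m S s)
    (hf : Frame w p s s')
    (hp : p.modReg 10 = false ∧ p.modReg 11 = false ∧ p.modArr 3 = false) : Ready N m S s' :=
  ⟨(hf.reg 10 hp.1).trans h.h10, (hf.reg 11 hp.2.1).trans h.h11, by
    rw [hf.arr 3 hp.2.2]; exact h.h3⟩

/-- Register `35` becomes the number of edges with code less than `e`. -/
def locateProg (e : WExpr) : Prog :=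
  .setReg 38 e ;; .setReg 35 0 ;; .setReg 36 (.reg 11) ;;
  bsearch (.wlt (.arr 3 (.reg 37)) (.reg 38))

theorem run_locateProg {w N m K D a : ℕ} {S : ℕ → ℕ} {s : State} {e : WExpr}
    (R : Ready N m S s) (he : e.eval w s = K) (ham : a ≤ m) (ha : ∀ p < m, S p < K ↔ p < a)
    (hD : m < 2 ^ D) (hw : 2 * m + 2 < 2 ^ w) :
    Run w (locateProg e) s (4 * D + 4) (fun s' => s'.reg 35 = a ∧ s'.reg 38 = K) := by
  refine Run.time (T₁ := 4 * D + 1 + 1 + 1 + 1) ?_ (by omega)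
  refine Run.assign he (Run.assign (v := 0) (by simp) (Run.assign (v := m)
    (by simp [R.h11]) ?_))
  obtain ⟨s₁, hs₁⟩ : ∃ s₁, s₁ = ((s.setReg 38 K).setReg 35 0).setReg 36 m := ⟨_, rfl⟩
  rw [← hs₁]
  have e38 : s₁.reg 38 = K := by rw [hs₁]; simp
  have e3 : s₁.arr 3 = s.arr 3 := by rw [hs₁]; rfl
  refine (run_bsearch (w := w) (D := D) (a := 0) (b := m) (ans := a) (by rw [hs₁]; simp)
    (by rw [hs₁]; simp) (.inr ⟨by omega, ham⟩) (by omega) hw ?_).post ?_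
  · rintro s' p hf - hp h37
    simp only [Test.eval_wlt, WExpr.eval_arr, WExpr.eval_reg, h37, hf.arr 3 rfl, hf.reg 38 rfl,
      e38, e3, R.h3 p hp, ha p hp]
  · intro s' hf h
    exact ⟨h, by rw [hf.reg 38 rfl, e38]⟩

/-- Register `24` becomes `0` if there is no edge from the value of `x` to that of `y`. -/
def queryProg (x y : WExpr) : Prog :=
  locateProg (x * .reg 10 + y) ;;
  .ite (.and (.wlt (.reg 35) (.reg 11)) (.weq (.arr 3 (.reg 35)) (.reg 38))) .skip (.setReg 24 0)

open scoped Classical in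
theorem run_queryProg {w N m x y D : ℕ} {S : ℕ → ℕ} {s : State} {ex ey : WExpr}
    (h : EdgeList N m S) (R : Ready N m S s) (hx : ex.eval w s = x) (hy : ey.eval w s = y)
    (hxN : x < N) (hyN : y < N) (hN : N * N < 2 ^ w) (hD : m < 2 ^ D) (hw : 2 * m + 2 < 2 ^ w) :
    Run w (queryProg ex ey) s (4 * D + 6)
      (fun s' => s'.reg 24 = if HasEdge N m S x y then s.reg 24 else 0) := by
  have hxy : (x + 1) * N ≤ N * N := Nat.mul_le_mul_right _ hxN
  rw [add_mul] at hxy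
  obtain ⟨a, ham, ha⟩ := h.exists_pos (x * N + y)
  refine Run.bind (T₁ := 4 * D + 4) (T₂ := 1 + 1) (run_locateProg R (K := x * N + y) ?_ ham ha hD hw)
    fun s₁ hf ⟨h35, h38⟩ => ?_
  · simp (disch := omega) only [WExpr.eval_add, WExpr.eval_mul, WExpr.eval_reg, hx, hy, R.h10,
      mod_pow_of_lt]
  have R₁ := R.of_frame hf ⟨rfl, rfl, rfl⟩
  have h24 : s₁.reg 24 = s.reg 24 := hf.reg 24 rfl
  refine Run.ite (fun hb => Run.skip ?_) (fun hb => Run.setReg ?_)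
  all_goals simp only [Test.eval_and, Test.eval_wlt, Test.eval_weq, WExpr.eval_reg, WExpr.eval_arr,
    R₁.h11, h35, h38] at hb
  · rw [R₁.h3 a hb.1] at hb
    rw [if_pos ⟨a, hb⟩, h24]
  · rw [if_neg]
    · simp
    · rintro ⟨p, hp, hS⟩
      have h1 := ha p hp
      have h2 : a = p := by
        rcases Nat.lt_trichotomy a p with h2 | h2 | h2
        · have := h.mono _ _ h2 hp
          have := ha a (h2.trans hp)
          omega
        · exact h2
        · omega
      rw [h2] at hb
      exact hb ⟨hp, (R₁.h3 p hp).trans hS⟩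

/-- A directed triangle. -/
def IsTriangle (N m : ℕ) (S : ℕ → ℕ) (x y z : ℕ) : Prop :=
  (x < N ∧ y < N ∧ z < N) ∧ HasEdge N m S x y ∧ HasEdge N m S y z ∧ HasEdge N m S z x

/-- Register `0` and array `0` hold a triangle, or register `0` is `0` and `E` is false. -/
def Found (N m : ℕ) (S : ℕ → ℕ) (E : Prop) (s : State) : Prop :=
  (s.reg 0 = 1 ∧ ∃ x y z, IsTriangle N m S x y z ∧ s.arr 0 0 = x ∧ s.arr 0 1 = y ∧ s.arr 0 2 = z) ∨
  (s.reg 0 = 0 ∧ ¬ E)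

theorem Found.mono {N m : ℕ} {S : ℕ → ℕ} {E E' : Prop} {s s' : State} (h : Found N m S E s)
    (h0 : s'.reg 0 = s.reg 0) (ha : s'.arr 0 = s.arr 0) (hE : E' → E) : Found N m S E' s' := by
  unfold Found at *
  rw [h0, ha]
  exact h.imp_right fun h => ⟨h.1, mt hE h.2⟩

/-- Tests the triple in registers `20`, `21` and `22`. -/
def checkProg : Prog :=
  .setReg 24 1 ;; queryProg (.reg 20) (.reg 21) ;; queryProg (.reg 21) (.reg 22) ;;
  queryProg (.reg 22) (.reg 20) ;;
  .ite (.weq (.reg 24) 1)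
    (.setReg 0 1 ;; .setArr 0 0 (.reg 20) ;; .setArr 0 1 (.reg 21) ;; .setArr 0 2 (.reg 22)) .skip

/-- A triple is reported only after its three edges have been looked up, so candidates may be
produced carelessly; `hE` records what has been ruled out if the check fails. -/
theorem run_checkProg {w N m x y z D : ℕ} {S : ℕ → ℕ} {s : State} {E E' : Prop}
    (h : EdgeList N m S) (R : Ready N m S s) (hx : s.reg 20 = x) (hy : s.reg 21 = y)
    (hz : s.reg 22 = z) (hxN : x < N) (hyN : y < N) (hzN : z < N) (hN : N * N < 2 ^ w)
    (hD : m < 2 ^ D) (hw : 2 * m + 2 < 2 ^ w) (hF : Found N m S E s)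
    (hE : E' → E ∨ IsTriangle N m S x y z) :
    Run w checkProg s (12 * D + 24) (fun s' => Found N m S E' s') := by
  have h1 : 1 < 2 ^ w := by omega
  have hNw : N < 2 ^ w := by
    rcases Nat.eq_zero_or_pos N with h0 | h0
    · omega
    · exact (Nat.le_mul_of_pos_left N h0).trans_lt hN
  refine Run.time (T₁ := ((4 * D + 6) + ((4 * D + 6) + ((4 * D + 6) + (4 + 1)))) + 1) ?_ (by omega)
  refine Run.assign (v := 1) (by simp (disch := omega) only [WExpr.eval_ofNat, mod_pow_of_lt]) ?_
  obtain ⟨s₁, hs₁⟩ : ∃ s₁, s₁ = s.setReg 24 1 := ⟨_, rfl⟩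
  rw [← hs₁]
  have R₁ : Ready N m S s₁ := ⟨by rw [hs₁]; simpa using R.h10, by rw [hs₁]; simpa using R.h11,
    by rw [hs₁]; exact R.h3⟩
  have x₁ : s₁.reg 20 = x := by rw [hs₁]; simpa using hx
  have y₁ : s₁.reg 21 = y := by rw [hs₁]; simpa using hy
  have z₁ : s₁.reg 22 = z := by rw [hs₁]; simpa using hz
  have f₁ : s₁.reg 24 = 1 := by rw [hs₁]; simp
  have F₁ : Found N m S E s₁ := hF.mono (by rw [hs₁]; simp) (by rw [hs₁]; rfl) id
  refine Run.bind (run_queryProg h R₁ x₁ y₁ hxN hyN hN hD hw) fun s₂ hf₂ q₂ => ?_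
  have R₂ := R₁.of_frame hf₂ ⟨rfl, rfl, rfl⟩
  refine Run.bind (run_queryProg h R₂ ((hf₂.reg 21 rfl).trans y₁) ((hf₂.reg 22 rfl).trans z₁)
    hyN hzN hN hD hw) fun s₃ hf₃ q₃ => ?_
  have R₃ := R₂.of_frame hf₃ ⟨rfl, rfl, rfl⟩
  refine Run.bind (run_queryProg h R₃ (((hf₃.reg 22 rfl).trans (hf₂.reg 22 rfl)).trans z₁)
    (((hf₃.reg 20 rfl).trans (hf₂.reg 20 rfl)).trans x₁) hzN hxN hN hD hw) fun s₄ hf₄ q₄ => ?_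
  have F₄ : Found N m S E s₄ := F₁.mono (by rw [hf₄.reg 0 rfl, hf₃.reg 0 rfl, hf₂.reg 0 rfl])
    (by rw [hf₄.arr 0 rfl, hf₃.arr 0 rfl, hf₂.arr 0 rfl]) id
  have x₄ : s₄.reg 20 = x := by rw [hf₄.reg 20 rfl, hf₃.reg 20 rfl, hf₂.reg 20 rfl, x₁]
  have y₄ : s₄.reg 21 = y := by rw [hf₄.reg 21 rfl, hf₃.reg 21 rfl, hf₂.reg 21 rfl, y₁]
  have z₄ : s₄.reg 22 = z := by rw [hf₄.reg 22 rfl, hf₃.reg 22 rfl, hf₂.reg 22 rfl, z₁]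
  rw [q₃, q₂, f₁] at q₄
  have key : s₄.reg 24 = 1 ↔ IsTriangle N m S x y z := by
    rw [q₄]
    unfold IsTriangle
    split_ifs <;> simp [*]
  refine Run.ite (fun hb => ?_) (fun hb => (Run.skip ?_).time (by omega))
  all_goals simp (disch := omega) only [Test.eval_weq, WExpr.eval_reg, WExpr.eval_ofNat,
    mod_pow_of_lt, key] at hb
  · refine Run.time (T₁ := 1 + 1 + 1 + 1) ?_ le_rfl
    refine Run.assign (v := 1) (by simp (disch := omega) only [WExpr.eval_ofNat, mod_pow_of_lt]) ?_
    refine Run.setArr_seq (Run.setArr_seq (Run.setArr (.inl ⟨by simp, x, y, z, hb, ?_⟩)))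
    have h2 : 2 < 2 ^ w := by
      have := hxN
      omega
    have hxw : x < 2 ^ w := by omega
    have hyw : y < 2 ^ w := by omega
    have hzw : z < 2 ^ w := by omega
    simp (disch := omega) only [State.setArr_arr, State.setArr_reg, State.setReg_reg,
      WExpr.eval_reg, WExpr.eval_ofNat, mod_pow_of_lt, x₄, y₄, z₄, reduceIte, and_self, OfNat.ofNat_ne_zero, OfNat.ofNat_ne_one, OfNat.zero_ne_ofNat,
      OfNat.one_ne_ofNat, one_ne_zero, zero_ne_one]
  · exact F₄.mono rfl rfl fun hE' => (hE hE').resolve_right hb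

/-! ## Sorting the edges -/

/-- Copies the size of the graph to registers `10` and `11` and the sorted edge list to array `3`. -/
def edgeListProg : Prog :=
  .setReg 10 (.reg 0) ;; .setReg 11 (.reg 1) ;;
  .for 14 (.reg 11) (.setArr 2 (.reg 14) (.arr 0 (.reg 14) * .reg 10 + .arr 1 (.reg 14))) ;;
  .setReg 0 (.reg 11) ;; dimsProg 1 ;; .setReg 30 (.reg 11) ;; .setReg 29 (.reg 2) ;;
  sortProg (fun e₁ e₂ => .wlt (.arr 2 e₁) (.arr 2 e₂)) ;;
  .for 14 (.reg 11) (.setArr 3 (.reg 14) (.arr 2 (.arr 10 (.reg 14))))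

theorem exists_edgeList {N m : ℕ} {K : ℕ → ℕ} (hinj : ∀ x < m, ∀ y < m, K x = K y → x = y)
    (hK : ∀ x < m, K x < N * N) :
    StrictOn (fun x y => K x < K y) m ∧ ∃ S, EdgeList N m S ∧
      (∀ x < m, S (rank (fun x y => K x < K y) m x) = K x) ∧
      ∀ a, (∃ p < m, S p = a) ↔ ∃ x < m, K x = a := by
  have st : StrictOn (fun x y => K x < K y) m :=
    ⟨fun x _ => lt_irrefl _, fun x _ y _ z _ => lt_trans,
      fun x hx y hy hne => Nat.lt_or_gt_of_ne fun e => hne (hinj x hx y hy e)⟩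
  have hs : ∀ p, ∃ x, p < m → x < m ∧ rank (fun x y => K x < K y) m x = p := fun p => by
    by_cases hp : p < m
    · obtain ⟨x, hx, e⟩ := st.rank_surj hp
      exact ⟨x, fun _ => ⟨hx, e⟩⟩
    · exact ⟨0, fun h => absurd h hp⟩
  choose f hf using hs
  have hfr : ∀ x < m, f (rank (fun x y => K x < K y) m x) = x := fun x hx =>
    st.rank_inj (hf _ (st.rank_lt hx)).1 hx (hf _ (st.rank_lt hx)).2
  refine ⟨st, fun p => K (f p), ⟨fun p q hpq hq => ?_, fun p hp => hK _ (hf p hp).1⟩,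
    fun x hx => congrArg K (hfr x hx), fun a => ⟨?_, ?_⟩⟩
  · have h1 := hf p (hpq.trans hq)
    have h2 := hf q hq
    rw [← st.rank_lt_iff h1.1 h2.1, h1.2, h2.2]
    exact hpq
  · rintro ⟨p, hp, rfl⟩
    exact ⟨f p, (hf p hp).1, rfl⟩
  · rintro ⟨x, hx, rfl⟩
    exact ⟨_, st.rank_lt hx, congrArg K (hfr x hx)⟩

/-- The word size suffices for sorting the edges. -/
structure ListWord (w N m : ℕ) : Prop where
  h1 : N * N < 2 ^ w
  h2 : 8 * 2 ^ Nat.clog 2 m + 4 < 2 ^ w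
  h3 : 16 * 1 * (Nat.clog 2 m + 1) * (2 * Nat.clog 2 m + 3) < 2 ^ w
  h4 : 4 * (Nat.clog 2 m + 1) * m < 2 ^ w

theorem run_edgeListProg {w N m : ℕ} {t h : ℕ → ℕ} {s : State} (hs : s.Bounded w)
    (h0 : s.reg 0 = N) (h1 : s.reg 1 = m) (hw : ListWord w N m)
    (ht : ∀ i < m, s.arr 0 i = t i ∧ s.arr 1 i = h i)
    (hN : ∀ i < m, t i < N ∧ h i < N)
    (hinj : ∀ i < m, ∀ j < m, t i = t j → h i = h j → i = j) :
    Run w edgeListProg s ((m * 3 + 2) + ((Nat.clog 2 m * 3 + 8) +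
        (((Nat.clog 2 m + 1) * (m * (4 * Nat.clog 2 m + 18) + 16)) + (m * 3 + 2))) + 5)
      (fun s' => ∃ S, EdgeList N m S ∧ Ready N m S s' ∧
        ∀ x < N, ∀ y < N, HasEdge N m S x y ↔ ∃ i < m, t i = x ∧ h i = y) := by
  obtain ⟨ℓ, hℓ⟩ : ∃ ℓ, ℓ = Nat.clog 2 m := ⟨_, rfl⟩
  have hmℓ : m ≤ 2 ^ ℓ := hℓ ▸ Nat.le_pow_clog (by omega) m
  obtain ⟨w1, w2, w3, w4⟩ := hw
  rw [← hℓ] at w2 w3 w4 ⊢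
  have hkey : ∀ {a b a' b' : ℕ}, b < N → b' < N → a * N + b = a' * N + b' → a = a' ∧ b = b' := by
    intro a b a' b' hb hb' e
    have e1 : (b + N * a) / N = (b' + N * a') / N := by rw [mul_comm N, mul_comm N]; congr 1; omega
    rw [Nat.add_mul_div_left _ _ (by omega), Nat.add_mul_div_left _ _ (by omega),
      Nat.div_eq_of_lt hb, Nat.div_eq_of_lt hb'] at e1
    have e2 : a = a' := by omega
    subst e2
    exact ⟨rfl, by omega⟩
  have hlt : ∀ {a b : ℕ}, a < N → b < N → a * N + b < N * N := by
    intro a b ha hb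
    have : (a + 1) * N ≤ N * N := Nat.mul_le_mul_right _ ha
    rw [add_mul] at this
    omega
  obtain ⟨st, S, hS, hr, hm⟩ := exists_edgeList (N := N) (m := m) (K := fun i => t i * N + h i)
    (fun x hx y hy e => by
      obtain ⟨a, b⟩ := hkey (hN x hx).2 (hN y hy).2 e
      exact hinj x hx y hy a b) fun x hx => hlt (hN x hx).1 (hN x hx).2
  refine Run.time (T₁ := ((m * (1 + 2) + 2) + (((ℓ * 3 + 8) +
    (((((ℓ + 1) * (m * (4 * ℓ + 18) + 16)) + (m * (1 + 2) + 2)) + 1) + 1)) + 1)) + 1 + 1) ?_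
    (by omega)
  refine Run.assign h0 (Run.assign (v := m) (by simpa using h1) ?_)
  obtain ⟨s₁, hs₁⟩ : ∃ s₁, s₁ = (s.setReg 10 N).setReg 11 m := ⟨_, rfl⟩
  rw [← hs₁]
  have hNw : N < 2 ^ w := by
    rcases Nat.eq_zero_or_pos N with h0 | h0
    · omega
    · exact (Nat.le_mul_of_pos_left N h0).trans_lt w1
  have b₁ : s₁.Bounded w := by rw [hs₁]; exact (hs.setReg _ hNw).setReg _ (by omega)
  have e10 : s₁.reg 10 = N := by rw [hs₁]; simp
  have e11 : s₁.reg 11 = m := by rw [hs₁]; simp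
  have e0 : s₁.arr 0 = s.arr 0 := by rw [hs₁]; rfl
  have e1 : s₁.arr 1 = s.arr 1 := by rw [hs₁]; rfl
  refine Run.bind (Run.for (n := m) (T := 1) (fun i s' => ∀ j < i, s'.arr 2 j = t j * N + h j)
    (by omega) rfl (fun s' hf => by rw [WExpr.eval_reg, hf.reg 11 rfl, e11]) (by simp)
    fun i s' hi hf h14 hI => Run.setArr ?_) fun s₂ f₂ h₂ => ?_
  · intro j hj
    have := hlt (hN i hi).1 (hN i hi).2
    simp (disch := omega) only [State.setReg_arr, State.setArr_arr, WExpr.eval_add, WExpr.eval_mul,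
      WExpr.eval_arr, WExpr.eval_reg, h14, hf.arr 0 rfl, hf.arr 1 rfl, hf.reg 10 rfl, e10, e0, e1,
      (ht i hi).1, (ht i hi).2, mod_pow_of_lt, reduceIte]
    split_ifs with hji
    · rw [hji]
    · exact hI j (by omega)
  have b₂ := f₂.bdd b₁
  -- `dimsProg` is reused for the binary logarithm and expects its argument in register `0`; `N` and
  -- `m` have been saved in registers `10` and `11`.
  refine Run.assign (v := m) (by rw [WExpr.eval_reg, f₂.reg 11 rfl, e11]) ?_
  obtain ⟨s₃, hs₃⟩ : ∃ s₃, s₃ = s₂.setReg 0 m := ⟨_, rfl⟩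
  rw [← hs₃]
  have b₃ : s₃.Bounded w := by rw [hs₃]; exact b₂.setReg _ (by omega)
  have hdims := run_dimsProg (k := 1) (w := w) (n := m) (s := s₃) (by rw [hs₃]; simp)
    (by rw [← hℓ]; exact w3) (by omega) (by rw [← hℓ]; exact w4) (by rw [← hℓ]; omega)
  rw [← hℓ] at hdims
  refine Run.bind hdims fun s₄ f₄ D₄ => ?_
  have e4 : s₄.reg 10 = N ∧ s₄.reg 11 = m ∧ s₄.arr 2 = s₂.arr 2 := by
    rw [f₄.reg 10 rfl, f₄.reg 11 rfl, f₄.arr 2 rfl, hs₃]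
    simp only [State.setReg_reg, State.setReg_arr, OfNat.ofNat_ne_zero, reduceIte,
      f₂.reg 10 rfl, f₂.reg 11 rfl, e10, e11, and_self]
  refine Run.assign (v := m) e4.2.1 (Run.assign (v := ℓ) (by simpa using D₄.h2) ?_)
  obtain ⟨s₅, hs₅⟩ : ∃ s₅, s₅ = (s₄.setReg 30 m).setReg 29 ℓ := ⟨_, rfl⟩
  rw [← hs₅]
  have e5 : s₅.reg 10 = N ∧ s₅.reg 11 = m ∧ s₅.arr 2 = s₂.arr 2 := by
    rw [hs₅]; simpa using e4
  have hℓw : ℓ < 2 ^ ℓ := Nat.lt_two_pow_self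
  refine Run.bind (run_sortProg st (s := s₅) (D := ℓ)
    (by rw [hs₅]; exact ((f₄.bdd b₃).setReg _ (by omega)).setReg _ (by omega)) hmℓ w2
    (by rw [hs₅]; simp) (by rw [hs₅]; simp) ?_) fun s₆ f₆ h₆ => ?_
  · intro s' hf e₁ e₂ l1 l2
    simp only [Test.eval_wlt, WExpr.eval_arr, hf.arr 2 rfl, e5.2.2, h₂ _ l1, h₂ _ l2]
  refine (Run.for (n := m) (T := 1) (fun i s' => ∀ j < i, s'.arr 3 j = S j)
    (by omega) rfl (fun s' hf => by rw [WExpr.eval_reg, hf.reg 11 rfl, f₆.reg 11 rfl, e5.2.1])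
    (by simp) fun i s' hi hf h14 hI => Run.setArr ?_).post fun s₇ f₇ h₇ =>
      ⟨S, hS, ⟨?_, ?_, h₇⟩, fun x hx y hy => ?_⟩
  · intro j hj
    obtain ⟨x, hx, rfl⟩ := st.rank_surj hi
    simp (disch := omega) only [State.setReg_arr, State.setArr_arr, WExpr.eval_arr, WExpr.eval_reg,
      h14, hf.arr 2 rfl, hf.arr 10 rfl, f₆.arr 2 rfl, e5.2.2, (h₆ x hx).1, h₂ x hx, reduceIte]
    split_ifs with hji
    · rw [hji, hr x hx]
    · exact hI j (by omega)
  · rw [f₇.reg 10 rfl, f₆.reg 10 rfl, e5.1]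
  · rw [f₇.reg 11 rfl, f₆.reg 11 rfl, e5.2.1]
  · unfold HasEdge
    rw [hm]
    refine exists_congr fun i => and_congr_right fun hi => ⟨fun e => hkey (hN i hi).2 hy e, ?_⟩
    rintro ⟨rfl, rfl⟩
    rfl

/-! ## Triangles through a vertex of low degree -/

/-- `Δ` is the degree threshold; every `Δ`-th edge of the sorted list is a sample, and there are `H`
of them. -/
structure TriContext (w N m Δ H D : ℕ) (S : ℕ → ℕ) : Prop where
  list : EdgeList N m S
  hN : N * N < 2 ^ w
  hD : m < 2 ^ D
  hw : 2 * m + 2 < 2 ^ w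
  hm : m * m < 2 ^ w
  pos : 1 ≤ m
  Δ_pos : 1 ≤ Δ
  Δ_le : Δ ≤ m
  hH : H = (m - 1) / Δ + 1

/-- The memory holds the edge list, the degree threshold and the number of samples. -/
structure Tuned (N m Δ H : ℕ) (S : ℕ → ℕ) (s : State) : Prop where
  ready : Ready N m S s
  h12 : s.reg 12 = Δ
  h13 : s.reg 13 = H

theorem Tuned.of_frame {N m Δ H w : ℕ} {S : ℕ → ℕ} {s s' : State} {p : Prog}
    (h : Tuned N m Δ H S s) (hf : Frame w p s s')
    (hp : p.modReg 10 = false ∧ p.modReg 11 = false ∧ p.modArr 3 = false ∧ p.modReg 12 = false ∧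
      p.modReg 13 = false) : Tuned N m Δ H S s' :=
  ⟨h.ready.of_frame hf ⟨hp.1, hp.2.1, hp.2.2.1⟩, (hf.reg 12 hp.2.2.2.1).trans h.h12,
    (hf.reg 13 hp.2.2.2.2).trans h.h13⟩

/-- The tail of the `i`-th sample. -/
def sample (N Δ : ℕ) (S : ℕ → ℕ) (i : ℕ) : ℕ := S (i * Δ) / N

/-- The first `i` candidate pairs of edges `(x, y)`, `(y, z)` contain two edges of a triangle. -/
def LowTriangle (N m Δ : ℕ) (S : ℕ → ℕ) (i : ℕ) : Prop :=
  ∃ p < i, ∃ x y z a, IsTriangle N m S x y z ∧ S (p / Δ) = x * N + y ∧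
    (a ≤ m ∧ ∀ r < m, S r < y * N ↔ r < a) ∧ a + p % Δ < m ∧ S (a + p % Δ) = y * N + z

section
variable {w N m Δ H D : ℕ} {S : ℕ → ℕ}

theorem TriContext.H_le (c : TriContext w N m Δ H D S) : H ≤ m := by
  have := Nat.div_le_self (m - 1) Δ
  have := c.hH
  have := c.pos
  omega

theorem TriContext.N_pos (c : TriContext w N m Δ H D S) : 0 < N :=
  Nat.pos_of_ne_zero fun h => by
    have := c.list.lt 0 c.pos
    rw [h] at this
    omega

theorem TriContext.N_lt (c : TriContext w N m Δ H D S) : N < 2 ^ w :=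
  (Nat.le_mul_of_pos_left N c.N_pos).trans_lt c.hN

theorem TriContext.sample_pos (c : TriContext w N m Δ H D S) {i : ℕ} (hi : i < H) :
    i * Δ < m := by
  have := c.pos
  have h1 : i ≤ (m - 1) / Δ := by have := c.hH; omega
  have := (Nat.le_div_iff_mul_le c.Δ_pos).1 h1
  omega

theorem TriContext.sample_lt (c : TriContext w N m Δ H D S) {i : ℕ} (hi : i < H) :
    sample N Δ S i < N := Nat.div_lt_of_lt_mul (c.list.lt _ (c.sample_pos hi))

/-- The edge `(y, z)` is not among the first `Δ` edges that leave `y`, since the pair with `(x, y)`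
would have been tried. So at least `Δ` edges from `y` precede it, and one of `Δ` consecutive
positions is a multiple of `Δ`. -/
theorem TriContext.exists_sample (c : TriContext w N m Δ H D S)
    (hlow : ¬ LowTriangle N m Δ S (m * Δ)) {x y z : ℕ} (h : IsTriangle N m S x y z) :
    ∃ i < H, sample N Δ S i = y := by
  obtain ⟨e, he, hxy⟩ := h.2.1
  obtain ⟨r, hr, hyz⟩ := h.2.2.1
  obtain ⟨a, ham, ha⟩ := c.list.exists_pos (y * N)
  have hΔ := c.Δ_pos
  have har : a ≤ r := by
    have := ha r hr
    omega
  rcases Nat.lt_or_ge r (a + Δ) with hlt | hge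
  · refine absurd ⟨e * Δ + (r - a), ?_, x, y, z, a, h, ?_, ⟨ham, ha⟩, ?_⟩ hlow
    · have : (e + 1) * Δ ≤ m * Δ := Nat.mul_le_mul_right _ he
      rw [add_mul] at this
      omega
    · rw [mul_comm, Nat.mul_add_div hΔ, Nat.div_eq_of_lt (by omega), Nat.add_zero, hxy]
    · rw [mul_comm, Nat.mul_add_mod, Nat.mod_eq_of_lt (by omega), Nat.add_sub_cancel' har]
      exact ⟨hr, hyz⟩
  · have h1 := Nat.div_mul_le_self (a + Δ - 1) Δ
    have h2 := Nat.lt_div_mul_add (a := a + Δ - 1) hΔ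
    obtain ⟨i, hi⟩ : ∃ i, i = (a + Δ - 1) / Δ := ⟨_, rfl⟩
    rw [← hi] at h1 h2
    have him : i * Δ < m := by omega
    have hiH : i ≤ (m - 1) / Δ := (Nat.le_div_iff_mul_le hΔ).2 (by omega)
    refine ⟨i, by have := c.hH; omega, ?_⟩
    have h3 := ha _ him
    have h4 : S (i * Δ) ≤ S r := by
      rcases Nat.lt_or_ge (i * Δ) r with h | h
      · exact (c.list.mono _ _ h hr).le
      · rw [show i * Δ = r by omega]
    have h5 := h.1.2.2
    exact Nat.div_eq_of_lt_le (by omega) (by rw [add_mul]; omega)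

/-- Tries the first `Δ` edges from the head of every edge. -/
def lowProg : Prog :=
  .for 14 (.reg 11 * .reg 12)
    (.setReg 20 (.arr 3 (.reg 14 / .reg 12) / .reg 10) ;;
     .setReg 21 (.arr 3 (.reg 14 / .reg 12) % .reg 10) ;;
     locateProg (.reg 21 * .reg 10) ;;
     .setReg 22 (.arr 3 (.reg 35 + .reg 14 % .reg 12) % .reg 10) ;;
     checkProg)

theorem run_lowProg (c : TriContext w N m Δ H D S) {s : State} (t : Tuned N m Δ H S s)
    (hs : s.Bounded w) (h0 : s.reg 0 = 0) :
    Run w lowProg s (m * Δ * (16 * D + 33) + 2) (Found N m S (LowTriangle N m Δ S (m * Δ))) := by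
  have hmΔ : m * Δ ≤ m * m := Nat.mul_le_mul_left _ c.Δ_le
  have hmm := c.hm
  have hΔ := c.Δ_pos
  have hΔm := c.Δ_le
  have hNp := c.N_pos
  have hNw := c.N_lt
  have hw := c.hw
  refine Run.time (T₁ := m * Δ * ((((4 * D + 4) + ((12 * D + 24) + 1)) + 1 + 1) + 2) + 2) ?_
    (Nat.add_le_add_right (Nat.mul_le_mul_left _ (by omega)) _)
  refine Run.for (n := m * Δ) (fun i s' => Found N m S (LowTriangle N m Δ S i) s') (by omega) rfl
    (fun s' hf => ?_) (.inr ⟨by simpa using h0, fun ⟨p, hp, _⟩ => by omega⟩)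
    fun i s' hi hf h14 hF => ?_
  · simp (disch := omega) only [WExpr.eval_mul, WExpr.eval_reg, hf.reg 11 rfl, hf.reg 12 rfl,
      t.ready.h11, t.h12, mod_pow_of_lt]
  have t' : Tuned N m Δ H S s' := t.of_frame hf ⟨rfl, rfl, rfl, rfl, rfl⟩
  have b' : s'.Bounded w := hf.bdd hs
  have hq : i / Δ < m := Nat.div_lt_of_lt_mul (by rw [mul_comm]; exact hi)
  have hr : i % Δ < Δ := Nat.mod_lt _ hΔ
  have hSlt := c.list.lt _ hq
  have hSw : S (i / Δ) < 2 ^ w := hSlt.trans c.hN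
  obtain ⟨x, hx⟩ : ∃ x, x = S (i / Δ) / N := ⟨_, rfl⟩
  obtain ⟨y, hy⟩ : ∃ y, y = S (i / Δ) % N := ⟨_, rfl⟩
  have hxN : x < N := by rw [hx]; exact Nat.div_lt_of_lt_mul hSlt
  have hyN : y < N := by rw [hy]; exact Nat.mod_lt _ hNp
  have hSe : S (i / Δ) = x * N + y := by rw [hx, hy, mul_comm, Nat.div_add_mod]
  obtain ⟨a, ham, ha⟩ := c.list.exists_pos (y * N)
  refine Run.assign (v := x) ?_ (Run.assign (v := y) ?_ ?_)
  · simp (disch := omega) only [WExpr.eval_div, WExpr.eval_arr, WExpr.eval_reg, h14, t'.h12,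
      t'.ready.h10, mod_pow_of_lt, t'.ready.h3]
    exact hx.symm
  · simp (disch := omega) only [WExpr.eval_div, WExpr.eval_mod, WExpr.eval_arr, WExpr.eval_reg,
      State.setReg_reg, State.setReg_arr, Nat.reduceEqDiff, reduceIte, h14, t'.h12, t'.ready.h10,
      mod_pow_of_lt, t'.ready.h3]
    exact hy.symm
  obtain ⟨s₁, hs₁⟩ : ∃ s₁, s₁ = (s'.setReg 20 x).setReg 21 y := ⟨_, rfl⟩
  rw [← hs₁]
  have b₁ : s₁.Bounded w := by rw [hs₁]; exact (b'.setReg _ (by omega)).setReg _ (by omega)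
  have R₁ : Ready N m S s₁ := ⟨by rw [hs₁]; simpa using t'.ready.h10,
    by rw [hs₁]; simpa using t'.ready.h11, by rw [hs₁]; exact t'.ready.h3⟩
  have x₁ : s₁.reg 20 = x := by rw [hs₁]; simp
  have y₁ : s₁.reg 21 = y := by rw [hs₁]; simp
  have d₁ : s₁.reg 12 = Δ := by rw [hs₁]; simpa using t'.h12
  have i₁ : s₁.reg 14 = i := by rw [hs₁]; simpa using h14
  have F₁ : Found N m S (LowTriangle N m Δ S i) s₁ :=
    hF.mono (by rw [hs₁]; simp) (by rw [hs₁]; rfl) id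
  have hyN' : y * N ≤ N * N := Nat.mul_le_mul_right _ hyN.le
  have := c.hN
  refine Run.bind (run_locateProg R₁ (K := y * N) ?_ ham ha c.hD hw) fun s₂ f₂ ⟨h35, _⟩ => ?_
  · simp (disch := omega) only [WExpr.eval_mul, WExpr.eval_reg, y₁, R₁.h10, mod_pow_of_lt]
  have R₂ := R₁.of_frame f₂ ⟨rfl, rfl, rfl⟩
  have b₂ := f₂.bdd b₁
  -- The position may be past the end of the list or past the edges from `y`. Reduction modulo `N`
  -- makes whatever is read the name of a vertex, and the check rejects wrong triples.
  obtain ⟨z, hz⟩ : ∃ z, z = s₂.arr 3 (a + i % Δ) % N := ⟨_, rfl⟩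
  have hzN : z < N := by rw [hz]; exact Nat.mod_lt _ hNp
  refine Run.assign (v := z) ?_ ?_
  · simp (disch := omega) only [WExpr.eval_add, WExpr.eval_mod, WExpr.eval_arr, WExpr.eval_reg,
      f₂.reg 14 rfl, f₂.reg 12 rfl, i₁, d₁, h35, R₂.h10, mod_pow_of_lt]
    exact hz.symm
  obtain ⟨s₃, hs₃⟩ : ∃ s₃, s₃ = s₂.setReg 22 z := ⟨_, rfl⟩
  rw [← hs₃]
  refine (run_checkProg (x := x) (y := y) (z := z) (E' := LowTriangle N m Δ S (i + 1)) c.list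
    ⟨by rw [hs₃]; simpa using R₂.h10, by rw [hs₃]; simpa using R₂.h11, by rw [hs₃]; exact R₂.h3⟩
    (by rw [hs₃]; simpa [f₂.reg 20 rfl] using x₁) (by rw [hs₃]; simpa [f₂.reg 21 rfl] using y₁)
    (by rw [hs₃]; simp) hxN hyN hzN c.hN c.hD hw
    (F₁.mono (by rw [hs₃]; simpa using f₂.reg 0 rfl) (by rw [hs₃]; exact f₂.arr 0 rfl) id)
    ?_).post fun s₄ f₄ h₄ => h₄.mono (by simp) rfl id
  rintro ⟨p, hp, x', y', z', a', h1, h2, h3, h4, h5⟩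
  rcases Nat.lt_succ_iff_lt_or_eq.1 hp with hp | rfl
  · exact .inl ⟨p, hp, x', y', z', a', h1, h2, h3, h4, h5⟩
  · right
    have e1 : x' = x := by
      rw [hx, h2, mul_comm, Nat.mul_add_div hNp, Nat.div_eq_of_lt h1.1.2.1, Nat.add_zero]
    have e2 : y' = y := by
      rw [hy, h2, mul_comm, Nat.mul_add_mod, Nat.mod_eq_of_lt h1.1.2.1]
    subst e1 e2
    have e3 : a' = a := by
      rcases Nat.lt_trichotomy a a' with h | h | h
      · have := ha a (by omega); have := h3.2 a (by omega); omega
      · exact h.symm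
      · have := ha a' (by omega); have := h3.2 a' (by omega); omega
    subst e3
    have e4 : z' = z := by
      rw [hz, R₂.h3 _ h4, h5, mul_comm, Nat.mul_add_mod, Nat.mod_eq_of_lt h1.1.2.2]
    rw [← e4]
    exact h1

/-! ## Triangles through samples -/

def sampleExpr (i : WExpr) : WExpr := .arr 3 (i * .reg 12) / .reg 10

theorem TriContext.eval_sample (c : TriContext w N m Δ H D S) {s : State}
    (t : Tuned N m Δ H S s) {e : WExpr} {i : ℕ} (he : e.eval w s = i) (hi : i < H) :
    (sampleExpr e).eval w s = sample N Δ S i := by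
  have h1 := c.sample_pos hi
  have h2 := c.sample_lt hi
  have h3 := c.N_lt
  have := c.hw
  unfold sampleExpr
  simp (disch := omega) only [WExpr.eval_div, WExpr.eval_mul, WExpr.eval_arr, WExpr.eval_reg, he,
    t.h12, t.ready.h10, t.ready.h3, mod_pow_of_lt]
  exact mod_pow_of_lt (h2.trans h3)

open scoped Classical in
/-- The adjacency matrix of the samples, row by row. -/
noncomputable def sampleAdj (N m Δ H : ℕ) (S : ℕ → ℕ) (p : ℕ) : ℝ :=
  if HasEdge N m S (sample N Δ S (p / H)) (sample N Δ S (p % H)) then 1 else 0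

def pairStep : Prog :=
  .setReg 20 (sampleExpr (.reg 14 / .reg 13)) ;; .setReg 21 (sampleExpr (.reg 14 % .reg 13)) ;;
  .setReg 24 1

theorem run_pairStep (c : TriContext w N m Δ H D S) {s : State} (t : Tuned N m Δ H S s) {p : ℕ}
    (hp : s.reg 14 = p) (hpH : p < H * H) :
    Run w pairStep s 3 (fun s' => s'.reg 20 = sample N Δ S (p / H) ∧
      s'.reg 21 = sample N Δ S (p % H) ∧ s'.reg 24 = 1) := by
  have := c.H_le
  have hHH : H * H ≤ m * m := Nat.mul_le_mul this this
  have hm := c.hm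
  have hw := c.hw
  have h1 : p / H < H := Nat.div_lt_of_lt_mul hpH
  have h2 : p % H < H := Nat.mod_lt _ (Nat.zero_lt_of_lt h1)
  refine Run.time (T₁ := 1 + 1 + 1) (Run.assign (v := sample N Δ S (p / H)) ?_
    (Run.assign (v := sample N Δ S (p % H)) ?_ (Run.setReg ?_))) le_rfl
  · exact c.eval_sample t (by simp (disch := omega) only [WExpr.eval_div, WExpr.eval_reg, hp, t.h13,
      mod_pow_of_lt]) h1
  · have t' := t.of_frame (frame_setReg w s 20 (sampleExpr (.reg 14 / .reg 13)))
      ⟨rfl, rfl, rfl, rfl, rfl⟩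
    have key := c.eval_sample t' (e := .reg 14 % .reg 13) (i := p % H) ?_ h2
    · rw [c.eval_sample t (e := .reg 14 / .reg 13) (by simp (disch := omega) only [WExpr.eval_div,
        WExpr.eval_reg, hp, t.h13, mod_pow_of_lt]) h1] at key
      exact key
    · simp (disch := omega) only [WExpr.eval_mod, WExpr.eval_reg, State.setReg_reg,
        Nat.reduceEqDiff, reduceIte, hp, t.h13, mod_pow_of_lt]
  · simp (disch := omega) only [State.setReg_reg, WExpr.eval_ofNat, mod_pow_of_lt,
      Nat.reduceEqDiff, reduceIte, and_self]

/-- Writes the adjacency matrix of the samples. -/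
def fillProg : Prog :=
  .for 14 (.reg 13 * .reg 13)
    (pairStep ;; queryProg (.reg 20) (.reg 21) ;;
     .setRArr 100 (.reg 14) (.ofWord (.reg 24)) ;; .setRArr 101 (.reg 14) (.ofWord (.reg 24)))

theorem run_fillProg (c : TriContext w N m Δ H D S) {s : State} (t : Tuned N m Δ H S s) :
    Run w fillProg s (H * H * (4 * D + 13) + 2) (fun s' => ∀ p < H * H,
      s'.rarr 100 p = sampleAdj N m Δ H S p ∧ s'.rarr 101 p = sampleAdj N m Δ H S p) := by
  have hHm := c.H_le
  have hHH : H * H ≤ m * m := Nat.mul_le_mul hHm hHm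
  have hm := c.hm
  have hw := c.hw
  refine Run.time (T₁ := H * H * ((3 + ((4 * D + 6) + (1 + 1))) + 2) + 2) ?_
    (Nat.add_le_add_right (Nat.mul_le_mul_left _ (by omega)) _)
  refine Run.for (n := H * H) (fun i s' => ∀ p < i, s'.rarr 100 p = sampleAdj N m Δ H S p ∧
    s'.rarr 101 p = sampleAdj N m Δ H S p) (by omega) rfl (fun s' hf => ?_) (by simp)
    fun i s' hi hf h14 hI => ?_
  · simp (disch := omega) only [WExpr.eval_mul, WExpr.eval_reg, hf.reg 13 rfl, t.h13, mod_pow_of_lt]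
  have t' : Tuned N m Δ H S s' := t.of_frame hf ⟨rfl, rfl, rfl, rfl, rfl⟩
  have h1 : i / H < H := Nat.div_lt_of_lt_mul hi
  have h2 : i % H < H := Nat.mod_lt _ (Nat.zero_lt_of_lt h1)
  refine Run.bind (run_pairStep c t' h14 hi) fun s₁ f₁ ⟨x₁, y₁, e₁⟩ => ?_
  have t₁ := t'.of_frame f₁ ⟨rfl, rfl, rfl, rfl, rfl⟩
  refine Run.bind (run_queryProg c.list t₁.ready x₁ y₁ (c.sample_lt h1) (c.sample_lt h2) c.hN c.hD
    hw) fun s₂ f₂ q₂ => ?_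
  have i₂ : s₂.reg 14 = i := by rw [f₂.reg 14 rfl, f₁.reg 14 rfl, h14]
  have e₂ : ((s₂.reg 24 : ℕ) : ℝ) = sampleAdj N m Δ H S i := by
    rw [q₂, e₁, sampleAdj]
    split_ifs <;> simp
  refine Run.setRArr_seq (Run.setRArr fun p hp => ?_)
  simp only [State.setReg_rarr, State.setRArr_rarr, State.setRArr_reg, WExpr.eval_reg,
    RExpr.eval_ofWord, i₂, e₂, Nat.reduceEqDiff, reduceIte]
  split_ifs with hpi
  · rw [hpi]; exact ⟨rfl, rfl⟩
  · rw [f₂.rarr 100 rfl, f₁.rarr 100 rfl, f₂.rarr 101 rfl, f₁.rarr 101 rfl]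
    exact hI p (by omega)

/-- There is a path of two edges between the samples of the `p`-th pair. -/
def TwoPath (N m Δ H : ℕ) (S : ℕ → ℕ) (p : ℕ) : Prop :=
  ∃ l < H, HasEdge N m S (sample N Δ S (p / H)) (sample N Δ S l) ∧
    HasEdge N m S (sample N Δ S l) (sample N Δ S (p % H))

/-- `M` multiplies `h × h` matrices in time `T`. -/
def Multiplies (w h T : ℕ) (M : Prog) : Prop :=
  ∀ X : MatrixPair, X.n = h → ∀ s : State, s.Bounded w → X.Input s → Run w M s T X.Output

def squareProg (M : Prog) : Prog := fillProg ;; .setReg 100 (.reg 13) ;; M.shift 100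

/-- The entries are nonnegative, so an entry of the square is positive iff one of its summands is. A
vertex may occur as several samples, which does no harm. -/
theorem run_squareProg (c : TriContext w N m Δ H D S) {s : State} (t : Tuned N m Δ H S s)
    (hs : s.Bounded w) {M : Prog} {T : ℕ} (hM : Multiplies w H T M) :
    Run w (squareProg M) s ((H * H * (4 * D + 13) + 2) + (T + 1)) (fun s' => ∀ p < H * H,
      0 < s'.rarr 102 p ↔ TwoPath N m Δ H S p) := by
  have hHm := c.H_le
  have hw := c.hw
  refine Run.bind (run_fillProg c t) fun s₁ f₁ h₁ => ?_
  have t₁ := t.of_frame f₁ ⟨rfl, rfl, rfl, rfl, rfl⟩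
  refine Run.assign (v := H) t₁.h13 ?_
  have hdm : ∀ i j, j < H → (H * i + j) / H = i ∧ (H * i + j) % H = j := fun i j hj =>
    ⟨by rw [Nat.mul_add_div (by omega), Nat.div_eq_of_lt hj, Nat.add_zero],
      by rw [Nat.mul_add_mod, Nat.mod_eq_of_lt hj]⟩
  have hlt : ∀ i j : Fin H, H * (i : ℕ) + j < H * H := fun i j => by
    have : H * ((i : ℕ) + 1) ≤ H * H := Nat.mul_le_mul_left _ i.2
    rw [mul_add] at this
    have := j.2
    omega
  refine (Run.shift (hM ⟨H, fun i j => sampleAdj N m Δ H S (H * i + j),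
    fun i j => sampleAdj N m Δ H S (H * i + j)⟩ rfl ((s₁.setReg 100 H).view 100)
    (((f₁.bdd hs).setReg _ (by omega)).view _) ⟨by simp [State.view], fun i j =>
      h₁ _ (hlt i j)⟩)).post fun s₂ f₂ h₂ p hp => ?_
  have h1 : p / H < H := Nat.div_lt_of_lt_mul hp
  have h2 : p % H < H := Nat.mod_lt _ (Nat.zero_lt_of_lt h1)
  have key : s₂.rarr 102 (H * (p / H) + p % H) = ∑ l : Fin H,
      sampleAdj N m Δ H S (H * (p / H) + l) * sampleAdj N m Δ H S (H * l + p % H) := by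
    refine (h₂ ⟨p / H, h1⟩ ⟨p % H, h2⟩).trans ?_
    rw [Matrix.mul_apply]
  rw [Nat.div_add_mod] at key
  have hnn : ∀ p, 0 ≤ sampleAdj N m Δ H S p := fun p => by
    unfold sampleAdj; split_ifs <;> norm_num
  rw [key, Finset.sum_pos_iff_of_nonneg fun _ _ => mul_nonneg (hnn _) (hnn _)]
  unfold sampleAdj TwoPath
  constructor
  · rintro ⟨l, -, hl⟩
    rw [(hdm _ _ l.2).1, (hdm _ _ l.2).2, (hdm _ _ h2).1, (hdm _ _ h2).2] at hl
    refine ⟨l, l.2, ?_⟩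
    by_contra hne
    rw [not_and_or] at hne
    rcases hne with hne | hne <;> simp [hne] at hl
  · rintro ⟨l, hl, a1, a2⟩
    refine ⟨⟨l, hl⟩, Finset.mem_univ _, ?_⟩
    rw [(hdm _ _ hl).1, (hdm _ _ hl).2, (hdm _ _ h2).1, (hdm _ _ h2).2, if_pos a1, if_pos a2]
    norm_num

/-- The `p`-th pair of samples is closed to a triangle by some sample. -/
def GoodPair (N m Δ H : ℕ) (S : ℕ → ℕ) (p : ℕ) : Prop :=
  HasEdge N m S (sample N Δ S (p % H)) (sample N Δ S (p / H)) ∧ TwoPath N m Δ H S p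

/-- Finds a good pair of samples. -/
def pairProg : Prog :=
  .setReg 30 0 ;;
  .for 14 (.reg 13 * .reg 13)
    (pairStep ;; queryProg (.reg 21) (.reg 20) ;;
     .ite (.and (.weq (.reg 24) 1) (.rlt (.ofWord 0) (.arr 102 (.reg 14)))) (.setReg 30 (.reg 14))
       .skip)

/-- If there is a good pair, the last one is kept; if not, the pair `0` is kept, and completing it
to a triangle is attempted in vain. -/
theorem run_pairProg (c : TriContext w N m Δ H D S) {s : State} (t : Tuned N m Δ H S s)
    (hC : ∀ p < H * H, 0 < s.rarr 102 p ↔ TwoPath N m Δ H S p) :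
    Run w pairProg s (H * H * (4 * D + 13) + 2 + 1) (fun s' => s'.reg 30 < H * H ∧
      ∀ p < H * H, GoodPair N m Δ H S p → GoodPair N m Δ H S (s'.reg 30)) := by
  have hHm := c.H_le
  have hHH : H * H ≤ m * m := Nat.mul_le_mul hHm hHm
  have hm := c.hm
  have hw := c.hw
  have hHp : 0 < H := c.hH ▸ Nat.succ_pos _
  have hHHp : 0 < H * H := Nat.mul_pos hHp hHp
  refine Run.assign (v := 0) (by simp) ?_
  obtain ⟨s₀, hs₀⟩ : ∃ s₀, s₀ = s.setReg 30 0 := ⟨_, rfl⟩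
  rw [← hs₀]
  have t₀ : Tuned N m Δ H S s₀ := ⟨⟨by rw [hs₀]; simpa using t.ready.h10,
    by rw [hs₀]; simpa using t.ready.h11, by rw [hs₀]; exact t.ready.h3⟩,
    by rw [hs₀]; simpa using t.h12, by rw [hs₀]; simpa using t.h13⟩
  have hC₀ : s₀.rarr 102 = s.rarr 102 := by rw [hs₀]; rfl
  refine Run.time (T₁ := H * H * ((3 + ((4 * D + 6) + (1 + 1))) + 2) + 2) ?_
    (Nat.add_le_add_right (Nat.mul_le_mul_left _ (by omega)) _)
  refine Run.for (n := H * H) (fun i s' => s'.reg 30 < H * H ∧ ∀ p < i, GoodPair N m Δ H S p →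
    GoodPair N m Δ H S (s'.reg 30)) (by omega) rfl (fun s' hf => ?_)
    ⟨by rw [hs₀]; simpa using hHHp, fun p hp => by omega⟩ fun i s' hi hf h14 hI => ?_
  · simp (disch := omega) only [WExpr.eval_mul, WExpr.eval_reg, hf.reg 13 rfl, t₀.h13,
      mod_pow_of_lt]
  have t' : Tuned N m Δ H S s' := t₀.of_frame hf ⟨rfl, rfl, rfl, rfl, rfl⟩
  have h1 : i / H < H := Nat.div_lt_of_lt_mul hi
  have h2 : i % H < H := Nat.mod_lt _ (Nat.zero_lt_of_lt h1)
  refine Run.bind (run_pairStep c t' h14 hi) fun s₁ f₁ ⟨x₁, y₁, e₁⟩ => ?_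
  have t₁ := t'.of_frame f₁ ⟨rfl, rfl, rfl, rfl, rfl⟩
  refine Run.bind (run_queryProg c.list t₁.ready y₁ x₁ (c.sample_lt h2) (c.sample_lt h1) c.hN c.hD
    hw) fun s₂ f₂ q₂ => ?_
  have i₂ : s₂.reg 14 = i := by rw [f₂.reg 14 rfl, f₁.reg 14 rfl, h14]
  have g₂ : s₂.reg 30 = s'.reg 30 := by rw [f₂.reg 30 rfl, f₁.reg 30 rfl]
  have C₂ : s₂.rarr 102 = s.rarr 102 := by
    rw [f₂.rarr 102 rfl, f₁.rarr 102 rfl, hf.rarr 102 rfl, hC₀]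
  have key : (s₂.reg 24 = 1 ∧ 0 < s.rarr 102 i) ↔ GoodPair N m Δ H S i := by
    rw [q₂, e₁, hC i hi, GoodPair]
    split_ifs <;> simp [*]
  refine Run.ite (fun hb => Run.setReg ?_) (fun hb => Run.skip ?_)
  all_goals
    simp (disch := omega) only [Test.eval_and, Test.eval_weq, Test.eval_rlt, WExpr.eval_reg,
      WExpr.eval_ofNat, RExpr.eval_arr, RExpr.eval_ofWord, mod_pow_of_lt, Nat.cast_zero, C₂, i₂,
      key] at hb
    simp only [State.setReg_reg, WExpr.eval_reg, i₂, g₂, Nat.reduceEqDiff, reduceIte]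
  · exact ⟨hi, fun _ _ _ => hb⟩
  · refine ⟨hI.1, fun p hp hg => ?_⟩
    rcases Nat.lt_succ_iff_lt_or_eq.1 hp with hp | rfl
    · exact hI.2 p hp hg
    · exact absurd hg hb

/-- Completes the pair in register `30` to a triangle. -/
def closeProg : Prog :=
  .for 15 (.reg 13)
    (.setReg 14 (.reg 30) ;; pairStep ;; .setReg 22 (.reg 21) ;; .setReg 21 (sampleExpr (.reg 15)) ;;
     checkProg)

theorem run_closeProg (c : TriContext w N m Δ H D S) {s : State} (t : Tuned N m Δ H S s) {E : Prop}
    (hF : Found N m S E s) {g : ℕ} (h30 : s.reg 30 = g) (hg : g < H * H) :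
    Run w closeProg s (H * (12 * D + 32) + 2) (Found N m S (E ∨ ∃ l < H, IsTriangle N m S
      (sample N Δ S (g / H)) (sample N Δ S l) (sample N Δ S (g % H)))) := by
  have hHm := c.H_le
  have hw := c.hw
  refine Run.time (T₁ := H * ((3 + ((12 * D + 24) + 1 + 1) + 1) + 2) + 2) ?_
    (Nat.add_le_add_right (Nat.mul_le_mul_left _ (by omega)) _)
  refine Run.for (n := H) (fun i s' => Found N m S (E ∨ ∃ l < i, IsTriangle N m S
      (sample N Δ S (g / H)) (sample N Δ S l) (sample N Δ S (g % H))) s') (by omega) rfl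
    (fun s' hf => by rw [WExpr.eval_reg, hf.reg 13 rfl, t.h13])
    (hF.mono (by simp) rfl (by simp)) fun i s' hi hf h15 hI => ?_
  have t' : Tuned N m Δ H S s' := t.of_frame hf ⟨rfl, rfl, rfl, rfl, rfl⟩
  have h1 : g / H < H := Nat.div_lt_of_lt_mul hg
  have h2 : g % H < H := Nat.mod_lt _ (Nat.zero_lt_of_lt h1)
  refine Run.assign (v := g) (by rw [WExpr.eval_reg, hf.reg 30 rfl, h30]) ?_
  obtain ⟨s₁, hs₁⟩ : ∃ s₁, s₁ = s'.setReg 14 g := ⟨_, rfl⟩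
  rw [← hs₁]
  have t₁ : Tuned N m Δ H S s₁ := ⟨⟨by rw [hs₁]; simpa using t'.ready.h10,
    by rw [hs₁]; simpa using t'.ready.h11, by rw [hs₁]; exact t'.ready.h3⟩,
    by rw [hs₁]; simpa using t'.h12, by rw [hs₁]; simpa using t'.h13⟩
  refine Run.bind (run_pairStep c t₁ (by rw [hs₁]; simp) hg) fun s₂ f₂ ⟨x₂, y₂, _⟩ => ?_
  have t₂ := t₁.of_frame f₂ ⟨rfl, rfl, rfl, rfl, rfl⟩
  have l₂ : s₂.reg 15 = i := by rw [f₂.reg 15 rfl, hs₁]; simpa using h15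
  have F₂ := hI.mono (s' := s₂) (by rw [f₂.reg 0 rfl, hs₁]; simp) (by rw [f₂.arr 0 rfl, hs₁]; rfl) id
  refine Run.assign (v := sample N Δ S (g % H)) y₂ ?_
  obtain ⟨s₃, hs₃⟩ : ∃ s₃, s₃ = s₂.setReg 22 (sample N Δ S (g % H)) := ⟨_, rfl⟩
  rw [← hs₃]
  have t₃ : Tuned N m Δ H S s₃ := ⟨⟨by rw [hs₃]; simpa using t₂.ready.h10,
    by rw [hs₃]; simpa using t₂.ready.h11, by rw [hs₃]; exact t₂.ready.h3⟩,
    by rw [hs₃]; simpa using t₂.h12, by rw [hs₃]; simpa using t₂.h13⟩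
  refine Run.assign (v := sample N Δ S i)
    (c.eval_sample t₃ (by rw [hs₃]; simpa using l₂) hi) ?_
  obtain ⟨s₄, hs₄⟩ : ∃ s₄, s₄ = s₃.setReg 21 (sample N Δ S i) := ⟨_, rfl⟩
  rw [← hs₄]
  refine (run_checkProg (E' := E ∨ ∃ l < i + 1, IsTriangle N m S
      (sample N Δ S (g / H)) (sample N Δ S l) (sample N Δ S (g % H))) c.list
    ⟨by rw [hs₄]; simpa using t₃.ready.h10, by rw [hs₄]; simpa using t₃.ready.h11,
      by rw [hs₄]; exact t₃.ready.h3⟩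
    (by rw [hs₄, hs₃]; simpa using x₂) (by rw [hs₄]; simp) (by rw [hs₄, hs₃]; simp)
    (c.sample_lt h1) (c.sample_lt hi) (c.sample_lt h2) c.hN c.hD hw
    (F₂.mono (by rw [hs₄, hs₃]; simp) (by rw [hs₄, hs₃]; rfl) id) ?_).post
      fun s₅ f₅ h₅ => h₅.mono (by simp) rfl id
  rintro (h | ⟨l, hl, h⟩)
  · exact .inl (.inl h)
  · rcases Nat.lt_succ_iff_lt_or_eq.1 hl with hl | rfl
    · exact .inl (.inr ⟨l, hl, h⟩)
    · exact .inr h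

/-- If the low-degree search finds nothing, `exists_sample`, applied to the three rotations of the
triangle, shows that all its vertices are samples. So a good pair exists, and the pair `g` can be
completed, possibly to another triangle. -/
theorem TriContext.found (c : TriContext w N m Δ H D S) {g : ℕ}
    (hgood : ∀ p < H * H, GoodPair N m Δ H S p → GoodPair N m Δ H S g) (hg : g < H * H)
    {x y z : ℕ} (h : IsTriangle N m S x y z) :
    LowTriangle N m Δ S (m * Δ) ∨ ∃ l < H, IsTriangle N m S
      (sample N Δ S (g / H)) (sample N Δ S l) (sample N Δ S (g % H)) := by
  rw [or_iff_not_imp_left]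
  intro hlow
  obtain ⟨⟨hx, hy, hz⟩, h1, h2, h3⟩ := h
  obtain ⟨l, hl, el⟩ := c.exists_sample hlow ⟨⟨hx, hy, hz⟩, h1, h2, h3⟩
  obtain ⟨j, hj, ej⟩ := c.exists_sample hlow ⟨⟨hy, hz, hx⟩, h2, h3, h1⟩
  obtain ⟨i, hi, ei⟩ := c.exists_sample hlow ⟨⟨hz, hx, hy⟩, h3, h1, h2⟩
  have hij : H * i + j < H * H := by
    have : H * (i + 1) ≤ H * H := Nat.mul_le_mul_left _ hi
    rw [mul_add] at this
    omega
  have e1 : (H * i + j) / H = i := by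
    rw [Nat.mul_add_div (by omega), Nat.div_eq_of_lt hj, Nat.add_zero]
  have e2 : (H * i + j) % H = j := by rw [Nat.mul_add_mod, Nat.mod_eq_of_lt hj]
  obtain ⟨a1, l', hl', a2, a3⟩ := hgood _ hij
    ⟨by rw [e1, e2, ei, ej]; exact h3, l, hl, by rw [e1, ei, el]; exact h1,
      by rw [e2, ej, el]; exact h2⟩
  exact ⟨l', hl', ⟨c.sample_lt (Nat.div_lt_of_lt_mul hg), c.sample_lt hl',
    c.sample_lt (Nat.mod_lt _ (by omega))⟩, a2, a3, a1⟩

end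

/-! ## The degree threshold -/

def powExpr (e : WExpr) : ℕ → WExpr
  | 0 => 1
  | q + 1 => powExpr e q * e

theorem eval_powExpr {w a : ℕ} {s : State} {e : WExpr} (he : e.eval w s = a) (ha : 1 ≤ a) (q : ℕ)
    (h : a ^ q < 2 ^ w) : (powExpr e q).eval w s = a ^ q := by
  induction q with
  | zero => simp only [powExpr, WExpr.eval_ofNat]; exact mod_pow_of_lt h
  | succ q ih =>
    have : a ^ q ≤ a ^ (q + 1) := Nat.pow_le_pow_right ha (by omega)
    simp only [powExpr, WExpr.eval_mul, ih (by omega), he, ← pow_succ]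
    exact mod_pow_of_lt h

theorem exists_threshold (p q m : ℕ) (hq : 1 ≤ q) : ∃ d, m ^ p ≤ (d + 1) ^ q :=
  ⟨m ^ p, (Nat.le_succ _).trans (Nat.le_self_pow (by omega) _)⟩

/-- The least positive `d` with `m ^ p ≤ d ^ q`. -/
def threshold (p q m : ℕ) : ℕ := if h : 1 ≤ q then Nat.find (exists_threshold p q m h) + 1 else 1

theorem le_threshold_pow {p q m : ℕ} (hq : 1 ≤ q) : m ^ p ≤ threshold p q m ^ q := by
  rw [threshold, dif_pos hq]
  exact Nat.find_spec (exists_threshold p q m hq)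

theorem threshold_le {p q m d : ℕ} (hq : 1 ≤ q) (hd : 1 ≤ d) (h : m ^ p ≤ d ^ q) :
    threshold p q m ≤ d := by
  rw [threshold, dif_pos hq]
  have : Nat.find (exists_threshold p q m hq) ≤ d - 1 :=
    Nat.find_min' _ (by rwa [Nat.sub_add_cancel hd])
  omega

theorem threshold_pos (p q m : ℕ) : 1 ≤ threshold p q m := by
  unfold threshold; split_ifs <;> omega

/-- Registers `12` and `13` become the degree threshold and the number of samples. -/
def thresholdProg (p q : ℕ) : Prog :=
  .setReg 12 1 ;;
  .while (.wlt (powExpr (.reg 12) q) (powExpr (.reg 11) p)) (.setReg 12 (.reg 12 + 1)) ;;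
  .setReg 13 ((.reg 11 - 1) / .reg 12 + 1)

/-- The threshold is an integer approximation of `m ^ (p / q)`, found with integer powers only.
Linear search is affordable because `m ^ p ≤ m ^ q` stops it at `m`. -/
theorem run_thresholdProg {w p q m : ℕ} {s : State} (h11 : s.reg 11 = m) (hm : 1 ≤ m)
    (hq : 1 ≤ q) (hpq : p ≤ q) (hw : m ^ q < 2 ^ w) (hw' : 2 * m + 2 < 2 ^ w) :
    Run w (thresholdProg p q) s (m * 2 + 3) (fun s' => s'.reg 12 = threshold p q m ∧
      s'.reg 13 = (m - 1) / threshold p q m + 1) := by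
  have hΔm : threshold p q m ≤ m := threshold_le hq hm (Nat.pow_le_pow_right hm hpq)
  refine Run.time (T₁ := ((m - 1) * (1 + 1) + 1) + 1 + 1) ?_ (by omega)
  refine Run.assign (v := 1) (by
    simp (disch := omega) only [WExpr.eval_ofNat, mod_pow_of_lt]) ?_
  obtain ⟨s₁, hs₁⟩ : ∃ s₁, s₁ = s.setReg 12 1 := ⟨_, rfl⟩
  rw [← hs₁]
  have e11 : s₁.reg 11 = m := by rw [hs₁]; simpa using h11
  have hcond : ∀ s', Frame w (.while (.wlt (powExpr (.reg 12) q) (powExpr (.reg 11) p))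
      (.setReg 12 (.reg 12 + 1))) s₁ s' → 1 ≤ s'.reg 12 → s'.reg 12 ≤ threshold p q m →
      (Test.eval w s' (.wlt (powExpr (.reg 12) q) (powExpr (.reg 11) p)) ↔
        s'.reg 12 ^ q < m ^ p) := fun s' hf h1 h2 => by
    have e1 := eval_powExpr (w := w) (s := s') (e := .reg 12) rfl h1 q
      ((Nat.pow_le_pow_left (h2.trans hΔm) q).trans_lt hw)
    have e2 := eval_powExpr (w := w) (s := s') (e := .reg 11) (a := m)
      (by rw [WExpr.eval_reg, hf.reg 11 rfl, e11]) hm p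
      ((Nat.pow_le_pow_right hm hpq).trans_lt hw)
    simp only [WExpr.eval_reg] at e1
    rw [Test.eval_wlt, e1, e2]
  refine Run.bind (T₁ := (m - 1) * (1 + 1) + 1) (T₂ := 1) (P := fun s' => s'.reg 12 = threshold p q m) ?_
    fun s₂ f₂ h₂ => ?_
  · refine (Run.while (T := 1) (fun s' => 1 ≤ s'.reg 12 ∧ s'.reg 12 ≤ threshold p q m)
      (fun s' => m - s'.reg 12) ?_ fun s' hf hI hb => ?_).mono ?_ fun s' hf h => ?_
    · rw [hs₁]; simpa using threshold_pos p q m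
    · rw [hcond s' hf hI.1 hI.2] at hb
      have hlt : s'.reg 12 < threshold p q m := by
        by_contra hge
        have := (le_threshold_pow hq).trans (Nat.pow_le_pow_left (not_lt.1 hge) q)
        omega
      refine Run.setReg ?_
      simp (disch := omega) only [State.setReg_reg, WExpr.eval_add, WExpr.eval_reg,
        WExpr.eval_ofNat, mod_pow_of_lt, reduceIte]
      omega
    · rw [hs₁]; simp
    · have h1 := h.2
      rw [hcond s' hf h.1.1 h.1.2, not_lt] at h1
      exact le_antisymm h.1.2 (threshold_le hq h.1.1 h1)
  · have h3 : (m - 1) / threshold p q m ≤ m - 1 := Nat.div_le_self _ _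
    have h11' : s₂.reg 11 = m := by rw [f₂.reg 11 rfl, e11]
    refine Run.setReg ?_
    simp (disch := omega) only [State.setReg_reg, WExpr.eval_add, WExpr.eval_sub, WExpr.eval_div,
      WExpr.eval_reg, WExpr.eval_ofNat, mod_pow_of_lt, reduceIte, Nat.reduceEqDiff, h₂, h11',
      and_self]

/-! ## Finding triangles in sparse digraphs -/

def triangleProg (p q : ℕ) (M : Prog) : Prog :=
  .ite (.weq (.reg 1) 0) (.setReg 0 0)
    (edgeListProg ;; .setReg 0 0 ;; thresholdProg p q ;; lowProg ;; squareProg M ;; pairProg ;;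
      closeProg)

def triangleTime (m Δ H ℓ T : ℕ) : ℕ :=
  ((m * 3 + 2) + ((ℓ * 3 + 8) + (((ℓ + 1) * (m * (4 * ℓ + 18) + 16)) + (m * 3 + 2))) + 5) +
  (((m * 2 + 3) + ((m * Δ * (16 * (ℓ + 1) + 33) + 2) +
    (((H * H * (4 * (ℓ + 1) + 13) + 2) + (T + 1)) + ((H * H * (4 * (ℓ + 1) + 13) + 2 + 1) +
      (H * (12 * (ℓ + 1) + 32) + 2))))) + 1) + 1

theorem isKCycle_three {V : Type} {adj : V → V → Prop} {a b c : V} (hab : a ≠ b) (hbc : b ≠ c)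
    (hca : c ≠ a) (h₁ : adj a b) (h₂ : adj b c) (h₃ : adj c a) : IsKCycle adj 3 ![a, b, c] := by
  have := hab.symm
  have := hbc.symm
  have := hca.symm
  refine ⟨fun i j hij => ?_, fun i j hij => ?_⟩ <;> fin_cases i <;> fin_cases j <;> simp_all

theorem run_triangleProg {w p q Δ H ℓ T : ℕ} {M : Prog} (G : SparseDigraph) {s : State}
    (hs : s.Bounded w) (hin : G.Input s) (hq : 1 ≤ q) (hpq : p ≤ q) (hw : ListWord w G.N G.m)
    (hwq : G.m ^ q < 2 ^ w) (hmm : G.m * G.m < 2 ^ w) (hw2 : 2 * G.m + 2 < 2 ^ w)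
    (hΔ : Δ = threshold p q G.m) (hH : H = (G.m - 1) / Δ + 1) (hℓ : ℓ = Nat.clog 2 G.m)
    (hM : 1 ≤ G.m → Multiplies w H T M) :
    Run w (triangleProg p q M) s (triangleTime G.m Δ H ℓ T) (CycleAnswer G.Adj 3) := by
  obtain ⟨N, m, edge, inj, loopless, sparse⟩ := G
  obtain ⟨h0, h1, hedge⟩ := hin
  simp only at h0 h1 hedge hw hwq hmm hw2 hΔ hH hℓ hM ⊢
  refine Run.ite (fun hb => (Run.setReg ?_).time (by omega)) (fun hb => ?_)
  all_goals simp only [Test.eval_weq, WExpr.eval_reg, WExpr.eval_ofNat, Nat.zero_mod, h1] at hb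
  · subst hb
    refine .inr ⟨by simp, ?_⟩
    rintro ⟨v, -⟩
    -- Without edges there are no vertices, by `N ≤ 2 * m`.
    exact absurd (Nat.lt_of_lt_of_le (v 0).2 sparse) (Nat.not_lt_zero _)
  have hm : 1 ≤ m := by omega
  have hΔp : 1 ≤ Δ := hΔ ▸ threshold_pos p q m
  have hΔm : Δ ≤ m := hΔ ▸ threshold_le hq hm (Nat.pow_le_pow_right hm hpq)
  have hlist := run_edgeListProg (t := fun i => if h : i < m then ((edge ⟨i, h⟩).1 : ℕ) else 0)
    (h := fun i => if h : i < m then ((edge ⟨i, h⟩).2 : ℕ) else 0) hs h0 h1 hw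
    (fun i hi => by simpa [hi] using hedge ⟨i, hi⟩) (fun i hi => by simp [hi])
    (fun i hi j hj e1 e2 => by
      simp only [hi, hj, dite_true] at e1 e2
      simpa using inj (Prod.ext (Fin.ext e1) (Fin.ext e2)))
  rw [← hℓ] at hlist
  refine Run.bind hlist fun s₁ f₁ ⟨S, hS, R₁, hE⟩ => ?_
  have hE' : ∀ x y : Fin N, HasEdge N m S x y ↔ SparseDigraph.Adj
      ⟨N, m, edge, inj, loopless, sparse⟩ x y := fun x y => by
    rw [hE _ x.2 _ y.2]
    constructor
    · rintro ⟨i, hi, e1, e2⟩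
      simp only [hi, dite_true] at e1 e2
      exact ⟨⟨i, hi⟩, Prod.ext (Fin.ext e1) (Fin.ext e2)⟩
    · rintro ⟨i, hi⟩
      simp only at hi
      exact ⟨i, i.2, by simp [hi], by simp [hi]⟩
  have hmℓ : m < 2 ^ (ℓ + 1) := by
    have h1 : m ≤ 2 ^ Nat.clog 2 m := Nat.le_pow_clog (by omega) m
    rw [← hℓ] at h1
    have := Nat.two_pow_pos ℓ
    rw [pow_succ]
    omega
  have c : TriContext w N m Δ H (ℓ + 1) S := ⟨hS, hw.h1, hmℓ, hw2, hmm, hm, hΔp, hΔm, hH⟩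
  refine Run.assign (v := 0) (by simp) ?_
  obtain ⟨s₂, hs₂⟩ : ∃ s₂, s₂ = s₁.setReg 0 0 := ⟨_, rfl⟩
  rw [← hs₂]
  have R₂ : Ready N m S s₂ := ⟨by rw [hs₂]; simpa using R₁.h10, by rw [hs₂]; simpa using R₁.h11,
    by rw [hs₂]; exact R₁.h3⟩
  have b₂ : s₂.Bounded w := by rw [hs₂]; exact (f₁.bdd hs).setReg _ (by omega)
  refine Run.bind (run_thresholdProg R₂.h11 hm hq hpq hwq hw2) fun s₃ f₃ ⟨h12, h13⟩ => ?_
  have fr : (thresholdProg p q).modReg 0 = false ∧ (thresholdProg p q).modReg 10 = false ∧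
    (thresholdProg p q).modReg 11 = false ∧ (thresholdProg p q).modArr 3 = false :=
    ⟨rfl, rfl, rfl, rfl⟩
  have t₃ : Tuned N m Δ H S s₃ := ⟨R₂.of_frame f₃ fr.2, by rw [h12, hΔ], by rw [h13, hH, hΔ]⟩
  have b₃ := f₃.bdd b₂
  refine Run.bind (run_lowProg c t₃ b₃ (by rw [f₃.reg 0 fr.1, hs₂]; simp)) fun s₄ f₄ h₄ => ?_
  have t₄ := t₃.of_frame f₄ ⟨rfl, rfl, rfl, rfl, rfl⟩
  refine Run.bind (run_squareProg c t₄ (f₄.bdd b₃) (hM hm)) fun s₅ f₅ h₅ => ?_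
  have sr : ∀ r < 32, fillProg.modReg r = false → (squareProg M).modReg r = false :=
    fun r hr h => by
      show (fillProg.modReg r || ((100 == r) || (M.shift 100).modReg r)) = false
      rw [h, (M.shift_mod (show r < 100 by omega)).1]
      simp; omega
  have sa : ∀ r < 32, fillProg.modArr r = false → (squareProg M).modArr r = false :=
    fun r hr h => by
      show (fillProg.modArr r || (false || (M.shift 100).modArr r)) = false
      rw [h, (M.shift_mod (show r < 100 by omega)).2.1]
      rfl
  have t₅ := t₄.of_frame f₅ ⟨sr 10 (by omega) rfl, sr 11 (by omega) rfl, sa 3 (by omega) rfl,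
    sr 12 (by omega) rfl, sr 13 (by omega) rfl⟩
  have F₅ := h₄.mono (f₅.reg 0 (sr 0 (by omega) rfl)) (f₅.arr 0 (sa 0 (by omega) rfl)) id
  refine Run.bind (run_pairProg c t₅ h₅) fun s₆ f₆ ⟨hg, hgood⟩ => ?_
  have t₆ := t₅.of_frame f₆ ⟨rfl, rfl, rfl, rfl, rfl⟩
  refine (run_closeProg c t₆ (F₅.mono (f₆.reg 0 rfl) (f₆.arr 0 rfl) id) rfl hg).post
    fun s₇ f₇ h₇ => ?_
  rcases h₇ with ⟨h0, x, y, z, ⟨⟨hx, hy, hz⟩, e1, e2, e3⟩, a0, a1, a2⟩ | ⟨h0, hno⟩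
  · have l1 := (hE' ⟨x, hx⟩ ⟨y, hy⟩).1 e1
    have l2 := (hE' ⟨y, hy⟩ ⟨z, hz⟩).1 e2
    have l3 := (hE' ⟨z, hz⟩ ⟨x, hx⟩).1 e3
    have hne : ∀ {a b : Fin N}, SparseDigraph.Adj ⟨N, m, edge, inj, loopless, sparse⟩ a b →
        a ≠ b := by
      rintro a b ⟨i, hi⟩ rfl
      exact loopless i (by simp only at hi; rw [hi])
    refine .inl ⟨h0, _, isKCycle_three (hne l1) (hne l2) (hne l3) l1 l2 l3, fun i => ?_⟩
    fin_cases i <;> simp [a0, a1, a2]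
  · refine .inr ⟨h0, ?_⟩
    rintro ⟨v, -, hv⟩
    exact hno (c.found hgood hg (x := v 0) (y := v 1) (z := v 2) ⟨⟨(v 0).2, (v 1).2, (v 2).2⟩,
      (hE' _ _).2 (hv 0 1 rfl), (hE' _ _).2 (hv 1 2 rfl), (hE' _ _).2 (hv 2 0 rfl)⟩)

/-! ## Multiplying matrices by the definition -/

def matMulProg : Prog :=
  .for 10 (.reg 0 * .reg 0)
    (.setRReg 0 (.ofWord 0) ;;
     .for 11 (.reg 0) (.setRReg 0 (.reg 0 +
       .arr 0 (.reg 0 * (.reg 10 / .reg 0) + .reg 11) *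
         .arr 1 (.reg 0 * .reg 11 + .reg 10 % .reg 0))) ;;
     .setRArr 2 (.reg 10) (.reg 0))

theorem run_matMulProg {w n : ℕ} {s : State} (h0 : s.reg 0 = n) (hw : n * n + n < 2 ^ w) :
    Run w matMulProg s (n * n * (n * 3 + 6) + 2) (fun s' => ∀ p < n * n, s'.rarr 2 p =
      ∑ l ∈ Finset.range n, s.rarr 0 (n * (p / n) + l) * s.rarr 1 (n * l + p % n)) := by
  refine Run.time (T₁ := n * n * (((n * (1 + 2) + 2) + 1 + 1) + 2) + 2) ?_
    (Nat.add_le_add_right (Nat.mul_le_mul_left _ (by omega)) _)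
  refine Run.for (n := n * n) (fun i s' => ∀ p < i, s'.rarr 2 p =
      ∑ l ∈ Finset.range n, s.rarr 0 (n * (p / n) + l) * s.rarr 1 (n * l + p % n)) (by omega) rfl
    (fun s' hf => ?_) (by simp) fun i s' hi hf h10 hI => ?_
  · simp (disch := omega) only [WExpr.eval_mul, WExpr.eval_reg, hf.reg 0 rfl, h0, mod_pow_of_lt]
  have h1 : i / n < n := Nat.div_lt_of_lt_mul hi
  have h2 : i % n < n := Nat.mod_lt _ (Nat.zero_lt_of_lt h1)
  have hbd : ∀ a < n, n * a + n ≤ n * n := fun a ha => by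
    have : n * (a + 1) ≤ n * n := Nat.mul_le_mul_left _ ha
    rwa [mul_add, mul_one] at this
  refine Run.setRReg_seq ?_
  obtain ⟨s₁, hs₁⟩ : ∃ s₁, s₁ = s'.setRReg 0 (RExpr.eval w s' (.ofWord 0)) := ⟨_, rfl⟩
  rw [← hs₁]
  have e0 : s₁.reg 0 = n := by rw [hs₁]; simpa [hf.reg 0 rfl] using h0
  have e10 : s₁.reg 10 = i := by rw [hs₁]; simpa using h10
  have a0 : s₁.rarr 0 = s.rarr 0 := by rw [hs₁]; exact hf.rarr 0 rfl
  have a1 : s₁.rarr 1 = s.rarr 1 := by rw [hs₁]; exact hf.rarr 1 rfl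
  refine Run.bind (T₁ := n * (1 + 2) + 2) (T₂ := 1) (Run.for (n := n) (T := 1) (fun j s'' => s''.rreg 0 = ∑ l ∈ Finset.range j,
    s.rarr 0 (n * (i / n) + l) * s.rarr 1 (n * l + i % n)) (by omega) rfl
    (fun s'' hf => by rw [WExpr.eval_reg, hf.reg 0 rfl, e0]) (by rw [hs₁]; simp)
    fun j s'' hj hf h11 hI => Run.setRReg ?_) fun s₂ f₂ h₂ => Run.setRArr ?_
  · have b1 := hbd _ h1
    have b2 := hbd _ hj
    simp (disch := omega) only [State.setReg_rreg, State.setRReg_rreg, reduceIte, RExpr.eval_add,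
      RExpr.eval_mul, RExpr.eval_arr, RExpr.eval_reg, WExpr.eval_add, WExpr.eval_mul,
      WExpr.eval_div, WExpr.eval_mod, WExpr.eval_reg, hf.reg 0 rfl, hf.reg 10 rfl, hf.rarr 0 rfl,
      hf.rarr 1 rfl, e0, e10, a0, a1, h11, hI, mod_pow_of_lt, Finset.sum_range_succ]
  · intro p hp
    simp only [State.setReg_rarr, State.setRArr_rarr, WExpr.eval_reg, RExpr.eval_reg, f₂.reg 10 rfl,
      e10, h₂, reduceIte]
    split_ifs with hpi
    · rw [hpi]
    · rw [f₂.rarr 2 rfl, hs₁]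
      exact hI p (by omega)

/-- This makes the set of exponents nonempty, so that its infimum is at least `2` and is approached
by admissible exponents; the infimum of the empty set would be `0`. -/
theorem exists_matMul : ∃ C : ℝ,
    Solves MatrixPair MatrixPair.n MatrixPair.Input MatrixPair.Output
      (fun n => C * ((n : ℝ) + 1) ^ (3 : ℝ)) := by
  have hB : ∀ n : ℕ, 2 ≤ n + 2 := fun n => by omega
  have hn : PolyIn (fun n => n + 2) (fun n => n) := PolyIn.self.mono fun n => by omega
  obtain ⟨c, hc⟩ := ((hn.mul hn).add hB hn).exists_word
  refine ⟨6, matMulProg, c, fun X w hw s hs hin => ?_⟩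
  obtain ⟨s', t, hE, ht, hQ⟩ := run_matMulProg hin.1 (hc X.n w hw)
  refine ⟨s', t, hE, ?_, fun i j => ?_⟩
  · have h1 : (t : ℝ) ≤ ((X.n * X.n * (X.n * 3 + 6) + 2 : ℕ) : ℝ) := by exact_mod_cast ht
    refine h1.trans ?_
    show _ ≤ 6 * ((X.n : ℝ) + 1) ^ (3 : ℝ)
    rw [show (3 : ℝ) = ((3 : ℕ) : ℝ) by norm_num, Real.rpow_natCast]
    push_cast
    have := X.n.cast_nonneg (α := ℝ)
    nlinarith [mul_nonneg this this, mul_nonneg (mul_nonneg this this) this]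
  · have hi : X.n * ((i : ℕ) + 1) ≤ X.n * X.n := Nat.mul_le_mul_left _ i.2
    rw [mul_add] at hi
    have hj := j.2
    rw [hQ _ (by omega), Matrix.mul_apply, Finset.sum_range]
    refine Finset.sum_congr rfl fun l _ => ?_
    rw [Nat.mul_add_div (by omega), Nat.div_eq_of_lt hj, Nat.add_zero, Nat.mul_add_mod,
      Nat.mod_eq_of_lt hj, (hin.2 i l).1, (hin.2 l j).2]

/-! ## The exponent of triangle finding -/

theorem solves_mono {Inst : Type} {size : Inst → ℕ} {Input Output : Inst → State → Prop}
    {T T' : ℕ → ℝ} (h : Solves Inst size Input Output T) (hT : ∀ n, T n ≤ T' n) :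
    Solves Inst size Input Output T' := by
  obtain ⟨p, c, h⟩ := h
  refine ⟨p, c, fun x w hw s hs hin => ?_⟩
  obtain ⟨s', t, hE, ht, ho⟩ := h x w hw s hs hin
  exact ⟨s', t, hE, ht.trans (hT _), ho⟩

theorem exists_triangle_word (q : ℕ) : ∃ c, ∀ m N w, N ≤ 2 * m → c * Nat.clog 2 (m + 2) ≤ w →
    ListWord w N m ∧ m ^ q < 2 ^ w ∧ m * m < 2 ^ w ∧ 2 * m + 2 < 2 ^ w := by
  have hB : ∀ n : ℕ, 2 ≤ n + 2 := fun n => by omega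
  have hc : ∀ a, PolyIn (fun n => n + 2) (fun _ => a) := PolyIn.const hB
  have hn : PolyIn (fun n => n + 2) (fun n => n) := PolyIn.self.mono fun n => by omega
  have h2 : PolyIn (fun n => n + 2) (fun n => 2 ^ Nat.clog 2 n) :=
    ((hc 2).mul hn |>.add hB (hc 1)).mono two_pow_clog_le
  have hl : PolyIn (fun n => n + 2) (fun n => Nat.clog 2 n) :=
    h2.mono fun n => Nat.lt_two_pow_self.le
  have hl1 := hl.add hB (hc 1)
  have hl3 := ((hc 2).mul hl).add hB (hc 3)
  obtain ⟨c, key⟩ := ((((((hc 4).mul (hn.mul hn)).add hB (((hc 8).mul h2).add hB (hc 4))).add hB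
    (((hc 16).mul hl1).mul hl3)).add hB (((hc 4).mul hl1).mul hn)).add hB ((hn.pow q).add hB
    (((hc 2).mul hn).add hB (hc 2)))).exists_word
  refine ⟨c, fun m N w hN hw => ?_⟩
  have := key m w hw
  have hNN : N * N ≤ 4 * (m * m) := (Nat.mul_le_mul hN hN).trans (by apply le_of_eq; ring)
  exact ⟨⟨by omega, by omega, by rw [mul_one]; omega, by omega⟩, by omega, by omega, by omega⟩

theorem exists_triangle_time (Δ H T : ℕ → ℕ) :
    QuasiIn (fun n => Nat.clog 2 n + 2) (fun m => m * Δ m + H m * H m + T m + m + 1)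
      (fun m => triangleTime m (Δ m) (H m) (Nat.clog 2 m) (T m)) := by
  have hB : ∀ n : ℕ, 2 ≤ Nat.clog 2 n + 2 := fun n => by omega
  obtain ⟨B, hBdef⟩ : ∃ B, B = fun n => Nat.clog 2 n + 2 := ⟨_, rfl⟩
  obtain ⟨g, hg⟩ : ∃ g, g = fun m => m * Δ m + H m * H m + T m + m + 1 := ⟨_, rfl⟩
  have hc : ∀ a, PolyIn B (fun _ => a) := by rw [hBdef]; exact PolyIn.const hB
  have hl : PolyIn B (fun n => Nat.clog 2 n) := by
    rw [hBdef]; exact PolyIn.self.mono fun n => by omega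
  rw [← hBdef, ← hg]
  replace hB : ∀ n, 2 ≤ B n := by rw [hBdef]; exact hB
  have gd : ∀ n, g n = n * Δ n + H n * H n + T n + n + 1 := fun n => by rw [hg]
  have qn : QuasiIn B g (fun n => n) := .of_le fun n => by rw [gd]; omega
  have qT : QuasiIn B g (fun n => T n) := .of_le fun n => by rw [gd]; omega
  have qD : QuasiIn B g (fun n => n * Δ n) := .of_le fun n => by rw [gd]; omega
  have qHH : QuasiIn B g (fun n => H n * H n) := .of_le fun n => by rw [gd]; omega
  have qH : QuasiIn B g (fun n => H n) := .of_le fun n => by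
    have := Nat.le_mul_self (H n)
    rw [gd]; omega
  have qc : ∀ a, QuasiIn B g (fun _ => a) := fun a => .of_poly (fun n => by rw [gd]; omega) (hc a)
  have ql : QuasiIn B g (fun n => Nat.clog 2 n) := .of_poly (fun n => by rw [gd]; omega) hl
  have hl1 := hl.add hB (hc 1)
  have pa : ∀ a b, PolyIn B (fun n => a * (Nat.clog 2 n + 1) + b) := fun a b =>
    .add hB (.mul (hc a) hl1) (hc b)
  have q3 := QuasiIn.add hB (qn.mul' (hc 3)) (qc 2)
  have qHt := QuasiIn.add hB (qHH.mul' (pa 4 13)) (qc 2)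
  exact .add hB (.add hB (.add hB (.add hB q3 (.add hB (.add hB (ql.mul' (hc 3)) (qc 8))
    (.add hB (.mul hl1 (.add hB (qn.mul' (.add hB (.mul (hc 4) hl) (hc 18))) (qc 16))) q3))) (qc 5))
    (.add hB (.add hB (.add hB (qn.mul' (hc 2)) (qc 3)) (.add hB (.add hB (qD.mul' (pa 16 33))
      (qc 2)) (.add hB (.add hB qHt (.add hB qT (qc 1))) (.add hB (.add hB qHt (qc 1))
        (.add hB (qH.mul' (pa 12 32)) (qc 2)))))) (qc 1))) (qc 1)

/-- From `log x ≤ x ^ σ / σ` with `σ = δ / (d + 1)`; the denominator `d + 1` also covers `d = 0`. -/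
theorem exists_log_pow_le (d : ℕ) {δ : ℝ} (hδ : 0 < δ) :
    ∃ C : ℝ, 0 ≤ C ∧ ∀ n : ℕ, Real.log ((n : ℝ) + 2) ^ d ≤ C * ((n : ℝ) + 1) ^ δ := by
  have hd : (0 : ℝ) < d + 1 := by positivity
  have hs : 0 < δ / (d + 1) := div_pos hδ hd
  obtain ⟨σ, hσ⟩ : ∃ σ, σ = δ / (d + 1) := ⟨_, rfl⟩
  rw [← hσ] at hs
  refine ⟨(2 ^ σ / σ) ^ d, by positivity, fun n => ?_⟩
  have hn := n.cast_nonneg (α := ℝ)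
  have h0 : 0 ≤ Real.log ((n : ℝ) + 2) := Real.log_nonneg (by linarith)
  have h1 : Real.log ((n : ℝ) + 2) ≤ 2 ^ σ / σ * ((n : ℝ) + 1) ^ σ := by
    refine (Real.log_le_rpow_div (by linarith) hs).trans ?_
    rw [div_mul_eq_mul_div, ← Real.mul_rpow (by norm_num) (by linarith)]
    exact div_le_div_of_nonneg_right (Real.rpow_le_rpow (by linarith) (by linarith) hs.le) hs.le
  refine (pow_le_pow_left₀ h0 h1 d).trans ?_
  rw [mul_pow, ← Real.rpow_mul_natCast (by linarith)]
  refine mul_le_mul_of_nonneg_left (Real.rpow_le_rpow_of_exponent_le (by linarith) ?_)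
    (by positivity)
  rw [hσ, div_mul_eq_mul_div, div_le_iff₀ hd]
  nlinarith

/-- The number of samples of a list of `m` edges. -/
def samples (p q m : ℕ) : ℕ := (m - 1) / threshold p q m + 1

theorem threshold_le_rpow {p q : ℕ} (hq : 1 ≤ q) (m : ℕ) :
    (threshold p q m : ℝ) ≤ 2 * ((m : ℝ) + 1) ^ ((p : ℝ) / q) := by
  have hm := m.cast_nonneg (α := ℝ)
  have hq' : (q : ℝ) ≠ 0 := by positivity
  have h1 : (1 : ℝ) ≤ ((m : ℝ) + 1) ^ ((p : ℝ) / q) := Real.one_le_rpow (by linarith) (by positivity)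
  have h2 : threshold p q m ≤ ⌈((m : ℝ) + 1) ^ ((p : ℝ) / q)⌉₊ := by
    refine threshold_le hq (Nat.one_le_ceil_iff.2 (by linarith)) ?_
    have h3 : ((m : ℝ) + 1) ^ p ≤ (⌈((m : ℝ) + 1) ^ ((p : ℝ) / q)⌉₊ : ℝ) ^ q := by
      refine le_trans (le_of_eq ?_) (pow_le_pow_left₀ (by linarith) (Nat.le_ceil _) q)
      rw [← Real.rpow_mul_natCast (by linarith), div_mul_cancel₀ _ hq', Real.rpow_natCast]
    have h4 : (m : ℝ) ^ p ≤ ((m : ℝ) + 1) ^ p := pow_le_pow_left₀ hm (by linarith) p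
    exact_mod_cast h4.trans h3
  have h3 : (threshold p q m : ℝ) ≤ ⌈((m : ℝ) + 1) ^ ((p : ℝ) / q)⌉₊ := by exact_mod_cast h2
  have h4 := Nat.ceil_lt_add_one (show 0 ≤ ((m : ℝ) + 1) ^ ((p : ℝ) / q) by linarith)
  linarith

theorem samples_le_rpow {p q : ℕ} (hq : 1 ≤ q) (hpq : p ≤ q) (m : ℕ) :
    (samples p q m : ℝ) ≤ 2 * ((m : ℝ) + 1) ^ (1 - (p : ℝ) / q) := by
  have hq' : (0 : ℝ) < q := by positivity
  have hθ : 0 ≤ 1 - (p : ℝ) / q := by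
    rw [sub_nonneg, div_le_one hq']; exact_mod_cast hpq
  have hm := m.cast_nonneg (α := ℝ)
  have h1 : (1 : ℝ) ≤ ((m : ℝ) + 1) ^ (1 - (p : ℝ) / q) := Real.one_le_rpow (by linarith) hθ
  have hΔ : (0 : ℝ) < threshold p q m := by exact_mod_cast threshold_pos p q m
  have h2 : (samples p q m : ℝ) ≤ m / threshold p q m + 1 := by
    have a1 : (((m - 1) / threshold p q m : ℕ) : ℝ) ≤ ((m - 1 : ℕ) : ℝ) / threshold p q m :=
      Nat.cast_div_le
    have a2 : ((m - 1 : ℕ) : ℝ) ≤ m := by exact_mod_cast Nat.sub_le _ _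
    rw [samples]
    push_cast
    linarith [div_le_div_of_nonneg_right a2 hΔ.le]
  rcases Nat.eq_zero_or_pos m with rfl | hpos
  · simp at h2 h1 ⊢
    linarith
  · have hm0 : (0 : ℝ) < m := by exact_mod_cast hpos
    have h3 : (m : ℝ) ^ ((p : ℝ) / q) ≤ threshold p q m := by
      refine le_of_pow_le_pow_left₀ (n := q) (by omega) hΔ.le ?_
      rw [← Real.rpow_mul_natCast hm, div_mul_cancel₀ _ hq'.ne', Real.rpow_natCast]
      exact_mod_cast le_threshold_pow hq
    have h4 : (m : ℝ) / threshold p q m ≤ (m : ℝ) ^ (1 - (p : ℝ) / q) := by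
      rw [Real.rpow_sub hm0, Real.rpow_one]
      exact div_le_div_of_nonneg_left hm (Real.rpow_pos_of_pos hm0 _) h3
    have h5 : (m : ℝ) ^ (1 - (p : ℝ) / q) ≤ ((m : ℝ) + 1) ^ (1 - (p : ℝ) / q) :=
      Real.rpow_le_rpow hm (by linarith) hθ
    linarith

/-- The machine can only compare integer powers, so the ideal exponent is rounded up to a multiple
of `1 / (n + 1) < δ`. -/
theorem exists_fraction {θ δ : ℝ} (h0 : 0 ≤ θ) (h1 : θ ≤ 1) (hδ : 0 < δ) :
    ∃ p q : ℕ, 1 ≤ q ∧ p ≤ q ∧ θ ≤ (p : ℝ) / q ∧ (p : ℝ) / q ≤ θ + δ := by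
  obtain ⟨n, hn⟩ := exists_nat_one_div_lt hδ
  have hq : (0 : ℝ) < ((n + 1 : ℕ) : ℝ) := by positivity
  refine ⟨⌈θ * (n + 1 : ℕ)⌉₊, n + 1, by omega, Nat.ceil_le.2 ?_, ?_, ?_⟩
  · nlinarith
  · rw [le_div_iff₀ hq]; exact Nat.le_ceil _
  · rw [div_le_iff₀ hq]
    have h2 := (Nat.ceil_lt_add_one (show 0 ≤ θ * ((n + 1 : ℕ) : ℝ) by positivity)).le
    have h3 := (div_lt_iff₀ (show (0 : ℝ) < (n : ℝ) + 1 by positivity)).1 hn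
    push_cast at h2 ⊢
    linarith

/-- The constant adds `2` for `m * Δ`, `3 ^ τ` for the pairs of samples, `|C| * 3 ^ τ` for the
matrix product and `1` for `m + 1`. Pairs of samples cost no more than a product because `τ ≥ 2`. -/
theorem exists_samples_time {p q : ℕ} (hq : 1 ≤ q) (hpq : p ≤ q) {τ β C : ℝ} (hτ : 2 ≤ τ)
    (h1 : 1 + (p : ℝ) / q ≤ β) (h2 : (1 - (p : ℝ) / q) * τ ≤ β) :
    ∃ C' : ℝ, 0 ≤ C' ∧ ∀ m : ℕ, ((m * threshold p q m + samples p q m * samples p q m +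
      ⌊C * ((samples p q m : ℝ) + 1) ^ τ⌋₊ + m + 1 : ℕ) : ℝ) ≤ C' * ((m : ℝ) + 1) ^ β := by
  refine ⟨2 + (1 + |C|) * 3 ^ τ + 1, by positivity, fun m => ?_⟩
  obtain ⟨θ, hθ⟩ : ∃ θ, θ = (p : ℝ) / q := ⟨_, rfl⟩
  have hθ0 : 0 ≤ θ := by rw [hθ]; positivity
  have hθ1 : 0 ≤ 1 - θ := by
    rw [hθ, sub_nonneg, div_le_one (by positivity)]; exact_mod_cast hpq
  have hΔ := threshold_le_rpow (p := p) hq m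
  have hH := samples_le_rpow hq hpq m
  rw [← hθ] at h1 h2 hΔ hH
  obtain ⟨H, hHd⟩ : ∃ H, H = samples p q m := ⟨_, rfl⟩
  rw [← hHd] at hH ⊢
  have hm := m.cast_nonneg (α := ℝ)
  have hm1 : (1 : ℝ) ≤ (m : ℝ) + 1 := by linarith
  have hHn := H.cast_nonneg (α := ℝ)
  have a1 : (m : ℝ) * threshold p q m ≤ 2 * ((m : ℝ) + 1) ^ β := by
    calc (m : ℝ) * threshold p q m ≤ ((m : ℝ) + 1) * (2 * ((m : ℝ) + 1) ^ θ) :=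
          mul_le_mul (by linarith) hΔ (Nat.cast_nonneg _) (by linarith)
      _ = 2 * ((m : ℝ) + 1) ^ (1 + θ) := by
          rw [Real.rpow_add (by linarith), Real.rpow_one]; ring
      _ ≤ _ := mul_le_mul_of_nonneg_left (Real.rpow_le_rpow_of_exponent_le hm1 h1) (by norm_num)
  have a2 : (m : ℝ) + 1 ≤ ((m : ℝ) + 1) ^ β := by
    calc (m : ℝ) + 1 = ((m : ℝ) + 1) ^ (1 : ℝ) := (Real.rpow_one _).symm
      _ ≤ _ := Real.rpow_le_rpow_of_exponent_le hm1 (by linarith)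
  have a3 : ((H : ℝ) + 1) ^ τ ≤ 3 ^ τ * ((m : ℝ) + 1) ^ β := by
    have b1 : (H : ℝ) + 1 ≤ 3 * ((m : ℝ) + 1) ^ (1 - θ) := by
      linarith [Real.one_le_rpow hm1 hθ1]
    refine (Real.rpow_le_rpow (by linarith) b1 (by linarith)).trans ?_
    rw [Real.mul_rpow (by norm_num) (by positivity), ← Real.rpow_mul (by linarith)]
    exact mul_le_mul_of_nonneg_left (Real.rpow_le_rpow_of_exponent_le hm1 h2) (by positivity)
  have a4 : (H : ℝ) * H ≤ ((H : ℝ) + 1) ^ τ := by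
    calc (H : ℝ) * H ≤ ((H : ℝ) + 1) ^ (2 : ℝ) := by
          rw [Real.rpow_two]; nlinarith
      _ ≤ _ := Real.rpow_le_rpow_of_exponent_le (by linarith) hτ
  have a5 : ((⌊C * ((H : ℝ) + 1) ^ τ⌋₊ : ℕ) : ℝ) ≤ |C| * ((H : ℝ) + 1) ^ τ := by
    have b1 : C * ((H : ℝ) + 1) ^ τ ≤ |C| * ((H : ℝ) + 1) ^ τ :=
      mul_le_mul_of_nonneg_right (le_abs_self C) (by positivity)
    exact (by exact_mod_cast Nat.floor_mono b1 :
      ((⌊C * ((H : ℝ) + 1) ^ τ⌋₊ : ℕ) : ℝ) ≤ (⌊|C| * ((H : ℝ) + 1) ^ τ⌋₊ : ℕ)).trans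
        (Nat.floor_le (by positivity))
  have a6 := mul_le_mul_of_nonneg_left a3 (abs_nonneg C)
  push_cast
  linarith

theorem digraphCycleInTime_three {τ C : ℝ} (hτ : 2 ≤ τ)
    (hM : Solves MatrixPair MatrixPair.n MatrixPair.Input MatrixPair.Output
      (fun n => C * ((n : ℝ) + 1) ^ τ)) {δ : ℝ} (hδ : 0 < δ) :
    ∃ C' : ℝ, 1 ≤ C' ∧
      DigraphCycleInTime 3 (fun m => C' * ((m : ℝ) + 1) ^ (2 * τ / (τ + 1) + δ)) := by
  have hτ1 : (0 : ℝ) < τ + 1 := by linarith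
  -- This `θ` solves `1 + θ = (1 - θ) * τ`. One half of `δ` pays for rounding `θ`, the other half
  -- for the logarithms.
  obtain ⟨p, q, hq, hpq, hθ, hθ'⟩ := exists_fraction (θ := (τ - 1) / (τ + 1)) (δ := δ / 2)
    (div_nonneg (by linarith) hτ1.le) (by rw [div_le_one hτ1]; linarith) (by linarith)
  have e1 : 1 + (τ - 1) / (τ + 1) = 2 * τ / (τ + 1) := by field_simp; ring
  have e2 : (1 - (τ - 1) / (τ + 1)) * τ = 2 * τ / (τ + 1) := by field_simp; ring
  obtain ⟨C₁, hC₁, hg⟩ := exists_samples_time (C := C) (β := 2 * τ / (τ + 1) + δ / 2) hq hpq hτ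
    (by linarith) (by nlinarith)
  obtain ⟨M, cM, hM⟩ := hM
  obtain ⟨c, hw⟩ := exists_triangle_word q
  obtain ⟨e, he⟩ := exists_triangle_time (threshold p q) (samples p q)
    (fun m => ⌊C * ((samples p q m : ℝ) + 1) ^ τ⌋₊)
  obtain ⟨C₂, hC₂, hlog⟩ := exists_log_pow_le e (show 0 < δ / 2 by linarith)
  refine ⟨8 ^ e * C₂ * C₁ + 1, le_add_of_nonneg_left (by positivity), triangleProg p q M, c + cM,
    fun G w hcw s hs hin => ?_⟩
  rw [add_mul] at hcw
  obtain ⟨w1, w2, w3, w4⟩ := hw G.m G.N w G.sparse (by omega)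
  have hmul : 1 ≤ G.m →
      Multiplies w (samples p q G.m) ⌊C * ((samples p q G.m : ℝ) + 1) ^ τ⌋₊ M := by
    intro hm X hX s hs hin
    have hle : samples p q G.m ≤ G.m := by
      have := Nat.div_le_self (G.m - 1) (threshold p q G.m)
      unfold samples; omega
    obtain ⟨s', t, hE, ht, ho⟩ := hM X w (by
      have h1 : cM * Nat.clog 2 (X.n + 2) ≤ cM * Nat.clog 2 (G.m + 2) :=
        Nat.mul_le_mul_left _ (Nat.clog_mono_right 2 (by omega))
      omega) s hs hin
    exact ⟨s', t, hE, Nat.le_floor (by rw [← hX]; exact ht), ho⟩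
  obtain ⟨s', t, hE, ht, ho⟩ := run_triangleProg G hs hin hq hpq w1 w2 w3 w4 rfl rfl rfl hmul
  refine ⟨s', t, hE, ?_, ho⟩
  have b1 : (t : ℝ) ≤ (((Nat.clog 2 G.m + 2) ^ e * (G.m * threshold p q G.m + samples p q G.m *
      samples p q G.m + ⌊C * ((samples p q G.m : ℝ) + 1) ^ τ⌋₊ + G.m + 1) : ℕ) : ℝ) := by
    exact_mod_cast ht.trans (he G.m)
  rw [Nat.cast_mul, Nat.cast_pow] at b1
  have hm := G.m.cast_nonneg (α := ℝ)
  have b2 := pow_le_pow_left₀ (Nat.cast_nonneg _) (clog_le_log G.m) e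
  have b3 : ((Nat.clog 2 G.m + 2 : ℕ) : ℝ) ^ e ≤ 8 ^ e * (C₂ * ((G.m : ℝ) + 1) ^ (δ / 2)) := by
    rw [mul_pow] at b2
    exact b2.trans (mul_le_mul_of_nonneg_left (hlog G.m) (by positivity))
  refine b1.trans ((mul_le_mul b3 (hg G.m) (Nat.cast_nonneg _) (by positivity)).trans ?_)
  dsimp only
  rw [show 2 * τ / (τ + 1) + δ = δ / 2 + (2 * τ / (τ + 1) + δ / 2) by ring,
    Real.rpow_add (by linarith) (δ / 2)]
  have : 0 ≤ ((G.m : ℝ) + 1) ^ (δ / 2) * ((G.m : ℝ) + 1) ^ (2 * τ / (τ + 1) + δ / 2) := by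
    positivity
  nlinarith

theorem segmentCycleInTime_three {τ C : ℝ} (hτ : 2 ≤ τ)
    (hM : Solves MatrixPair MatrixPair.n MatrixPair.Input MatrixPair.Output
      (fun n => C * ((n : ℝ) + 1) ^ τ)) {δ : ℝ} (hδ : 0 < δ) :
    ∃ C' : ℝ, 0 ≤ C' ∧
      SegmentCycleInTime 3 (fun n => C' * ((n : ℝ) + 1) ^ (2 * τ / (τ + 1) + δ)) := by
  obtain ⟨C₁, hC₁, hD⟩ := digraphCycleInTime_three hτ hM (half_pos hδ)
  have hT : ∀ m : ℕ, (m : ℝ) ≤ C₁ * ((m : ℝ) + 1) ^ (2 * τ / (τ + 1) + δ / 2) := fun m => by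
    have hm := m.cast_nonneg (α := ℝ)
    have h1 : 1 ≤ 2 * τ / (τ + 1) + δ / 2 := by
      have : 1 ≤ 2 * τ / (τ + 1) := by rw [le_div_iff₀ (by linarith)]; linarith
      linarith
    have h2 := Real.rpow_le_rpow_of_exponent_le (show (1 : ℝ) ≤ (m : ℝ) + 1 by linarith) h1
    rw [Real.rpow_one] at h2
    nlinarith
  obtain ⟨C₂, d, hS⟩ := segmentCycleInTime_of_digraph le_rfl hT hD
  obtain ⟨C₃, hC₃, hlog⟩ := exists_log_pow_le d (half_pos hδ)
  refine ⟨|C₂| * C₁ * C₃, by positivity, solves_mono hS fun n => ?_⟩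
  have hn : (0 : ℝ) < (n : ℝ) + 1 := by positivity
  rw [show 2 * τ / (τ + 1) + δ = 2 * τ / (τ + 1) + δ / 2 + δ / 2 by ring,
    Real.rpow_add hn (2 * τ / (τ + 1) + δ / 2)]
  obtain ⟨X, hX⟩ : ∃ X, X = ((n : ℝ) + 1) ^ (2 * τ / (τ + 1) + δ / 2) := ⟨_, rfl⟩
  rw [← hX]
  have hX0 : 0 ≤ X := by rw [hX]; positivity
  calc C₂ * (C₁ * X) * Real.log ((n : ℝ) + 2) ^ d
      ≤ |C₂| * (C₁ * X) * Real.log ((n : ℝ) + 2) ^ d := by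
        have : 0 ≤ Real.log ((n : ℝ) + 2) := Real.log_nonneg (by linarith)
        gcongr
        exact le_abs_self _
    _ ≤ |C₂| * (C₁ * X) * (C₃ * ((n : ℝ) + 1) ^ (δ / 2)) :=
        mul_le_mul_of_nonneg_left (hlog n) (by positivity)
    _ = _ := by ring

/-- The exponents `τ` for which matrices can be multiplied in time `O(n ^ τ)`. -/
def matMulSet : Set ℝ := {τ : ℝ | 2 ≤ τ ∧ ∃ C : ℝ,
    Solves MatrixPair MatrixPair.n MatrixPair.Input MatrixPair.Output
      (fun n => C * ((n : ℝ) + 1) ^ τ)}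

theorem matMulSet_nonempty : matMulSet.Nonempty := ⟨3, by norm_num, exists_matMul⟩

theorem two_le_matMulExponent : 2 ≤ matMulExponent :=
  le_csInf matMulSet_nonempty fun _ h => h.1

theorem segmentCycleInTime_matMulExponent {ε : ℝ} (hε : 0 < ε) : ∃ C : ℝ,
    SegmentCycleInTime 3
      (fun n => C * ((n : ℝ) + 1) ^ (2 * matMulExponent / (matMulExponent + 1) + ε)) := by
  obtain ⟨τ, ⟨hτ, C, hC⟩, hlt⟩ := exists_lt_of_csInf_lt matMulSet_nonempty
    (show sInf matMulSet < matMulExponent + ε / 2 from lt_add_of_pos_right _ (half_pos hε))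
  obtain ⟨C', hC', h⟩ := segmentCycleInTime_three hτ hC (half_pos hε)
  refine ⟨C', solves_mono h fun n => mul_le_mul_of_nonneg_left
    (Real.rpow_le_rpow_of_exponent_le (by linarith [n.cast_nonneg (α := ℝ)]) ?_) hC'⟩
  have h2 := two_le_matMulExponent
  obtain ⟨ω, hω⟩ : ∃ ω, ω = matMulExponent := ⟨_, rfl⟩
  rw [← hω] at h2 hlt ⊢
  -- The function `2 - 2 / (τ + 1)` grows by at most `τ - ω < ε / 2`; the other half of `ε` was
  -- spent on `segmentCycleInTime_three`.
  have h3 : 2 * τ / (τ + 1) ≤ 2 * ω / (ω + 1) + ε / 2 := by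
    have e1 : 2 * τ / (τ + 1) = 2 - 2 / (τ + 1) := by
      have : τ + 1 ≠ 0 := by linarith
      field_simp; ring
    have e2 : 2 * ω / (ω + 1) = 2 - 2 / (ω + 1) := by
      have : ω + 1 ≠ 0 := by linarith
      field_simp; ring
    have h4 : 2 / (ω + 1) ≤ 2 / (τ + 1) + ε / 2 := by
      rw [div_le_iff₀ (by linarith)]
      have h5 : 2 / (τ + 1) * (τ + 1) = 2 := div_mul_cancel₀ _ (by linarith)
      have h6 : 2 / (τ + 1) ≤ 1 := by rw [div_le_one (by linarith)]; linarith
      have h7 : 0 ≤ 2 / (τ + 1) := div_nonneg (by norm_num) (by linarith)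
      nlinarith
    rw [e1, e2]
    linarith
  linarith

end RealRAM

theorem mainTheorem3 :
    (∀ k : ℕ, 3 ≤ k → ∀ T : ℕ → ℝ, (∀ m : ℕ, (m : ℝ) ≤ T m) → DigraphCycleInTime k T →
      ∃ (C : ℝ) (d : ℕ),
        SegmentCycleInTime k (fun n => C * T n * Real.log ((n : ℝ) + 2) ^ d)) ∧
    (∀ ε : ℝ, 0 < ε → ∃ C : ℝ,
      SegmentCycleInTime 3
        (fun n => C * ((n : ℝ) + 1) ^ (2 * matMulExponent / (matMulExponent + 1) + ε))) ∧
    (matMulExponent < 2.373 → ∃ C : ℝ,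
      SegmentCycleInTime 3 (fun n => C * ((n : ℝ) + 1) ^ (1.408 : ℝ))) := by
  refine ⟨fun k hk T hT h => segmentCycleInTime_of_digraph hk hT h,
    fun ε hε => segmentCycleInTime_matMulExponent hε, fun hω => ?_⟩
  have h2 := two_le_matMulExponent
  -- This amounts to `ω < 1.408 / 0.592`, which exceeds `2.378`; the positive remainder then serves
  -- as `ε`.
  have h3 : 2 * matMulExponent / (matMulExponent + 1) < 1.408 := by
    rw [div_lt_iff₀ (by linarith)]
    norm_num at hω ⊢
    linarith
  have h := segmentCycleInTime_matMulExponent (sub_pos.2 h3)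
  rwa [add_sub_cancel] at h
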